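/- **Setting.** Let $\Gamma$ be a finite connected cubic vertex-transitive simple graph whose edge set is partitioned into a $2$-factor $\mathcal C$ (a set of disjoint cycles covering all vertices) and a $1$-factor $\mathcal I$. The quotient graph $\Gamma_{\mathcal C}$ has vertex set $\mathcal C$, two distinct members being adjacent when some edge of $\Gamma$ joins them. An outside neighbour of a vertex $v$ is a neighbour of $v$ lying on a member of $\mathcal C$ other than the one through $v$. Assume that $\Gamma$ is of *alternating cycle quotient type* with respect to $\mathcal C$: the graph $\Gamma_{\mathcal C}$ is a cycle, and any two vertices that are consecutive on a member of $\mathcal C$ have their outside neighbours on different members of $\mathcal C$. Let $m=|\mathcal C|$ and let $n$ be such that $\Gamma$ has order $mn$. **The graphs.** For $m\ge 3$, even $n\ge 4$, $\ell\in\mathbb Z_n$ of the same parity as $m$, and odd $k_0,\dots,k_{m-1}\in\mathbb Z_n$, consider the graph with vertices $u_{i,j}$ ($0\le i\le m-1$, $j\in\mathbb Z_n$) and edges $u_{i,j}u_{i,j\pm k_i}$ for all $i,j$; $u_{i,j}u_{i+1,j}$ for $0\le i\le m-2$ and $j\equiv i \pmod 2$; and $u_{m-1,j}u_{0,j+\ell}$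 for $j\equiv m-1\pmod 2$. It is denoted $\mathrm{HTG}(m,n,\ell)$ if all $k_i=1$, and $\mathcal X_a(m,n,k,\ell)$ if $m$ is even, $k_i=1$ for even $i$ and $k_i=k$ for odd $i$. Its standard $2$-factor consists of the subgraphs induced on the sets $V_i=\{u_{i,j}: j\in\mathbb Z_n\}$. Below, $(\Gamma,\mathcal C)\cong X$ means that there is a graph isomorphism from $\Gamma$ to $X$ carrying $\mathcal C$ to the standard $2$-factor of $X$. Equations between $k$, $\ell$ and integers are in $\mathbb Z_n$, and $x=\pm y$ means $x\in\{y,-y\}$. **Theorem.** $\mathcal C$ is invariant under $\mathrm{Aut}(\Gamma)$ if and only if $n\geq 4$ is even and one of the following holds. (i) $(\Gamma,\mathcal C)\cong \mathrm{HTG}(m,n,\ell)$ for some $\ell\in\mathbb Z_n$ of the same parity as $m$ satisfying none of the following three conditions (whose truth does not depend on the integer representing $\ell$): - $\gcd(\ell+m,n)=2m$ and $2mn\mid \ell^2+2m\ell-3m^2$; - $\gcd(\ell-m,n)=2m$ and $2mn\mid \ell^2-2m\ell-3m^2$; - $\gcd(\ell+m,n)=\gcd(\ell-m,n)=2m$ and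 $2mn\mid \ell^2+3m^2$. (ii) $m$ is even and, with $n=2n'$, $(\Gamma,\mathcal C)\cong \mathcal X_a(m,n,k,\ell)$ for some even $\ell\in\mathbb Z_n$ and odd $k\in\mathbb Z_n$ with $2k\ne\pm2$ and $2k^2=\pm2$, such that one of - $\ell k=\pm\ell$, and at least one of $k^2=\pm1$ and $4\mid m$ holds, - $\ell k=n'\pm\ell$, $m\equiv 2\pmod 4$ and $k^2=n'\pm1$ holds, and such that no pair obtained from $(k,\ell)$ by repeatedly applying the replacements $(k,\ell)\mapsto(-k,\ell)$, $(k,\ell)\mapsto(k,-\ell)$ and, if $4\mid n$, $(k,\ell)\mapsto(k+n',\ell)$ when $4\mid m$, respectively $(k,\ell)\mapsto(k+n',\ell+n')$ when $4\nmid m$, gives, together with $m$ and $n$, one of the graphs - $\mathcal X_a(4,10,3,0)$ or $\mathcal X_a(4,20,3,10)$; - $\mathcal X_a(2m_0,8m_0n_0,2m_0n_0+1,2m_0\ell_0)$ with integers $m_0\ge2$, $n_0\ge1$, $0\le\ell_0<4n_0$ such that $8n_0\mid(m_0n_0+\ell_0-1)(m_0n_0+\ell_0+3)$; - $\mathcal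 X_a(2m_0,8m_0n_0,2m_0n_0+1,2m_0\ell_0)$ with odd integers $m_0\ge3$, $n_0\ge1$ and an even integer $\ell_0$, $0\le\ell_0<4n_0$, such that $4\mid m_0n_0+\ell_0-1$ and $n_0\mid\ell_0^2+3$. -/

import Mathlib

namespace AltCycleQuotient

section Factors

variable {V : Type*}

/-- The automorphism group of `Γ` acts transitively on the vertices. -/
def IsVertexTransitive (Γ : SimpleGraph V) : Prop :=
  ∀ v w : V, ∃ φ : Γ ≃g Γ, φ v = w

/-- `C` and `I` are spanning subgraphs of `Γ` that partition its edge set, `C` is a `2`-factor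
and `I` is a `1`-factor. The members (cycles) of the `2`-factor are the connected components
of `C`. -/
structure IsFactorPartition (Γ C I : SimpleGraph V) [C.LocallyFinite] [I.LocallyFinite] :
    Prop where
  union_eq : C ⊔ I = Γ
  disjoint : Disjoint C I
  two_factor : C.IsRegularOfDegree 2
  one_factor : I.IsRegularOfDegree 1

/-- The quotient graph of `Γ` with respect to the set of components of `C`: two distinct
components are adjacent when some edge of `Γ` joins them. -/
def quotientGraph (Γ C : SimpleGraph V) : SimpleGraph C.ConnectedComponent where
  Adj c d := c ≠ d ∧
    ∃ v w : V, C.connectedComponentMk v = c ∧ C.connectedComponentMk w = d ∧ Γ.Adj v w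
  symm := ⟨fun _ _ ⟨hne, v, w, hv, hw, h⟩ => ⟨hne.symm, w, v, hw, hv, h.symm⟩⟩
  loopless := ⟨fun _ h => h.1 rfl⟩

/-- The quotient graph is a (finite) cycle: it is connected, and each vertex has precisely two
neighbours. -/
def IsCycleQuotientType (Γ C : SimpleGraph V) : Prop :=
  (quotientGraph Γ C).Connected ∧
    ∀ c : C.ConnectedComponent, ((quotientGraph Γ C).neighborSet c).ncard = 2

/-- `v'` is an outside neighbour of `v`: it is adjacent to `v` and lies on another member
of the `2`-factor. -/
def IsOutsideNeighbor (Γ C : SimpleGraph V) (v v' : V) : Prop :=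
  Γ.Adj v v' ∧ C.connectedComponentMk v ≠ C.connectedComponentMk v'

/-- Alternating cycle quotient type: the quotient graph is a cycle, and consecutive vertices of
a member of the `2`-factor never have their outside neighbours in one and the same member. -/
def IsAlternating (Γ C : SimpleGraph V) : Prop :=
  IsCycleQuotientType Γ C ∧
    ∀ v w v' w' : V, C.Adj v w → IsOutsideNeighbor Γ C v v' → IsOutsideNeighbor Γ C w w' →
      C.connectedComponentMk v' ≠ C.connectedComponentMk w'

/-- The `2`-factor `C` is preserved by every automorphism of `Γ`. -/
def IsAutInvariant (Γ C : SimpleGraph V) : Prop :=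
  ∀ φ : Γ ≃g Γ, ∀ v w : V, C.Adj (φ v) (φ w) ↔ C.Adj v w

/-- There is a graph isomorphism from `Γ` to `Δ` that carries the `2`-factor `C` to the
`2`-factor `D`. -/
def FactorIso {W : Type*} (Γ C : SimpleGraph V) (Δ D : SimpleGraph W) : Prop :=
  ∃ φ : Γ ≃g Δ, ∀ v w : V, D.Adj (φ v) (φ w) ↔ C.Adj v w

end Factors

section Graphs

/-- The graph `X_a(m, n, S, ℓ)` with signature `S = [{a 0, b 0}, …, {a (m-1), b (m-1)}]`, on the
vertices `u_{i,j} = (i, j)`. It is used for even `n ≥ 4`, `m ≥ 3`, and `ℓ` of the parity of `m`;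
the parity of an element of `ZMod n` is that of its canonical representative.
For `j ≡ i (mod 2)` the vertex `u_{i,j}` is joined
* to `u_{i+1,j}` when `i ≤ m - 2`,
* to `u_{0,j+ℓ}` when `i = m - 1`,
* to `u_{i,j + a i}` and `u_{i,j + b i}`. -/
def alternatingGraph (m n : ℕ) (a b : Fin m → ZMod n) (ℓ : ZMod n) :
    SimpleGraph (Fin m × ZMod n) :=
  SimpleGraph.fromRel fun p q =>
    p.2.val % 2 = (p.1 : ℕ) % 2 ∧
      (((p.1 : ℕ) + 1 = (q.1 : ℕ) ∧ q.2 = p.2) ∨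
        ((p.1 : ℕ) + 1 = m ∧ (q.1 : ℕ) = 0 ∧ q.2 = p.2 + ℓ) ∨
        (q.1 = p.1 ∧ (q.2 = p.2 + a p.1 ∨ q.2 = p.2 + b p.1)))

/-- The honeycomb toroidal graph `HTG(m, n, ℓ)`: all members of the signature are `{1, -1}`. -/
def honeycomb (m n : ℕ) (ℓ : ZMod n) : SimpleGraph (Fin m × ZMod n) :=
  alternatingGraph m n (fun _ => 1) (fun _ => -1) ℓ

/-- The graph `X_a(m, n, k, ℓ)` for even `m`: the signature is
`[{1, -1}, {k, -k}, {1, -1}, {k, -k}, …, {1, -1}, {k, -k}]`. -/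
def xGraph (m n : ℕ) (k ℓ : ZMod n) : SimpleGraph (Fin m × ZMod n) :=
  alternatingGraph m n (fun i => if (i : ℕ) % 2 = 0 then 1 else k)
    (fun i => if (i : ℕ) % 2 = 0 then -1 else -k) ℓ

/-- The `2`-factor of a graph on the vertices `u_{i,j}` that consists of the subgraphs induced on
the sets `V_i = {u_{i,j} : j ∈ ZMod n}`. -/
def standardFactor {m n : ℕ} (X : SimpleGraph (Fin m × ZMod n)) :
    SimpleGraph (Fin m × ZMod n) where
  Adj p q := X.Adj p q ∧ p.1 = q.1
  symm := ⟨fun _ _ h => ⟨h.1.symm, h.2.symm⟩⟩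
  loopless := ⟨fun _ h => X.irrefl h.1⟩

end Graphs

section Parameters

/-- One of the three conditions on `HTG(m, n, ℓ)` holds. They are evaluated at the canonical
integer representative of `ℓ`; their truth does not depend on the representative. -/
def HoneycombException (m n : ℕ) (ℓ : ZMod n) : Prop :=
  (Int.gcd ((ℓ.val : ℤ) + m) n = 2 * m ∧
      (2 * m * n : ℤ) ∣ (ℓ.val : ℤ) ^ 2 + 2 * m * ℓ.val - 3 * (m : ℤ) ^ 2) ∨
    (Int.gcd ((ℓ.val : ℤ) - m) n = 2 * m ∧
      (2 * m * n : ℤ) ∣ (ℓ.val : ℤ) ^ 2 - 2 * m * ℓ.val - 3 * (m : ℤ) ^ 2) ∨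
    (Int.gcd ((ℓ.val : ℤ) + m) n = 2 * m ∧ Int.gcd ((ℓ.val : ℤ) - m) n = 2 * m ∧
      (2 * m * n : ℤ) ∣ (ℓ.val : ℤ) ^ 2 + 3 * (m : ℤ) ^ 2)

/-- The conditions on the parameters under which the standard `2`-factor of `X_a(m, n, k, ℓ)` is
preserved by a vertex-transitive group of automorphisms (here `n = 2n'`). -/
def XParameters (m n : ℕ) (k ℓ : ZMod n) : Prop :=
  Even m ∧ k.val % 2 = 1 ∧ ℓ.val % 2 = 0 ∧
    (2 * k ≠ 2 ∧ 2 * k ≠ -2) ∧ (2 * k ^ 2 = 2 ∨ 2 * k ^ 2 = -2) ∧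
    (((ℓ * k = ℓ ∨ ℓ * k = -ℓ) ∧ ((k ^ 2 = 1 ∨ k ^ 2 = -1) ∨ 4 ∣ m)) ∨
      ((ℓ * k = ((n / 2 : ℕ) : ZMod n) + ℓ ∨ ℓ * k = ((n / 2 : ℕ) : ZMod n) - ℓ) ∧
        m % 4 = 2 ∧
        (k ^ 2 = ((n / 2 : ℕ) : ZMod n) + 1 ∨ k ^ 2 = ((n / 2 : ℕ) : ZMod n) - 1)))

/-- `Reachable m n k ℓ k' ℓ'`: the parameters `(k', ℓ')` arise from `(k, ℓ)` by the isomorphisms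
`X_a(m, n, k, ℓ) = X_a(m, n, -k, ℓ)`, `X_a(m, n, k, ℓ) ≅ X_a(m, n, k, -ℓ)` and, when `4 ∣ n`,
`X_a(m, n, k, ℓ) ≅ X_a(m, n, k + n', ℓ)` for `4 ∣ m` and
`X_a(m, n, k, ℓ) ≅ X_a(m, n, k + n', ℓ + n')` for `4 ∤ m`, where `n = 2n'`. -/
inductive Reachable (m n : ℕ) (k ℓ : ZMod n) : ZMod n → ZMod n → Prop
  | refl : Reachable m n k ℓ k ℓ
  | neg_left {k' ℓ' : ZMod n} : Reachable m n k ℓ k' ℓ' → Reachable m n k ℓ (-k') ℓ'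
  | neg_right {k' ℓ' : ZMod n} : Reachable m n k ℓ k' ℓ' → Reachable m n k ℓ k' (-ℓ')
  | shift {k' ℓ' : ZMod n} : 4 ∣ n → 4 ∣ m → Reachable m n k ℓ k' ℓ' →
      Reachable m n k ℓ (k' + ((n / 2 : ℕ) : ZMod n)) ℓ'
  | shift_both {k' ℓ' : ZMod n} : 4 ∣ n → ¬ 4 ∣ m → Reachable m n k ℓ k' ℓ' →
      Reachable m n k ℓ (k' + ((n / 2 : ℕ) : ZMod n)) (ℓ' + ((n / 2 : ℕ) : ZMod n))

/-- The family of graphs `X_a(2m₀, 8m₀n₀, 2m₀n₀ + 1, 2m₀ℓ₀)` that admit an automorphism fixing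
`u_{0,0}` and interchanging `u_{0,1}` with `u_{1,0}`. -/
def SwapFamily (m n : ℕ) (k ℓ : ZMod n) : Prop :=
  ∃ m₀ n₀ ℓ₀ : ℕ, 2 ≤ m₀ ∧ 1 ≤ n₀ ∧ ℓ₀ < 4 * n₀ ∧
    (8 * n₀ : ℤ) ∣ ((m₀ : ℤ) * n₀ + ℓ₀ - 1) * ((m₀ : ℤ) * n₀ + ℓ₀ + 3) ∧
    m = 2 * m₀ ∧ n = 8 * m₀ * n₀ ∧
    k = ((2 * m₀ * n₀ + 1 : ℕ) : ZMod n) ∧ ℓ = ((2 * m₀ * ℓ₀ : ℕ) : ZMod n)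

/-- The family of graphs `X_a(2m₀, 8m₀n₀, 2m₀n₀ + 1, 2m₀ℓ₀)` that admit an automorphism fixing
`u_{0,0}` and cyclically permuting its three neighbours. -/
def RotateFamily (m n : ℕ) (k ℓ : ZMod n) : Prop :=
  ∃ m₀ n₀ ℓ₀ : ℕ, Odd m₀ ∧ Odd n₀ ∧ Even ℓ₀ ∧ 3 ≤ m₀ ∧ 1 ≤ n₀ ∧ ℓ₀ < 4 * n₀ ∧
    (4 : ℤ) ∣ (m₀ : ℤ) * n₀ + ℓ₀ - 1 ∧ n₀ ∣ ℓ₀ ^ 2 + 3 ∧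
    m = 2 * m₀ ∧ n = 8 * m₀ * n₀ ∧
    k = ((2 * m₀ * n₀ + 1 : ℕ) : ZMod n) ∧ ℓ = ((2 * m₀ * ℓ₀ : ℕ) : ZMod n)

/-- `X_a(m, n, k, ℓ)` is `X_a(4, 10, 3, 0)`, `X_a(4, 20, 3, 10)` or belongs to one of the two
families above. -/
def XException (m n : ℕ) (k ℓ : ZMod n) : Prop :=
  (m = 4 ∧ n = 10 ∧ k = 3 ∧ ℓ = 0) ∨ (m = 4 ∧ n = 20 ∧ k = 3 ∧ ℓ = 10) ∨
    SwapFamily m n k ℓ ∨ RotateFamily m n k ℓ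

end Parameters

end AltCycleQuotient

open AltCycleQuotient

/-! ### Coordinates: the three-coloured cover with vertex set ℤ × ℤ -/

namespace AltCycleQuotient

lemma dvd_of_eq_mul {a b n : ℤ} (h : n ∣ b) (c : ℤ) (e : a = c * b) : n ∣ a :=
  e ▸ h.mul_left c

/-- The length of the steps along the layer `i`. -/
def layerStep (K i : ℤ) : ℤ := if i % 2 = 0 then 1 else K

/-- The sign `1` of an up vertex and `-1` of a down vertex. -/
def vsign (z : ℤ × ℤ) : ℤ := if (z.1 + z.2) % 2 = 0 then 1 else -1

/-- The neighbour of `z` along the edge of colour `x`: colour `0` joins different layers, colours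
`1` and `2` stay within a layer. -/
def move (K : ℤ) (x : Fin 3) (z : ℤ × ℤ) : ℤ × ℤ :=
  if x = 0 then (z.1 + vsign z, z.2)
  else if x = 1 then (z.1, z.2 + vsign z * layerStep K z.1)
  else (z.1, z.2 - vsign z * layerStep K z.1)

/-- A translation of the plane that is trivial on the quotient. -/
def deck (m : ℕ) (lam s : ℤ) (z : ℤ × ℤ) : ℤ × ℤ := (z.1 - m * s, z.2 + lam * s)

/-- A labelling of a graph with a `2`-factor by a quotient of `ℤ × ℤ`, which identifies it with
the graph `X_a(m, n, K, lam)`. -/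
structure Chart {V : Type*} (Γ C : SimpleGraph V) (m n : ℕ) (K lam : ℤ) (p : ℤ × ℤ → V) :
    Prop where
  three_le : 3 ≤ m
  four_le : 4 ≤ n
  n_even : n % 2 = 0
  K_odd : K % 2 = 1
  lam_parity : (lam - m) % 2 = 0
  even_or_one : m % 2 = 0 ∨ K = 1
  not_dvd : ¬ (n : ℤ) ∣ 2 * K
  surj : Function.Surjective p
  eq_iff : ∀ z w, p z = p w ↔ ∃ s : ℤ, z.1 = w.1 + m * s ∧ (n : ℤ) ∣ z.2 - w.2 + lam * s
  adj : ∀ z v, Γ.Adj (p z) v ↔ ∃ x, v = p (move K x z)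
  adjC : ∀ z v, C.Adj (p z) v ↔ ∃ x, x ≠ 0 ∧ v = p (move K x z)

lemma layerStep_odd {K : ℤ} (hK : K % 2 = 1) (i : ℤ) : layerStep K i % 2 = 1 := by
  unfold layerStep; split_ifs <;> omega

lemma layerStep_congr {m : ℕ} {K : ℤ} (h : m % 2 = 0 ∨ K = 1) (i s : ℤ) :
    layerStep K (i - m * s) = layerStep K i := by
  unfold layerStep
  rcases h with h | rfl
  · have : (m : ℤ) * s % 2 = 0 := by
      rw [Int.mul_emod]; have : (m : ℤ) % 2 = 0 := by omega
      simp [this]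
    have h2 : (i - m * s) % 2 = i % 2 := by omega
    rw [h2]
  · simp

lemma vsign_eq (z : ℤ × ℤ) : vsign z = 1 ∨ vsign z = -1 := by unfold vsign; split_ifs <;> simp

lemma vsign_congr {z w : ℤ × ℤ} (h : (z.1 + z.2 - w.1 - w.2) % 2 = 0) : vsign z = vsign w := by
  unfold vsign
  have : (z.1 + z.2) % 2 = (w.1 + w.2) % 2 := by omega
  rw [this]

lemma vsign_flip {z w : ℤ × ℤ} (h : (z.1 + z.2 - w.1 - w.2) % 2 = 1) : vsign z = - vsign w := by
  unfold vsign; split_ifs <;> omega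

lemma mul_odd_emod {a b : ℤ} (ha : a = 1 ∨ a = -1) (hb : b % 2 = 1) : (a * b) % 2 = 1 := by
  rcases ha with rfl | rfl <;> omega

lemma move_parity {K : ℤ} (hK : K % 2 = 1) (x : Fin 3) (z : ℤ × ℤ) :
    ((move K x z).1 + (move K x z).2 - z.1 - z.2) % 2 = 1 := by
  have h1 := mul_odd_emod (vsign_eq z) (layerStep_odd hK z.1)
  have h2 := vsign_eq z
  unfold move
  split_ifs <;> simp only <;> omega

lemma vsign_move {K : ℤ} (hK : K % 2 = 1) (x : Fin 3) (z : ℤ × ℤ) :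
    vsign (move K x z) = - vsign z := vsign_flip (move_parity hK x z)

lemma move_move {K : ℤ} (hK : K % 2 = 1) (x : Fin 3) (z : ℤ × ℤ) :
    move K x (move K x z) = z := by
  have h := vsign_move hK x z
  have e : ∀ w, move K x w = if x = 0 then (w.1 + vsign w, w.2)
    else if x = 1 then (w.1, w.2 + vsign w * layerStep K w.1)
    else (w.1, w.2 - vsign w * layerStep K w.1) := fun w => rfl
  rw [e (move K x z), h, e z]
  split_ifs <;> ext <;> simp

lemma deck_parity {m : ℕ} {lam : ℤ} (h : (lam - m) % 2 = 0) (s : ℤ) (z : ℤ × ℤ) :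
    ((deck m lam s z).1 + (deck m lam s z).2 - z.1 - z.2) % 2 = 0 := by
  have : (deck m lam s z).1 + (deck m lam s z).2 - z.1 - z.2 = (lam - m) * s := by
    simp [deck]; ring
  rw [this, Int.mul_emod, h]; simp

/-- The congruence of `lam` and `m` modulo 2 keeps up vertices up, and the alternative for `m` and
`K` keeps the step length of the layer; so colours descend to the quotient. -/
lemma move_deck {m : ℕ} {K lam : ℤ} (h1 : (lam - m) % 2 = 0) (h2 : m % 2 = 0 ∨ K = 1)
    (x : Fin 3) (s : ℤ) (z : ℤ × ℤ) :
    move K x (deck m lam s z) = deck m lam s (move K x z) := by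
  have hs := vsign_congr (deck_parity h1 s z)
  have hl : layerStep K (deck m lam s z).1 = layerStep K z.1 := layerStep_congr h2 _ _
  unfold move
  rw [hs, hl]
  split_ifs <;> simp only [deck] <;> ext <;> simp <;> ring

/-! ### The standard graphs as quotients of the cover -/

section Standard

variable {m n : ℕ}

/-- The graph `X_a(m, n, K, lam)` for integers `K` and `lam`. -/
def modelGraph (m n : ℕ) (K lam : ℤ) : SimpleGraph (Fin m × ZMod n) :=
  alternatingGraph m n (fun i => ((layerStep K (i : ℕ) : ℤ) : ZMod n))
    (fun i => -((layerStep K (i : ℕ) : ℤ) : ZMod n)) (lam : ZMod n)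

/-- The standard labelling of `X_a(m, n, K, lam)`. -/
def modelMap (m n : ℕ) [NeZero m] (lam : ℤ) (z : ℤ × ℤ) : Fin m × ZMod n :=
  (⟨(z.1 % m).toNat, by
      have := Int.emod_lt_of_pos z.1 (Int.natCast_pos.2 (NeZero.pos m))
      have := Int.emod_nonneg z.1 (Int.natCast_pos.2 (NeZero.pos m)).ne'
      omega⟩, ((z.2 + lam * (z.1 / m) : ℤ) : ZMod n))

lemma honeycomb_eq (m n : ℕ) (lam : ℤ) : honeycomb m n (lam : ZMod n) = modelGraph m n 1 lam := by
  simp [honeycomb, modelGraph, layerStep]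

lemma xGraph_eq (m n : ℕ) (K lam : ℤ) :
    xGraph m n (K : ZMod n) (lam : ZMod n) = modelGraph m n K lam := by
  unfold xGraph modelGraph
  congr 1
  · ext i
    by_cases h : (i : ℕ) % 2 = 0
    · have : ((i : ℕ) : ℤ) % 2 = 0 := by omega
      simp [layerStep, h, this]
    · have : ¬ ((i : ℕ) : ℤ) % 2 = 0 := by omega
      simp only [layerStep, h, this, if_false]
  · ext i
    by_cases h : (i : ℕ) % 2 = 0
    · have : ((i : ℕ) : ℤ) % 2 = 0 := by omega
      simp [layerStep, h, this]
    · have : ¬ ((i : ℕ) : ℤ) % 2 = 0 := by omega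
      simp only [layerStep, h, this, if_false]

lemma val_parity (hn : n % 2 = 0) [NeZero n] (a : ℤ) : (((a : ZMod n).val : ℕ) : ℤ) % 2 = a % 2 := by
  rw [ZMod.val_intCast]
  have : (2 : ℤ) ∣ n := by omega
  exact Int.emod_emod_of_dvd a this

lemma modelMap_deck [NeZero m] (lam s : ℤ) (z : ℤ × ℤ) :
    modelMap m n lam (deck m lam s z) = modelMap m n lam z := by
  have hm : (m : ℤ) ≠ 0 := by exact_mod_cast NeZero.ne m
  unfold modelMap deck
  have h1 : (z.1 - m * s) % m = z.1 % m := by simp [Int.sub_emod]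
  have h2 : (z.1 - m * s) / m = z.1 / m - s := by
    rw [Int.sub_ediv_of_dvd _ (dvd_mul_right _ _), Int.mul_ediv_cancel_left _ hm]
  ext
  · simp [h1]
  · simp only [h2]; push_cast; ring

lemma modelMap_of_lt [NeZero m] (lam i j : ℤ) (h0 : 0 ≤ i) (h1 : i < m) :
    modelMap m n lam (i, j) = (⟨i.toNat, by omega⟩, (j : ZMod n)) := by
  unfold modelMap
  have e1 : i % m = i := Int.emod_eq_of_lt h0 h1
  have e2 : i / m = 0 := Int.ediv_eq_zero_of_lt h0 h1
  ext <;> simp [e1, e2]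

lemma modelMap_eq_iff [NeZero m] (lam : ℤ) (z w : ℤ × ℤ) :
    modelMap m n lam z = modelMap m n lam w ↔
      ∃ s : ℤ, z.1 = w.1 + m * s ∧ (n : ℤ) ∣ z.2 - w.2 + lam * s := by
  have hm : (m : ℤ) ≠ 0 := by exact_mod_cast NeZero.ne m
  have hz := Int.emod_nonneg z.1 hm
  have hw := Int.emod_nonneg w.1 hm
  have ez := Int.emod_add_mul_ediv z.1 m
  have ew := Int.emod_add_mul_ediv w.1 m
  simp only [modelMap, Prod.mk.injEq, Fin.mk.injEq, ZMod.intCast_eq_intCast_iff_dvd_sub]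
  constructor
  · rintro ⟨h1, h2⟩
    have h1' : z.1 % m = w.1 % m := by omega
    refine ⟨z.1 / m - w.1 / m, ?_, ?_⟩
    · linear_combination -ez + ew + h1'
    · exact dvd_of_eq_mul h2 (-1) (by ring)
  · rintro ⟨s, h1, h2⟩
    have e1 : z.1 % m = w.1 % m := by rw [h1]; simp
    have e2 : z.1 / m = w.1 / m + s := by
      rw [h1, Int.add_mul_ediv_left _ _ hm]
    refine ⟨by rw [e1], ?_⟩
    rw [e2]
    exact dvd_of_eq_mul h2 (-1) (by ring)

lemma even_of_dvd {a : ℤ} (hn : n % 2 = 0) (h : (n : ℤ) ∣ a) : a % 2 = 0 := by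
  obtain ⟨c, rfl⟩ := h
  rw [Int.mul_emod]
  have : (n : ℤ) % 2 = 0 := by omega
  simp [this]

lemma parity_of_deck {lam : ℤ} (hn : n % 2 = 0) (hl : (lam - m) % 2 = 0) {z w : ℤ × ℤ} {s : ℤ}
    (h1 : z.1 = w.1 + m * s) (h2 : (n : ℤ) ∣ z.2 - w.2 + lam * s) :
    (z.1 + z.2 - w.1 - w.2) % 2 = 0 := by
  have h3 := even_of_dvd hn h2
  have h4 : (lam - m) * s % 2 = 0 := by rw [Int.mul_emod, hl]; simp
  have h5 : (lam - m) * s = lam * s - m * s := by ring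
  omega

/-- The relation that generates the adjacency of `modelGraph`, in integer coordinates. -/
def modelRel (m n : ℕ) (K lam : ℤ) (i : ℤ) (a : ℤ) (i' : ℤ) (b : ℤ) : Prop :=
  a % 2 = i % 2 ∧ ((i + 1 = i' ∧ (n : ℤ) ∣ b - a) ∨
    (i + 1 = m ∧ i' = 0 ∧ (n : ℤ) ∣ b - (a + lam)) ∨
    (i' = i ∧ ((n : ℤ) ∣ b - (a + layerStep K i) ∨ (n : ℤ) ∣ b - (a - layerStep K i))))

lemma modelGraph_adj_iff_rel [NeZero m] [NeZero n] {K lam : ℤ} (hn : n % 2 = 0) (i : Fin m)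
    (a : ℤ) (i' : Fin m) (b : ℤ) :
    (modelGraph m n K lam).Adj (i, (a : ZMod n)) (i', (b : ZMod n)) ↔
      ((i, (a : ZMod n)) : Fin m × ZMod n) ≠ (i', (b : ZMod n)) ∧
        (modelRel m n K lam (i : ℕ) a (i' : ℕ) b ∨ modelRel m n K lam (i' : ℕ) b (i : ℕ) a) := by
  have key : ∀ (i : Fin m) (a : ℤ) (i' : Fin m) (b : ℤ),
      ((a : ZMod n).val % 2 = (i : ℕ) % 2 ∧
      (((i : ℕ) + 1 = (i' : ℕ) ∧ (b : ZMod n) = a) ∨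
        ((i : ℕ) + 1 = m ∧ (i' : ℕ) = 0 ∧ (b : ZMod n) = a + lam) ∨
        (i' = i ∧ ((b : ZMod n) = a + ((layerStep K (i : ℕ) : ℤ) : ZMod n) ∨
          (b : ZMod n) = a + -((layerStep K (i : ℕ) : ℤ) : ZMod n))))) ↔
      modelRel m n K lam (i : ℕ) a (i' : ℕ) b := by
    intro i a i' b
    have hv := val_parity (n := n) hn a
    have e : ∀ x y : ℤ, ((x : ZMod n) = (y : ZMod n)) ↔ (n : ℤ) ∣ x - y := fun x y => by
      rw [eq_comm, ZMod.intCast_eq_intCast_iff_dvd_sub]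
    have e1 := e b a
    have e2 := e b (a + lam)
    have e3 := e b (a + layerStep K (i : ℕ))
    have e4 := e b (a - layerStep K (i : ℕ))
    push_cast at e2 e3 e4
    rw [sub_eq_add_neg] at e4
    rw [e1, e2, e3, e4, Fin.ext_iff]
    unfold modelRel
    constructor
    · rintro ⟨h1, h2⟩
      exact ⟨by omega, h2.imp (fun h => ⟨by omega, h.2⟩)
        (Or.imp (fun h => ⟨by omega, by omega, h.2.2⟩) (fun h => ⟨by omega, h.2⟩))⟩
    · rintro ⟨h1, h2⟩
      exact ⟨by omega, h2.imp (fun h => ⟨by omega, h.2⟩)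
        (Or.imp (fun h => ⟨by omega, by omega, h.2.2⟩) (fun h => ⟨by omega, h.2⟩))⟩
  rw [modelGraph, alternatingGraph, SimpleGraph.fromRel_adj]
  refine and_congr_right fun _ => or_congr ?_ ?_
  · exact key i a i' b
  · exact key i' b i a

lemma exists_rep [NeZero m] (lam : ℤ) (v : Fin m × ZMod n) :
    ∃ b : ℤ, v = (v.1, (b : ZMod n)) ∧ v = modelMap m n lam ((v.1 : ℕ), b) := by
  obtain ⟨i, a⟩ := v
  obtain ⟨b, rfl⟩ := ZMod.intCast_surjective a
  refine ⟨b, rfl, ?_⟩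
  rw [modelMap_of_lt lam _ _ (by omega) (by have := i.2; simp)]
  ext <;> simp

lemma modelGraph_adj [NeZero m] [NeZero n] {K lam : ℤ} (hm : 3 ≤ m) (hn : n % 2 = 0)
    (hK : K % 2 = 1) (hl : (lam - m) % 2 = 0) (i : ℕ) (hi : i < m) (j : ℤ) (v : Fin m × ZMod n) :
    (modelGraph m n K lam).Adj (modelMap m n lam (i, j)) v ↔
      ∃ x, v = modelMap m n lam (move K x (i, j)) := by
  obtain ⟨b, hv, hv'⟩ := exists_rep lam v
  have hi' := v.1.2
  set i' : Fin m := v.1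
  rw [modelMap_of_lt lam _ _ (by omega) (by omega)]
  conv_lhs => rw [hv]
  rw [modelGraph_adj_iff_rel hn]
  have hsplit : ∀ c : ℤ, c % 2 = 0 ∨ c % 2 = 1 := fun c => by omega
  simp only [Int.toNat_natCast]
  constructor
  · rintro ⟨-, h | h⟩
    · obtain ⟨h1, h2⟩ := h
      have hs : vsign ((i : ℤ), j) = 1 := by unfold vsign; rw [if_pos]; simp only; omega
      rw [hv']
      rcases h2 with h2 | h2 | ⟨h2, h3 | h3⟩
      · refine ⟨0, (modelMap_eq_iff lam _ _).2 ⟨0, ?_, ?_⟩⟩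
        · simp [move, hs]; omega
        · simpa [move] using h2.2
      · refine ⟨0, (modelMap_eq_iff lam _ _).2 ⟨-1, ?_, ?_⟩⟩
        · simp [move, hs]; omega
        · exact dvd_of_eq_mul h2.2.2 1 (by simp [move]; ring)
      · refine ⟨1, (modelMap_eq_iff lam _ _).2 ⟨0, ?_, ?_⟩⟩
        · simpa [move, hs] using h2
        · simpa [move, hs] using h3
      · refine ⟨2, (modelMap_eq_iff lam _ _).2 ⟨0, ?_, ?_⟩⟩
        · simpa [move, hs] using h2
        · simpa [move, hs] using h3
    · obtain ⟨h1, h2⟩ := h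
      rw [hv']
      rcases h2 with h2 | h2 | ⟨h2, h3⟩
      · have := even_of_dvd hn h2.2
        have hs : vsign ((i : ℤ), j) = -1 := by unfold vsign; rw [if_neg]; simp only; omega
        refine ⟨0, (modelMap_eq_iff lam _ _).2 ⟨0, ?_, ?_⟩⟩
        · simp [move, hs]; omega
        · exact dvd_of_eq_mul h2.2 (-1) (by simp [move])
      · have := even_of_dvd hn h2.2.2
        have hs : vsign ((i : ℤ), j) = -1 := by unfold vsign; rw [if_neg]; simp only; omega
        refine ⟨0, (modelMap_eq_iff lam _ _).2 ⟨1, ?_, ?_⟩⟩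
        · simp [move, hs]; omega
        · exact dvd_of_eq_mul h2.2.2 (-1) (by simp [move]; ring)
      · have ho := layerStep_odd hK i
        rw [← h2] at h3
        have hs : vsign ((i : ℤ), j) = -1 := by
          unfold vsign; rw [if_neg]; simp only
          rcases h3 with h3 | h3 <;> have := even_of_dvd hn h3 <;> omega
        rcases h3 with h3 | h3
        · refine ⟨1, (modelMap_eq_iff lam _ _).2 ⟨0, ?_, ?_⟩⟩
          · simpa [move, hs] using h2.symm
          · exact dvd_of_eq_mul h3 (-1) (by simp [move, hs]; ring)
        · refine ⟨2, (modelMap_eq_iff lam _ _).2 ⟨0, ?_, ?_⟩⟩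
          · simpa [move, hs] using h2.symm
          · exact dvd_of_eq_mul h3 (-1) (by simp [move, hs]; ring)
  · rintro ⟨x, hx⟩
    constructor
    · intro he
      have e0 := modelMap_of_lt (m := m) (n := n) lam (i : ℤ) j (by omega) (by omega)
      simp only [Int.toNat_natCast] at e0
      rw [← hv, hx, ← e0, modelMap_eq_iff] at he
      obtain ⟨s, h1, h2⟩ := he
      have h3 := parity_of_deck hn hl h1 h2
      have h4 := move_parity hK x ((i : ℤ), j)
      omega
    · rw [hv', modelMap_eq_iff] at hx
      obtain ⟨s, h1, h2⟩ := hx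
      have hpar := parity_of_deck hn hl h1 h2
      have h4 := move_parity hK x ((i : ℤ), j)
      simp only at h1 h2 hpar h4
      have hb : (((i' : ℕ) : ℤ) + b - i - j) % 2 = 1 := by omega
      have hsmall : x = 0 ∨ s = 0 := by
        by_cases h0 : x = 0
        · exact Or.inl h0
        · right
          have e1 : (move K x ((i : ℤ), j)).1 = i := by
            rw [move, if_neg h0]; split_ifs <;> rfl
          rw [e1] at h1
          have : (m : ℤ) * s < m * 1 ∧ (m : ℤ) * (-1) < m * s := by constructor <;> omega
          have a1 := lt_of_mul_lt_mul_left this.1 (by omega)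
          have a2 := lt_of_mul_lt_mul_left this.2 (by omega)
          omega
      rcases vsign_eq ((i : ℤ), j) with hs | hs
      · have hup : ((i : ℤ) + j) % 2 = 0 := by
          by_contra hc; unfold vsign at hs; rw [if_neg hc] at hs; omega
        by_cases hx0 : x = 0
        · subst hx0
          simp only [move, if_true, hs] at h1 h2
          have hs01 : s = 0 ∨ s = -1 := by
            have : (m : ℤ) * s < m * 1 ∧ (m : ℤ) * (-2) < m * s := by constructor <;> omega
            have a1 := lt_of_mul_lt_mul_left this.1 (by omega)
            have a2 := lt_of_mul_lt_mul_left this.2 (by omega)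
            omega
          rcases hs01 with rfl | rfl
          · exact Or.inl ⟨by omega, Or.inl ⟨by omega, by simpa using h2⟩⟩
          · exact Or.inl ⟨by omega, Or.inr (Or.inl ⟨by omega, by omega,
              dvd_of_eq_mul h2 1 (by ring)⟩)⟩
        · obtain rfl : s = 0 := by tauto
          left
          refine ⟨by omega, Or.inr (Or.inr ?_)⟩
          by_cases hx1 : x = 1
          · subst hx1
            simp only [move, hs] at h1 h2
            exact ⟨by simpa using h1, Or.inl (by simpa using h2)⟩
          · simp only [move, hs, hx0, hx1, if_false] at h1 h2
            exact ⟨by simpa using h1, Or.inr (by simpa using h2)⟩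
      · have hup : ((i : ℤ) + j) % 2 = 1 := by
          by_contra hc; unfold vsign at hs; rw [if_pos (by omega)] at hs; omega
        by_cases hx0 : x = 0
        · subst hx0
          simp only [move, if_true, hs] at h1 h2
          have hs01 : s = 0 ∨ s = 1 := by
            have : (m : ℤ) * s < m * 2 ∧ (m : ℤ) * (-1) < m * s := by constructor <;> omega
            have a1 := lt_of_mul_lt_mul_left this.1 (by omega)
            have a2 := lt_of_mul_lt_mul_left this.2 (by omega)
            omega
          rcases hs01 with rfl | rfl
          · exact Or.inr ⟨by omega, Or.inl ⟨by omega, dvd_of_eq_mul h2 (-1) (by ring)⟩⟩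
          · exact Or.inr ⟨by omega, Or.inr (Or.inl ⟨by omega, by omega,
              dvd_of_eq_mul h2 (-1) (by ring)⟩)⟩
        · obtain rfl : s = 0 := by tauto
          right
          refine ⟨by omega, Or.inr (Or.inr ?_)⟩
          by_cases hx1 : x = 1
          · subst hx1
            simp [move, hs] at h1 h2
            rw [h1]
            exact ⟨rfl, Or.inl (dvd_of_eq_mul h2 (-1) (by ring))⟩
          · simp [move, hs, hx0, hx1] at h1 h2
            rw [h1]
            exact ⟨rfl, Or.inr (dvd_of_eq_mul h2 (-1) (by ring))⟩

lemma modelMap_surjective [NeZero m] (lam : ℤ) : Function.Surjective (modelMap m n lam) :=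
  fun v => let ⟨_, _, h⟩ := exists_rep lam v; ⟨_, h.symm⟩

theorem chart_model {K lam : ℤ} [NeZero m] (hm : 3 ≤ m) (hn4 : 4 ≤ n) (hn : n % 2 = 0)
    (hK : K % 2 = 1) (hl : (lam - m) % 2 = 0) (hmK : m % 2 = 0 ∨ K = 1)
    (hKn : ¬ (n : ℤ) ∣ 2 * K) :
    Chart (modelGraph m n K lam) (standardFactor (modelGraph m n K lam)) m n K lam
      (modelMap m n lam) := by
  have : NeZero n := ⟨by omega⟩
  have hadj : ∀ z v, (modelGraph m n K lam).Adj (modelMap m n lam z) v ↔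
      ∃ x, v = modelMap m n lam (move K x z) := by
    intro z v
    have hm0 : (m : ℤ) ≠ 0 := by omega
    have hz := Int.emod_nonneg z.1 hm0
    have hz' := Int.emod_lt_of_pos z.1 (by omega : (0 : ℤ) < m)
    have ez := Int.emod_add_mul_ediv z.1 m
    obtain ⟨i, hi⟩ : ∃ i : ℕ, (i : ℤ) = z.1 % m := ⟨(z.1 % m).toNat, by omega⟩
    -- A deck translation brings z into the fundamental domain, where adjacency has been computed.
    have h1 : deck m lam (z.1 / m) z = ((i : ℤ), z.2 + lam * (z.1 / m)) := by
      simp only [deck]; ext <;> simp; omega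
    rw [← modelMap_deck lam (z.1 / m) z, h1, modelGraph_adj hm hn hK hl i (by omega)]
    refine exists_congr fun x => ?_
    rw [← h1, move_deck hl hmK, modelMap_deck]
  refine ⟨hm, hn4, hn, hK, hl, hmK, hKn, modelMap_surjective lam, modelMap_eq_iff lam, hadj, ?_⟩
  intro z v
  have hfst : ∀ x, (modelMap m n lam z).1 = (modelMap m n lam (move K x z)).1 ↔ x ≠ 0 := by
    intro x
    have hm0 : (m : ℤ) ≠ 0 := by omega
    have hz := Int.emod_nonneg z.1 hm0
    have hz2 := Int.emod_nonneg (move K x z).1 hm0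
    rw [modelMap, modelMap, Fin.mk.injEq]
    constructor
    · rintro h rfl
      have h' : z.1 % m = (z.1 + vsign z) % m := by
        simp only [move, if_true] at h hz2; omega
      have : (m : ℤ) ∣ z.1 + vsign z - z.1 := Int.ModEq.dvd h'
      rw [add_sub_cancel_left] at this
      rcases vsign_eq z with hs | hs <;> rw [hs] at this
      · have := Int.le_of_dvd (by norm_num) this; omega
      · have := Int.le_of_dvd (by norm_num) ((dvd_neg).2 this); omega
    · intro h
      have : (move K x z).1 = z.1 := by unfold move; split_ifs <;> simp_all
      rw [this]
  change (modelGraph m n K lam).Adj (modelMap m n lam z) v ∧ (modelMap m n lam z).1 = v.1 ↔ _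
  rw [hadj]
  constructor
  · rintro ⟨⟨x, rfl⟩, h⟩
    exact ⟨x, (hfst x).1 h, rfl⟩
  · rintro ⟨x, hx, rfl⟩
    exact ⟨⟨x, rfl⟩, (hfst x).2 hx⟩

end Standard
end AltCycleQuotient

namespace AltCycleQuotient

/-! ### Charts and changes of the parameters -/

section Charts

variable {V : Type*} {Γ C : SimpleGraph V} {m n : ℕ} {K lam : ℤ} {p : ℤ × ℤ → V}

lemma Chart.deck (hp : Chart Γ C m n K lam p) (s : ℤ) (z : ℤ × ℤ) :
    p (deck m lam s z) = p z :=
  (hp.eq_iff _ _).2 ⟨-s, by simp [AltCycleQuotient.deck]; ring,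
    by simp [AltCycleQuotient.deck]⟩

lemma Chart.parity (hp : Chart Γ C m n K lam p) {z w : ℤ × ℤ} (h : p z = p w) :
    (z.1 + z.2 - w.1 - w.2) % 2 = 0 := by
  obtain ⟨s, h1, h2⟩ := (hp.eq_iff z w).1 h
  exact parity_of_deck hp.n_even hp.lam_parity h1 h2

lemma Chart.vsign_eq (hp : Chart Γ C m n K lam p) {z w : ℤ × ℤ} (h : p z = p w) :
    vsign z = vsign w := vsign_congr (hp.parity h)

lemma Chart.layerStep_eq (hp : Chart Γ C m n K lam p) {z w : ℤ × ℤ} (h : p z = p w) :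
    layerStep K z.1 = layerStep K w.1 := by
  obtain ⟨s, h1, h2⟩ := (hp.eq_iff z w).1 h
  have := layerStep_congr hp.even_or_one z.1 s
  rw [← this, h1]; congr 1; ring

lemma Chart.move_eq (hp : Chart Γ C m n K lam p) {z w : ℤ × ℤ} (h : p z = p w) (x : Fin 3) :
    p (move K x z) = p (move K x w) := by
  obtain ⟨s, h1, h2⟩ := (hp.eq_iff z w).1 h
  have hs := hp.vsign_eq h
  have hl := hp.layerStep_eq h
  refine (hp.eq_iff _ _).2 ⟨s, ?_, ?_⟩
  · unfold move; rw [hs, hl]; split_ifs <;> simp only <;> omega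
  · unfold move; rw [hs, hl]; split_ifs
    · exact h2
    · exact dvd_of_eq_mul h2 1 (by ring)
    · exact dvd_of_eq_mul h2 1 (by ring)

lemma Chart.not_dvd_two_layerStep (hp : Chart Γ C m n K lam p) (i : ℤ) :
    ¬ (n : ℤ) ∣ 2 * layerStep K i := by
  unfold layerStep
  split_ifs
  · intro h
    have := Int.le_of_dvd (by norm_num) h
    have := hp.four_le
    omega
  · exact hp.not_dvd

/-- The neighbour of colour 0 lies in another layer because m ≥ 3, and those of colours 1 and 2 are
two step lengths apart, which is not a multiple of n. Hence colours are well defined on the edges of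
Γ. -/
lemma Chart.move_inj (hp : Chart Γ C m n K lam p) {z : ℤ × ℤ} {x y : Fin 3}
    (h : p (move K x z) = p (move K y z)) : x = y := by
  obtain ⟨s, h1, h2⟩ := (hp.eq_iff _ _).1 h
  have hm := hp.three_le
  have hsgn := AltCycleQuotient.vsign_eq z
  have hns := hp.not_dvd_two_layerStep z.1
  have hlt : ∀ s : ℤ, (∃ c : ℤ, (m : ℤ) * s = c ∧ -2 < c ∧ c < 2) → s = 0 := by
    rintro s ⟨c, h, h3, h4⟩
    have a1 : (m : ℤ) * s < m * 1 := by omega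
    have a2 : (m : ℤ) * (-1) < m * s := by omega
    have a1 := lt_of_mul_lt_mul_left a1 (by omega)
    have a2 := lt_of_mul_lt_mul_left a2 (by omega)
    omega
  have hs : s = 0 := by
    apply hlt
    refine ⟨(move K x z).1 - (move K y z).1, by omega, ?_⟩
    unfold move
    split_ifs <;> simp only <;> omega
  subst hs
  by_contra hxy
  unfold move at h1 h2
  have hx : x = 0 ∨ x = 1 ∨ x = 2 := by fin_cases x <;> simp
  have hy : y = 0 ∨ y = 1 ∨ y = 2 := by fin_cases y <;> simp
  rcases hx with rfl | rfl | rfl <;> rcases hy with rfl | rfl | rfl <;>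
    first
    | exact hxy rfl
    | (simp at h1; omega)
    | (simp at h2
       apply hns
       rcases hsgn with hs | hs <;> rw [hs] at h2
       · first
         | exact dvd_of_eq_mul h2 1 (by ring1)
         | exact dvd_of_eq_mul h2 (-1) (by ring1)
       · first
         | exact dvd_of_eq_mul h2 1 (by ring1)
         | exact dvd_of_eq_mul h2 (-1) (by ring1))

theorem Chart.of_factorIso {W : Type*} {Δ D : SimpleGraph W} {q : ℤ × ℤ → W}
    (hq : Chart Δ D m n K lam q) (h : FactorIso Γ C Δ D) : ∃ p, Chart Γ C m n K lam p := by
  obtain ⟨φ, hφ⟩ := h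
  refine ⟨fun z => φ.symm (q z), hq.three_le, hq.four_le, hq.n_even, hq.K_odd, hq.lam_parity,
    hq.even_or_one, hq.not_dvd, φ.symm.surjective.comp hq.surj, ?_, ?_, ?_⟩
  · intro z w
    rw [φ.symm.injective.eq_iff, hq.eq_iff]
  · intro z v
    rw [← φ.map_rel_iff, RelIso.apply_symm_apply, hq.adj]
    exact exists_congr fun x => by rw [← φ.symm.injective.eq_iff]; simp
  · intro z v
    rw [← hφ, RelIso.apply_symm_apply, hq.adjC]
    exact exists_congr fun x => by rw [← φ.symm.injective.eq_iff]; simp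

/-- Charts with the same parameters have the same fibres and the same description of adjacency, so
matching labels is an isomorphism. -/
theorem Chart.factorIso (hp : Chart Γ C m n K lam p) {W : Type*} {Δ D : SimpleGraph W}
    {q : ℤ × ℤ → W} (hq : Chart Δ D m n K lam q) : FactorIso Γ C Δ D := by
  choose s hs using hp.surj
  have hqp : ∀ z w, q z = q w ↔ p z = p w := fun z w => by rw [hp.eq_iff, hq.eq_iff]
  have hf : ∀ z, q (s (p z)) = q z := fun z => (hqp _ _).2 (hs _)
  have hbij : Function.Bijective (fun v => q (s v)) := by
    constructor
    · intro v w h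
      have := (hqp _ _).1 h
      rwa [hs, hs] at this
    · intro w
      obtain ⟨z, rfl⟩ := hq.surj w
      exact ⟨p z, hf z⟩
  have hadj : ∀ v w, Δ.Adj (q (s v)) (q (s w)) ↔ Γ.Adj v w := by
    intro v w
    obtain ⟨z, rfl⟩ := hp.surj v
    obtain ⟨z', rfl⟩ := hp.surj w
    rw [hf, hf, hq.adj, hp.adj]
    exact exists_congr fun x => hqp _ _
  have hadjC : ∀ v w, D.Adj (q (s v)) (q (s w)) ↔ C.Adj v w := by
    intro v w
    obtain ⟨z, rfl⟩ := hp.surj v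
    obtain ⟨z', rfl⟩ := hp.surj w
    rw [hf, hf, hq.adjC, hp.adjC]
    exact exists_congr fun x => and_congr_right fun _ => hqp _ _
  exact ⟨⟨Equiv.ofBijective _ hbij, fun {v w} => hadj v w⟩, hadjC⟩

/-- Changing the parameters within their residue classes. -/
theorem Chart.congr (hp : Chart Γ C m n K lam p) {K' lam' : ℤ} (hK : (n : ℤ) ∣ K' - K)
    (hl : (n : ℤ) ∣ lam' - lam) (h1 : m % 2 = 0 ∨ K' = 1) : Chart Γ C m n K' lam' p := by
  have hKodd : K' % 2 = 1 := by
    have := even_of_dvd hp.n_even hK; have := hp.K_odd; omega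
  have hstep : ∀ i, (n : ℤ) ∣ layerStep K' i - layerStep K i := by
    intro i; unfold layerStep; split_ifs
    · simp
    · exact hK
  have hmove : ∀ x z, p (move K' x z) = p (move K x z) := by
    intro x z
    refine (hp.eq_iff _ _).2 ⟨0, ?_, ?_⟩
    · unfold move; split_ifs <;> simp
    · unfold move; split_ifs
      · simp
      · exact dvd_of_eq_mul (hstep z.1) (vsign z) (by ring)
      · exact dvd_of_eq_mul (hstep z.1) (-vsign z) (by ring)
  refine ⟨hp.three_le, hp.four_le, hp.n_even, hKodd, ?_, h1, ?_, hp.surj, ?_, ?_, ?_⟩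
  · have := even_of_dvd hp.n_even hl; have := hp.lam_parity; omega
  · intro h
    refine hp.not_dvd ?_
    have := h.sub (hK.mul_left 2)
    exact dvd_of_eq_mul this 1 (by ring)
  · intro z w
    rw [hp.eq_iff]
    refine exists_congr fun s => and_congr_right fun _ => ?_
    have := hl.mul_right s
    constructor
    · intro h; exact dvd_of_eq_mul (h.add this) 1 (by ring)
    · intro h; exact dvd_of_eq_mul (h.sub this) 1 (by ring)
  · intro z v; rw [hp.adj]; simp only [hmove]
  · intro z v; rw [hp.adjC]; simp only [hmove]

/-- Interchanging the colours `1` and `2`. -/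
def swapCol : Equiv.Perm (Fin 3) := Equiv.swap 1 2

lemma swapCol_ne_zero {x : Fin 3} : swapCol x ≠ 0 ↔ x ≠ 0 := by revert x; decide

/-- The reflection j ↦ -j respects up and down vertices, interchanges the colours 1 and 2 and
reverses the shift after m layers. -/
theorem Chart.mirror (hp : Chart Γ C m n K lam p) :
    Chart Γ C m n K (-lam) (fun z => p (z.1, -z.2)) := by
  have hs : ∀ z : ℤ × ℤ, vsign (z.1, -z.2) = vsign z := fun z =>
    vsign_congr (by simp only; omega)
  have hmove : ∀ x (z : ℤ × ℤ), ((move K x z).1, -(move K x z).2) =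
      move K (swapCol x) (z.1, -z.2) := by
    intro x z
    have hx : x = 0 ∨ x = 1 ∨ x = 2 := by fin_cases x <;> simp
    have e0 : swapCol 0 = 0 := by decide
    have e1 : swapCol 1 = 2 := by decide
    have e2 : swapCol 2 = 1 := by decide
    rcases hx with rfl | rfl | rfl
    · rw [e0]; simp [move, hs]
    · rw [e1]; simp [move, hs]; ring
    · rw [e2]; simp [move, hs]; ring
  refine ⟨hp.three_le, hp.four_le, hp.n_even, hp.K_odd, ?_, hp.even_or_one, hp.not_dvd, ?_, ?_, ?_,
    ?_⟩
  · have := hp.lam_parity; omega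
  · intro v
    obtain ⟨z, rfl⟩ := hp.surj v
    exact ⟨(z.1, -z.2), by simp⟩
  · intro z w
    rw [hp.eq_iff]
    refine exists_congr fun s => and_congr_right fun _ => ?_
    constructor
    · intro h; exact dvd_of_eq_mul h (-1) (by ring)
    · intro h; exact dvd_of_eq_mul h (-1) (by ring)
  · intro z v
    rw [hp.adj]
    simp only [hmove]
    exact swapCol.surjective.exists
  · intro z v
    rw [hp.adjC]
    simp only [hmove]
    rw [swapCol.surjective.exists]
    simp only [swapCol_ne_zero]

/-- The labelling stays the same; merely the colours 1 and 2 are interchanged in the odd layers. -/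
theorem Chart.neg_left (hp : Chart Γ C m n K lam p) (hm : m % 2 = 0) :
    Chart Γ C m n (-K) lam p := by
  have hmove : ∀ (z : ℤ × ℤ), (z.1 % 2 = 0 → ∀ x, move (-K) x z = move K x z) ∧
      (z.1 % 2 ≠ 0 → ∀ x, move (-K) x z = move K (swapCol x) z) := by
    intro z
    have e0 : swapCol 0 = 0 := by decide
    have e1 : swapCol 1 = 2 := by decide
    have e2 : swapCol 2 = 1 := by decide
    refine ⟨fun h x => by simp [move, layerStep, h], fun h x => ?_⟩
    have hx : x = 0 ∨ x = 1 ∨ x = 2 := by fin_cases x <;> simp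
    rcases hx with rfl | rfl | rfl
    · rw [e0]; simp [move]
    · rw [e1]; simp [move, layerStep, h]; ring
    · rw [e2]; simp [move, layerStep, h]
  refine ⟨hp.three_le, hp.four_le, hp.n_even, ?_, hp.lam_parity, Or.inl hm, ?_, hp.surj,
    hp.eq_iff, ?_, ?_⟩
  · have := hp.K_odd; omega
  · intro h; exact hp.not_dvd (dvd_of_eq_mul h (-1) (by ring))
  · intro z v
    rw [hp.adj]
    by_cases h : z.1 % 2 = 0
    · simp only [(hmove z).1 h]
    · simp only [(hmove z).2 h]
      exact swapCol.surjective.exists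
  · intro z v
    rw [hp.adjC]
    by_cases h : z.1 % 2 = 0
    · simp only [(hmove z).1 h]
    · simp only [(hmove z).2 h]
      rw [swapCol.surjective.exists]
      simp only [swapCol_ne_zero]

/-- The number of half turns applied at a vertex in the isomorphism that adds `n / 2` to `K`. -/
def halfTurns (z : ℤ × ℤ) : ℤ := if (z.1 + z.2) % 2 = 0 then (z.1 + 1) / 2 else z.1 / 2

/-- Each vertex is rotated by `halfTurns` half turns. The number of half turns is the same at both
ends of an edge of colour 0 and on a whole even layer, but in an odd layer up vertices get one more
than down vertices, which changes the step from K to K + h modulo n. Over m layers m/2 half turns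
accumulate, whence the new shift. Evenness of h keeps up vertices up. -/
theorem Chart.shift (hp : Chart Γ C m n K lam p) (hm : m % 2 = 0) (h : ℤ) (hh : h % 2 = 0)
    (hn : (n : ℤ) = 2 * h) :
    ∃ q, Chart Γ C m n (K + h) (lam + h * (m / 2 : ℕ)) q := by
  obtain ⟨m', rfl⟩ : ∃ m', m = 2 * m' := ⟨m / 2, by omega⟩
  have hmm : (2 * m' / 2 : ℕ) = m' := by omega
  rw [hmm]
  set G : ℤ × ℤ → ℤ × ℤ := fun z => (z.1, z.2 + h * halfTurns z) with hG
  have hpar : ∀ a : ℤ, (h * a) % 2 = 0 := fun a => by rw [Int.mul_emod, hh]; simp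
  have hsG : ∀ z, vsign (G z) = vsign z := fun z => vsign_congr (by
    have := hpar (halfTurns z); simp only [hG]; omega)
  have hKo := hp.K_odd
  have hKo' : (K + h) % 2 = 1 := by omega
  have hmove : ∀ x z, p (G (move (K + h) x z)) = p (move K x (G z)) := by
    intro x z
    have hst := hsG z
    have hpm := move_parity hKo' x z
    have hodd := layerStep_odd hKo' z.1
    refine (hp.eq_iff _ _).2 ⟨0, ?_, ?_⟩
    · unfold move; rw [hst]; split_ifs <;> simp [hG]
    · have hx : x = 0 ∨ x = 1 ∨ x = 2 := by fin_cases x <;> simp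
      rcases hx with rfl | rfl | rfl
      · have : halfTurns (move (K + h) 0 z) = halfTurns z := by
          simp only [move, if_true, vsign, halfTurns]
          split_ifs <;> omega
        simp only [hG, this]
        simp [move]
      · by_cases hi : z.1 % 2 = 0
        · have : halfTurns (move (K + h) 1 z) = halfTurns z := by
            simp [move, layerStep, hi, vsign, halfTurns]
            split_ifs <;> omega
          simp only [hG, this]
          simp [move, layerStep, hi]
          exact dvd_of_eq_mul (dvd_zero _) 1 (by have := hsG z; simp only [hG] at this; rw [this]; ring)
        · have : halfTurns (move (K + h) 1 z) = halfTurns z - vsign z := by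
            simp [move, layerStep, hi, vsign, halfTurns]
            split_ifs <;> omega
          simp only [hG, this]
          have h2 := hsG z
          simp only [hG] at h2
          simp [move, layerStep, hi, h2]
          exact dvd_of_eq_mul (dvd_zero _) 1 (by ring)
      · by_cases hi : z.1 % 2 = 0
        · have : halfTurns (move (K + h) 2 z) = halfTurns z := by
            simp [move, layerStep, hi, vsign, halfTurns]
            split_ifs <;> omega
          simp only [hG, this]
          simp [move, layerStep, hi]
          exact dvd_of_eq_mul (dvd_zero _) 1 (by have := hsG z; simp only [hG] at this; rw [this]; ring)
        · have : halfTurns (move (K + h) 2 z) = halfTurns z - vsign z := by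
            simp [move, layerStep, hi, vsign, halfTurns]
            split_ifs <;> omega
          simp only [hG, this]
          have h2 := hsG z
          simp only [hG] at h2
          simp [move, layerStep, hi, h2]
          exact dvd_of_eq_mul (dvd_refl _) (-vsign z) (by rw [hn]; ring)
  refine ⟨fun z => p (G z), hp.three_le, hp.four_le, hp.n_even, hKo', ?_, Or.inl hm, ?_, ?_, ?_, ?_,
    ?_⟩
  · have := hp.lam_parity; have := hpar m'; omega
  · intro hd
    refine hp.not_dvd ?_
    exact dvd_of_eq_mul (hd.sub (dvd_refl _)) 1 (by rw [hn]; ring)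
  · intro v
    obtain ⟨z, rfl⟩ := hp.surj v
    refine ⟨(z.1, z.2 - h * halfTurns z), ?_⟩
    have aux : ∀ a : ℤ, a % 2 = 0 → halfTurns (z.1, z.2 - a) = halfTurns z := by
      intro a ha; unfold halfTurns; split_ifs <;> omega
    have := aux _ (hpar (halfTurns z))
    simp [hG, this]
  · intro z w
    rw [hp.eq_iff]
    refine exists_congr fun s => and_congr_right fun h1 => ?_
    have hl := hp.lam_parity
    have hz1 := hpar (halfTurns z)
    have hz2 := hpar (halfTurns w)
    have hz3 := hpar (m' * s)
    simp only [hG] at h1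
    have hls : (lam * s) % 2 = 0 := by
      have : lam % 2 = 0 := by push_cast at hl; omega
      rw [Int.mul_emod, this]; simp
    have hms : (2 * m' * s : ℤ) % 2 = 0 := by rw [mul_assoc]; omega
    push_cast at h1
    have key : (z.1 + z.2) % 2 = (w.1 + w.2) % 2 → halfTurns z = halfTurns w + m' * s := by
      intro hzw
      have e : (2 * m' * s : ℤ) = 2 * (m' * s) := by ring
      unfold halfTurns
      rw [hzw, h1, e]
      split_ifs <;> omega
    constructor
    · intro hd
      have := even_of_dvd hp.n_even hd
      have hk := key (by simp only [hG] at this; omega)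
      simp only [hG, hk] at hd
      exact dvd_of_eq_mul hd 1 (by ring)
    · intro hd
      have := even_of_dvd hp.n_even hd
      have e : (lam + h * m') * s = lam * s + h * (m' * s) := by ring
      rw [e] at this
      have hk := key (by omega)
      simp only [hG, hk]
      exact dvd_of_eq_mul hd 1 (by ring)
  · intro z v; simp only [hmove]; rw [hp.adj]
  · intro z v; simp only [hmove]; rw [hp.adjC]

end Charts

end AltCycleQuotient

namespace AltCycleQuotient

/-! ### Charts for reachable parameters, and edges moved into the factor -/

section Reach

variable {V : Type*} {Γ C : SimpleGraph V} {m n : ℕ}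

theorem Reachable.chart {k ℓ k' ℓ' : ZMod n} (hR : Reachable m n k ℓ k' ℓ') (hm : m % 2 = 0)
    {K lam : ℤ} {p : ℤ × ℤ → V} (hp : Chart Γ C m n K lam p) (hK : (K : ZMod n) = k)
    (hl : (lam : ZMod n) = ℓ) :
    ∃ (K' lam' : ℤ) (q : ℤ × ℤ → V), (K' : ZMod n) = k' ∧ (lam' : ZMod n) = ℓ' ∧
      Chart Γ C m n K' lam' q := by
  induction hR with
  | refl => exact ⟨K, lam, p, hK, hl, hp⟩
  | neg_left _ ih =>
    obtain ⟨K', lam', q, h1, h2, h3⟩ := ih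
    exact ⟨-K', lam', q, by simp [h1], h2, h3.neg_left hm⟩
  | neg_right _ ih =>
    obtain ⟨K', lam', q, h1, h2, h3⟩ := ih
    exact ⟨K', -lam', _, h1, by simp [h2], h3.mirror⟩
  | shift hn4 hm4 _ ih =>
    obtain ⟨K', lam', q, h1, h2, h3⟩ := ih
    obtain ⟨q', h4⟩ := h3.shift hm ((n / 2 : ℕ) : ℤ) (by omega) (by omega)
    -- With m/2 even the accumulated half turns amount to a multiple of n, and `lam` is unchanged;
    -- in the next case m/2 is odd and one half turn survives.
    obtain ⟨c, hc⟩ : ∃ c : ℕ, m / 2 = 2 * c := ⟨m / 4, by omega⟩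
    have hn : (n : ℤ) = 2 * ((n / 2 : ℕ) : ℤ) := by omega
    refine ⟨_, lam', q', by rw [Int.cast_add, h1, Int.cast_natCast], h2, h4.congr (K' := K' + ((n / 2 : ℕ) : ℤ))
      (by simp) ?_ (Or.inl hm)⟩
    rw [hc]
    refine ⟨-c, ?_⟩
    rw [hn]; push_cast; ring
  | shift_both hn4 hm4 _ ih =>
    obtain ⟨K', lam', q, h1, h2, h3⟩ := ih
    obtain ⟨q', h4⟩ := h3.shift hm ((n / 2 : ℕ) : ℤ) (by omega) (by omega)
    obtain ⟨c, hc⟩ : ∃ c : ℕ, m / 2 = 2 * c + 1 := ⟨m / 4, by omega⟩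
    have hn : (n : ℤ) = 2 * ((n / 2 : ℕ) : ℤ) := by omega
    refine ⟨_, lam' + ((n / 2 : ℕ) : ℤ), q', by rw [Int.cast_add, h1, Int.cast_natCast], by rw [Int.cast_add, h2, Int.cast_natCast],
      h4.congr (K' := K' + ((n / 2 : ℕ) : ℤ)) (by simp) ?_ (Or.inl hm)⟩
    rw [hc]
    refine ⟨-c, ?_⟩
    rw [hn]; push_cast; ring

/-- An automorphism that does not preserve the `2`-factor maps some edge outside of the factor to
an edge of the factor. -/
lemma Chart.exists_of_not_invariant {K lam : ℤ} {p : ℤ × ℤ → V} (hp : Chart Γ C m n K lam p)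
    (h : ¬ IsAutInvariant Γ C) :
    ∃ (φ : Γ ≃g Γ) (z z' : ℤ × ℤ) (y : Fin 3), y ≠ 0 ∧ φ (p z) = p z' ∧
      φ (p (move K 0 z)) = p (move K y z') := by
  have key : ∀ (φ : Γ ≃g Γ) (v w : V), C.Adj (φ v) (φ w) → Γ.Adj v w → ¬ C.Adj v w →
      ∃ (φ : Γ ≃g Γ) (z z' : ℤ × ℤ) (y : Fin 3), y ≠ 0 ∧ φ (p z) = p z' ∧
      φ (p (move K 0 z)) = p (move K y z') := by
    intro φ v w h1 h2 h3
    obtain ⟨z, rfl⟩ := hp.surj v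
    obtain ⟨z', hz'⟩ := hp.surj (φ (p z))
    obtain ⟨x, rfl⟩ := (hp.adj z w).1 h2
    rw [hp.adjC] at h3
    obtain rfl : x = 0 := by
      by_contra hx; exact h3 ⟨x, hx, rfl⟩
    rw [← hz', hp.adjC] at h1
    obtain ⟨y, hy, h1⟩ := h1
    exact ⟨φ, z, z', y, hy, hz'.symm, h1⟩
  have hCΓ : ∀ v w, C.Adj v w → Γ.Adj v w := by
    intro v w h
    obtain ⟨z, rfl⟩ := hp.surj v
    rw [hp.adj]
    obtain ⟨x, -, hx⟩ := (hp.adjC z w).1 h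
    exact ⟨x, hx⟩
  simp only [IsAutInvariant, not_forall] at h
  obtain ⟨φ, v, w, h⟩ := h
  by_cases h1 : C.Adj v w
  -- Here an edge of the factor leaves it, so the inverse automorphism moves an outside edge into
  -- the factor.
  · have h2 : ¬ C.Adj (φ v) (φ w) := fun h2 => h ⟨fun _ => h1, fun _ => h2⟩
    exact key φ.symm (φ v) (φ w) (by simpa using h1) (φ.map_rel_iff.2 (hCΓ _ _ h1)) h2
  · have h2 : C.Adj (φ v) (φ w) := by
      by_contra h2; exact h ⟨fun h3 => absurd h3 h2, fun h3 => absurd h3 h1⟩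
    exact key φ v w h2 (φ.map_rel_iff.1 (hCΓ _ _ h2)) h1

end Reach

/-! ### Displacements of walks in the cover -/

section Displacements

/-- A displacement: the number of layers, and the coefficients of `1` and `K` in the change of
the position within the layer. -/
abbrev Disp := ℤ × ℤ × ℤ

/-- The step of colour `x` from a vertex at the given displacement from a vertex of a layer of
parity `e`, which is an up vertex iff `f` is even. -/
def smove (e f : ℤ) (x : Fin 3) (t : Disp) : Disp :=
  let s : ℤ := if (f + t.1 + t.2.1 + t.2.2) % 2 = 0 then 1 else -1
  if x = 0 then (t.1 + s, t.2.1, t.2.2)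
  else
    let s' : ℤ := if x = 1 then s else -s
    if (e + t.1) % 2 = 0 then (t.1, t.2.1 + s', t.2.2) else (t.1, t.2.1, t.2.2 + s')

/-- The vertex at a given displacement from `z`. -/
def pos (K : ℤ) (z : ℤ × ℤ) (t : Disp) : ℤ × ℤ := (z.1 + t.1, z.2 + t.2.1 + t.2.2 * K)

/-- Since K is odd, a + bK has the parity of a + b. Thus the displacement of a walk, with 1 and K
kept as independent lengths, depends only on its colours and on two parities of the starting vertex,
and not on the parameters of the graph. -/
lemma move_pos {K : ℤ} (hK : K % 2 = 1) (x : Fin 3) (z : ℤ × ℤ) (t : Disp) :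
    move K x (pos K z t) = pos K z (smove (z.1 % 2) ((z.1 + z.2) % 2) x t) := by
  obtain ⟨d, a, b⟩ := t
  have hb : (b * K) % 2 = b % 2 := by rw [Int.mul_emod, hK]; simp
  have hs : vsign (pos K z (d, a, b)) =
      if ((z.1 + z.2) % 2 + d + a + b) % 2 = 0 then 1 else -1 := by
    unfold vsign pos; simp only; split_ifs <;> omega
  have hl : layerStep K (pos K z (d, a, b)).1 = if (z.1 % 2 + d) % 2 = 0 then 1 else K := by
    unfold layerStep pos; simp only; split_ifs <;> first | rfl | omega
  unfold move smove
  rw [hs, hl]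
  simp only [pos]
  split_ifs <;> ext <;> simp <;> ring

/-- The colours other than `y`. -/
def others (y : Fin 3) : List (Fin 3) := if y = 0 then [1, 2] else if y = 1 then [0, 2] else [0, 1]

/-- The displacements of the ends of the walks of `t` further steps that have no two consecutive
steps of the same colour, whose last step does not have the colour `x₀`. -/
def ends (e f : ℤ) (x₀ : Fin 3) : ℕ → Fin 3 → Disp → List Disp
  | 0, y, t => if y = x₀ then [] else [t]
  | s + 1, y, t => (others y).flatMap fun x => ends e f x₀ s x (smove e f x t)

/-- The displacements of closed walks. -/
def IsClosing (m n : ℕ) (K lam : ℤ) (t : Disp) : Prop :=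
  ∃ s : ℤ, t.1 = m * s ∧ (n : ℤ) ∣ t.2.1 + t.2.2 * K + lam * s

variable {V : Type*} {Γ C : SimpleGraph V} {m n : ℕ} {K lam : ℤ} {p : ℤ × ℤ → V}

lemma Chart.isClosing (hp : Chart Γ C m n K lam p) (z : ℤ × ℤ) (t : Disp) :
    p (pos K z t) = p z ↔ IsClosing m n K lam t := by
  rw [hp.eq_iff]
  refine exists_congr fun s => ?_
  have e1 : (pos K z t).1 = z.1 + m * s ↔ t.1 = m * s := by simp [pos]
  have e2 : (pos K z t).2 - z.2 + lam * s = t.2.1 + t.2.2 * K + lam * s := by simp [pos]; ring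
  rw [e1, e2]

end Displacements

/-! ### Counting closed non-backtracking walks -/

section ClosedWalks

variable {V : Type*} [Fintype V]

open Classical in
/-- The number of ways to extend the non-backtracking walk whose last arc is `(u, v)` by `t` steps
to a closed walk from `s` that is cyclically non-backtracking, where `(s, f)` is its first arc. -/
noncomputable def closedWalks (Γ : SimpleGraph V) (s f : V) : ℕ → V → V → ℕ
  | 0, u, v => if v = s ∧ u ≠ f then 1 else 0
  | t + 1, u, v => ∑ w ∈ Finset.univ.filter (fun w => Γ.Adj v w ∧ w ≠ u), closedWalks Γ s f t v w

lemma closedWalks_map {Γ : SimpleGraph V} (φ : Γ ≃g Γ) (s f : V) (t : ℕ) (u v : V) :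
    closedWalks Γ (φ s) (φ f) t (φ u) (φ v) = closedWalks Γ s f t u v := by
  induction t generalizing u v with
  | zero =>
    have h : (φ v = φ s ∧ φ u ≠ φ f) ↔ (v = s ∧ u ≠ f) := by
      rw [ne_eq, φ.injective.eq_iff, φ.injective.eq_iff]
    simp only [closedWalks]
    by_cases h' : v = s ∧ u ≠ f
    · rw [if_pos (h.2 h'), if_pos h']
    · rw [if_neg (fun h2 => h' (h.1 h2)), if_neg h']
  | succ t ih =>
    simp only [closedWalks]
    symm
    refine Finset.sum_bij (fun w _ => φ w) ?_ ?_ ?_ ?_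
    · intro w hw; simpa [φ.map_rel_iff, φ.injective.eq_iff] using hw
    · intro a _ b _ h; exact φ.injective h
    · intro b hb
      refine ⟨φ.symm b, ?_, by simp⟩
      simp only [Finset.mem_filter, Finset.mem_univ, true_and] at hb ⊢
      refine ⟨?_, ?_⟩
      · rw [← φ.map_rel_iff]; simpa using hb.1
      · intro h; exact hb.2 (by rw [← h]; simp)
    · intro w _; exact (ih v w).symm

variable {Γ C : SimpleGraph V} {m n : ℕ} {K lam : ℤ} {p : ℤ × ℤ → V}

open Classical in
-- The three colours at a vertex lead to three different neighbours, so non-backtracking walks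
-- correspond to words without repeated consecutive letters. The count, an invariant of Γ, thereby
-- becomes a count in a list that can be computed.
theorem Chart.closedWalks_eq (hp : Chart Γ C m n K lam p) (z : ℤ × ℤ) (x₀ : Fin 3) (s : ℕ)
    (y : Fin 3) (t : Disp) :
    closedWalks Γ (p z) (p (move K x₀ z)) s (p (move K y (pos K z t))) (p (pos K z t)) =
      (ends (z.1 % 2) ((z.1 + z.2) % 2) x₀ s y t).countP (IsClosing m n K lam ·) := by
  induction s generalizing y t with
  | zero =>
    simp only [closedWalks, ends]
    by_cases h : p (pos K z t) = p z
    · have h1 := hp.move_eq h y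
      by_cases hy : y = x₀
      · subst hy; simp [h, h1]
      · have h2 : p (move K y (pos K z t)) ≠ p (move K x₀ z) := fun h3 =>
          hy (hp.move_inj (h1.symm.trans h3))
        rw [if_pos ⟨h, h2⟩, if_neg hy]
        simp [(hp.isClosing z t).1 h]
    · have h3 : ¬ IsClosing m n K lam t := fun h3 => h ((hp.isClosing z t).2 h3)
      rw [if_neg (fun h4 => h h4.1)]
      split_ifs <;> simp [h3]
  | succ s ih =>
    simp only [closedWalks, ends]
    have hset : (Finset.univ.filter fun w => Γ.Adj (p (pos K z t)) w ∧
        w ≠ p (move K y (pos K z t))) =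
        ((Finset.univ : Finset (Fin 3)).filter (· ≠ y)).image
          (fun x => p (move K x (pos K z t))) := by
      ext w
      simp only [Finset.mem_filter, Finset.mem_univ, true_and, Finset.mem_image, hp.adj]
      constructor
      · rintro ⟨⟨x, rfl⟩, h⟩
        exact ⟨x, fun hx => h (by rw [hx]), rfl⟩
      · rintro ⟨x, hx, rfl⟩
        exact ⟨⟨x, rfl⟩, fun h => hx (hp.move_inj h)⟩
    rw [hset, Finset.sum_image (fun a _ b _ h => hp.move_inj h)]
    have hstep : ∀ x, closedWalks Γ (p z) (p (move K x₀ z)) s (p (pos K z t))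
        (p (move K x (pos K z t))) = (ends (z.1 % 2) ((z.1 + z.2) % 2) x₀ s x
          (smove (z.1 % 2) ((z.1 + z.2) % 2) x t)).countP (IsClosing m n K lam ·) := by
      intro x
      rw [← ih, ← move_pos hp.K_odd, move_move hp.K_odd]
    simp only [hstep, List.countP_flatMap]
    have hy : y = 0 ∨ y = 1 ∨ y = 2 := by fin_cases y <;> simp
    have f0 : (Finset.univ : Finset (Fin 3)).filter (· ≠ 0) = {1, 2} := by decide
    have f1 : (Finset.univ : Finset (Fin 3)).filter (· ≠ 1) = {0, 2} := by decide
    have f2 : (Finset.univ : Finset (Fin 3)).filter (· ≠ 2) = {0, 1} := by decide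
    rcases hy with rfl | rfl | rfl
    · rw [f0, Finset.sum_pair (by decide)]; simp [others]
    · rw [f1, Finset.sum_pair (by decide)]; simp [others]
    · rw [f2, Finset.sum_pair (by decide)]; simp [others]

open Classical in
/-- The closed walks that extend a walk correspond to those that extend its image under an
automorphism. -/
theorem Chart.countP_eq (hp : Chart Γ C m n K lam p) (φ : Γ ≃g Γ) {z z' : ℤ × ℤ} {x x' y y' : Fin 3}
    {t t' : Disp} (h1 : φ (p z) = p z') (h2 : φ (p (move K x z)) = p (move K x' z'))
    (h3 : φ (p (pos K z t)) = p (pos K z' t'))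
    (h4 : φ (p (move K y (pos K z t))) = p (move K y' (pos K z' t'))) (s : ℕ) :
    (ends (z.1 % 2) ((z.1 + z.2) % 2) x s y t).countP (IsClosing m n K lam ·) =
      (ends (z'.1 % 2) ((z'.1 + z'.2) % 2) x' s y' t').countP (IsClosing m n K lam ·) := by
  rw [← hp.closedWalks_eq, ← hp.closedWalks_eq, ← h1, ← h2, ← h3, ← h4, closedWalks_map]

end ClosedWalks

end AltCycleQuotient

/-! ### Closed walks of length 10 without coincidences -/

namespace AltCycleQuotient

/-- The displacements of the walks of length `L` whose first step has the colour `x`. -/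
def edgeEnds (L : ℕ) (e f : ℤ) (x : Fin 3) : List Disp := ends e f x (L - 1) x (smove e f x (0, 0, 0))

section
variable {V : Type*} {Γ C : SimpleGraph V} {m n : ℕ} {K lam : ℤ} {p : ℤ × ℤ → V}

lemma pos_zero (K : ℤ) (z : ℤ × ℤ) : pos K z (0, 0, 0) = z := by simp [pos]

open Classical in
theorem Chart.edge_countP_eq [Fintype V] (hp : Chart Γ C m n K lam p) (φ : Γ ≃g Γ) {z z' : ℤ × ℤ}
    {x x' : Fin 3} (h1 : φ (p z) = p z') (h2 : φ (p (move K x z)) = p (move K x' z')) (L : ℕ) :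
    (edgeEnds L (z.1 % 2) ((z.1 + z.2) % 2) x).countP (IsClosing m n K lam ·) =
      (edgeEnds L (z'.1 % 2) ((z'.1 + z'.2) % 2) x').countP (IsClosing m n K lam ·) := by
  have e : ∀ (z : ℤ × ℤ) x, pos K z (smove (z.1 % 2) ((z.1 + z.2) % 2) x (0, 0, 0)) = move K x z :=
    fun z x => by rw [← move_pos hp.K_odd, pos_zero]
  refine hp.countP_eq φ h1 h2 ?_ ?_ (L - 1)
  · rw [e, e, h2]
  · rw [e, e, move_move hp.K_odd, move_move hp.K_odd, h1]

end

lemma emod_two_mem (a : ℤ) : a % 2 ∈ [(0 : ℤ), 1] := by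
  have := Int.emod_two_eq_zero_or_one a; simpa using this

lemma edgeEnds_bound : ∀ e ∈ [(0 : ℤ), 1], ∀ f ∈ [(0 : ℤ), 1], ∀ x, ∀ t ∈ edgeEnds 10 e f x,
    -5 ≤ t.1 ∧ t.1 ≤ 5 := by
  decide +kernel

/-- The nonzero displacements within a layer of walks of length at most `10`. -/
def layerDisps : List (ℤ × ℤ) :=
  [(2, 0), (4, 0), (10, 0), (0, 2), (0, 4), (0, 10), (4, 2), (4, -2), (2, 4), (2, -4), (2, 6),
    (2, -6), (6, 2), (6, -2), (4, 4), (4, -4)]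

lemma edgeEnds_layer : ∀ e ∈ [(0 : ℤ), 1], ∀ f ∈ [(0 : ℤ), 1], ∀ x, ∀ t ∈ edgeEnds 10 e f x,
    t.1 = 0 → t.2 = (0, 0) ∨ t.2 ∈ layerDisps ∨ -t.2 ∈ layerDisps := by
  decide +kernel

/-- These are the walks that close for all values of the parameters. The surplus 8 - 6 = 2 of the
colour 0 is what distinguishes the edges outside the factor. -/
lemma edgeEnds_count : ∀ e ∈ [(0 : ℤ), 1], ∀ f ∈ [(0 : ℤ), 1], ∀ x,
    (edgeEnds 10 e f x).count (0, 0, 0) = if x = 0 then 8 else 6 := by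
  decide +kernel

/-- The displacements by four layers, up to orientation. -/
def fourLayers (l : List Disp) : List (ℤ × ℤ) :=
  l.filterMap fun t => if t.1 = 4 then some t.2 else if t.1 = -4 then some (-t.2) else none

/-- For m = 4, walks across four layers may close as well. Beyond those through an edge of colour 0,
an edge of another colour has only four candidates: the middle two coincide, and the outer two
differ by 4 or 4K. -/
lemma fourLayers_diff : ∀ e ∈ [(0 : ℤ), 1], ∀ f ∈ [(0 : ℤ), 1], ∀ x : Fin 3, x ≠ 0 →
    ∀ e' ∈ [(0 : ℤ), 1], ∀ f' ∈ [(0 : ℤ), 1],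
    (fourLayers (edgeEnds 10 e f x)).diff (fourLayers (edgeEnds 10 e' f' 0)) ∈
      [[(-4, -2), (-4, 0), (-4, 0), (-4, 2)], [(-2, -4), (0, -4), (0, -4), (2, -4)],
        [(4, -2), (4, 0), (4, 0), (4, 2)], [((-2 : ℤ), (4 : ℤ)), (0, 4), (0, 4), (2, 4)]] := by
  decide +kernel

/-- There are no coincidences among the displacements within a layer. -/
def NoCoincidence (n : ℕ) (K : ℤ) : Prop := ∀ ab ∈ layerDisps, ¬ (n : ℤ) ∣ ab.1 + ab.2 * K

lemma isClosing_six {m n : ℕ} {K lam : ℤ} (hm : 6 ≤ m) {t : Disp} (h1 : -5 ≤ t.1) (h2 : t.1 ≤ 5) :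
    IsClosing m n K lam t ↔ t.1 = 0 ∧ (n : ℤ) ∣ t.2.1 + t.2.2 * K := by
  constructor
  · rintro ⟨s, h3, h4⟩
    have : s = 0 := by
      have a1 : (m : ℤ) * s < m * 1 := by omega
      have a2 : (m : ℤ) * (-1) < m * s := by omega
      have a1 := lt_of_mul_lt_mul_left a1 (by omega)
      have a2 := lt_of_mul_lt_mul_left a2 (by omega)
      omega
    subst this
    exact ⟨by simpa using h3, by simpa using h4⟩
  · rintro ⟨h3, h4⟩
    exact ⟨0, by simpa using h3, by simpa using h4⟩

lemma isClosing_four {n : ℕ} {K lam : ℤ} {t : Disp} (h1 : -5 ≤ t.1) (h2 : t.1 ≤ 5) :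
    IsClosing 4 n K lam t ↔ (t.1 = 0 ∧ (n : ℤ) ∣ t.2.1 + t.2.2 * K) ∨
      (t.1 = 4 ∧ (n : ℤ) ∣ t.2.1 + t.2.2 * K + lam) ∨
      (t.1 = -4 ∧ (n : ℤ) ∣ -t.2.1 + -t.2.2 * K + lam) := by
  constructor
  · rintro ⟨s, h3, h4⟩
    push_cast at h3
    have hs : s = 0 ∨ s = 1 ∨ s = -1 := by omega
    rcases hs with rfl | rfl | rfl
    · exact Or.inl ⟨by simpa using h3, by simpa using h4⟩
    · exact Or.inr (Or.inl ⟨by simpa using h3, by simpa using h4⟩)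
    · exact Or.inr (Or.inr ⟨by simpa using h3, dvd_of_eq_mul h4 (-1) (by ring)⟩)
  · rintro (⟨h3, h4⟩ | ⟨h3, h4⟩ | ⟨h3, h4⟩)
    · exact ⟨0, by simpa using h3, by simpa using h4⟩
    · exact ⟨1, by simpa using h3, by simpa using h4⟩
    · exact ⟨-1, by simpa using h3, dvd_of_eq_mul h4 (-1) (by ring)⟩

lemma NoCoincidence.eq_zero {n : ℕ} {K : ℤ} (h : NoCoincidence n K) {t : Disp}
    (ht : t.2 = (0, 0) ∨ t.2 ∈ layerDisps ∨ -t.2 ∈ layerDisps)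
    (hd : (n : ℤ) ∣ t.2.1 + t.2.2 * K) : t.2 = (0, 0) := by
  rcases ht with ht | ht | ht
  · exact ht
  · exact absurd hd (h _ ht)
  · refine absurd ?_ (h _ ht)
    exact dvd_of_eq_mul hd (-1) (by simp; ring)

open Classical in
lemma countP_six {m n : ℕ} {K lam : ℤ} (hm : 6 ≤ m) (hK : NoCoincidence n K) {e f : ℤ}
    (he : e ∈ [(0 : ℤ), 1]) (hf : f ∈ [(0 : ℤ), 1]) (x : Fin 3) :
    (edgeEnds 10 e f x).countP (IsClosing m n K lam ·) = if x = 0 then 8 else 6 := by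
  rw [← edgeEnds_count e he f hf x, List.count]
  refine List.countP_congr fun t ht => ?_
  have hb := edgeEnds_bound e he f hf x t ht
  have hl := edgeEnds_layer e he f hf x t ht
  simp only [decide_eq_true_eq, beq_iff_eq]
  rw [isClosing_six hm hb.1 hb.2]
  constructor
  · rintro ⟨h1, h2⟩
    have := hK.eq_zero (hl h1) h2
    ext <;> simp [h1, this]
  · rintro rfl; simp

open Classical in
lemma countP_four {n : ℕ} {K lam : ℤ} (hK : NoCoincidence n K) (l : List Disp)
    (hl : ∀ t ∈ l, (-5 ≤ t.1 ∧ t.1 ≤ 5) ∧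
      (t.1 = 0 → t.2 = (0, 0) ∨ t.2 ∈ layerDisps ∨ -t.2 ∈ layerDisps)) :
    l.countP (IsClosing 4 n K lam ·) = l.count (0, 0, 0) +
      (fourLayers l).countP (fun ab => (n : ℤ) ∣ ab.1 + ab.2 * K + lam) := by
  induction l with
  | nil => simp [fourLayers]
  | cons t l ih =>
    have ih := ih fun t ht => hl t (List.mem_cons_of_mem _ ht)
    obtain ⟨hb, h0⟩ := hl t List.mem_cons_self
    have hc := isClosing_four (n := n) (K := K) (lam := lam) hb.1 hb.2
    rw [List.countP_cons, ih, List.count_cons]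
    simp only [fourLayers] at *
    by_cases h4 : t.1 = 4
    · have hne : t ≠ (0, 0, 0) := by rintro rfl; simp at h4
      rw [List.filterMap_cons_some (b := t.2) (by simp [h4]), List.countP_cons]
      simp [hc, h4, hne]
      ring
    · by_cases h5 : t.1 = -4
      · have hne : t ≠ (0, 0, 0) := by rintro rfl; simp at h5
        rw [List.filterMap_cons_some (b := -t.2) (by simp [h5]), List.countP_cons]
        simp [hc, h5, hne]
        ring
      · rw [List.filterMap_cons_none (by simp [h4, h5])]
        have : IsClosing 4 n K lam t ↔ t = (0, 0, 0) := by
          rw [hc]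
          constructor
          · rintro (⟨h1, h2⟩ | ⟨h1, -⟩ | ⟨h1, -⟩)
            · have := hK.eq_zero (h0 h1) h2
              ext <;> simp [h1, this]
            · exact absurd h1 h4
            · exact absurd h1 h5
          · rintro rfl; simp
        simp [this]
        ring

lemma countP_le_diff {α : Type*} [BEq α] [LawfulBEq α] (q : α → Bool) (l l' : List α) :
    l.countP q ≤ l'.countP q + (l.diff l').countP q := by
  induction l' generalizing l with
  | nil => simp
  | cons a l' ih =>
    rw [List.diff_cons, List.countP_cons]
    have := ih (l.erase a)
    by_cases ha : a ∈ l
    · have h := (List.perm_cons_erase ha).countP_eq q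
      rw [List.countP_cons] at h
      omega
    · rw [List.erase_of_not_mem ha] at this ⊢
      omega

open Classical in
-- Among the four additional displacements, the hypotheses on `lam` exclude the middle two, and at
-- most one of the outer two closes, as their difference 4 or 4K is not a multiple of n. A gain of
-- at most 1 cannot outweigh the surplus 2 of the colour 0.
lemma countP_four_lt {n : ℕ} {K lam : ℤ} (hK : NoCoincidence n K) (h1 : ¬ (n : ℤ) ∣ lam + 4)
    (h2 : ¬ (n : ℤ) ∣ lam - 4) (h3 : ¬ (n : ℤ) ∣ lam + 4 * K) (h4 : ¬ (n : ℤ) ∣ lam - 4 * K)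
    {e f e' f' : ℤ} (he : e ∈ [(0 : ℤ), 1]) (hf : f ∈ [(0 : ℤ), 1]) (he' : e' ∈ [(0 : ℤ), 1])
    (hf' : f' ∈ [(0 : ℤ), 1]) {x : Fin 3} (hx : x ≠ 0) :
    (edgeEnds 10 e f x).countP (IsClosing 4 n K lam ·) <
      (edgeEnds 10 e' f' 0).countP (IsClosing 4 n K lam ·) := by
  have hl : ∀ e ∈ [(0 : ℤ), 1], ∀ f ∈ [(0 : ℤ), 1], ∀ x, ∀ t ∈ edgeEnds 10 e f x,
      (-5 ≤ t.1 ∧ t.1 ≤ 5) ∧ (t.1 = 0 → t.2 = (0, 0) ∨ t.2 ∈ layerDisps ∨ -t.2 ∈ layerDisps) :=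
    fun e he f hf x t ht => ⟨edgeEnds_bound e he f hf x t ht, edgeEnds_layer e he f hf x t ht⟩
  rw [countP_four hK _ (hl e he f hf x), countP_four hK _ (hl e' he' f' hf' 0),
    edgeEnds_count e he f hf x, edgeEnds_count e' he' f' hf' 0, if_neg hx, if_pos rfl]
  have hdiff := countP_le_diff (fun ab : ℤ × ℤ => decide ((n : ℤ) ∣ ab.1 + ab.2 * K + lam))
    (fourLayers (edgeEnds 10 e f x)) (fourLayers (edgeEnds 10 e' f' 0))
  have hmem := fourLayers_diff e he f hf x hx e' he' f' hf'
  suffices h : ((fourLayers (edgeEnds 10 e f x)).diff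
      (fourLayers (edgeEnds 10 e' f' 0))).countP
        (fun ab : ℤ × ℤ => decide ((n : ℤ) ∣ ab.1 + ab.2 * K + lam)) ≤ 1 by omega
  have g1 : ¬ (n : ℤ) ∣ 0 + 4 * K := hK (0, 4) (by decide)
  have g2 : ¬ (n : ℤ) ∣ 4 + 0 * K := hK (4, 0) (by decide)
  simp only [List.mem_cons, List.not_mem_nil, or_false] at hmem
  have cnt : ∀ a b c d : ℤ × ℤ, ¬ (n : ℤ) ∣ b.1 + b.2 * K + lam →
      ¬ (n : ℤ) ∣ c.1 + c.2 * K + lam →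
      ¬ (n : ℤ) ∣ (d.1 - a.1) + (d.2 - a.2) * K →
      [a, b, c, d].countP (fun ab : ℤ × ℤ => decide ((n : ℤ) ∣ ab.1 + ab.2 * K + lam)) ≤ 1 := by
    intro a b c d hb hc had
    have : ¬ ((n : ℤ) ∣ a.1 + a.2 * K + lam ∧ (n : ℤ) ∣ d.1 + d.2 * K + lam) := by
      rintro ⟨u, v⟩
      exact had (dvd_of_eq_mul (v.sub u) 1 (by ring))
    simp only [List.countP_cons, List.countP_nil, hb, hc, decide_false]
    by_cases ha : (n : ℤ) ∣ a.1 + a.2 * K + lam <;> by_cases hd : (n : ℤ) ∣ d.1 + d.2 * K + lam <;>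
      simp_all
  rcases hmem with h | h | h | h <;> rw [h] <;> refine cnt _ _ _ _ ?_ ?_ ?_ <;> intro hh
  · exact h2 (dvd_of_eq_mul hh 1 (by ring))
  · exact h2 (dvd_of_eq_mul hh 1 (by ring))
  · exact g1 (dvd_of_eq_mul hh 1 (by ring))
  · exact h4 (dvd_of_eq_mul hh 1 (by ring))
  · exact h4 (dvd_of_eq_mul hh 1 (by ring))
  · exact g2 (dvd_of_eq_mul hh 1 (by ring))
  · exact h1 (dvd_of_eq_mul hh 1 (by ring))
  · exact h1 (dvd_of_eq_mul hh 1 (by ring))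
  · exact g1 (dvd_of_eq_mul hh 1 (by ring))
  · exact h3 (dvd_of_eq_mul hh 1 (by ring))
  · exact h3 (dvd_of_eq_mul hh 1 (by ring))
  · exact g2 (dvd_of_eq_mul hh 1 (by ring))

end AltCycleQuotient

/-! ### Invariance when 4k ≠ ±4 -/

namespace AltCycleQuotient

/-- The conditions on the parameter `k` of `X_a(m, n, k, ℓ)`. -/
structure IsXStep (n : ℕ) (K : ℤ) : Prop where
  sub : ¬ (n : ℤ) ∣ 2 * K - 2
  add : ¬ (n : ℤ) ∣ 2 * K + 2
  sq : (n : ℤ) ∣ 2 * K ^ 2 - 2 ∨ (n : ℤ) ∣ 2 * K ^ 2 + 2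

lemma IsXStep.neg {n : ℕ} {K : ℤ} (h : IsXStep n K) : IsXStep n (-K) :=
  ⟨fun h1 => h.add (dvd_of_eq_mul h1 (-1) (by ring)),
    fun h1 => h.sub (dvd_of_eq_mul h1 (-1) (by ring)), by simpa using h.sq⟩

lemma dvd_iff_emod_eq {n : ℕ} (K : ℤ) (a b : ℤ) :
    (n : ℤ) ∣ a + b * K ↔ (a + b * (K % n)) % n = 0 := by
  rw [← Int.dvd_iff_emod_eq_zero]
  have e : a + b * K = (a + b * (K % n)) + n * (b * (K / n)) := by
    have := Int.emod_add_mul_ediv K n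
    linear_combination (-b) * this
  rw [e, Int.dvd_add_left (dvd_mul_right _ _)]

set_option synthInstance.maxSize 2000 in
-- The finite part of `noCoincidence_or`, which treats n ≥ 81 by hand; it reveals n = 10 and n = 20
-- as the only moduli with further coincidences.
lemma small_coincidences : ∀ n : ℕ, n < 81 → ∀ K : ℕ, K < n →
    (4 ≤ n ∧ n % 2 = 0 ∧ K % 2 = 1 ∧
    ((-2 + 2 * (K : ℤ)) % n ≠ 0 ∧ (2 + 2 * (K : ℤ)) % n ≠ 0) ∧
    ((2 * (K : ℤ) * K - 2) % n = 0 ∨ (2 * (K : ℤ) * K + 2) % n = 0) ∧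
    ((-4 + 4 * (K : ℤ)) % n ≠ 0 ∧ (4 + 4 * (K : ℤ)) % n ≠ 0)) →
    (∀ ab ∈ layerDisps, (ab.1 + ab.2 * (K : ℤ)) % n ≠ 0) ∨ (n = 10 ∧ (K = 3 ∨ K = 7)) ∨
      (n = 20 ∧ (K = 3 ∨ K = 7 ∨ K = 13 ∨ K = 17)) := by
  decide +kernel

lemma noCoincidence_or {n : ℕ} {K : ℤ} (h4 : 4 ≤ n) (hn : n % 2 = 0) (hK : K % 2 = 1)
    (h : IsXStep n K) (h1 : ¬ (n : ℤ) ∣ 4 * K - 4) (h2 : ¬ (n : ℤ) ∣ 4 * K + 4) :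
    NoCoincidence n K ∨ (n = 10 ∧ (K % n = 3 ∨ K % n = 7)) ∨
      (n = 20 ∧ (K % n = 3 ∨ K % n = 7 ∨ K % n = 13 ∨ K % n = 17)) := by
  by_cases hlt : n < 81
  · have hn0 : (n : ℤ) ≠ 0 := by omega
    have hp0 := Int.emod_nonneg K hn0
    have hlt' := Int.emod_lt_of_pos K (by omega : (0 : ℤ) < n)
    obtain ⟨k, hk⟩ : ∃ k : ℕ, (k : ℤ) = K % n := ⟨(K % n).toNat, by omega⟩
    have hkodd : (k : ℤ) % 2 = 1 := by
      rw [hk, Int.emod_emod_of_dvd K (by omega : (2 : ℤ) ∣ n), hK]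
    have hsq : ∀ c : ℤ, (n : ℤ) ∣ 2 * K ^ 2 + c → (2 * (k : ℤ) * k + c) % n = 0 := by
      intro c hc
      rw [← Int.dvd_iff_emod_eq_zero, hk]
      have := Int.emod_add_mul_ediv K n
      have e : K % n = K - n * (K / n) := by linear_combination this
      rw [e]
      refine (dvd_of_eq_mul (hc.sub (dvd_mul_right (n : ℤ)
        (4 * K * (K / n) - 2 * n * (K / n) ^ 2))) 1 ?_)
      ring
    have := small_coincidences n hlt k (by omega) ⟨h4, hn, (by omega),
      ⟨fun h3 => h.sub (by
        have := (dvd_iff_emod_eq K (-2) 2).2 (by rw [← hk]; exact h3)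
        exact dvd_of_eq_mul this 1 (by ring)),
       fun h3 => h.add (by
        have := (dvd_iff_emod_eq K 2 2).2 (by rw [← hk]; exact h3)
        exact dvd_of_eq_mul this 1 (by ring))⟩,
      (h.sq.imp (fun h3 => by simpa [sub_eq_add_neg] using hsq (-2) (by rw [← sub_eq_add_neg]; exact h3)) (hsq 2)),
      ⟨fun h3 => h1 (by
        have := (dvd_iff_emod_eq K (-4) 4).2 (by rw [← hk]; exact h3)
        exact dvd_of_eq_mul this 1 (by ring)),
       fun h3 => h2 (by
        have := (dvd_iff_emod_eq K 4 4).2 (by rw [← hk]; exact h3)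
        exact dvd_of_eq_mul this 1 (by ring))⟩⟩
    rcases this with h3 | h3 | h3
    · left
      intro ab hab
      rw [dvd_iff_emod_eq, ← hk]
      exact h3 ab hab
    · right; left; omega
    · right; right; omega
  · left
    -- Multiplying a + bK by 2(a - bK) and using 2K² = ±2 eliminates K. For the displacements with a
    -- ≠ ±b other than 10 and 10K, the resulting numbers are nonzero and at most 2(6² + 2²) = 80 in
    -- absolute value, so they are not multiples of n ≥ 81.
    have key : ∀ a b : ℤ, (n : ℤ) ∣ a + b * K →
        (n : ℤ) ∣ 2 * a ^ 2 - 2 * b ^ 2 ∨ (n : ℤ) ∣ 2 * a ^ 2 + 2 * b ^ 2 := by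
      intro a b hab
      rcases h.sq with h3 | h3
      · left
        exact dvd_of_eq_mul ((hab.mul_right (2 * (a - b * K))).add (h3.mul_right (b ^ 2))) 1
          (by ring)
      · right
        exact dvd_of_eq_mul ((hab.mul_right (2 * (a - b * K))).add (h3.mul_right (b ^ 2))) 1
          (by ring)
    have small : ∀ c : ℤ, c ≠ 0 → -80 ≤ c → c ≤ 80 → ¬ (n : ℤ) ∣ c := by
      intro c h0 hl hu hd
      rcases lt_or_gt_of_ne h0 with h3 | h3
      · have := Int.le_of_dvd (by omega) ((dvd_neg).2 hd); omega
      · have := Int.le_of_dvd h3 hd; omega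
    have fin : ∀ a b : ℤ, (2 * a ^ 2 - 2 * b ^ 2 ≠ 0 ∧ -80 ≤ 2 * a ^ 2 - 2 * b ^ 2 ∧
        2 * a ^ 2 + 2 * b ^ 2 ≠ 0 ∧ 2 * a ^ 2 + 2 * b ^ 2 ≤ 80 ∧ 0 ≤ 2 * a ^ 2 + 2 * b ^ 2 ∧
        2 * a ^ 2 - 2 * b ^ 2 ≤ 80) → ¬ (n : ℤ) ∣ a + b * K := by
      rintro a b ⟨q1, q2, q3, q4, q5, q6⟩ hab
      rcases key a b hab with h3 | h3
      · exact small _ q1 q2 q6 h3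
      · exact small _ q3 (by omega) q4 h3
    intro ab hab
    simp only [layerDisps, List.mem_cons, List.not_mem_nil, or_false] at hab
    rcases hab with rfl | rfl | rfl | rfl | rfl | rfl | rfl | rfl | rfl | rfl | rfl | rfl | rfl |
      rfl | rfl | rfl
    · exact fin _ _ (by norm_num)
    · exact fin _ _ (by norm_num)
    · simpa using small 10 (by norm_num) (by norm_num) (by norm_num)
    · exact fin _ _ (by norm_num)
    · exact fin _ _ (by norm_num)
    · intro hd
      rcases h.sq with h3 | h3
      · exact small 20 (by norm_num) (by norm_num) (by norm_num)
          (dvd_of_eq_mul ((hd.mul_right (2 * K)).sub (h3.mul_right 10)) 1 (by ring))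
      · exact small (-20) (by norm_num) (by norm_num) (by norm_num)
          (dvd_of_eq_mul ((hd.mul_right (2 * K)).sub (h3.mul_right 10)) 1 (by ring))
    · exact fin _ _ (by norm_num)
    · exact fin _ _ (by norm_num)
    · exact fin _ _ (by norm_num)
    · exact fin _ _ (by norm_num)
    · exact fin _ _ (by norm_num)
    · exact fin _ _ (by norm_num)
    · exact fin _ _ (by norm_num)
    · exact fin _ _ (by norm_num)
    · intro hd; exact h2 (dvd_of_eq_mul hd 1 (by ring))
    · intro hd; exact h1 (dvd_of_eq_mul hd (-1) (by ring))

lemma countP_ten : ∀ e ∈ [(0 : ℤ), 1], ∀ f ∈ [(0 : ℤ), 1], ∀ x,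
    (edgeEnds 10 e f x).countP (fun t => t.1 = 0 ∧ (t.2.1 + t.2.2 * 3) % ((10 : ℕ) : ℤ) = 0) =
      if x = 0 then 16 else 18 := by
  decide +kernel

lemma countP_twenty : ∀ k ∈ [(3 : ℤ), 7], ∀ e ∈ [(0 : ℤ), 1], ∀ f ∈ [(0 : ℤ), 1], ∀ x,
    (edgeEnds 10 e f x).countP (fun t => t.1 = 0 ∧ (t.2.1 + t.2.2 * k) % ((20 : ℕ) : ℤ) = 0) =
      (if x = 0 then 12 else 14) ∧
    (edgeEnds 10 e f x).countP
      (fun t => (t.1 = 0 ∨ t.1 = 4 ∨ t.1 = -4) ∧ (t.2.1 + t.2.2 * k) % ((20 : ℕ) : ℤ) = 0) =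
      (if x = 0 then 12 else 14) := by
  decide +kernel

variable {V : Type*} {Γ C : SimpleGraph V} {m n : ℕ} {K lam : ℤ} {p : ℤ × ℤ → V}

open Classical in
lemma Chart.invariant_of_countP [Fintype V] (hp : Chart Γ C m n K lam p) (L : ℕ)
    (h : ∀ e ∈ [(0 : ℤ), 1], ∀ f ∈ [(0 : ℤ), 1], ∀ e' ∈ [(0 : ℤ), 1], ∀ f' ∈ [(0 : ℤ), 1],
      ∀ x : Fin 3, x ≠ 0 → (edgeEnds L e f 0).countP (IsClosing m n K lam ·) ≠
        (edgeEnds L e' f' x).countP (IsClosing m n K lam ·)) : IsAutInvariant Γ C := by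
  by_contra hinv
  obtain ⟨φ, z, z', y, hy, h1, h2⟩ := hp.exists_of_not_invariant hinv
  exact h _ (emod_two_mem _) _ (emod_two_mem _) _ (emod_two_mem _) _ (emod_two_mem _) y hy
    (hp.edge_countP_eq φ h1 h2 L)

open Classical in
/-- Outside of the family with `4 k = ± 4` the closed walks of length `10` distinguish the edges
of the `2`-factor. -/
theorem Chart.invariant_of_not_four [Fintype V] (hp : Chart Γ C m n K lam p) (hm : m % 2 = 0)
    (h : IsXStep n K) (h1 : ¬ (n : ℤ) ∣ 4 * K - 4) (h2 : ¬ (n : ℤ) ∣ 4 * K + 4)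
    (hl : m = 4 → (n : ℤ) ∣ lam * K - lam ∨ (n : ℤ) ∣ lam * K + lam)
    (h10 : ¬ (m = 4 ∧ n = 10)) (h20 : ¬ (m = 4 ∧ n = 20 ∧ (n : ℤ) ∣ lam - 10)) :
    IsAutInvariant Γ C := by
  have hm3 := hp.three_le
  have h4 := hp.four_le
  -- the case of a residue of `K` in the lower half suffices
  wlog hres : NoCoincidence n K ∨ (n = 10 ∧ K % n = 3) ∨ (n = 20 ∧ (K % n = 3 ∨ K % n = 7))
    generalizing K p
  · rcases noCoincidence_or h4 hp.n_even hp.K_odd h h1 h2 with h3 | h3 | h3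
    · exact this hp h h1 h2 hl (Or.inl h3)
    · by_cases h5 : K % n = 3
      · exact this hp h h1 h2 hl (Or.inr (Or.inl ⟨h3.1, h5⟩))
      · refine this (hp.neg_left hm) h.neg (fun h6 => h2 (dvd_of_eq_mul h6 (-1) (by ring)))
          (fun h6 => h1 (dvd_of_eq_mul h6 (-1) (by ring))) (fun h6 => ?_) (Or.inr (Or.inl ?_))
        · exact (hl h6).symm.imp (fun h7 => dvd_of_eq_mul h7 (-1) (by ring))
            (fun h7 => dvd_of_eq_mul h7 (-1) (by ring))
        · obtain ⟨rfl, h3⟩ := h3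
          refine ⟨rfl, ?_⟩
          simp only [Nat.cast_ofNat] at h3 h5 ⊢
          omega
    · by_cases h5 : K % n = 3 ∨ K % n = 7
      · exact this hp h h1 h2 hl (Or.inr (Or.inr ⟨h3.1, h5⟩))
      · refine this (hp.neg_left hm) h.neg (fun h6 => h2 (dvd_of_eq_mul h6 (-1) (by ring)))
          (fun h6 => h1 (dvd_of_eq_mul h6 (-1) (by ring))) (fun h6 => ?_) (Or.inr (Or.inr ?_))
        · exact (hl h6).symm.imp (fun h7 => dvd_of_eq_mul h7 (-1) (by ring))
            (fun h7 => dvd_of_eq_mul h7 (-1) (by ring))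
        · obtain ⟨rfl, h3⟩ := h3
          refine ⟨rfl, ?_⟩
          simp only [Nat.cast_ofNat] at h3 h5 ⊢
          omega
  refine hp.invariant_of_countP 10 ?_
  intro e he f hf e' he' f' hf' x hx
  have hb := edgeEnds_bound
  have hfix : ∀ (k : ℤ) (N : ℕ), n = N → K % N = k → ∀ t : Disp,
      (n : ℤ) ∣ t.2.1 + t.2.2 * K ↔ (t.2.1 + t.2.2 * k) % N = 0 := by
    rintro k N rfl rfl t; exact dvd_iff_emod_eq K _ _
  have hsix : ∀ (k : ℤ) (N : ℕ), n = N → K % N = k → 6 ≤ m → ∀ e ∈ [(0 : ℤ), 1],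
      ∀ f ∈ [(0 : ℤ), 1], ∀ x, (edgeEnds 10 e f x).countP (IsClosing m n K lam ·) =
        (edgeEnds 10 e f x).countP (fun t => t.1 = 0 ∧ (t.2.1 + t.2.2 * k) % N = 0) := by
    intro k N h3 h5 hm6 e he f hf x
    refine List.countP_congr fun t ht => ?_
    have := hb e he f hf x t ht
    simp only [decide_eq_true_eq]
    rw [isClosing_six hm6 this.1 this.2, hfix k N h3 h5]
  rcases hres with h3 | ⟨rfl, h3⟩ | ⟨rfl, h3⟩
  · by_cases hm6 : 6 ≤ m
    · rw [countP_six hm6 h3 he hf, countP_six hm6 h3 he' hf', if_pos rfl, if_neg hx]; norm_num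
    · obtain rfl : m = 4 := by omega
      have hl := hl rfl
      -- Since `lam` * K = ±`lam` modulo n, `lam` = ±4 would give 4K = ±4. In the same way `lam` =
      -- ±4K would give 4K² = ±4K, hence again 4K = ±4 because 4K² = ±4.
      have aux1 : ∀ c : ℤ, (c = 4 ∨ c = -4) → ¬ (n : ℤ) ∣ lam - c := by
        intro c hc hd
        rcases hl with h5 | h5
        · have h6 : (n : ℤ) ∣ c * K - c :=
            dvd_of_eq_mul (h5.sub (hd.mul_right (K - 1))) 1 (by ring)
          rcases hc with rfl | rfl
          · exact h1 h6
          · exact h1 (dvd_of_eq_mul h6 (-1) (by ring))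
        · have h6 : (n : ℤ) ∣ c * K + c :=
            dvd_of_eq_mul (h5.sub (hd.mul_right (K + 1))) 1 (by ring)
          rcases hc with rfl | rfl
          · exact h2 h6
          · exact h2 (dvd_of_eq_mul h6 (-1) (by ring))
      have aux2 : ∀ c : ℤ, (c = 4 ∨ c = -4) → ¬ (n : ℤ) ∣ lam - c * K := by
        intro c hc hd
        have h6 : ∀ ε : ℤ, (n : ℤ) ∣ lam * K - ε * lam → (n : ℤ) ∣ c * K ^ 2 - ε * c * K := by
          intro ε h7
          exact dvd_of_eq_mul (h7.sub (hd.mul_right (K - ε))) 1 (by ring)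
        have h7 : (n : ℤ) ∣ c * K ^ 2 - c * K ∨ (n : ℤ) ∣ c * K ^ 2 + c * K :=
          hl.imp (fun h8 => dvd_of_eq_mul (h6 1 (dvd_of_eq_mul h8 1 (by ring))) 1 (by ring))
            (fun h8 => dvd_of_eq_mul (h6 (-1) (dvd_of_eq_mul h8 1 (by ring))) 1 (by ring))
        have h8 : (n : ℤ) ∣ 4 * K ^ 2 - 4 * K ∨ (n : ℤ) ∣ 4 * K ^ 2 + 4 * K := by
          rcases hc with rfl | rfl
          · exact h7
          · exact h7.imp (fun h8 => dvd_of_eq_mul h8 (-1) (by ring))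
              (fun h8 => dvd_of_eq_mul h8 (-1) (by ring))
        rcases h.sq with h5 | h5 <;> rcases h8 with h8 | h8
        · exact h1 (dvd_of_eq_mul ((h5.mul_right 2).sub h8) 1 (by ring))
        · exact h2 (dvd_of_eq_mul (h8.sub (h5.mul_right 2)) 1 (by ring))
        · exact h2 (dvd_of_eq_mul ((h5.mul_right 2).sub h8) 1 (by ring))
        · exact h1 (dvd_of_eq_mul (h8.sub (h5.mul_right 2)) 1 (by ring))
      refine (countP_four_lt h3 ?_ ?_ ?_ ?_ he' hf' he hf hx).ne'
      · exact fun h5 => aux1 (-4) (Or.inr rfl) (by simpa using h5)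
      · exact aux1 4 (Or.inl rfl)
      · exact fun h5 => aux2 (-4) (Or.inr rfl) (by simpa using h5)
      · exact aux2 4 (Or.inl rfl)
  · have hm6 : 6 ≤ m := by omega
    rw [hsix 3 10 rfl h3 hm6 e he f hf, hsix 3 10 rfl h3 hm6 e' he' f' hf']
    have e1 := countP_ten e he f hf 0
    have e2 := countP_ten e' he' f' hf' x
    rw [if_neg hx] at e2
    rw [if_pos rfl] at e1
    rw [e1, e2]; norm_num
  · obtain ⟨k, hk, h3⟩ : ∃ k ∈ [(3 : ℤ), 7], K % (20 : ℕ) = k := by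
      rcases h3 with h3 | h3
      · exact ⟨3, by simp, h3⟩
      · exact ⟨7, by simp, h3⟩
    have e1 := countP_twenty k hk e he f hf 0
    have e2 := countP_twenty k hk e' he' f' hf' x
    rw [if_neg hx] at e2
    rw [if_pos rfl] at e1
    by_cases hm6 : 6 ≤ m
    · rw [hsix k 20 rfl h3 hm6 e he f hf, hsix k 20 rfl h3 hm6 e' he' f' hf']
      rw [e1.1, e2.1]; norm_num
    · obtain rfl : m = 4 := by omega
      -- The relation `lam` * k = ±`lam` with k = 3 or 7 and `lam` even leaves only 0 and 10 modulo
      -- 20, and 10 is the sporadic graph.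
      have hlam0 : ((20 : ℕ) : ℤ) ∣ lam := by
        have h5 := hl rfl
        have hlp := hp.lam_parity
        have h6 : ¬ ((20 : ℕ) : ℤ) ∣ lam - 10 := fun h6 => h20 ⟨rfl, rfl, h6⟩
        obtain ⟨c, hc⟩ : ∃ c, K = k + 20 * c := ⟨K / 20, by push_cast at h3; omega⟩
        have h7 : ((20 : ℕ) : ℤ) ∣ lam * k - lam ∨ ((20 : ℕ) : ℤ) ∣ lam * k + lam := by
          subst hc
          refine h5.imp (fun h7 => ?_) (fun h7 => ?_)
          · exact dvd_of_eq_mul (h7.sub (dvd_mul_right ((20 : ℕ) : ℤ) (lam * c))) 1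
              (by push_cast; ring)
          · exact dvd_of_eq_mul (h7.sub (dvd_mul_right ((20 : ℕ) : ℤ) (lam * c))) 1
              (by push_cast; ring)
        simp only [List.mem_cons, List.not_mem_nil, or_false] at hk
        push_cast at h6 h7 hlp ⊢
        rcases hk with rfl | rfl <;> omega
      have hfour : ∀ e ∈ [(0 : ℤ), 1], ∀ f ∈ [(0 : ℤ), 1], ∀ x,
          (edgeEnds 10 e f x).countP (IsClosing 4 20 K lam ·) = (edgeEnds 10 e f x).countP
            (fun t => (t.1 = 0 ∨ t.1 = 4 ∨ t.1 = -4) ∧ (t.2.1 + t.2.2 * k) % ((20 : ℕ) : ℤ) = 0) := by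
        intro e he f hf x
        refine List.countP_congr fun t ht => ?_
        have hbt := hb e he f hf x t ht
        have hf := hfix k 20 rfl h3 t
        simp only [decide_eq_true_eq]
        rw [isClosing_four hbt.1 hbt.2, Int.dvd_add_left hlam0, Int.dvd_add_left hlam0]
        have : ((20 : ℕ) : ℤ) ∣ -t.2.1 + -t.2.2 * K ↔ ((20 : ℕ) : ℤ) ∣ t.2.1 + t.2.2 * K := by
          rw [← dvd_neg]; ring_nf
        rw [this, hf]
        rw [← or_and_right, ← or_and_right]
      rw [hfour e he f hf, hfour e' he' f' hf']
      rw [e1.2, e2.2]; norm_num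

end AltCycleQuotient

namespace AltCycleQuotient

/-! ### Periods of maps on ℤ -/

section Period

variable {α : Type*}

/-- The integers k with f k = f 0 form a subgroup of ℤ, nonzero because f takes finitely many
values; n is its positive generator. -/
lemma exists_period [Finite α] (f : ℤ → α) (hf : ∀ i j k, f i = f j → f (i + k) = f (j + k)) :
    ∃ n : ℕ, 0 < n ∧ ∀ i j, f i = f j ↔ (n : ℤ) ∣ i - j := by
  have hf' : ∀ i j, f i = f j ↔ f (i - j) = f 0 := fun i j =>
    ⟨fun h => by simpa [sub_eq_add_neg] using hf i j (-j) h,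
      fun h => by simpa using hf _ _ j h⟩
  let H : AddSubgroup ℤ :=
    { carrier := {k | f k = f 0}
      zero_mem' := rfl
      add_mem' := fun {a b} ha hb => by
        have := hf a 0 b ha
        rw [zero_add] at this
        exact this.trans hb
      neg_mem' := fun {a} ha => by
        have := hf a 0 (-a) ha
        simp only [add_neg_cancel, zero_add] at this
        exact this.symm }
  obtain ⟨a, ha⟩ := Int.subgroup_cyclic H
  have hmem : ∀ k, f k = f 0 ↔ (a.natAbs : ℤ) ∣ k := by
    intro k
    change k ∈ H ↔ _
    rw [ha, ← AddSubgroup.zmultiples_eq_closure, Int.mem_zmultiples_iff, Int.natAbs_dvd]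
  refine ⟨a.natAbs, ?_, fun i j => by rw [hf', hmem]⟩
  obtain ⟨i, j, hij, h⟩ := Finite.exists_ne_map_eq_of_infinite f
  rw [hf', hmem] at h
  rcases Nat.eq_zero_or_pos a.natAbs with h0 | h0
  · rw [h0] at h
    simp only [Nat.cast_zero, zero_dvd_iff] at h
    omega
  · exact h0

lemma card_range_of_period {f : ℤ → α} {n : ℕ} (hn : 0 < n)
    (hf : ∀ i j, f i = f j ↔ (n : ℤ) ∣ i - j) : Nat.card (Set.range f) = n := by
  have : Function.Bijective (fun i : Fin n => (⟨f (i : ℕ), Set.mem_range_self _⟩ : Set.range f)) := by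
    constructor
    · intro i j h
      have h1 := (hf _ _).1 (Subtype.ext_iff.1 h)
      obtain ⟨c, hc⟩ := h1
      have hi := i.2
      have hj := j.2
      have hc0 : c = 0 := by
        have a1 : (n : ℤ) * c < n * 1 := by omega
        have a2 : (n : ℤ) * (-1) < n * c := by omega
        have a1 := lt_of_mul_lt_mul_left a1 (by omega)
        have a2 := lt_of_mul_lt_mul_left a2 (by omega)
        omega
      subst hc0
      ext; omega
    · rintro ⟨_, j, rfl⟩
      have h1 := Int.emod_nonneg j (by omega : (n : ℤ) ≠ 0)
      have h2 := Int.emod_lt_of_pos j (by omega : (0 : ℤ) < n)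
      refine ⟨⟨(j % n).toNat, by omega⟩, Subtype.ext ((hf _ _).2 ?_)⟩
      have : ((j % n).toNat : ℤ) = j % n := by omega
      simp only [this]
      exact dvd_of_eq_mul (dvd_refl (n : ℤ)) (-(j / n)) (by
        have := Int.emod_add_mul_ediv j n; linear_combination this)
  rw [← Nat.card_eq_of_bijective _ this, Nat.card_fin]

end Period

/-! ### Labelled cycles -/

section Cycles

variable {V : Type*} {C : SimpleGraph V} {n n' : ℕ} {γ δ : ℤ → V}

/-- A labelling of a connected component of `C`, which is a cycle of length `n`. -/
structure CycleParam (C : SimpleGraph V) (n : ℕ) (γ : ℤ → V) : Prop where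
  three_le : 3 ≤ n
  adj : ∀ j u, C.Adj (γ j) u ↔ u = γ (j + 1) ∨ u = γ (j - 1)
  eq_iff : ∀ i j, γ i = γ j ↔ (n : ℤ) ∣ i - j

/-- Sending an arc (u, v) to (v, w), with w the other neighbour of v, permutes the arcs. The tails
along the orbit of one arc give the labelling, and the period of the orbit is the length. -/
theorem exists_cycleParam [Finite V]
    (hnb : ∀ v, ∃ a b, a ≠ b ∧ ∀ w, C.Adj v w ↔ w = a ∨ w = b) (v : V) :
    ∃ n γ, CycleParam C n γ ∧ γ 0 = v := by
  have ho : ∀ v w, ∃ u, C.Adj v w → C.Adj v u ∧ u ≠ w ∧ ∀ u', C.Adj v u' → u' = w ∨ u' = u := by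
    intro v w
    obtain ⟨a, b, hab, h⟩ := hnb v
    by_cases h1 : w = a
    · exact ⟨b, fun _ => ⟨(h b).2 (Or.inr rfl), by rw [h1]; exact hab.symm,
        fun u' hu' => by rw [h1]; exact (h u').1 hu'⟩⟩
    · refine ⟨a, fun hw => ⟨(h a).2 (Or.inl rfl), fun h2 => h1 h2.symm, fun u' hu' => ?_⟩⟩
      have h2 := (h w).1 hw
      have h3 := (h u').1 hu'
      rcases h2 with h2 | h2
      · exact absurd h2 h1
      · rw [h2]; exact h3.symm
  choose o ho using ho
  have hoo : ∀ {v w}, C.Adj v w → o v (o v w) = w := by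
    intro v w h
    obtain ⟨h1, h2, h3⟩ := ho v w h
    obtain ⟨h4, h5, h6⟩ := ho v _ h1
    exact (h3 _ h4).resolve_right h5
  let D := {d : V × V // C.Adj d.1 d.2}
  let N : Equiv.Perm D :=
    { toFun := fun d => ⟨(d.1.2, o d.1.2 d.1.1), (ho _ _ d.2.symm).1⟩
      invFun := fun d => ⟨(o d.1.1 d.1.2, d.1.1), (ho _ _ d.2).1.symm⟩
      left_inv := fun d => Subtype.ext (Prod.ext (hoo d.2.symm) rfl)
      right_inv := fun d => Subtype.ext (Prod.ext rfl (hoo d.2)) }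
  obtain ⟨a, b, -, hv⟩ := hnb v
  let d0 : D := ⟨(v, a), (hv a).2 (Or.inl rfl)⟩
  let f : ℤ → D := fun j => (N ^ j) d0
  have hfs : ∀ j, f (j + 1) = N (f j) := by
    intro j
    change (N ^ (j + 1)) d0 = N ((N ^ j) d0)
    rw [add_comm, zpow_add, zpow_one, Equiv.Perm.mul_apply]
  have hf : ∀ i j k, f i = f j → f (i + k) = f (j + k) := by
    intro i j k h
    change (N ^ (i + k)) d0 = (N ^ (j + k)) d0
    rw [add_comm i, add_comm j, zpow_add, zpow_add, Equiv.Perm.mul_apply, Equiv.Perm.mul_apply]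
    exact congrArg _ h
  obtain ⟨n, hn0, hn⟩ := exists_period f hf
  set γ : ℤ → V := fun j => (f j).1.1 with hγ
  have h1 : ∀ j, (f j).1.2 = γ (j + 1) := fun j => by rw [hγ]; simp only [hfs]; rfl
  have h2 : ∀ j, γ (j + 2) = o (γ (j + 1)) (γ j) := by
    intro j
    rw [← h1 j, show j + 2 = (j + 1) + 1 by ring, ← h1, hfs]
    rfl
  have hadj1 : ∀ j, C.Adj (γ j) (γ (j + 1)) := fun j => by rw [← h1]; exact (f j).2
  have h3 : ∀ j, γ j = o (γ (j + 1)) (γ (j + 2)) := fun j => by rw [h2, hoo (hadj1 j).symm]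
  have hne : ∀ j, γ (j + 1) ≠ γ (j - 1) := by
    intro j
    have := h2 (j - 1)
    rw [show j - 1 + 2 = j + 1 by ring, show j - 1 + 1 = j by ring] at this
    rw [this]
    have h5 := hadj1 (j - 1)
    rw [show j - 1 + 1 = j by ring] at h5
    exact (ho _ _ h5.symm).2.1
  have hadj : ∀ j u, C.Adj (γ j) u ↔ u = γ (j + 1) ∨ u = γ (j - 1) := by
    intro j u
    have h5 := hadj1 (j - 1)
    rw [show j - 1 + 1 = j by ring] at h5
    have h6 := h3 (j - 1)
    rw [show j - 1 + 2 = j + 1 by ring, show j - 1 + 1 = j by ring] at h6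
    constructor
    · intro h
      rw [h6]
      exact (ho _ _ (hadj1 j)).2.2 u h
    · rintro (rfl | rfl)
      · exact hadj1 j
      · exact h5.symm
  have hrev : ∀ i j, γ i = γ j → γ (i + 1) = γ (j - 1) → ∀ k : ℕ,
      γ (i + k) = γ (j - k) ∧ γ (i + k + 1) = γ (j - k - 1) := by
    intro i j e1 e2 k
    induction k with
    | zero => simpa using ⟨e1, e2⟩
    | succ k ih =>
      push_cast
      refine ⟨by rw [← add_assoc, ← sub_sub]; exact ih.2, ?_⟩
      have a1 := h2 (i + k)
      have a2 := h3 (j - k - 2)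
      rw [show j - k - 2 + 1 = j - k - 1 by ring, show j - k - 2 + 2 = j - k by ring, ← ih.2,
        ← ih.1] at a2
      rw [show i + ((k : ℤ) + 1) + 1 = i + k + 2 by ring, show j - ((k : ℤ) + 1) - 1 = j - k - 2 by ring,
        a1, a2]
  -- A vertex met twice is left along the same arc. Otherwise the sequence from i onwards would
  -- retrace the sequence from j backwards, and halfway between them it would turn back or traverse
  -- a loop.
  have hfγ : ∀ i j, i ≤ j → γ i = γ j → f i = f j := by
    intro i j hij h
    have h4 := hadj1 i
    rw [h, hadj] at h4
    rcases h4 with h4 | h4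
    · exact Subtype.ext (Prod.ext h (by rw [h1, h1, h4]))
    · exfalso
      obtain ⟨k, hk⟩ : ∃ k : ℕ, j - i = 2 * k ∨ j - i = 2 * k + 1 :=
        ⟨((j - i) / 2).toNat, by omega⟩
      have h5 := hrev i j h h4 k
      rcases hk with hk | hk
      · refine hne (i + k) ?_
        rw [h5.2]; congr 1; omega
      · refine (hadj1 (i + k)).ne ?_
        rw [h5.1]; congr 1; omega
  have heq : ∀ i j, γ i = γ j ↔ (n : ℤ) ∣ i - j := by
    intro i j
    rw [← hn]
    refine ⟨fun h => ?_, fun h => by rw [hγ]; simp only [h]⟩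
    rcases le_total i j with h5 | h5
    · exact hfγ i j h5 h
    · exact (hfγ j i h5 h.symm).symm
  refine ⟨n, γ, ⟨?_, hadj, heq⟩, rfl⟩
  by_contra hlt
  have : n = 1 ∨ n = 2 := by omega
  refine hne 0 ((heq _ _).2 ?_)
  rcases this with rfl | rfl <;> norm_num

lemma CycleParam.neg (h : CycleParam C n γ) : CycleParam C n (fun j => γ (-j)) :=
  ⟨h.three_le, fun j u => by
    rw [h.adj, or_comm, show -j - 1 = -(j + 1) by ring, show -j + 1 = -(j - 1) by ring],
   fun i j => by rw [h.eq_iff, ← dvd_neg]; ring_nf⟩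

lemma CycleParam.shift (h : CycleParam C n γ) (s : ℤ) : CycleParam C n (fun j => γ (s + j)) :=
  ⟨h.three_le, fun j u => by
    rw [h.adj, show s + j + 1 = s + (j + 1) by ring, show s + j - 1 = s + (j - 1) by ring],
   fun i j => by rw [h.eq_iff]; ring_nf⟩

lemma CycleParam.comp (h : CycleParam C n γ) {φ : V → V} (hφ : Function.Bijective φ)
    (hC : ∀ v w, C.Adj (φ v) (φ w) ↔ C.Adj v w) : CycleParam C n (fun j => φ (γ j)) :=
  ⟨h.three_le, fun j u => by
    obtain ⟨w, rfl⟩ := hφ.2 u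
    rw [hC, h.adj, hφ.1.eq_iff, hφ.1.eq_iff], fun i j => by rw [hφ.1.eq_iff, h.eq_iff]⟩

lemma CycleParam.eq_of_nbr (h : CycleParam C n γ) {j : ℤ} {ε : ℤ} (hε : ε = 1 ∨ ε = -1) {u : V}
    (hu : C.Adj (γ j) u) (hne : u ≠ γ (j - ε)) : u = γ (j + ε) := by
  rw [h.adj] at hu
  rcases hε with rfl | rfl
  · exact hu.resolve_right hne
  · rw [sub_neg_eq_add] at hne
    exact hu.resolve_left hne

lemma CycleParam.ne (h : CycleParam C n γ) (j : ℤ) : γ (j + 1) ≠ γ (j - 1) := by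
  rw [Ne, h.eq_iff]
  intro hd
  have := Int.le_of_dvd (by omega) hd
  have := h.three_le
  omega

lemma CycleParam.two_step (hγ : CycleParam C n γ) (hδ : CycleParam C n' δ) {ε : ℤ}
    (hε : ε = 1 ∨ ε = -1) {j t : ℤ} (h0 : δ j = γ t) (h1 : δ (j + 1) = γ (t + ε)) :
    δ (j + 2) = γ (t + 2 * ε) := by
  have := hδ.ne (j + 1)
  rw [show j + 1 + 1 = j + 2 by ring, show j + 1 - 1 = j by ring, h0] at this
  have h2 : C.Adj (γ (t + ε)) (δ (j + 2)) := by
    rw [← h1, hδ.adj]; left; congr 1; ring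
  rw [hγ.eq_of_nbr hε h2 (by rwa [show t + ε - ε = t by ring])]
  congr 1; ring

lemma CycleParam.dihedral_of_one (hγ : CycleParam C n γ) (hδ : CycleParam C n' δ) {s ε : ℤ}
    (hε : ε = 1 ∨ ε = -1) (h0 : δ 0 = γ s) (h1 : δ 1 = γ (s + ε)) (j : ℤ) :
    δ j = γ (s + ε * j) := by
  have key : ∀ (γ' δ' : ℤ → V), CycleParam C n γ' → CycleParam C n' δ' → ∀ s' ε' : ℤ,
      (ε' = 1 ∨ ε' = -1) → δ' 0 = γ' s' → δ' 1 = γ' (s' + ε') → ∀ k : ℕ,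
      δ' k = γ' (s' + ε' * k) ∧ δ' (k + 1) = γ' (s' + ε' * (k + 1)) := by
    intro γ' δ' hγ' hδ' s' ε' hε' a0 a1 k
    induction k with
    | zero => simpa using ⟨a0, a1⟩
    | succ k ih =>
      push_cast
      refine ⟨ih.2, ?_⟩
      have := hγ'.two_step hδ' hε' ih.1 (by rw [ih.2]; congr 1; ring)
      rw [show (k : ℤ) + 1 + 1 = k + 2 by ring, this]
      congr 1; ring
  obtain ⟨k, rfl | rfl⟩ := Int.eq_nat_or_neg j
  · exact (key γ δ hγ hδ s ε hε h0 h1 k).1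
  · have h2 := hγ.two_step hδ.neg (ε := -ε) (j := -1) (t := s + ε) (by omega) (by simpa using h1)
      (by simpa using h0)
    have := (key γ (fun j => δ (-j)) hγ hδ.neg s (-ε) (by omega) (by simpa using h0) (by
      simp only [show (-1 : ℤ) + 2 = 1 by ring] at h2
      rw [h2]; congr 1; ring) k).1
    rw [this]; congr 1; ring

lemma CycleParam.dihedral (hγ : CycleParam C n γ) (hδ : CycleParam C n' δ) {s : ℤ}
    (h0 : δ 0 = γ s) : ∃ ε : ℤ, (ε = 1 ∨ ε = -1) ∧ ∀ j, δ j = γ (s + ε * j) := by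
  have h1 : C.Adj (γ s) (δ 1) := by rw [← h0, hδ.adj]; left; congr 1
  rw [hγ.adj] at h1
  rcases h1 with h1 | h1
  · exact ⟨1, Or.inl rfl, hγ.dihedral_of_one hδ (Or.inl rfl) h0 h1⟩
  · exact ⟨-1, Or.inr rfl, hγ.dihedral_of_one hδ (Or.inr rfl) h0 h1⟩

lemma CycleParam.mk_eq_iff (hγ : CycleParam C n γ) (j : ℤ) (v : V) :
    C.connectedComponentMk v = C.connectedComponentMk (γ j) ↔ ∃ k, v = γ k := by
  constructor
  · intro h
    obtain ⟨w⟩ := SimpleGraph.ConnectedComponent.eq.1 h.symm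
    have : ∀ a b (w : C.Walk a b), (∃ k, a = γ k) → ∃ k, b = γ k := by
      intro a b w
      induction w with
      | nil => exact id
      | cons hadj w ih =>
        rintro ⟨k, rfl⟩
        rw [hγ.adj] at hadj
        exact ih (hadj.elim (fun h => ⟨_, h⟩) (fun h => ⟨_, h⟩))
    exact this _ _ w ⟨j, rfl⟩
  · rintro ⟨k, rfl⟩
    have key : ∀ k, C.connectedComponentMk (γ k) = C.connectedComponentMk (γ 0) := by
      intro k
      have hs : ∀ k, C.connectedComponentMk (γ (k + 1)) = C.connectedComponentMk (γ k) := fun k =>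
        SimpleGraph.ConnectedComponent.sound (((hγ.adj k _).2 (Or.inl rfl)).symm.reachable)
      induction k using Int.induction_on with
      | zero => rfl
      | succ k ih => rw [hs, ih]
      | pred k ih => rw [← ih, ← hs]; congr 2; ring
    rw [key, key j]

end Cycles

end AltCycleQuotient

namespace AltCycleQuotient

/-! ### The members of an invariant factor, numbered around the quotient cycle -/

section System

variable {V : Type*} {Γ C : SimpleGraph V} {m n : ℕ} {ι : V → V} {c : ℤ → C.ConnectedComponent}

/-- A vertex-transitive graph of alternating cycle quotient type with an invariant `2`-factor `C`
whose members are the `c i` and have length `n`; the other edges are the `{v, ι v}`. -/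
structure AltSystem (Γ C : SimpleGraph V) (m n : ℕ) (ι : V → V) (c : ℤ → C.ConnectedComponent) :
    Prop where
  three_le : 3 ≤ m
  adj : ∀ v w, Γ.Adj v w ↔ C.Adj v w ∨ w = ι v
  invol : ∀ v, ι (ι v) = v
  surj : Function.Surjective c
  eq_iff : ∀ i j, c i = c j ↔ (m : ℤ) ∣ i - j
  side : ∀ v i, C.connectedComponentMk v = c i → C.connectedComponentMk (ι v) = c (i + 1) ∨
    C.connectedComponentMk (ι v) = c (i - 1)
  alt : ∀ v w, C.Adj v w → C.connectedComponentMk (ι v) ≠ C.connectedComponentMk (ι w)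
  aut : ∀ φ : Γ ≃g Γ, ∀ v w, C.Adj (φ v) (φ w) ↔ C.Adj v w
  vt : IsVertexTransitive Γ
  param : ∀ v, ∃ γ, CycleParam C n γ ∧ γ 0 = v

lemma mk_map_iff (φ : Γ ≃g Γ) (hφ : ∀ v w, C.Adj (φ v) (φ w) ↔ C.Adj v w) (v w : V) :
    C.connectedComponentMk (φ v) = C.connectedComponentMk (φ w) ↔
      C.connectedComponentMk v = C.connectedComponentMk w := by
  let ψ : C ≃g C := ⟨φ.toEquiv, fun {a b} => hφ a b⟩
  rw [SimpleGraph.ConnectedComponent.eq, SimpleGraph.ConnectedComponent.eq]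
  exact SimpleGraph.Iso.reachable_iff (φ := ψ)

/-- An automorphism g moving a vertex to a factor-neighbour of its outside neighbour carries its
member to an adjacent one, and by alternation it keeps going in the same direction. The images under
the powers of g number the members cyclically. -/
theorem exists_altSystem [Finite V] (I : SimpleGraph V) [C.LocallyFinite] [I.LocallyFinite]
    (hconn : Γ.Connected) (hvt : IsVertexTransitive Γ) (hpart : IsFactorPartition Γ C I)
    (halt : IsAlternating Γ C) (hinv : IsAutInvariant Γ C)
    (hm : Nat.card C.ConnectedComponent = m) : ∃ n ι c, AltSystem Γ C m n ι c := by
  classical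
  have hI : ∀ v, ∃ w, ∀ u, I.Adj v u ↔ u = w := by
    intro v
    have := hpart.one_factor v
    rw [SimpleGraph.degree, Finset.card_eq_one] at this
    obtain ⟨w, hw⟩ := this
    exact ⟨w, fun u => by rw [← SimpleGraph.mem_neighborFinset, hw, Finset.mem_singleton]⟩
  have hC : ∀ v, ∃ a b, a ≠ b ∧ ∀ w, C.Adj v w ↔ w = a ∨ w = b := by
    intro v
    have := hpart.two_factor v
    rw [SimpleGraph.degree, Finset.card_eq_two] at this
    obtain ⟨a, b, hab, hw⟩ := this
    exact ⟨a, b, hab, fun u => by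
      rw [← SimpleGraph.mem_neighborFinset, hw, Finset.mem_insert, Finset.mem_singleton]⟩
  choose ι hι using hI
  have hadj : ∀ v w, Γ.Adj v w ↔ C.Adj v w ∨ w = ι v := fun v w => by
    rw [← hpart.union_eq, SimpleGraph.sup_adj, hι]
  have hinvol : ∀ v, ι (ι v) = v := fun v => by
    have := (hι v (ι v)).2 rfl
    exact ((hι _ _).1 this.symm).symm
  have hdis : ∀ v, ¬ C.Adj v (ι v) := fun v h => by
    have h1 : (C ⊓ I).Adj v (ι v) := ⟨h, (hι _ _).2 rfl⟩
    rw [hpart.disjoint.eq_bot] at h1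
    exact h1
  have hcomm : ∀ (φ : Γ ≃g Γ) v, φ (ι v) = ι (φ v) := by
    intro φ v
    have h1 : Γ.Adj (φ v) (φ (ι v)) := φ.map_rel_iff.2 ((hadj _ _).2 (Or.inr rfl))
    rw [hadj, hinv] at h1
    exact h1.resolve_left (hdis v)
  set mk := C.connectedComponentMk with hmk
  have hmap : ∀ (φ : Γ ≃g Γ) v w, mk (φ v) = mk (φ w) ↔ mk v = mk w :=
    fun φ => mk_map_iff φ (hinv φ)
  have hadjmk : ∀ {v w}, C.Adj v w → mk v = mk w := fun h =>
    SimpleGraph.ConnectedComponent.sound h.reachable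
  -- If one edge of the 1-factor stayed within a member, all would by transitivity, and the quotient
  -- graph would have no edges.
  have hout : ∀ v, mk (ι v) ≠ mk v := by
    by_contra hcon
    push Not at hcon
    obtain ⟨v, hv⟩ := hcon
    have hall : ∀ w, mk (ι w) = mk w := by
      intro w
      obtain ⟨φ, rfl⟩ := hvt v w
      rw [← hcomm, hmap]; exact hv
    have h2 := halt.1.2 (mk v)
    have h3 : (quotientGraph Γ C).neighborSet (mk v) = ∅ := by
      ext d
      simp only [SimpleGraph.mem_neighborSet, Set.mem_empty_iff_false, iff_false]
      rintro ⟨hne, a, b, ha, rfl, hab⟩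
      rcases (hadj _ _).1 hab with h4 | rfl
      · exact hne (ha.symm.trans (hadjmk h4))
      · exact hne (ha.symm.trans (hall a).symm)
    rw [h3] at h2
    simp at h2
  have halt' : ∀ v w, C.Adj v w → mk (ι v) ≠ mk (ι w) := fun v w h =>
    halt.2 v w (ι v) (ι w) h ⟨(hadj _ _).2 (Or.inr rfl), (hout v).symm⟩
      ⟨(hadj _ _).2 (Or.inr rfl), (hout w).symm⟩
  have hquot : ∀ v, (quotientGraph Γ C).Adj (mk v) (mk (ι v)) := fun v =>
    ⟨(hout v).symm, v, ι v, rfl, rfl, (hadj _ _).2 (Or.inr rfl)⟩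
  obtain ⟨v₀⟩ := hconn.nonempty
  obtain ⟨w₀, _, -, hw₀⟩ := hC (ι v₀)
  have hw₀ := (hw₀ w₀).2 (Or.inl rfl)
  obtain ⟨g, hg⟩ := hvt v₀ w₀
  set c : ℤ → C.ConnectedComponent := fun i => mk ((g ^ i) v₀) with hc
  have hmul : ∀ (a b : ℤ) v, (g ^ (a + b)) v = (g ^ a) ((g ^ b) v) := fun a b v => by
    rw [zpow_add]; rfl
  have hnext : ∀ i, mk (ι ((g ^ i) v₀)) = c (i + 1) := by
    intro i
    simp only [hc]
    rw [hmul, ← hcomm, hmap, zpow_one, hg]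
    exact hadjmk hw₀
  -- The consecutive vertices ι v₀ and w₀ have their outside neighbours on different members; the
  -- powers of g transport this to every index.
  have hne2 : ∀ i, c (i + 1) ≠ c (i - 1) := by
    intro i
    have e1 : c (i + 1) = mk ((g ^ (i - 1)) (ι w₀)) := by
      have : i + 1 = (i - 1) + 1 + 1 := by ring
      rw [this, ← hnext, hcomm, hmul (i - 1) 1, zpow_one, hg]
    rw [e1]
    simp only [hc]
    rw [Ne, hmap]
    have := halt' _ _ hw₀
    rw [hinvol] at this
    exact this.symm
  have hqa : ∀ i, (quotientGraph Γ C).Adj (c i) (c (i + 1)) := fun i => by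
    rw [← hnext]; exact hquot _
  have hnbr : ∀ i d, (quotientGraph Γ C).Adj (c i) d → d = c (i + 1) ∨ d = c (i - 1) := by
    intro i d hd
    have h1 : ({c (i + 1), c (i - 1)} : Set C.ConnectedComponent) ⊆
        (quotientGraph Γ C).neighborSet (c i) := by
      intro d hd
      rcases hd with rfl | rfl
      · exact hqa i
      · have := hqa (i - 1)
        rw [sub_add_cancel] at this
        exact this.symm
    have h2 := Set.eq_of_subset_of_ncard_le h1 (by
      rw [halt.1.2, Set.ncard_pair (hne2 i)]) (Set.toFinite _)
    have : d ∈ (quotientGraph Γ C).neighborSet (c i) := hd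
    rw [← h2] at this
    exact this
  have hside : ∀ v i, mk v = c i → mk (ι v) = c (i + 1) ∨ mk (ι v) = c (i - 1) := by
    intro v i h
    have := hquot v
    rw [h] at this
    exact hnbr i _ this
  have hsurj : Function.Surjective c := by
    have key : ∀ v w (p : Γ.Walk v w), (∃ i, c i = mk v) → ∃ i, c i = mk w := by
      intro v w p
      induction p with
      | nil => exact id
      | cons h p ih =>
        rintro ⟨i, hi⟩
        refine ih ?_
        rcases (hadj _ _).1 h with h1 | rfl
        · exact ⟨i, by rw [hi, hadjmk h1]⟩
        · exact (hside _ i hi.symm).elim (fun h => ⟨_, h.symm⟩) (fun h => ⟨_, h.symm⟩)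
    intro d
    obtain ⟨w, rfl⟩ := d.exists_rep
    obtain ⟨p⟩ := hconn.preconnected v₀ w
    exact key v₀ w p ⟨0, rfl⟩
  have htrans : ∀ i j k, c i = c j → c (i + k) = c (j + k) := by
    intro i j k h
    simp only [hc]
    rw [add_comm i, add_comm j, hmul, hmul, hmap]
    exact h
  obtain ⟨m', hm0, hm'⟩ := exists_period c htrans
  obtain rfl : m' = m := by
    rw [← hm, ← card_range_of_period hm0 hm', hsurj.range_eq]
    exact Nat.card_congr (Equiv.Set.univ _)
  obtain ⟨n, γ, hγ, h0⟩ := exists_cycleParam hC v₀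
  refine ⟨n, ι, c, ?_, hadj, hinvol, hsurj, hm', hside, halt', hinv, hvt, ?_⟩
  · by_contra hlt
    have : m' = 1 ∨ m' = 2 := by omega
    refine hne2 0 ((hm' _ _).2 ?_)
    rcases this with rfl | rfl <;> norm_num
  · intro v
    obtain ⟨φ, rfl⟩ := hvt v₀ v
    exact ⟨_, hγ.comp φ.bijective (hinv φ), by rw [h0]⟩


end System
end AltCycleQuotient

namespace AltCycleQuotient

/-! ### An automorphism rotating all members -/

section Rotations

variable {V : Type*} {Γ C : SimpleGraph V} {m n : ℕ} {ι : V → V} {c : ℤ → C.ConnectedComponent}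

lemma zpow_param {ρ : Γ ≃g Γ} {γ : ℤ → V} {s : ℤ} (h : ∀ j, ρ (γ j) = γ (j + s)) (k j : ℤ) :
    (ρ ^ k) (γ j) = γ (j + k * s) := by
  have hmul : ∀ (a b : ℤ) v, (ρ ^ (a + b)) v = (ρ ^ a) ((ρ ^ b) v) := fun a b v => by
    rw [zpow_add]; rfl
  induction k using Int.induction_on generalizing j with
  | zero => simp
  | succ k ih => rw [hmul, zpow_one, h, ih]; congr 1; ring
  | pred k ih =>
    have h1 : (ρ ^ (-1 : ℤ)) (γ j) = γ (j - s) := by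
      have := h (j - s)
      rw [sub_add_cancel] at this
      rw [← this, zpow_neg, zpow_one]
      exact ρ.symm_apply_apply _
    rw [sub_eq_add_neg, hmul, h1, ih]; congr 1; ring

lemma CycleParam.mk_eq {γ : ℤ → V} (h : CycleParam C n γ) (i j : ℤ) :
    C.connectedComponentMk (γ i) = C.connectedComponentMk (γ j) := (h.mk_eq_iff j _).2 ⟨i, rfl⟩

lemma mk_eq_of_adj {v w : V} (h : C.Adj v w) :
    C.connectedComponentMk v = C.connectedComponentMk w :=
  SimpleGraph.ConnectedComponent.sound h.reachable

namespace AltSystem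

variable (S : AltSystem Γ C m n ι c)
include S

lemma ne_succ_pred (i : ℤ) : c (i + 1) ≠ c (i - 1) := by
  rw [Ne, S.eq_iff]
  intro h
  have := Int.le_of_dvd (by omega) h
  have := S.three_le
  omega

lemma ne_succ (i : ℤ) : c (i + 1) ≠ c i := by
  rw [Ne, S.eq_iff]
  intro h
  have := Int.le_of_dvd (by omega) h
  have := S.three_le
  omega

lemma not_adj (v : V) : ¬ C.Adj v (ι v) := by
  intro h
  obtain ⟨i, hi⟩ := S.surj (C.connectedComponentMk v)
  have h1 := mk_eq_of_adj h
  rcases S.side v i hi.symm with h2 | h2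
  · exact S.ne_succ i (by rw [← h2, ← h1, hi])
  · have := S.ne_succ (i - 1)
    rw [sub_add_cancel] at this
    exact this (by rw [← h2, ← h1, hi])

lemma comm (φ : Γ ≃g Γ) (v : V) : φ (ι v) = ι (φ v) := by
  have h1 : Γ.Adj (φ v) (φ (ι v)) := φ.map_rel_iff.2 ((S.adj _ _).2 (Or.inr rfl))
  rw [S.adj, S.aut] at h1
  exact h1.resolve_left (S.not_adj v)

lemma map_param (φ : Γ ≃g Γ) {γ : ℤ → V} (h : CycleParam C n γ) :
    CycleParam C n (fun j => φ (γ j)) := h.comp φ.bijective (S.aut φ)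

lemma mk_map (φ : Γ ≃g Γ) (v w : V) :
    C.connectedComponentMk (φ v) = C.connectedComponentMk (φ w) ↔
      C.connectedComponentMk v = C.connectedComponentMk w := mk_map_iff φ (S.aut φ) v w

lemma side_step {v w : V} (h : C.Adj v w) {i σ : ℤ} (hσ : σ = 1 ∨ σ = -1)
    (h0 : C.connectedComponentMk v = c i) (h1 : C.connectedComponentMk (ι v) = c (i + σ)) :
    C.connectedComponentMk (ι w) = c (i - σ) := by
  have h2 := S.side w i (by rw [← mk_eq_of_adj h, h0])
  have h3 := S.alt _ _ h
  rw [h1] at h3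
  rcases hσ with rfl | rfl
  · exact h2.resolve_left h3.symm
  · rw [sub_neg_eq_add]; exact h2.resolve_right h3.symm

lemma side_param {γ : ℤ → V} (h : CycleParam C n γ) {i σ : ℤ} (hσ : σ = 1 ∨ σ = -1) {t : ℤ}
    (h0 : C.connectedComponentMk (γ t) = c i)
    (h1 : C.connectedComponentMk (ι (γ t)) = c (i + σ)) (j : ℤ) :
    C.connectedComponentMk (ι (γ (t + j))) = c (i + if j % 2 = 0 then σ else -σ) := by
  have key : ∀ j, C.connectedComponentMk (γ j) = c i := fun j => by rw [h.mk_eq j t, h0]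
  induction j using Int.induction_on with
  | zero => simpa using h1
  | succ k ih =>
    have h2 : C.Adj (γ (t + k)) (γ (t + (k + 1))) := by rw [h.adj]; left; congr 1; ring
    have := S.side_step h2 (by split_ifs <;> omega) (key _) ih
    rw [this]; congr 1; split_ifs <;> omega
  | pred k ih =>
    have h2 : C.Adj (γ (t + -k)) (γ (t + (-k - 1))) := by rw [h.adj]; right; congr 1; ring
    have := S.side_step h2 (by split_ifs <;> omega) (key _) ih
    rw [this]; congr 1; split_ifs <;> omega

lemma exists_side (v : V) : ∃ i σ : ℤ, (σ = 1 ∨ σ = -1) ∧ C.connectedComponentMk v = c i ∧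
    C.connectedComponentMk (ι v) = c (i + σ) := by
  obtain ⟨i, hi⟩ := S.surj (C.connectedComponentMk v)
  rcases S.side v i hi.symm with h | h
  · exact ⟨i, 1, Or.inl rfl, hi.symm, h⟩
  · exact ⟨i, -1, Or.inr rfl, hi.symm, h⟩

/-- Vertices of a cycle have their outside neighbours in the same member if and only if they have
even distance. -/
lemma side_eq_iff {γ : ℤ → V} (h : CycleParam C n γ) (t j : ℤ) :
    C.connectedComponentMk (ι (γ (t + j))) = C.connectedComponentMk (ι (γ t)) ↔ j % 2 = 0 := by
  obtain ⟨i, σ, hσ, h0, h1⟩ := S.exists_side (γ t)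
  rw [S.side_param h hσ h0 h1 j, h1]
  split_ifs with hj
  · simp [hj]
  · refine iff_of_false (fun h2 => ?_) hj
    have := S.ne_succ_pred i
    rcases hσ with rfl | rfl
    · exact this h2.symm
    · exact this (by rw [neg_neg] at h2; exact h2)

lemma even : n % 2 = 0 := by
  obtain ⟨v, -⟩ := (c 0).exists_rep
  obtain ⟨γ, hγ, -⟩ := S.param v
  have := S.side_eq_iff hγ 0 n
  rw [show (γ (0 + n)) = γ 0 from (hγ.eq_iff _ _).2 (by simp)] at this
  have := this.1 rfl
  omega

lemma four_le : 4 ≤ n := by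
  obtain ⟨v, -⟩ := (c 0).exists_rep
  obtain ⟨γ, hγ, -⟩ := S.param v
  have := S.even
  have := hγ.three_le
  omega

lemma exists_up (i : ℤ) (σ : ℤ) (hσ : σ = 1 ∨ σ = -1) : ∃ v, C.connectedComponentMk v = c i ∧
    C.connectedComponentMk (ι v) = c (i + σ) := by
  obtain ⟨v, hv⟩ := (c i).exists_rep
  have hv : C.connectedComponentMk v = c i := hv
  obtain ⟨γ, hγ, rfl⟩ := S.param v
  have h1 : C.Adj (γ 0) (γ 1) := by rw [hγ.adj]; left; rfl
  by_cases h : C.connectedComponentMk (ι (γ 0)) = c (i + σ)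
  · exact ⟨_, hv, h⟩
  · refine ⟨γ 1, by rw [← hv]; exact (mk_eq_of_adj h1).symm, ?_⟩
    have h2 : C.connectedComponentMk (ι (γ 0)) = c (i + -σ) := by
      rcases hσ with rfl | rfl
      · exact (S.side _ _ hv).resolve_left h
      · rw [neg_neg]; exact (S.side _ _ hv).resolve_right h
    rw [S.side_step h1 (by omega) hv h2, sub_neg_eq_add]

/-- Fixing two consecutive members forces the next one to be fixed, since it is the only other
neighbour; so all members around the cycle are fixed. -/
lemma fix_comp (ρ : Γ ≃g Γ) {u₀ u₁ : V} (h0 : C.connectedComponentMk u₀ = c 0)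
    (h0' : C.connectedComponentMk (ρ u₀) = c 0) (h1 : C.connectedComponentMk u₁ = c 1)
    (h1' : C.connectedComponentMk (ρ u₁) = c 1) (v : V) :
    C.connectedComponentMk (ρ v) = C.connectedComponentMk v := by
  have key : ∀ i : ℕ, (∀ v, C.connectedComponentMk v = c i → C.connectedComponentMk (ρ v) = c i) ∧
      ∀ v, C.connectedComponentMk v = c (i + 1) → C.connectedComponentMk (ρ v) = c (i + 1) := by
    intro i
    induction i with
    | zero =>
      constructor
      · intro v hv
        rw [Nat.cast_zero] at hv ⊢
        rw [← h0', S.mk_map, hv, h0]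
      · intro v hv
        rw [Nat.cast_zero, zero_add] at hv ⊢
        rw [← h1', S.mk_map, hv, h1]
    | succ i ih =>
      push_cast
      refine ⟨ih.2, fun v hv => ?_⟩
      obtain ⟨y, hy, hy'⟩ := S.exists_up (i + 1) 1 (Or.inl rfl)
      have h2 : C.connectedComponentMk (ρ v) = C.connectedComponentMk (ρ (ι y)) := by
        rw [S.mk_map, hv, hy']
      rw [h2, S.comm]
      refine (S.side _ _ (ih.2 y hy)).resolve_right fun h3 => ?_
      rw [add_sub_cancel_right, ← S.comm] at h3
      obtain ⟨u, hu, -⟩ := S.exists_up i 1 (Or.inl rfl)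
      rw [← ih.1 u hu, S.mk_map, hy', hu] at h3
      have := S.ne_succ_pred (i + 1)
      rw [add_sub_cancel_right] at this
      exact this h3
  obtain ⟨i, hi⟩ := S.surj (C.connectedComponentMk v)
  have hm : (m : ℤ) ≠ 0 := by have := S.three_le; omega
  have h2 : c i = c ((i % m).toNat : ℤ) := by
    rw [S.eq_iff, Int.toNat_of_nonneg (Int.emod_nonneg _ hm)]
    exact Int.dvd_self_sub_emod
  rw [← hi, h2]
  exact (key _).1 v (by rw [← hi, h2])

end AltSystem

/-- The automorphism `ρ` acts on every member of the `2`-factor as a rotation that generates the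
rotations by an even number of steps. -/
structure IsRotation (C : SimpleGraph V) (n : ℕ) (ρ : Γ ≃g Γ) : Prop where
  rot : ∀ v, ∃ γ, ∃ b : ℤ, CycleParam C n γ ∧ γ 0 = v ∧ ∀ j, (ρ ^ b) (γ j) = γ (j + 2)
  pow_eq_iff : ∀ v (k : ℤ), (ρ ^ k) v = v ↔ (n : ℤ) ∣ 2 * k

/-- The hypothesis says that s/2 is not a zero divisor modulo n/2. Hence it is a unit there, and
Bézout's identity provides its inverse b. -/
lemma exists_mul_two_of_dvd_iff {n : ℕ} {s : ℤ} (hn : n % 2 = 0) (hs : s % 2 = 0) (hn0 : 0 < n)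
    (h : ∀ k : ℤ, (n : ℤ) ∣ k * s ↔ (n : ℤ) ∣ 2 * k) : ∃ b : ℤ, (n : ℤ) ∣ b * s - 2 := by
  obtain ⟨n', hn'⟩ : ∃ n' : ℤ, (n : ℤ) = 2 * n' := ⟨n / 2, by omega⟩
  obtain ⟨s', rfl⟩ : ∃ s' : ℤ, s = 2 * s' := ⟨s / 2, by omega⟩
  have h2 : ∀ k, n' ∣ k * s' ↔ n' ∣ k := by
    intro k
    have := h k
    rw [hn', show k * (2 * s') = 2 * (k * s') by ring, mul_dvd_mul_iff_left two_ne_zero,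
      mul_dvd_mul_iff_left two_ne_zero] at this
    exact this
  have hd1 : (Int.gcd n' s' : ℤ) ∣ n' := Int.gcd_dvd_left _ _
  have hd2 : (Int.gcd n' s' : ℤ) ∣ s' := Int.gcd_dvd_right _ _
  obtain ⟨a, ha⟩ := hd1
  obtain ⟨a', ha'⟩ := hd2
  have h3 : n' ∣ a := (h2 a).1 ⟨a', by rw [ha']; conv_rhs => rw [ha]
                                       ring⟩
  have h4 : (Int.gcd n' s' : ℤ) = 1 := by
    obtain ⟨e, he⟩ := h3
    have h5 : (Int.gcd n' s' : ℤ) * e = 1 := by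
      have h6 : n' * ((Int.gcd n' s' : ℤ) * e - 1) = 0 := by
        have : n' * ((Int.gcd n' s' : ℤ) * e - 1) = Int.gcd n' s' * (n' * e) - n' := by ring
        rw [this, ← he, ← ha]; ring
      rcases mul_eq_zero.1 h6 with h7 | h7
      · omega
      · omega
    have := Int.eq_one_or_neg_one_of_mul_eq_one h5
    omega
  have h5 := Int.gcd_eq_gcd_ab n' s'
  rw [h4] at h5
  exact ⟨Int.gcdB n' s', -Int.gcdA n' s', by rw [hn']; linear_combination -2 * h5⟩

/-- A rotation by two steps on one member is obtained from transitivity. It fixes all members,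
commutes with ι, and so has the same order on every vertex orbit; this order makes it a generator of
the even rotations on the next member, and induction leads around the quotient cycle. -/
theorem AltSystem.exists_rotation (S : AltSystem Γ C m n ι c) :
    ∃ ρ : Γ ≃g Γ, IsRotation C n ρ ∧
      (∀ v, C.connectedComponentMk (ρ v) = C.connectedComponentMk v) ∧
      ∃ γ, CycleParam C n γ ∧ C.connectedComponentMk (γ 0) = c 0 ∧ ∀ j, ρ (γ j) = γ (j + 2) := by
  have hne := S.even
  have hn4 := S.four_le
  -- For n = 4 a reflection could have the same order 2 as the rotation, so the general argument
  -- fails. Here the antipodal map on all members is an automorphism: antipodes have their outside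
  -- neighbours on one member, at even nonzero distance, hence antipodal.
  by_cases h4 : n = 4
  · subst h4
    choose γ hγ hγ0 using S.param
    have hcan : ∀ {δ : ℤ → V}, CycleParam C 4 δ → ∀ j, γ (δ j) 2 = δ (j + 2) := by
      intro δ hδ j
      obtain ⟨ε, hε, h⟩ := hδ.dihedral (hγ (δ j)) (s := j) (hγ0 _)
      rw [h, hδ.eq_iff]
      rcases hε with rfl | rfl
      · simp
      · exact ⟨-1, by push_cast; ring⟩
    set f : V → V := fun v => γ v 2 with hf
    have hff : ∀ v, f (f v) = v := by
      intro v
      have := hcan (hγ v) 2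
      simp only [hf]
      rw [this]
      conv_rhs => rw [← hγ0 v]
      rw [(hγ v).eq_iff]; norm_num
    have hfC : ∀ v w, C.Adj v w → C.Adj (f v) (f w) := by
      intro v w h
      rw [← hγ0 v, (hγ v).adj] at h
      conv_lhs => rw [← hγ0 v]
      simp only [hf]
      rcases h with rfl | rfl
      · rw [hcan (hγ v), hcan (hγ v), (hγ v).adj]; left; congr 1
      · rw [hcan (hγ v), hcan (hγ v), (hγ v).adj]; right; congr 1
    have hfι : ∀ v, f (ι v) = ι (f v) := by
      intro v
      have h1 : C.connectedComponentMk (ι (γ v 2)) = C.connectedComponentMk (ι v) := by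
        have := (S.side_eq_iff (hγ v) 0 2).2 (by norm_num)
        rwa [hγ0] at this
      rw [← hγ0 (ι v), (hγ (ι v)).mk_eq_iff] at h1
      obtain ⟨t, ht⟩ := h1
      have h2 := S.side_eq_iff (hγ (ι v)) 0 t
      rw [zero_add, ← ht, hγ0, S.invol, S.invol] at h2
      have h2 := h2.1 (by conv_rhs => rw [← hγ0 v]
                          exact (hγ v).mk_eq _ _)
      have h3 : ¬ (4 : ℤ) ∣ t := by
        intro h3
        have e : ι (γ v 2) = ι v := by
          conv_rhs => rw [← hγ0 (ι v)]
          rw [ht, (hγ (ι v)).eq_iff]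
          simpa using h3
        have e2 := congrArg ι e
        rw [S.invol, S.invol] at e2
        conv_rhs at e2 => rw [← hγ0 v]
        rw [(hγ v).eq_iff] at e2
        norm_num at e2
      simp only [hf]
      rw [ht, (hγ (ι v)).eq_iff]
      push_cast
      omega
    have hfadj : ∀ v w, Γ.Adj v w → Γ.Adj (f v) (f w) := by
      intro v w h
      rw [S.adj] at h ⊢
      rcases h with h | rfl
      · exact Or.inl (hfC _ _ h)
      · exact Or.inr (hfι v)
    let ρ : Γ ≃g Γ := ⟨⟨f, f, hff, hff⟩, fun {a b} =>
      ⟨fun h => by simpa [hff] using hfadj _ _ h, hfadj a b⟩⟩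
    have hρ : ∀ {δ : ℤ → V}, CycleParam C 4 δ → ∀ j, ρ (δ j) = δ (j + 2) := hcan
    refine ⟨ρ, ⟨fun v => ⟨γ v, 1, hγ v, hγ0 v, fun j => by rw [zpow_one]; exact hρ (hγ v) j⟩,
      fun v k => ?_⟩, fun v => ?_, ?_⟩
    · have := zpow_param (hρ (hγ v)) k 0
      rw [hγ0] at this
      rw [this]
      conv_lhs => rhs; rw [← hγ0 v]
      rw [(hγ v).eq_iff]; ring_nf
    · change C.connectedComponentMk (γ v 2) = _
      conv_rhs => rw [← hγ0 v]
      exact (hγ v).mk_eq _ _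
    · obtain ⟨v, hv, -⟩ := S.exists_up 0 1 (Or.inl rfl)
      exact ⟨γ v, hγ v, by rw [hγ0, hv], hρ (hγ v)⟩
  obtain ⟨v₀, hv₀, hv₀'⟩ := S.exists_up 0 1 (Or.inl rfl)
  rw [zero_add] at hv₀'
  obtain ⟨γ, hγ, rfl⟩ := S.param v₀
  -- An automorphism taking position 0 to 2 is either the desired rotation or j ↦ 2 - j, and one
  -- taking 1 to 3 is either the rotation or j ↦ 4 - j. Two reflections compose to the rotation.
  obtain ⟨ρ, hρ⟩ : ∃ ρ : Γ ≃g Γ, ∀ j, ρ (γ j) = γ (j + 2) := by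
    obtain ⟨φ, hφ⟩ := S.vt (γ 0) (γ 2)
    obtain ⟨ε, hε, h⟩ := hγ.dihedral (S.map_param φ hγ) (s := 2) hφ
    rcases hε with rfl | rfl
    · exact ⟨φ, fun j => by rw [h]; congr 1; ring⟩
    · obtain ⟨ψ, hψ⟩ := S.vt (γ 1) (γ 3)
      obtain ⟨ε, hε, h'⟩ := hγ.dihedral ((S.map_param ψ hγ).shift 1) (s := 3) hψ
      rcases hε with rfl | rfl
      · refine ⟨ψ, fun j => ?_⟩
        have := h' (j - 1)
        simp only [add_sub_cancel] at this
        rw [this]; congr 1; ring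
      · refine ⟨φ.trans ψ, fun j => ?_⟩
        have := h' (1 - j)
        change ψ (φ (γ j)) = _
        rw [h]
        rw [show (2 : ℤ) + -1 * j = 1 + (1 - j) by ring, this]
        congr 1; ring
  have hfix : ∀ v, C.connectedComponentMk (ρ v) = C.connectedComponentMk v := by
    refine S.fix_comp ρ hv₀ (by rw [hρ, ← hv₀]; exact hγ.mk_eq _ _) hv₀' ?_
    rw [S.comm, hρ, ← hv₀']
    exact (S.side_eq_iff hγ 0 2).2 (by norm_num)
  have key : ∀ i : ℕ, ∀ v, C.connectedComponentMk v = c i →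
      (∃ γ, ∃ b : ℤ, CycleParam C n γ ∧ γ 0 = v ∧ ∀ j, (ρ ^ b) (γ j) = γ (j + 2)) ∧
      ∀ k : ℤ, (ρ ^ k) v = v ↔ (n : ℤ) ∣ 2 * k := by
    intro i
    induction i with
    | zero =>
      intro v hv
      rw [Nat.cast_zero, ← hv₀, hγ.mk_eq_iff] at hv
      obtain ⟨t, rfl⟩ := hv
      refine ⟨⟨_, 1, hγ.shift t, by simp, fun j => by rw [zpow_one, hρ]; congr 1; ring⟩,
        fun k => ?_⟩
      rw [zpow_param hρ, hγ.eq_iff]; ring_nf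
    | succ i ih =>
      intro v hv
      push_cast at hv
      obtain ⟨y, hy, hy'⟩ := S.exists_up (i + 1) (-1) (Or.inr rfl)
      rw [add_neg_cancel_right] at hy'
      have hx := (ih _ hy').2
      have hcomm : ∀ k : ℤ, (ρ ^ k) y = y ↔ (n : ℤ) ∣ 2 * k := by
        intro k
        rw [← hx k, S.comm]
        exact ⟨fun h => by rw [h], fun h => by have := congrArg ι h; rwa [S.invol, S.invol] at this⟩
      obtain ⟨δ, hδ, rfl⟩ := S.param y
      obtain ⟨s, hs⟩ := (hδ.mk_eq_iff 0 (ρ (δ 0))).1 (hfix _)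
      obtain ⟨ε, hε, h⟩ := hδ.dihedral (S.map_param ρ hδ) (s := s) hs
      -- On a reflected member the square of ρ would be trivial, which forces n to divide 4.
      have hε1 : ε = 1 := by
        refine hε.resolve_right ?_
        rintro rfl
        have h2 : (ρ ^ (2 : ℤ)) (δ 0) = δ 0 := by
          change ρ (ρ (δ 0)) = δ 0
          rw [hs, h]; congr 1; ring
        rw [hcomm] at h2
        have := Int.le_of_dvd (by norm_num) h2
        omega
      subst hε1
      have h' : ∀ j, ρ (δ j) = δ (j + s) := fun j => by rw [h]; congr 1; ring
      have hs2 : s % 2 = 0 := by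
        have h2 := S.side_eq_iff hδ 0 s
        rw [zero_add, ← hs, ← S.comm] at h2
        exact h2.1 (hfix _)
      have hdvd : ∀ k : ℤ, (n : ℤ) ∣ k * s ↔ (n : ℤ) ∣ 2 * k := by
        intro k
        rw [← hcomm, zpow_param h', hδ.eq_iff]; ring_nf
      obtain ⟨b, hb⟩ := exists_mul_two_of_dvd_iff hne hs2 (by omega) hdvd
      rw [← hy, hδ.mk_eq_iff] at hv
      obtain ⟨t, rfl⟩ := hv
      refine ⟨⟨_, b, hδ.shift t, by simp, fun j => ?_⟩, fun k => ?_⟩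
      · rw [zpow_param h', hδ.eq_iff]
        exact dvd_of_eq_mul hb 1 (by ring)
      · rw [zpow_param h', hδ.eq_iff, ← hdvd]; ring_nf
  have key' : ∀ v, ∃ i : ℕ, C.connectedComponentMk v = c i := by
    intro v
    obtain ⟨i, hi⟩ := S.surj (C.connectedComponentMk v)
    have hm : (m : ℤ) ≠ 0 := by have := S.three_le; omega
    refine ⟨(i % m).toNat, ?_⟩
    rw [← hi, S.eq_iff, Int.toNat_of_nonneg (Int.emod_nonneg _ hm)]
    exact Int.dvd_self_sub_emod
  exact ⟨ρ, ⟨fun v => (key _ v (key' v).choose_spec).1, fun v => (key _ v (key' v).choose_spec).2⟩,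
    hfix, γ, hγ, hv₀, hρ⟩

end Rotations

end AltCycleQuotient

/-! ### The step length K -/

namespace AltCycleQuotient

/-- `x = ± y` modulo `n / 2`. -/
def EqUpToSign (n : ℕ) (x y : ℤ) : Prop := (n : ℤ) ∣ 2 * (x - y) ∨ (n : ℤ) ∣ 2 * (x + y)

namespace EqUpToSign

variable {n : ℕ} {x y z : ℤ}

lemma iff_exists : EqUpToSign n x y ↔ ∃ ε : ℤ, (ε = 1 ∨ ε = -1) ∧ (n : ℤ) ∣ 2 * (x - ε * y) := by
  constructor
  · rintro (h | h)
    · exact ⟨1, Or.inl rfl, by simpa using h⟩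
    · exact ⟨-1, Or.inr rfl, by simpa using h⟩
  · rintro ⟨ε, rfl | rfl, h⟩
    · exact Or.inl (by simpa using h)
    · exact Or.inr (by simpa using h)

lemma symm (h : EqUpToSign n x y) : EqUpToSign n y x :=
  h.imp (fun h => dvd_of_eq_mul h (-1) (by ring)) (fun h => dvd_of_eq_mul h 1 (by ring))

lemma trans (h : EqUpToSign n x y) (h' : EqUpToSign n y z) : EqUpToSign n x z := by
  rcases h with h | h <;> rcases h' with h' | h'
  · exact Or.inl (dvd_of_eq_mul (h.add h') 1 (by ring))
  · exact Or.inr (dvd_of_eq_mul (h.add h') 1 (by ring))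
  · exact Or.inr (dvd_of_eq_mul (h.sub h') 1 (by ring))
  · exact Or.inl (dvd_of_eq_mul (h.sub h') 1 (by ring))

lemma mul_left (h : EqUpToSign n x y) (a : ℤ) : EqUpToSign n (a * x) (a * y) :=
  h.imp (fun h => dvd_of_eq_mul h a (by ring)) (fun h => dvd_of_eq_mul h a (by ring))

lemma mul_right (h : EqUpToSign n x y) (a : ℤ) : EqUpToSign n (x * a) (y * a) := by
  rw [mul_comm x, mul_comm y]; exact h.mul_left a

lemma of_dvd (h : (n : ℤ) ∣ 2 * (x - y)) : EqUpToSign n x y := Or.inl h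

end EqUpToSign

section Step

variable {V : Type*} {Γ C : SimpleGraph V} {m n : ℕ} {ι : V → V} {c : ℤ → C.ConnectedComponent}
  {ρ : Γ ≃g Γ}

lemma zpow_add_apply (ρ : Γ ≃g Γ) (a b : ℤ) (v : V) : (ρ ^ (a + b)) v = (ρ ^ a) ((ρ ^ b) v) := by
  rw [zpow_add]; rfl

lemma IsRotation.eq_iff (hR : IsRotation C n ρ) (v : V) (a b : ℤ) :
    (ρ ^ a) v = (ρ ^ b) v ↔ (n : ℤ) ∣ 2 * (a - b) := by
  rw [← hR.pow_eq_iff v, ← (ρ ^ b).injective.eq_iff (a := (ρ ^ (a - b)) v), ← zpow_add_apply]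
  simp

lemma zpow_mul_param {γ : ℤ → V} {b : ℤ} (h : ∀ j, (ρ ^ b) (γ j) = γ (j + 2)) (k j : ℤ) :
    (ρ ^ (b * k)) (γ j) = γ (j + 2 * k) := by
  rw [zpow_mul, zpow_param h]; congr 1; ring

/-- The signature of the graph: rotating by `layerStep K i` moves the members of index `i` by two
steps. -/
theorem AltSystem.exists_step (S : AltSystem Γ C m n ι c) (hR : IsRotation C n ρ) {γ₀ : ℤ → V}
    (hγ₀ : CycleParam C n γ₀) (h₀ : C.connectedComponentMk (γ₀ 0) = c 0)
    (hρ : ∀ j, ρ (γ₀ j) = γ₀ (j + 2)) :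
    ∃ K : ℤ, K % 2 = 1 ∧ (m % 2 = 0 ∨ K = 1) ∧ (K = 1 ∨ ¬ EqUpToSign n K 1) ∧
      EqUpToSign n (K * K) 1 ∧ ∀ v i, C.connectedComponentMk v = c i →
        ∃ γ, CycleParam C n γ ∧ γ 0 = v ∧ ∀ j, (ρ ^ layerStep K i) (γ j) = γ (j + 2) := by
  have hne := S.even
  have hn4 := S.four_le
  choose γ b hγ hγ0 hb using hR.rot
  have hpow : ∀ v k, (ρ ^ (b v * k)) v = γ v (2 * k) := by
    intro v k
    have := zpow_mul_param (hb v) k 0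
    rwa [hγ0, zero_add] at this
  have hcomm : ∀ (k : ℤ) v, (ρ ^ k) (ι v) = ι ((ρ ^ k) v) := fun k v => S.comm (ρ ^ k) v
  have hunit : ∀ v x, (n : ℤ) ∣ 2 * (b v * x) → (n : ℤ) ∣ 2 * x := by
    intro v x h
    have h1 := (hR.pow_eq_iff v _).2 h
    rw [hpow] at h1
    conv_rhs at h1 => rw [← hγ0 v]
    rw [(hγ v).eq_iff] at h1
    simpa using h1
  -- The double step at v is carried by ι to a vertex at even distance 2r from ι v, because outside
  -- neighbours of vertices at distance 2 lie on one member. Comparing the powers of ρ at both ends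
  -- relates `b v` and `b (ι v)`.
  have hr : ∀ v, ∃ r : ℤ, (n : ℤ) ∣ 2 * (b v - b (ι v) * r) := by
    intro v
    have h1 : C.connectedComponentMk (ι (γ v 2)) = C.connectedComponentMk (ι v) := by
      have := (S.side_eq_iff (hγ v) 0 2).2 (by norm_num)
      rwa [hγ0] at this
    rw [← hγ0 (ι v), (hγ (ι v)).mk_eq_iff] at h1
    obtain ⟨t, ht⟩ := h1
    have h2 := S.side_eq_iff (hγ (ι v)) 0 t
    rw [zero_add, ← ht, hγ0, S.invol, S.invol] at h2
    have h2 := h2.1 (by conv_rhs => rw [← hγ0 v]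
                        exact (hγ v).mk_eq _ _)
    refine ⟨t / 2, ?_⟩
    rw [← hR.eq_iff (ι v), hpow, show 2 * (t / 2) = t by omega, ← ht, hcomm]
    have := hpow v 1
    rw [mul_one, mul_one] at this
    rw [this]
  choose r hr using hr
  have hrk : ∀ v k, ι (γ v (2 * k)) = γ (ι v) (2 * (r v * k)) := by
    intro v k
    rw [← hpow, ← hcomm, ← hpow, hR.eq_iff]
    exact dvd_of_eq_mul (hr v) k (by ring)
  -- The two directions of an edge have inverse ratios. As the ratios agree up to sign by
  -- transitivity, their common value has square ±1 modulo n/2.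
  have hrr : ∀ v, (n : ℤ) ∣ 2 * (r v * r (ι v) - 1) := by
    intro v
    refine hunit v _ ?_
    have h1 := hr v
    have h2 := hr (ι v)
    rw [S.invol] at h2
    exact dvd_of_eq_mul ((h2.mul_right (r v)).add h1) (-1) (by ring)
  -- An automorphism carries the chosen labellings at v and ι v to those at the images, each up to
  -- reversal; this affects the ratio by a sign only.
  have hmap : ∀ (φ : Γ ≃g Γ) v, EqUpToSign n (r (φ v)) (r v) := by
    intro φ v
    obtain ⟨ε, hε, h⟩ := (hγ (φ v)).dihedral (S.map_param φ (hγ v)) (s := 0) (by rw [hγ0, hγ0])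
    obtain ⟨ε', hε', h'⟩ := (hγ (ι (φ v))).dihedral (S.map_param φ (hγ (ι v))) (s := 0)
      (by rw [hγ0, hγ0, S.comm])
    have h1 := congrArg φ (hrk v 1)
    simp only [mul_one] at h1
    rw [h', S.comm, h, zero_add, zero_add, mul_comm ε 2, hrk, (hγ (ι (φ v))).eq_iff] at h1
    rcases hε with rfl | rfl <;> rcases hε' with rfl | rfl
    · exact Or.inl (dvd_of_eq_mul h1 1 (by ring))
    · exact Or.inr (dvd_of_eq_mul h1 1 (by ring))
    · exact Or.inr (dvd_of_eq_mul h1 (-1) (by ring))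
    · exact Or.inl (dvd_of_eq_mul h1 (-1) (by ring))
  have hgen : ∀ {δ : ℤ → V} {a : ℤ}, CycleParam C n δ → (∀ j, (ρ ^ a) (δ j) = δ (j + 2)) → ∀ u,
      C.connectedComponentMk u = C.connectedComponentMk (δ 0) → EqUpToSign n (b u) a := by
    intro δ a hδ ha u hu
    obtain ⟨s, hs⟩ := (hδ.mk_eq_iff 0 u).1 hu
    obtain ⟨ε, hε, h⟩ := hδ.dihedral (hγ u) (s := s) (by rw [hγ0, hs])
    refine EqUpToSign.iff_exists.2 ⟨ε, hε, ?_⟩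
    rw [← hR.eq_iff u]
    have h1 := hpow u 1
    rw [mul_one, mul_one, h] at h1
    rw [h1]
    conv_rhs => rw [hs]
    rw [mul_comm ε a, zpow_mul_param ha]; congr 1; ring
  have hb0 : ∀ v, C.connectedComponentMk v = c 0 → EqUpToSign n (b v) 1 := fun v hv =>
    hgen hγ₀ (fun j => by rw [zpow_one]; exact hρ j) v (by rw [hv, h₀])
  have hconst : ∀ u v, C.connectedComponentMk u = C.connectedComponentMk v →
      EqUpToSign n (b u) (b v) := fun u v h => hgen (hγ v) (hb v) u (by rw [hγ0, h])
  set r₀ := r (γ₀ 0) with hr₀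
  have hrall : ∀ v, EqUpToSign n (r v) r₀ := by
    intro v
    obtain ⟨φ, rfl⟩ := S.vt (γ₀ 0) v
    exact hmap φ _
  have hsq : EqUpToSign n (r₀ * r₀) 1 :=
    ((hrall (ι (γ₀ 0))).symm.mul_left r₀).trans (EqUpToSign.of_dvd (hrr _))
  have hstep : ∀ v, EqUpToSign n (b (ι v)) (r₀ * b v) := by
    intro v
    have h1 : EqUpToSign n (b (ι v)) (r (ι v) * b v) := EqUpToSign.of_dvd (by
      have h2 := hr (ι v)
      rw [S.invol, mul_comm (b v)] at h2
      exact h2)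
    exact h1.trans ((hrall _).mul_right _)
  have hlayer : ∀ (i : ℕ) v, C.connectedComponentMk v = c i →
      EqUpToSign n (b v) (if i % 2 = 0 then 1 else r₀) := by
    intro i
    induction i with
    | zero => intro v hv; exact hb0 v hv
    | succ i ih =>
      intro v hv
      obtain ⟨x, hx, hx'⟩ := S.exists_up i 1 (Or.inl rfl)
      push_cast at hv
      refine (hconst v (ι x) (by rw [hv, hx'])).trans ((hstep x).trans ?_)
      refine ((ih x hx).mul_left r₀).trans ?_
      by_cases h : i % 2 = 0
      · rw [if_pos h, if_neg (by omega), mul_one]; exact EqUpToSign.of_dvd (by simp)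
      · rw [if_neg h, if_pos (by omega)]; exact hsq
  -- The layers m and 0 coincide, while for odd m their exponents are r₀ and 1.
  have hodd : m % 2 = 1 → EqUpToSign n r₀ 1 := by
    intro hm
    have h1 : C.connectedComponentMk (γ₀ 0) = c m := by
      rw [h₀, S.eq_iff]; simp
    have h2 := hlayer m _ h1
    rw [if_neg (by omega)] at h2
    exact h2.symm.trans (hb0 _ h₀)
  -- K matters modulo n/2 and up to sign, so it can be taken to be 1 whenever possible and otherwise
  -- odd: an even r₀ with square ±1 modulo n/2 forces n/2 to be odd, and r₀ + n/2 is odd.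
  obtain ⟨K, hK, hKr, hK1, hKm⟩ : ∃ K : ℤ, K % 2 = 1 ∧ EqUpToSign n r₀ K ∧
      (K = 1 ∨ ¬ EqUpToSign n K 1) ∧ (m % 2 = 0 ∨ K = 1) := by
    by_cases h1 : EqUpToSign n r₀ 1
    · exact ⟨1, by norm_num, h1, Or.inl rfl, Or.inr rfl⟩
    · have hm2 : m % 2 = 0 := by
        by_contra h2; exact h1 (hodd (by omega))
      have hgood : ∀ K : ℤ, EqUpToSign n r₀ K → ¬ EqUpToSign n K 1 := fun K h2 h3 =>
        h1 (h2.trans h3)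
      obtain ⟨q, hq⟩ : ∃ q : ℤ, (n : ℤ) = 2 * q := ⟨n / 2, by omega⟩
      by_cases h2 : r₀ % 2 = 1
      · have h3 : EqUpToSign n r₀ r₀ := EqUpToSign.of_dvd (by simp)
        exact ⟨r₀, h2, h3, Or.inr (hgood _ h3), Or.inl hm2⟩
      · have h3 : q % 2 = 1 := by
          by_contra h3
          obtain ⟨x, hx⟩ : ∃ x, r₀ = 2 * x := ⟨r₀ / 2, by omega⟩
          rw [EqUpToSign, hx, hq, mul_dvd_mul_iff_left two_ne_zero,
            mul_dvd_mul_iff_left two_ne_zero] at hsq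
          have h4 : (2 : ℤ) ∣ q := by omega
          have e : (2 * x) * (2 * x) = 2 * (2 * (x * x)) := by ring
          rw [e] at hsq
          rcases hsq with h5 | h5 <;> have := h4.trans h5 <;> omega
        have h4 : EqUpToSign n r₀ (r₀ + q) := EqUpToSign.of_dvd ⟨-1, by rw [hq]; ring⟩
        exact ⟨r₀ + q, by omega, h4, Or.inr (hgood _ h4), Or.inl hm2⟩
  refine ⟨K, hK, hKm, hK1, ?_, ?_⟩
  · exact ((hKr.symm.mul_left K).trans (hKr.symm.mul_right r₀)).trans hsq
  · intro v i hv
    have h1 : EqUpToSign n (b v) (layerStep K i) := by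
      have hm : (m : ℤ) ≠ 0 := by have := S.three_le; omega
      have e1 : ((i % m).toNat : ℤ) = i % m := Int.toNat_of_nonneg (Int.emod_nonneg _ hm)
      have h2 : c i = c ((i % m).toNat : ℤ) := by
        rw [S.eq_iff, e1]; exact Int.dvd_self_sub_emod
      rw [h2] at hv
      have h3 := hlayer _ v hv
      have h4 : layerStep K i = layerStep K (i % m) := by
        rw [← layerStep_congr hKm i (i / m)]
        congr 1
        have := Int.emod_add_mul_ediv i m
        omega
      rw [h4, ← e1, layerStep]
      by_cases h5 : (i % m).toNat % 2 = 0
      · rw [if_pos h5] at h3; rw [if_pos (by omega)]; exact h3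
      · rw [if_neg h5] at h3; rw [if_neg (by omega)]; exact h3.trans hKr
    obtain ⟨ε, hε, h2⟩ := EqUpToSign.iff_exists.1 h1
    have h3 : ∀ u, (ρ ^ layerStep K i) u = (ρ ^ (b v * ε)) u := by
      intro u
      rw [hR.eq_iff]
      rcases hε with rfl | rfl
      · exact dvd_of_eq_mul h2 (-1) (by ring)
      · exact dvd_of_eq_mul h2 1 (by ring)
    refine ⟨fun j => γ v (ε * j), ?_, ?_, ?_⟩
    · rcases hε with rfl | rfl
      · simpa using hγ v
      · simpa using (hγ v).neg
    · simp [hγ0]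
    · intro j
      simp only
      rw [h3, zpow_mul_param (hb v)]; congr 1; ring

end Step

end AltCycleQuotient

/-! ### Construction of a chart -/

namespace AltCycleQuotient

/-- The position of the base points of the layers: consecutive values differ by the length of the
steps in a layer. -/
def drift (K i : ℤ) : ℤ := (i + 1) / 2 * K + i / 2

lemma drift_sub (K i : ℤ) : drift K i - drift K (i - 1) = layerStep K i := by
  unfold drift layerStep
  split_ifs with h
  · obtain ⟨a, rfl⟩ : ∃ a, i = 2 * a := ⟨i / 2, by omega⟩
    rw [show (2 * a + 1) / 2 = a by omega, show 2 * a / 2 = a by omega,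
      show (2 * a - 1 + 1) / 2 = a by omega, show (2 * a - 1) / 2 = a - 1 by omega]
    ring
  · obtain ⟨a, rfl⟩ : ∃ a, i = 2 * a + 1 := ⟨i / 2, by omega⟩
    rw [show (2 * a + 1 + 1) / 2 = a + 1 by omega, show (2 * a + 1) / 2 = a by omega,
      show (2 * a + 1 - 1 + 1) / 2 = a by omega, show (2 * a + 1 - 1) / 2 = a by omega]
    ring

lemma drift_add {m : ℕ} {K : ℤ} (h : m % 2 = 0 ∨ K = 1) (i s : ℤ) :
    drift K (i + m * s) = drift K i + s * drift K m := by
  unfold drift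
  rcases h with h | rfl
  · obtain ⟨a, rfl⟩ : ∃ a, m = 2 * a := ⟨m / 2, by omega⟩
    push_cast
    rw [show i + 2 * (a : ℤ) * s + 1 = i + 1 + 2 * (a * s) by ring,
      show i + 2 * (a : ℤ) * s = i + 2 * (a * s) by ring,
      show (i + 1 + 2 * (a * s)) / 2 = (i + 1) / 2 + a * s by omega,
      show (i + 2 * (a * s)) / 2 = i / 2 + a * s by omega,
      show (2 * (a : ℤ) + 1) / 2 = a by omega, show 2 * (a : ℤ) / 2 = a by omega]
    ring
  · have : ∀ i : ℤ, (i + 1) / 2 * 1 + i / 2 = i := fun i => by omega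
    rw [this, this, this]; ring

lemma drift_zero (K : ℤ) : drift K 0 = 0 := by simp [drift]

lemma drift_parity {K : ℤ} (hK : K % 2 = 1) (i : ℤ) : (drift K i - i) % 2 = 0 := by
  unfold drift
  obtain ⟨k, rfl⟩ : ∃ k, K = 2 * k + 1 := ⟨K / 2, by omega⟩
  rw [show (i + 1) / 2 * (2 * k + 1) = 2 * ((i + 1) / 2 * k) + (i + 1) / 2 by ring]
  omega

section BuildChart

variable {V : Type*} {Γ C : SimpleGraph V} {m n : ℕ} {ι : V → V} {c : ℤ → C.ConnectedComponent}

/-- In each layer choose a down vertex Y and its factor-neighbour X such that the rotation of the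
layer takes Y to the other neighbour of X; the outside neighbour of X is the next Y. The rotations
of these base points cover all vertices. -/
theorem AltSystem.exists_chart (S : AltSystem Γ C m n ι c) :
    ∃ K lam p, Chart Γ C m n K lam p ∧ (K = 1 ∨ ¬ EqUpToSign n K 1) ∧ EqUpToSign n (K * K) 1 := by
  have hne := S.even
  have hn4 := S.four_le
  have hm3 := S.three_le
  have hm0 : (m : ℤ) ≠ 0 := by omega
  obtain ⟨ρ, hR, hfix, γ₀, hγ₀, h₀, hρ⟩ := S.exists_rotation
  obtain ⟨K, hK, hKm, hK1, hKK, hst⟩ := S.exists_step hR hγ₀ h₀ hρ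
  refine ⟨K, ?_⟩
  suffices h : ∃ lam p, Chart Γ C m n K lam p by
    obtain ⟨lam, p, h⟩ := h; exact ⟨lam, p, h, hK1, hKK⟩
  set mk := C.connectedComponentMk with hmk
  have hcomm : ∀ (k : ℤ) v, (ρ ^ k) (ι v) = ι ((ρ ^ k) v) := fun k v => S.comm (ρ ^ k) v
  have hfixk : ∀ (k : ℤ) v, mk ((ρ ^ k) v) = mk v := by
    intro k
    induction k using Int.induction_on with
    | zero => intro v; rfl
    | succ k ih => intro v; rw [zpow_add_apply, zpow_one, ih, hfix]
    | pred k ih =>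
      intro v
      have e : ρ ((ρ ^ (-1 : ℤ)) v) = v := by
        rw [zpow_neg, zpow_one]; exact ρ.apply_symm_apply v
      rw [sub_eq_add_neg, zpow_add_apply, ih, ← hfix, e]
  have hmem : ∀ u v, mk u = mk v → mk (ι u) = mk (ι v) → ∃ a : ℤ, v = (ρ ^ a) u := by
    intro u v h1 h2
    obtain ⟨i, hi⟩ := S.surj (mk u)
    obtain ⟨γ, hγ, rfl, hγ'⟩ := hst u i hi.symm
    obtain ⟨t, rfl⟩ := (hγ.mk_eq_iff 0 v).1 h1.symm
    have h3 := (S.side_eq_iff hγ 0 t).1 (by rw [zero_add]; exact h2.symm)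
    refine ⟨layerStep K i * (t / 2), ?_⟩
    rw [zpow_mul_param hγ']; congr 1; omega
  have hX : ∀ v i, ∃ x, mk v = c i → (∀ u, C.Adj x u ↔ u = v ∨ u = (ρ ^ layerStep K i) v) ∧
      ∀ u, C.Adj v u ↔ u = x ∨ u = (ρ ^ (-layerStep K i)) x := by
    intro v i
    by_cases hi : mk v = c i
    · obtain ⟨γ, hγ, rfl, hγ'⟩ := hst v i hi
      refine ⟨γ 1, fun _ => ⟨fun u => ?_, fun u => ?_⟩⟩
      · rw [hγ.adj, hγ', or_comm]; norm_num
      · have : (ρ ^ (-layerStep K i)) (γ 1) = γ (-1) := by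
          rw [← (ρ ^ layerStep K i).injective.eq_iff, ← zpow_add_apply, hγ']; simp
        rw [hγ.adj, this]; norm_num
    · exact ⟨v, fun h => absurd h hi⟩
  choose xf hxf using hX
  obtain ⟨y₀, hy₀, hy₀'⟩ := S.exists_up 0 (-1) (Or.inr rfl)
  let Y : ℕ → V := fun i => Nat.rec y₀ (fun i y => ι (xf y i)) i
  have hYs : ∀ i : ℕ, Y (i + 1) = ι (xf (Y i) i) := fun i => rfl
  have hadjX : ∀ v i, mk v = c i → C.Adj v (xf v i) := fun v i h => ((hxf v i h).2 _).2 (Or.inl rfl)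
  have hY : ∀ i : ℕ, mk (Y i) = c i ∧ mk (ι (Y i)) = c (i - 1) := by
    intro i
    induction i with
    | zero => exact ⟨hy₀, hy₀'⟩
    | succ i ih =>
      rw [hYs, S.invol]
      push_cast
      have h1 := hadjX _ _ ih.1
      constructor
      · have := S.side_step h1 (Or.inr rfl) ih.1 ih.2
        rw [sub_neg_eq_add] at this
        exact this
      · rw [add_sub_cancel_right, ← ih.1]; exact (mk_eq_of_adj h1).symm
  -- After a full turn the base point returns to the same member and the same side, so it differs
  -- from the first one by a power of ρ. The base points are then extended periodically to all i.
  obtain ⟨r, hr⟩ : ∃ r : ℤ, Y m = (ρ ^ r) (Y 0) := by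
    refine hmem _ _ ?_ ?_
    · rw [(hY 0).1, (hY m).1, S.eq_iff]; simp
    · rw [(hY 0).2, (hY m).2, S.eq_iff]; exact ⟨-1, by push_cast; ring⟩
  let YY : ℤ → V := fun i => (ρ ^ (r * (i / m))) (Y (i % m).toNat)
  let XX : ℤ → V := fun i => (ρ ^ (r * (i / m))) (xf (Y (i % m).toNat) (i % m))
  have hnat : ∀ i : ℤ, ((i % m).toNat : ℤ) = i % m := fun i =>
    Int.toNat_of_nonneg (Int.emod_nonneg _ hm0)
  have hcm : ∀ i, c (i % m) = c i := fun i => by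
    rw [eq_comm, S.eq_iff]; exact Int.dvd_self_sub_emod
  have hYY : ∀ i, mk (YY i) = c i ∧ mk (ι (YY i)) = c (i - 1) := by
    intro i
    have h1 := hY (i % m).toNat
    rw [hnat] at h1
    refine ⟨by rw [hfixk, h1.1, hcm], ?_⟩
    rw [← hcomm, hfixk, h1.2, eq_comm, S.eq_iff]
    have : (m : ℤ) ∣ i - i % m := Int.dvd_self_sub_emod
    exact dvd_of_eq_mul this 1 (by ring)
  have hstepmod : ∀ i, layerStep K (i % m) = layerStep K i := by
    intro i
    rw [← layerStep_congr hKm i (i / m)]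
    congr 1
    have := Int.emod_add_mul_ediv i m
    omega
  have hXY : ∀ i, (∀ u, C.Adj (XX i) u ↔ u = YY i ∨ u = (ρ ^ layerStep K i) (YY i)) ∧
      ∀ u, C.Adj (YY i) u ↔ u = XX i ∨ u = (ρ ^ (-layerStep K i)) (XX i) := by
    intro i
    have h1 := hY (i % m).toNat
    rw [hnat] at h1
    have h2 := hxf _ _ h1.1
    rw [hstepmod] at h2
    have hpush : ∀ a b w, (ρ ^ (a : ℤ)) ((ρ ^ (b : ℤ)) w) = (ρ ^ b) ((ρ ^ a) w) := fun a b w => by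
      rw [← zpow_add_apply, ← zpow_add_apply, add_comm]
    constructor
    · intro u
      obtain ⟨w, rfl⟩ := (ρ ^ (r * (i / m))).surjective u
      simp only [XX, YY]
      rw [S.aut, h2.1, hpush, (ρ ^ (r * (i / m))).injective.eq_iff,
        (ρ ^ (r * (i / m))).injective.eq_iff]
    · intro u
      obtain ⟨w, rfl⟩ := (ρ ^ (r * (i / m))).surjective u
      simp only [XX, YY]
      rw [S.aut, h2.2, hpush, (ρ ^ (r * (i / m))).injective.eq_iff,
        (ρ ^ (r * (i / m))).injective.eq_iff]
  have hXι : ∀ i, ι (XX i) = YY (i + 1) := by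
    intro i
    simp only [XX, YY]
    rw [← hcomm]
    have hlt := Int.emod_lt_of_pos i (by omega : (0 : ℤ) < m)
    have h0 := Int.emod_nonneg i hm0
    have hdiv := Int.emod_add_mul_ediv i m
    by_cases h1 : i % m + 1 < m
    · have e1 : (i + 1) % m = i % m + 1 := by
        rw [← Int.emod_add_emod, Int.emod_eq_of_lt (by omega) h1]
      have e2 : (i + 1) / m = i / m := by
        have := Int.emod_add_mul_ediv (i + 1) m
        exact mul_left_cancel₀ hm0 (by linarith)
      rw [e1, e2, show (i % m + 1).toNat = (i % m).toNat + 1 by omega, hYs, hnat]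
    · have e1 : (i + 1) % m = 0 := by
        rw [← Int.emod_add_emod, show i % m + 1 = m by omega, Int.emod_self]
      have e2 : (i + 1) / m = i / m + 1 := by
        have := Int.emod_add_mul_ediv (i + 1) m
        exact mul_left_cancel₀ hm0 (by linarith)
      rw [e1, e2, mul_add, mul_one, zpow_add_apply, Int.toNat_zero, ← hr]
      have e3 : m = (i % m).toNat + 1 := by omega
      conv_rhs => rw [e3]
      rw [hYs, hnat, ← e3]
  have hYι : ∀ i, ι (YY i) = XX (i - 1) := by
    intro i
    have := hXι (i - 1)
    rw [sub_add_cancel] at this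
    rw [← this, S.invol]
  have hXXmk : ∀ i, mk (XX i) = c i ∧ mk (ι (XX i)) = c (i + 1) := by
    intro i
    rw [hXι]
    refine ⟨?_, (hYY _).1⟩
    rw [← (hYY i).1]
    exact mk_eq_of_adj (((hXY i).1 _).2 (Or.inl rfl))
  have hper : ∀ i s : ℤ, YY (i + m * s) = (ρ ^ (r * s)) (YY i) ∧
      XX (i + m * s) = (ρ ^ (r * s)) (XX i) := by
    intro i s
    simp only [XX, YY]
    rw [Int.add_mul_emod_self_left, Int.add_mul_ediv_left _ _ hm0, mul_add, add_comm,
      zpow_add_apply, zpow_add_apply]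
    exact ⟨rfl, rfl⟩
  set D := drift K with hD
  have hDpar := drift_parity hK
  rw [← hD] at hDpar
  -- One application of ρ changes the position by 2. The drift puts X at position D i and Y at
  -- position D (i - 1), so that they are joined by the colour 2; `lam` is what remains of r after m
  -- layers.
  let lam : ℤ := 2 * r - D m
  let p : ℤ × ℤ → V := fun z => if (z.1 + z.2) % 2 = 0 then (ρ ^ ((z.2 - D z.1) / 2)) (XX z.1)
    else (ρ ^ ((z.2 - D (z.1 - 1)) / 2)) (YY z.1)
  have hpX : ∀ i a, p (i, D i + 2 * a) = (ρ ^ a) (XX i) := by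
    intro i a
    have := hDpar i
    simp only [p]
    rw [if_pos (by omega)]
    congr 2; omega
  have hpY : ∀ i a, p (i, D (i - 1) + 2 * a) = (ρ ^ a) (YY i) := by
    intro i a
    have := hDpar (i - 1)
    simp only [p]
    rw [if_neg (by omega)]
    congr 2; omega
  have hcases : ∀ z : ℤ × ℤ, (vsign z = 1 ∧ ∃ i a, z = (i, D i + 2 * a)) ∨
      (vsign z = -1 ∧ ∃ i a, z = (i, D (i - 1) + 2 * a)) := by
    rintro ⟨i, j⟩
    have h1 := hDpar i
    have h2 := hDpar (i - 1)
    by_cases h : (i + j) % 2 = 0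
    · refine Or.inl ⟨by unfold vsign; rw [if_pos h], i, (j - D i) / 2, ?_⟩
      ext
      · rfl
      · simp only; omega
    · refine Or.inr ⟨by unfold vsign; rw [if_neg h], i, (j - D (i - 1)) / 2, ?_⟩
      ext
      · rfl
      · simp only; omega
  have hDs : ∀ i, D i = D (i - 1) + layerStep K i := fun i => by
    have := drift_sub K i; rw [hD]; omega
  have hDadd : ∀ i s : ℤ, D (i + m * s) = D i + s * D m := drift_add hKm
  have hdeck : ∀ s z, p (deck m lam s z) = p z := by
    intro s z
    rcases hcases z with ⟨-, i, a, rfl⟩ | ⟨-, i, a, rfl⟩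
    · have e : deck m lam s (i, D i + 2 * a) =
          (i + m * (-s), D (i + m * (-s)) + 2 * (a + r * s)) := by
        rw [hDadd]; simp only [deck, lam]; ext
        · simp only; ring
        · simp only; ring
      rw [e, hpX, hpX, (hper _ _).2, ← zpow_add_apply]; congr 2; ring
    · have e : deck m lam s (i, D (i - 1) + 2 * a) =
          (i + m * (-s), D (i + m * (-s) - 1) + 2 * (a + r * s)) := by
        rw [show i + m * (-s) - 1 = (i - 1) + m * (-s) by ring, hDadd]
        simp only [deck, lam]; ext
        · simp only; ring
        · simp only; ring
      rw [e, hpY, hpY, (hper _ _).1, ← zpow_add_apply]; congr 2; ring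
  have hι : ∀ z, ι (p z) = p (move K 0 z) := by
    intro z
    rcases hcases z with ⟨hs, i, a, rfl⟩ | ⟨hs, i, a, rfl⟩
    · have e : move K 0 (i, D i + 2 * a) = (i + 1, D (i + 1 - 1) + 2 * a) := by
        simp [move, hs]
      rw [e, hpY, hpX, ← hcomm, hXι]
    · have e : move K 0 (i, D (i - 1) + 2 * a) = (i - 1, D (i - 1) + 2 * a) := by
        simp [move, hs]; ring
      rw [e, hpX, hpY, ← hcomm, hYι]
  have hCadj : ∀ z v, C.Adj (p z) v ↔ v = p (move K 1 z) ∨ v = p (move K 2 z) := by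
    intro z v
    rcases hcases z with ⟨hs, i, a, rfl⟩ | ⟨hs, i, a, rfl⟩
    · have e1 : move K 1 (i, D i + 2 * a) = (i, D (i - 1) + 2 * (a + layerStep K i)) := by
        have := hDs i
        simp only [move, hs]
        ext
        · rfl
        · simp; linarith
      have e2 : move K 2 (i, D i + 2 * a) = (i, D (i - 1) + 2 * a) := by
        have := hDs i
        simp only [move, hs]
        ext
        · rfl
        · simp; linarith
      obtain ⟨w, rfl⟩ := (ρ ^ a).surjective v
      rw [e1, e2, hpX, hpY, hpY, S.aut, (hXY i).1, zpow_add_apply, (ρ ^ a).injective.eq_iff,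
        (ρ ^ a).injective.eq_iff, or_comm]
    · have e1 : move K 1 (i, D (i - 1) + 2 * a) = (i, D i + 2 * (a + -layerStep K i)) := by
        have := hDs i
        simp only [move, hs]
        ext
        · rfl
        · simp; linarith
      have e2 : move K 2 (i, D (i - 1) + 2 * a) = (i, D i + 2 * a) := by
        have := hDs i
        simp only [move, hs]
        ext
        · rfl
        · simp; linarith
      obtain ⟨w, rfl⟩ := (ρ ^ a).surjective v
      rw [e1, e2, hpX, hpY, hpX, S.aut, (hXY i).2, zpow_add_apply, (ρ ^ a).injective.eq_iff,
        (ρ ^ a).injective.eq_iff, or_comm]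
  have hpmk : ∀ z : ℤ × ℤ, mk (p z) = c z.1 ∧ mk (ι (p z)) = c (z.1 + vsign z) := by
    intro z
    rcases hcases z with ⟨hs, i, a, rfl⟩ | ⟨hs, i, a, rfl⟩
    · rw [hpX, hs, ← hcomm]
      exact ⟨(hfixk _ _).trans (hXXmk i).1, (hfixk a _).trans (hXXmk i).2⟩
    · rw [hpY, hs, ← hcomm]
      exact ⟨(hfixk _ _).trans (hYY i).1, (hfixk a _).trans (hYY i).2⟩
  have h012 : ∀ P : Fin 3 → Prop, (∃ x, P x) ↔ P 0 ∨ P 1 ∨ P 2 := fun P => by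
    rw [Fin.exists_fin_succ]; simp [Fin.exists_fin_two]
  have h12 : ∀ P : Fin 3 → Prop, (∃ x, x ≠ 0 ∧ P x) ↔ P 1 ∨ P 2 := fun P => by
    rw [h012]; simp
  refine ⟨lam, p, hm3, hn4, hne, hK, ?_, hKm, ?_, ?_, ?_, ?_, ?_⟩
  · have := hDpar m; simp only [lam]; omega
  · intro h
    have h1 : (n : ℤ) ∣ 2 * (K * K) := dvd_of_eq_mul h K (by ring)
    have h2 : (n : ℤ) ∣ 2 := by
      rcases hKK with h3 | h3
      · exact dvd_of_eq_mul (h1.sub h3) 1 (by ring)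
      · exact dvd_of_eq_mul (h3.sub h1) 1 (by ring)
    have := Int.le_of_dvd (by norm_num) h2
    omega
  · intro v
    obtain ⟨i, hi⟩ := S.surj (mk v)
    rcases S.side v i hi.symm with h | h
    · obtain ⟨a, ha⟩ := hmem (XX i) v (by rw [(hXXmk i).1, hi]) (by rw [(hXXmk i).2]; exact h.symm)
      exact ⟨_, (hpX i a).trans ha.symm⟩
    · obtain ⟨a, ha⟩ := hmem (YY i) v (by rw [(hYY i).1, hi]) (by rw [(hYY i).2]; exact h.symm)
      exact ⟨_, (hpY i a).trans ha.symm⟩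
  · intro z w
    constructor
    · intro h
      have h1 := (hpmk z).1
      rw [h, (hpmk w).1, S.eq_iff] at h1
      obtain ⟨s, hs⟩ := h1
      refine ⟨-s, by rw [mul_neg]; omega, ?_⟩
      rw [← hdeck (-s)] at h
      have hfst : (deck m lam (-s) z).1 = w.1 := by simp only [deck, mul_neg]; omega
      set z' := deck m lam (-s) z with hz'
      have hz2 : z.2 - w.2 + lam * -s = z'.2 - w.2 := by rw [hz']; simp only [deck]; ring
      rw [hz2]
      have h2 := (hpmk z').2
      rw [h, (hpmk w).2, hfst, S.eq_iff] at h2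
      have hse : vsign w = vsign z' := by
        have h3 : (m : ℤ) ∣ vsign w - vsign z' := dvd_of_eq_mul h2 1 (by ring)
        rcases vsign_eq w with h4 | h4 <;> rcases vsign_eq z' with h5 | h5 <;>
          rw [h4, h5] at h3 ⊢
        · have := Int.le_of_dvd (by norm_num) h3; omega
        · have := Int.le_of_dvd (by norm_num) ((dvd_neg).2 h3); omega
      rcases hcases z' with ⟨hs1, i, a, e1⟩ | ⟨hs1, i, a, e1⟩ <;>
        rcases hcases w with ⟨hs2, i', a', e2⟩ | ⟨hs2, i', a', e2⟩
      · rw [e1, e2] at hfst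
        simp only at hfst
        subst hfst
        rw [e1, e2, hpX, hpX, hR.eq_iff] at h
        rw [e1, e2]
        exact dvd_of_eq_mul h 1 (by ring)
      · omega
      · omega
      · rw [e1, e2] at hfst
        simp only at hfst
        subst hfst
        rw [e1, e2, hpY, hpY, hR.eq_iff] at h
        rw [e1, e2]
        exact dvd_of_eq_mul h 1 (by ring)
    · rintro ⟨s, h1, h2⟩
      rw [← hdeck s z]
      have hfst : (deck m lam s z).1 = w.1 := by simp only [deck]; omega
      have h3 : (n : ℤ) ∣ (deck m lam s z).2 - w.2 := dvd_of_eq_mul h2 1 (by simp only [deck]; ring)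
      have hpar := even_of_dvd hne h3
      have hse : vsign (deck m lam s z) = vsign w := vsign_congr (by omega)
      rcases hcases (deck m lam s z) with ⟨hs1, i, a, e1⟩ | ⟨hs1, i, a, e1⟩ <;>
        rcases hcases w with ⟨hs2, i', a', e2⟩ | ⟨hs2, i', a', e2⟩
      · rw [e1, e2] at hfst h3
        simp only at hfst
        subst hfst
        rw [e1, e2, hpX, hpX, hR.eq_iff]
        exact dvd_of_eq_mul h3 1 (by ring)
      · omega
      · omega
      · rw [e1, e2] at hfst h3
        simp only at hfst
        subst hfst
        rw [e1, e2, hpY, hpY, hR.eq_iff]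
        exact dvd_of_eq_mul h3 1 (by ring)
  · intro z v
    rw [S.adj, hCadj, hι, h012]
    tauto
  · intro z v
    rw [hCadj, h12]

end BuildChart

end AltCycleQuotient

namespace AltCycleQuotient

/-! ### Relations between the parameters -/

section Parameters

variable {V : Type*} {Γ C : SimpleGraph V} {m n : ℕ} {K lam : ℤ} {p : ℤ × ℤ → V}

/-- K is a unit modulo n/2, so x is a multiple of n/2; on such multiples the odd number K acts
trivially modulo n. -/
lemma dvd_of_dvd_mul_of_sq (hn : n % 2 = 0) (hK : K % 2 = 1) (hKK : EqUpToSign n (K * K) 1) {x : ℤ}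
    (h : (n : ℤ) ∣ K * x) : (n : ℤ) ∣ x := by
  have h2 : (n : ℤ) ∣ 2 * x := by
    rcases hKK with h3 | h3
    · exact dvd_of_eq_mul ((h.mul_left (2 * K)).sub (h3.mul_right x)) 1 (by ring)
    · exact dvd_of_eq_mul ((h3.mul_right x).sub (h.mul_left (2 * K))) 1 (by ring)
  obtain ⟨y, hy⟩ := h2
  obtain ⟨k, hk⟩ : ∃ k, K = 2 * k + 1 := ⟨K / 2, by omega⟩
  obtain ⟨e, he⟩ : ∃ e : ℤ, (n : ℤ) = 2 * e := ⟨n / 2, by omega⟩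
  have h4 : x = e * y := by
    rw [he] at hy
    have : 2 * x = 2 * (e * y) := by rw [hy]; ring
    omega
  refine dvd_of_eq_mul (h.sub (dvd_mul_right (n : ℤ) (k * y))) 1 ?_
  rw [h4, hk, he]; ring

lemma Chart.layer_dvd (hp : Chart Γ C m n K lam p) (hKK : EqUpToSign n (K * K) 1) (i : ℤ) {x : ℤ}
    (h : (n : ℤ) ∣ layerStep K i * x) : (n : ℤ) ∣ x := by
  unfold layerStep at h
  split_ifs at h
  · simpa using h
  · exact dvd_of_dvd_mul_of_sq hp.n_even hp.K_odd hKK h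

lemma Chart.cycleParam (hp : Chart Γ C m n K lam p) (hKK : EqUpToSign n (K * K) 1) (i a : ℤ) :
    CycleParam C n (fun t => p (i, a + layerStep K i * t)) := by
  refine ⟨by have := hp.four_le; omega, fun t u => ?_, fun s t => ?_⟩
  · have e1 : move K 1 (i, a + layerStep K i * t) =
        (i, a + layerStep K i * (t + vsign (i, a + layerStep K i * t))) := by
      simp only [move]; ext
      · rfl
      · simp; ring
    have e2 : move K 2 (i, a + layerStep K i * t) =
        (i, a + layerStep K i * (t - vsign (i, a + layerStep K i * t))) := by
      simp only [move]; ext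
      · rfl
      · simp; ring
    have h12 : ∀ P : Fin 3 → Prop, (∃ x, x ≠ 0 ∧ P x) ↔ P 1 ∨ P 2 := fun P => by
      rw [Fin.exists_fin_succ]; simp [Fin.exists_fin_two]
    rw [hp.adjC, h12, e1, e2]
    rcases AltCycleQuotient.vsign_eq (i, a + layerStep K i * t) with h | h
    · rw [h]
    · rw [h, sub_neg_eq_add, or_comm]; rfl
  · rw [hp.eq_iff]
    have hm := hp.three_le
    constructor
    · rintro ⟨r, h1, h2⟩
      have hr : r = 0 := by
        have h3 : (m : ℤ) * r = 0 := by simp only at h1; omega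
        rcases mul_eq_zero.1 h3 with h4 | h4
        · omega
        · exact h4
      subst hr
      exact hp.layer_dvd hKK i (dvd_of_eq_mul h2 1 (by ring))
    · intro h
      exact ⟨0, by simp, dvd_of_eq_mul h (layerStep K i) (by ring)⟩

lemma Chart.map_move_zero (hp : Chart Γ C m n K lam p) {φ : Γ ≃g Γ}
    (hφ : ∀ v w, C.Adj (φ v) (φ w) ↔ C.Adj v w) {z z' : ℤ × ℤ} (h : φ (p z) = p z') :
    φ (p (move K 0 z)) = p (move K 0 z') := by
  have h1 : Γ.Adj (φ (p z)) (φ (p (move K 0 z))) := φ.map_rel_iff.2 ((hp.adj _ _).2 ⟨0, rfl⟩)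
  rw [h, hp.adj] at h1
  obtain ⟨x, hx⟩ := h1
  by_cases h0 : x = 0
  · rw [hx, h0]
  · exfalso
    have h2 : C.Adj (φ (p z)) (φ (p (move K 0 z))) := by
      rw [h, hx]; exact (hp.adjC _ _).2 ⟨x, h0, rfl⟩
    rw [hφ, hp.adjC] at h2
    obtain ⟨y, hy, h3⟩ := h2
    exact hy (hp.move_inj h3).symm

lemma Chart.map_layer (hp : Chart Γ C m n K lam p) (hKK : EqUpToSign n (K * K) 1) {φ : Γ ≃g Γ}
    (hφ : ∀ v w, C.Adj (φ v) (φ w) ↔ C.Adj v w) {i j i' j' : ℤ} (h : φ (p (i, j)) = p (i', j')) :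
    ∃ ε : ℤ, (ε = 1 ∨ ε = -1) ∧ ∀ t, φ (p (i, j + layerStep K i * t)) =
      p (i', j' + layerStep K i' * (ε * t)) := by
  obtain ⟨ε, hε, h1⟩ := (hp.cycleParam hKK i' j').dihedral
    ((hp.cycleParam hKK i j).comp φ.bijective hφ) (s := 0) (by simpa using h)
  exact ⟨ε, hε, fun t => by have := h1 t; rwa [zero_add] at this⟩

/-- An automorphism that preserves the `2`-factor and moves the layer `0` to the layer `1` forces
the relations between the parameters. -/
theorem Chart.param_relation (hp : Chart Γ C m n K lam p) (hm : m % 2 = 0)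
    (hK1 : ¬ EqUpToSign n K 1) {δ : ℤ} (hδ1 : δ = 1 ∨ δ = -1)
    (hδ : (n : ℤ) ∣ 2 * (K * K - δ)) {φ : Γ ≃g Γ}
    (hφ : ∀ v w, C.Adj (φ v) (φ w) ↔ C.Adj v w) (h : φ (p (0, 0)) = p (1, 1)) :
    ∃ ε : ℤ, (ε = 1 ∨ ε = -1) ∧ (n : ℤ) ∣ ε * K * lam - lam - (m / 2 : ℕ) * (ε * (δ - K * K)) := by
  have hKK : EqUpToSign n (K * K) 1 := EqUpToSign.iff_exists.2 ⟨δ, hδ1, by simpa using hδ⟩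
  have hKo := hp.K_odd
  -- For n = 4 every odd K would be ±1 modulo n/2. Consequently a sign is determined by its double
  -- modulo n.
  have hn4 : ¬ (n : ℤ) ∣ 4 := by
    intro h4
    have h5 : (n : ℤ) = 4 := by
      have := Int.le_of_dvd (by norm_num) h4
      have := hp.four_le
      omega
    apply hK1
    rw [EqUpToSign, h5]
    omega
  have hsign : ∀ a b : ℤ, (a = 1 ∨ a = -1) → (b = 1 ∨ b = -1) → (n : ℤ) ∣ 2 * (a - b) → a = b := by
    rintro a b (rfl | rfl) (rfl | rfl) h
    · rfl
    · exact absurd h (by norm_num; exact hn4)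
    · exact absurd h (by norm_num; exact hn4)
    · rfl
  have hK2 : (K * K) % 2 = 1 := by rw [Int.mul_emod, hKo]; rfl
  have hmod : ∀ {i a b : ℤ}, (n : ℤ) ∣ a - b → p (i, a) = p (i, b) := fun h =>
    (hp.eq_iff _ _).2 ⟨0, by simp, by simpa using h⟩
  have hmod' : ∀ {i a b : ℤ}, p (i, a) = p (i, b) → (n : ℤ) ∣ a - b := by
    intro i a b h
    obtain ⟨r, h1, h2⟩ := (hp.eq_iff _ _).1 h
    have hm3 := hp.three_le
    have hr : r = 0 := by
      have h3 : (m : ℤ) * r = 0 := by simp only at h1; omega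
      rcases mul_eq_zero.1 h3 with h4 | h4
      · omega
      · exact h4
    subst hr
    simpa using h2
  have hup : ∀ i j : ℤ, (i + j) % 2 = 0 → move K 0 (i, j) = (i + 1, j) := fun i j h => by
    simp [move, vsign, h]
  have hev : ∀ i : ℤ, i % 2 = 0 → layerStep K i = 1 := fun i h => by simp [layerStep, h]
  have hod : ∀ i : ℤ, i % 2 = 1 → layerStep K i = K := fun i h => by simp [layerStep, h]
  obtain ⟨ε, hε, h0⟩ := hp.map_layer hKK hφ h
  refine ⟨ε, hε, ?_⟩
  set τ := ε * (δ - K * K) with hτ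
  have hτ2 : ∀ a : ℤ, (a * τ) % 2 = 0 := by
    intro a
    have : (δ - K * K) % 2 = 0 := by omega
    obtain ⟨b, hb⟩ : ∃ b, δ - K * K = 2 * b := ⟨_, (Int.mul_ediv_cancel' (by omega)).symm⟩
    rw [hτ, hb, show a * (ε * (2 * b)) = 2 * (a * ε * b) by ring]
    omega
  -- On even layers the automorphism is affine with slope εK. Passing two layers replaces K² by the
  -- sign δ, and they agree only modulo n/2; the discrepancy τ is picked up once for every two
  -- layers.
  have key : ∀ h : ℕ, ∀ j, φ (p (2 * h, j)) = p (2 * h + 1, 1 + ε * K * j + h * τ) := by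
    intro h
    induction h with
    | zero =>
      intro j
      have := h0 j
      rw [hev 0 (by norm_num), hod 1 (by norm_num)] at this
      simp only [zero_add, one_mul] at this
      simp only [Nat.cast_zero, mul_zero, zero_add, zero_mul, add_zero]
      rw [this]; congr 2; ring
    | succ h ih =>
      have e1 : ∀ j, j % 2 = 0 → φ (p (2 * h + 1, j)) = p (2 * h + 2, 1 + ε * K * j + h * τ) := by
        intro j hj
        have h1 := hp.map_move_zero hφ (ih j)
        have hKj : (ε * K * j) % 2 = 0 := by
          rw [Int.mul_emod, hj]; simp
        have := hτ2 h
        rwa [hup _ _ (by omega), hup _ _ (by omega), add_assoc (2 * (h : ℤ))] at h1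
      have e10 := e1 0 (by norm_num)
      obtain ⟨ε', hε', e2⟩ := hp.map_layer hKK hφ e10
      rw [hod _ (by omega), hev _ (by omega)] at e2
      -- The outside edges from layer 2h already give the images of the even positions of layer 2h +
      -- 1; the position two steps of length K away determines the sign.
      have hε'' : ε' = ε * δ := by
        refine hsign _ _ hε' (by rcases hε with rfl | rfl <;> rcases hδ1 with rfl | rfl <;> simp) ?_
        have h3 := e2 2
        rw [e1 _ (by omega)] at h3
        have h4 := hmod' h3
        exact dvd_of_eq_mul (h4.sub (hδ.mul_right ε)) (-1) (by ring)
      have e3 : φ (p (2 * h + 2, K)) = p (2 * h + 3, 1 + h * τ + ε * δ) := by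
        have h3 := e2 1
        have h4 := hp.map_move_zero hφ h3
        have := hτ2 h
        have hpar : (ε' * 1) % 2 = 1 := by omega
        rw [hup _ _ (by omega), hup _ _ (by omega)] at h4
        rw [show (2 : ℤ) * h + 1 + 1 = 2 * h + 2 by ring,
          show (2 : ℤ) * h + 2 + 1 = 2 * h + 3 by ring] at h4
        rw [show K = 0 + K * 1 by ring]
        conv_rhs => rw [← hε'']
        rw [h4]; congr 2; ring
      obtain ⟨ε₂, hε₂, e4⟩ := hp.map_layer hKK hφ e3
      rw [hev _ (by omega), hod _ (by omega)] at e4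
      have hε₂' : ε₂ = ε := by
        refine hsign _ _ hε₂ hε ?_
        have h3 := e2 3
        have h4 := hp.map_move_zero hφ h3
        have := hτ2 h
        have hpar : (ε' * 3) % 2 = 1 := by omega
        rw [hup _ _ (by omega), hup _ _ (by omega),
          show (2 : ℤ) * h + 1 + 1 = 2 * h + 2 by ring,
          show (2 : ℤ) * h + 2 + 1 = 2 * h + 3 by ring] at h4
        have h5 := e4 (2 * K)
        rw [show K + 1 * (2 * K) = 0 + K * 3 by ring, h4] at h5
        have h6 := hmod' h5
        rw [hε''] at h6
        have h7 : (n : ℤ) ∣ K * K * (2 * (ε₂ - ε)) :=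
          dvd_of_eq_mul (h6.add (hδ.mul_right ε)) (-1) (by ring)
        have h8 := hp.layer_dvd hKK 1 (x := K * (2 * (ε₂ - ε))) (by
          rw [hod 1 (by norm_num), ← mul_assoc]; exact h7)
        exact hp.layer_dvd hKK 1 (by rw [hod 1 (by norm_num)]; exact h8)
      subst hε₂'
      intro j
      have h3 := e4 (j - K)
      push_cast
      rw [show (2 : ℤ) * (h + 1) = 2 * h + 2 by ring, show (2 : ℤ) * h + 2 + 1 = 2 * h + 3 by ring,
        show j = K + 1 * (j - K) by ring, h3]
      congr 2
      rw [hτ]; ring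
  obtain ⟨m', rfl⟩ : ∃ m', m = 2 * m' := ⟨m / 2, by omega⟩
  -- Layer m is layer 0 shifted by `lam`, so the two descriptions of the image of p (m, 0) = p (0,
  -- lam) can be compared.
  rw [show 2 * m' / 2 = m' by omega]
  have h1 := key m' 0
  have h2 : p (2 * m', 0) = p (0, lam) := by
    rw [← hp.deck 1]; congr 1; simp [AltCycleQuotient.deck]
  have h3 : p (2 * m' + 1, 1 + ε * K * 0 + m' * τ) = p (1, 1 + m' * τ + lam) := by
    rw [← hp.deck 1]; congr 1
    simp only [AltCycleQuotient.deck]; ext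
    · push_cast; ring
    · simp only; ring
  have h4 := key 0 lam
  simp only [Nat.cast_zero, mul_zero, zero_add, zero_mul, add_zero] at h4
  rw [h2, h3, h4] at h1
  exact dvd_of_eq_mul (hmod' h1) 1 (by ring)

/-- An automorphism from an up vertex of layer 0 to one of layer 1 exists by transitivity. With δ -
K² = (n/2)u the relation it forces contains the error (m/2)(n/2)u, which vanishes modulo n if 4
divides m or u is even, and is n/2 otherwise; these are the two alternatives. -/
theorem Chart.xParameters (hp : Chart Γ C m n K lam p) (hm : m % 2 = 0)
    (hK1 : ¬ EqUpToSign n K 1) (hKK : EqUpToSign n (K * K) 1) (hinv : IsAutInvariant Γ C)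
    (hvt : IsVertexTransitive Γ) : XParameters m n (K : ZMod n) (lam : ZMod n) := by
  have hn := hp.n_even
  have hn4 := hp.four_le
  have : NeZero n := ⟨by omega⟩
  obtain ⟨δ, hδ1, hδ⟩ := EqUpToSign.iff_exists.1 hKK
  rw [mul_one] at hδ
  obtain ⟨φ, hφ⟩ := hvt (p (0, 0)) (p (1, 1))
  obtain ⟨ε, hε, hrel⟩ := hp.param_relation hm hK1 hδ1 hδ (hinv φ) hφ
  obtain ⟨h, hh⟩ : ∃ h : ℕ, n = 2 * h := ⟨n / 2, by omega⟩
  have hh' : n / 2 = h := by omega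
  have cast : ∀ x y : ℤ, ((x : ZMod n) = (y : ZMod n)) ↔ (n : ℤ) ∣ x - y := fun x y => by
    rw [eq_comm, ZMod.intCast_eq_intCast_iff_dvd_sub]
  have hKv := val_parity hn K
  have hlv := val_parity hn lam
  have hKo := hp.K_odd
  have hlp := hp.lam_parity
  refine ⟨⟨m / 2, by omega⟩, by omega, by omega, ⟨fun h1 => hK1 (Or.inl ?_),
    fun h1 => hK1 (Or.inr ?_)⟩, ?_, ?_⟩
  · have := (cast (2 * K) 2).1 (by push_cast; exact h1)
    exact dvd_of_eq_mul this 1 (by ring)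
  · have := (cast (2 * K) (-2)).1 (by push_cast; exact h1)
    exact dvd_of_eq_mul this 1 (by ring)
  · rcases hδ1 with rfl | rfl
    · left
      have := (cast (2 * K ^ 2) 2).2 (dvd_of_eq_mul hδ 1 (by ring))
      push_cast at this; exact this
    · right
      have := (cast (2 * K ^ 2) (-2)).2 (dvd_of_eq_mul hδ 1 (by ring))
      push_cast at this; exact this
  · have hu : (h : ℤ) ∣ δ - K * K := by
      have : ((2 * h : ℕ) : ℤ) ∣ 2 * (K * K - δ) := by rw [← hh]; exact hδ
      push_cast at this
      rw [mul_dvd_mul_iff_left two_ne_zero] at this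
      exact dvd_of_eq_mul this (-1) (by ring)
    obtain ⟨u, hu⟩ := hu
    rw [hu] at hrel
    have hnz : (n : ℤ) = 2 * h := by omega
    have hKlam : (n : ℤ) ∣ ε * K * lam - lam → ((lam : ZMod n) * K = lam ∨ (lam : ZMod n) * K = -lam) := by
      intro h1
      rcases hε with rfl | rfl
      · left
        have := (cast (lam * K) lam).2 (dvd_of_eq_mul h1 1 (by ring))
        push_cast at this; exact this
      · right
        have := (cast (lam * K) (-lam)).2 (dvd_of_eq_mul h1 (-1) (by ring))
        push_cast at this; exact this
    by_cases h4 : 4 ∣ m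
    · left
      refine ⟨hKlam ?_, Or.inr h4⟩
      obtain ⟨m', rfl⟩ := h4
      rw [show 4 * m' / 2 = 2 * m' by omega] at hrel
      refine dvd_of_eq_mul (hrel.add (dvd_mul_right (n : ℤ) (m' * ε * u))) 1 ?_
      rw [hnz]; push_cast; ring
    · obtain ⟨m', hm'⟩ : ∃ m', m = 4 * m' + 2 := ⟨m / 4, by omega⟩
      rw [show m / 2 = 2 * m' + 1 by omega] at hrel
      have hrel' : (n : ℤ) ∣ ε * K * lam - lam - ε * (h * u) := by
        refine dvd_of_eq_mul (hrel.add (dvd_mul_right (n : ℤ) (m' * ε * u))) 1 ?_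
        rw [hnz]; push_cast; ring
      rcases Int.even_or_odd' u with ⟨w, hw | hw⟩
      · left
        refine ⟨hKlam ?_, Or.inl ?_⟩
        · refine dvd_of_eq_mul (hrel'.add (dvd_mul_right (n : ℤ) (ε * w))) 1 ?_
          rw [hnz, hw]; ring
        · have h5 : (n : ℤ) ∣ K ^ 2 - δ := ⟨-w, by rw [hnz]; rw [hw] at hu; linear_combination -hu⟩
          have h6 := (cast (K ^ 2) δ).2 h5
          push_cast at h6
          rcases hδ1 with rfl | rfl
          · left; simpa using h6
          · right; simpa using h6
      · right
        rw [hh']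
        refine ⟨?_, by omega, ?_⟩
        · rcases hε with rfl | rfl
          · left
            have := (cast (lam * K) (h + lam)).2 (dvd_of_eq_mul
              (hrel'.add (dvd_mul_right (n : ℤ) w)) 1 (by rw [hnz, hw]; ring))
            push_cast at this; exact this
          · right
            have := (cast (lam * K) (h - lam)).2 (dvd_of_eq_mul
              (hrel'.sub (dvd_mul_right (n : ℤ) w)) (-1) (by rw [hnz, hw]; ring))
            push_cast at this; exact this
        · rw [hw] at hu
          rcases hδ1 with rfl | rfl
          · left
            have := (cast (K ^ 2) (h + 1)).2 ⟨-(w + 1), by rw [hnz]; linear_combination -hu⟩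
            push_cast at this; exact this
          · right
            have := (cast (K ^ 2) (h - 1)).2 ⟨-(w + 1), by rw [hnz]; linear_combination -hu⟩
            push_cast at this; exact this

end Parameters

end AltCycleQuotient

namespace AltCycleQuotient

/-! ### Automorphisms from global colour permutations -/

section Automorphisms

variable {V : Type*} {Γ C : SimpleGraph V} {m n : ℕ} {K lam : ℤ} {p : ℤ × ℤ → V}

/-- The induced map on the finite set of arcs is injective, hence surjective, so non-adjacent
vertices stay non-adjacent. -/
lemma exists_iso_of_bijective [Finite V] {f : V → V} (hf : Function.Bijective f)
    (h : ∀ v w, Γ.Adj v w → Γ.Adj (f v) (f w)) : ∃ φ : Γ ≃g Γ, ∀ v, φ v = f v := by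
  let g : {d : V × V // Γ.Adj d.1 d.2} → {d : V × V // Γ.Adj d.1 d.2} :=
    fun d => ⟨(f d.1.1, f d.1.2), h _ _ d.2⟩
  have hg : Function.Injective g := by
    intro d d' e
    have e := Subtype.ext_iff.1 e
    exact Subtype.ext (Prod.ext (hf.1 (Prod.ext_iff.1 e).1) (hf.1 (Prod.ext_iff.1 e).2))
  have hg' := Finite.injective_iff_surjective.1 hg
  refine ⟨⟨Equiv.ofBijective f hf, fun {v w} => ⟨fun e => ?_, h v w⟩⟩, fun v => rfl⟩
  obtain ⟨⟨⟨a, b⟩, hab⟩, hd⟩ := hg' ⟨(f v, f w), e⟩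
  have hd := Subtype.ext_iff.1 hd
  have h1 : a = v := hf.1 (Prod.ext_iff.1 hd).1
  have h2 : b = w := hf.1 (Prod.ext_iff.1 hd).2
  subst h1 h2; exact hab

/-- A map of up vertices that is compatible with the colours up to a permutation moving the
colour `0` extends to an automorphism that does not preserve the `2`-factor. -/
theorem Chart.not_invariant_of_colour_perm [Finite V] (hp : Chart Γ C m n K lam p)
    (hconn : Γ.Connected) (π : Equiv.Perm (Fin 3)) (hπ : π 0 ≠ 0) (F : ℤ × ℤ → ℤ × ℤ)
    (hF : ∀ z w, vsign z = 1 → p z = p w → p (F z) = p (F w))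
    (hmove : ∀ z, vsign z = 1 → ∀ x, x ≠ 2 →
      p (F (move K x (move K 2 z))) = p (move K (π x) (move K (π 2) (F z)))) :
    ¬ IsAutInvariant Γ C := by
  have hK := hp.K_odd
  -- A down vertex is reached from an up vertex by the colour 2, so its image must be reached by the
  -- colour π 2.
  set G : ℤ × ℤ → ℤ × ℤ := fun z => if vsign z = 1 then F z else move K (π 2) (F (move K 2 z))
    with hG
  have hdown : ∀ z, vsign z ≠ 1 → vsign (move K 2 z) = 1 := by
    intro z hz
    rw [vsign_move hK]
    rcases AltCycleQuotient.vsign_eq z with h | h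
    · exact absurd h hz
    · rw [h]; norm_num
  have hGp : ∀ z w, p z = p w → p (G z) = p (G w) := by
    intro z w h
    have hs := hp.vsign_eq h
    simp only [hG]
    rw [← hs]
    split_ifs with h1
    · exact hF z w h1 h
    · exact hp.move_eq (hF _ _ (hdown z h1) (hp.move_eq h 2)) _
  have hGm : ∀ z x, p (G (move K x z)) = p (move K (π x) (G z)) := by
    intro z x
    by_cases h1 : vsign z = 1
    · have h2 : ¬ vsign (move K x z) = 1 := by rw [vsign_move hK, h1]; norm_num
      simp only [hG]
      rw [if_neg h2, if_pos h1]
      by_cases hx : x = 2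
      · subst hx; rw [move_move hK]
      · set w := move K 2 (move K x z) with hw
        have h3 := hmove w (hdown _ h2) x hx
        rw [hw, move_move hK, move_move hK, ← hw] at h3
        have h4 := hp.move_eq h3 (π x)
        rw [move_move hK] at h4
        exact h4.symm
    · have h2 : vsign (move K x z) = 1 := by
        rw [vsign_move hK]
        rcases AltCycleQuotient.vsign_eq z with h | h
        · exact absurd h h1
        · rw [h]; norm_num
      simp only [hG]
      rw [if_pos h2, if_neg h1]
      by_cases hx : x = 2
      · subst hx; rw [move_move hK]
      · have h3 := hmove (move K 2 z) (hdown z h1) x hx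
        rwa [move_move hK] at h3
  choose s hs using hp.surj
  set f : V → V := fun v => p (G (s v)) with hf
  have hfp : ∀ z, f (p z) = p (G z) := fun z => hGp _ _ (hs _)
  have hadj : ∀ v w, Γ.Adj v w → Γ.Adj (f v) (f w) := by
    intro v w h
    obtain ⟨z, rfl⟩ := hp.surj v
    obtain ⟨x, rfl⟩ := (hp.adj _ _).1 h
    rw [hfp, hfp, hGm]
    exact (hp.adj _ _).2 ⟨_, rfl⟩
  -- The image is closed under taking neighbours, as π permutes all colours, and Γ is connected;
  -- finiteness then gives injectivity.
  have hsurj : Function.Surjective f := by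
    have key : ∀ v w (q : Γ.Walk v w), (∃ u, f u = v) → ∃ u, f u = w := by
      intro v w q
      induction q with
      | nil => exact id
      | cons h q ih =>
        rintro ⟨u, rfl⟩
        refine ih ?_
        obtain ⟨z, rfl⟩ := hp.surj u
        rw [hfp] at h
        obtain ⟨x, rfl⟩ := (hp.adj _ _).1 h
        exact ⟨p (move K (π.symm x) z), by rw [hfp, hGm, π.apply_symm_apply]⟩
    intro w
    obtain ⟨q⟩ := hconn.preconnected (f w) w
    exact key _ _ q ⟨w, rfl⟩
  obtain ⟨φ, hφ⟩ := exists_iso_of_bijective ⟨Finite.injective_iff_surjective.2 hsurj, hsurj⟩ hadj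
  intro hinv
  have h1 : π.symm 0 ≠ 0 := fun h => hπ (by rw [← h, π.apply_symm_apply, h])
  have h2 := (hinv φ (p (0, 0)) (p (move K (π.symm 0) (0, 0)))).2 ((hp.adjC _ _).2 ⟨_, h1, rfl⟩)
  rw [hφ, hφ, hfp, hfp, hGm, π.apply_symm_apply, hp.adjC] at h2
  obtain ⟨x, hx, h3⟩ := h2
  exact hx (hp.move_inj h3).symm

lemma move_zero_one_two (K i j : ℤ) (h : vsign (i, j) = 1) :
    move K 0 (i, j) = (i + 1, j) ∧ move K 1 (i, j) = (i, j + layerStep K i) ∧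
      move K 2 (i, j) = (i, j - layerStep K i) := by
  simp [move, h]

lemma move_zero_one_two' (K i j : ℤ) (h : vsign (i, j) = -1) :
    move K 0 (i, j) = (i - 1, j) ∧ move K 1 (i, j) = (i, j - layerStep K i) ∧
      move K 2 (i, j) = (i, j + layerStep K i) := by
  simp [move, h, sub_eq_add_neg]

/-- Parameters for which the translations of the universal cover act diagonally. -/
structure Chart.Diagonal (m n : ℕ) (K lam s e q t : ℤ) : Prop where
  n_eq : (n : ℤ) = 2 * m * s
  K_eq : K = 1 + 2 * q
  q_eq : 2 * q = m * e
  lam_eq : m * (1 + q) + lam = 2 * m * t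
  dvd_e : s ∣ 2 * e
  dvd_t : s ∣ e * (t + 1)

/-- Colour permutations in diagonal coordinates of the up vertices. -/
theorem Chart.not_invariant_of_diagonal [Finite V] (hp : Chart Γ C m n K lam p)
    (hconn : Γ.Connected) {s e q t : ℤ} (hd : Chart.Diagonal m n K lam s e q t)
    (π : Equiv.Perm (Fin 3)) (hπ : π 0 ≠ 0) (F : ℤ → ℤ → ℤ × ℤ)
    (hper : ∀ i y x, p (F i (y + m * s * x)) = p (F i y))
    (hdeck : ∀ i y x, p (F (i - m * x) (y + layerStep K i * m * t * x)) = p (F i y))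
    (h1 : ∀ i y, p (F i (y - 1)) = p (move K (π 1) (move K (π 2) (F i y))))
    (h0 : ∀ i y, p (F (i - 1) (K * y)) = p (move K (π 0) (move K (π 2) (F i y)))) :
    ¬ IsAutInvariant Γ C := by
  obtain ⟨hn, hK, hq, hlam, he, ht⟩ := hd
  have hDpar := drift_parity hp.K_odd
  have hDm : drift K m = m * (1 + q) := by
    rcases hp.even_or_one with h | h
    · obtain ⟨a, rfl⟩ : ∃ a, m = 2 * a := ⟨m / 2, by omega⟩
      rw [drift, hK]; push_cast
      rw [show (2 * (a : ℤ) + 1) / 2 = a by omega, show (2 * (a : ℤ)) / 2 = a by omega]; ring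
    · have : q = 0 := by omega
      rw [drift, h, this]; omega
  have hcases : ∀ z : ℤ × ℤ, vsign z = 1 → ∃ i a, z = (i, drift K i + 2 * a) := by
    rintro ⟨i, j⟩ hz
    have h3 : (i + j) % 2 = 0 := by
      unfold vsign at hz; split_ifs at hz with h
      exact h
    have := hDpar i
    refine ⟨i, (j - drift K i) / 2, ?_⟩
    ext
    · rfl
    · simp only; omega
  have hsq : ∃ x, K * K = 1 + m * s * x := by
    obtain ⟨x, hx⟩ := he
    rcases hp.even_or_one with h | h
    · obtain ⟨a, rfl⟩ : ∃ a, m = 2 * a := ⟨m / 2, by omega⟩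
      refine ⟨x * (1 + a * e), ?_⟩
      push_cast at hq ⊢
      have h2 : q = a * e := by linarith
      rw [hK, h2]
      linear_combination (2 * a) * (1 + a * e) * hx
    · exact ⟨0, by rw [h]; ring⟩
  obtain ⟨x₀, hx₀⟩ := hsq
  have hstep : ∀ i, layerStep K i = 1 ∨ layerStep K i = K := fun i => by
    unfold layerStep; split_ifs <;> simp
  have hss : ∀ i, ∃ x, layerStep K i * layerStep K i = 1 + m * s * x := by
    intro i
    rcases hstep i with h | h
    · exact ⟨0, by rw [h]; ring⟩
    · exact ⟨x₀, by rw [h, hx₀]⟩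
  have hss' : ∀ i, ∃ x, layerStep K (i - 1) = K * layerStep K i + m * s * x := by
    intro i
    by_cases h : i % 2 = 0
    · have h2 : ¬ (i - 1) % 2 = 0 := by omega
      exact ⟨0, by simp [layerStep, h, h2]⟩
    · have h2 : (i - 1) % 2 = 0 := by omega
      refine ⟨-x₀, ?_⟩
      simp only [layerStep, h, h2, if_true, if_false]
      rw [hx₀]; ring
  -- Weighting the position a of an up vertex by the step length of its layer gives coordinates (i,
  -- y) in which the colours 2, 1 act as y ↦ y - 1 and the colours 2, 0 as (i, y) ↦ (i - 1, Ky),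
  -- with y taken modulo ms.
  set F' : ℤ × ℤ → ℤ × ℤ := fun z => F z.1 (layerStep K z.1 * ((z.2 - drift K z.1) / 2)) with hF'
  have hF'e : ∀ i a, F' (i, drift K i + 2 * a) = F i (layerStep K i * a) := by
    intro i a
    simp only [hF']
    congr 2; omega
  refine hp.not_invariant_of_colour_perm hconn π hπ F' ?_ ?_
  · intro z w hz hzw
    have hw := (hp.vsign_eq hzw).symm.trans hz
    obtain ⟨i, a, rfl⟩ := hcases z hz
    obtain ⟨i', a', rfl⟩ := hcases w hw
    obtain ⟨r, h2, h3⟩ := (hp.eq_iff _ _).1 hzw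
    simp only at h2 h3
    rw [h2, drift_add hp.even_or_one, hDm] at h3
    obtain ⟨x, hx⟩ := h3
    rw [hF'e, hF'e]
    have ha : a' = a + m * t * r - m * s * x := by
      have : 2 * a' = 2 * (a + m * t * r - m * s * x) := by
        rw [hn] at hx; linear_combination -hx + r * hlam
      omega
    have hi : layerStep K i' = layerStep K i := by
      rw [← layerStep_congr hp.even_or_one i r]; congr 1; omega
    rw [← hdeck i _ r, hi, show i - m * r = i' by omega, ha,
      ← hper i' (layerStep K i * a + layerStep K i * m * t * r) (-(layerStep K i * x))]
    congr 2; ring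
  · intro z hz x hx
    obtain ⟨i, a, rfl⟩ := hcases z hz
    have e2 : move K 2 (i, drift K i + 2 * a) = (i, drift K (i - 1) + 2 * a) := by
      have := drift_sub K i
      simp only [move, hz]
      ext
      · rfl
      · simp; linarith
    have hz' : vsign (i, drift K (i - 1) + 2 * a) = -1 := by
      rw [← e2, vsign_move hp.K_odd, hz]
    have hx' : x = 0 ∨ x = 1 := by revert hx; revert x; decide
    rw [e2]
    rcases hx' with rfl | rfl
    · have e0 : move K 0 (i, drift K (i - 1) + 2 * a) = (i - 1, drift K (i - 1) + 2 * a) :=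
        (move_zero_one_two' K _ _ hz').1
      rw [e0, hF'e, hF'e, ← h0]
      obtain ⟨r, hr⟩ := hss' i
      rw [hr, ← hper (i - 1) (K * (layerStep K i * a)) (r * a)]
      congr 2; ring
    · have e1 : move K 1 (i, drift K (i - 1) + 2 * a) =
          (i, drift K i + 2 * (a - layerStep K i)) := by
        have := drift_sub K i
        simp only [move, hz']
        ext
        · rfl
        · simp; linarith
      rw [e1, hF'e, hF'e, ← h1]
      obtain ⟨r, hr⟩ := hss i
      rw [← hper i (layerStep K i * a - 1) (-r), mul_sub, hr]
      congr 2; ring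

lemma Chart.shift_layers (hp : Chart Γ C m n K lam p) (i j r : ℤ) :
    p (i + m * r, j) = p (i, j + lam * r) := by
  rw [← hp.deck r]; congr 1; simp [AltCycleQuotient.deck]

lemma Chart.drift_eq (hp : Chart Γ C m n K lam p) {s e q t : ℤ}
    (hd : Chart.Diagonal m n K lam s e q t) (i r a : ℤ) :
    p (i + m * r, drift K (i + m * r) + a) = p (i, drift K i + a + 2 * m * t * r) := by
  have hDm : drift K m = m * (1 + q) := by
    rcases hp.even_or_one with h | h
    · obtain ⟨a, rfl⟩ : ∃ a, m = 2 * a := ⟨m / 2, by omega⟩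
      rw [drift, hd.K_eq]; push_cast
      rw [show (2 * (a : ℤ) + 1) / 2 = a by omega, show (2 * (a : ℤ)) / 2 = a by omega]; ring
    · have : q = 0 := by have := hd.K_eq; omega
      rw [drift, h, this]; omega
  rw [hp.shift_layers, drift_add hp.even_or_one, hDm]
  congr 2; linear_combination r * hd.lam_eq

/-- The automorphism interchanging the colours `0` and `1`. -/
theorem Chart.not_invariant_swap [Finite V] (hp : Chart Γ C m n K lam p)
    (hconn : Γ.Connected) {s e q t : ℤ} (hd : Chart.Diagonal m n K lam s e q t)
    (ht : s ∣ t ^ 2 - 1) : ¬ IsAutInvariant Γ C := by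
  have hmod : ∀ {i a b : ℤ}, (n : ℤ) ∣ a - b → p (i, a) = p (i, b) := fun h =>
    (hp.eq_iff _ _).2 ⟨0, by simp, by simpa using h⟩
  have hKo := hp.K_odd
  have hdp := drift_parity hKo
  have hup : ∀ i y : ℤ, vsign (y, 2 * i + drift K y) = 1 := fun i y => by
    unfold vsign; rw [if_pos]; have := hdp y; simp only; omega
  have hme : s ∣ m * e := by
    rcases hp.even_or_one with h | h
    · obtain ⟨a, rfl⟩ : ∃ a, m = 2 * a := ⟨m / 2, by omega⟩
      exact dvd_of_eq_mul hd.dvd_e a (by push_cast; ring)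
    · have : m * e = 0 := by have := hd.K_eq; have := hd.q_eq; omega
      rw [this]; exact dvd_zero _
  refine hp.not_invariant_of_diagonal hconn hd (Equiv.swap 0 1) (by decide)
    -- The layer index and the coordinate along the layer exchange their roles; for this to respect
    -- the deck translations t must be its own inverse modulo s.
    (fun i y => (y, 2 * i + drift K y)) ?_ ?_ ?_ ?_
  · intro i y x
    have := hp.drift_eq hd y (s * x) (2 * i)
    rw [← mul_assoc, add_comm, add_comm _ (2 * i)] at this
    rw [add_comm (y) _, this]
    refine hmod ⟨t * x, ?_⟩
    rw [hd.n_eq]; ring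
  · intro i y x
    have := hp.drift_eq hd y (layerStep K i * t * x) (2 * (i - m * x))
    rw [show y + layerStep K i * m * t * x = y + m * (layerStep K i * t * x) by ring,
      add_comm (2 * (i - m * x)), this]
    refine hmod ?_
    have h2 : s ∣ layerStep K i * t ^ 2 - 1 := by
      unfold layerStep; split_ifs
      · simpa using ht
      · rw [hd.K_eq, hd.q_eq]
        exact dvd_of_eq_mul (ht.add (hme.mul_right (t ^ 2))) 1 (by ring)
    obtain ⟨r, hr⟩ := h2
    refine ⟨x * r, ?_⟩
    rw [hd.n_eq]; linear_combination 2 * m * x * hr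
  · intro i y
    have e1 : (Equiv.swap (0 : Fin 3) 1) 1 = 0 := by decide
    have e2 : (Equiv.swap (0 : Fin 3) 1) 2 = 2 := by decide
    have h1 := (move_zero_one_two K _ _ (hup i y)).2.2
    have h2 : vsign (y, 2 * i + drift K y - layerStep K y) = -1 := by
      rw [← h1, vsign_move hKo, hup]
    rw [e1, e2, h1, (move_zero_one_two' K _ _ h2).1]
    congr 2
    have := drift_sub K y
    omega
  · intro i y
    have e1 : (Equiv.swap (0 : Fin 3) 1) 0 = 1 := by decide
    have e2 : (Equiv.swap (0 : Fin 3) 1) 2 = 2 := by decide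
    have h1 := (move_zero_one_two K _ _ (hup i y)).2.2
    have h2 : vsign (y, 2 * i + drift K y - layerStep K y) = -1 := by
      rw [← h1, vsign_move hKo, hup]
    rw [e1, e2, h1, (move_zero_one_two' K _ _ h2).2.1]
    have := hp.drift_eq hd y (e * y) (2 * (i - 1))
    rw [show K * y = y + m * (e * y) by rw [hd.K_eq, hd.q_eq]; ring, add_comm (2 * (i - 1)), this]
    refine hmod ?_
    by_cases h : y % 2 = 0
    · obtain ⟨z, rfl⟩ : ∃ z, y = 2 * z := ⟨y / 2, by omega⟩
      obtain ⟨r, hr⟩ := hd.dvd_e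
      refine ⟨t * z * r, ?_⟩
      simp only [layerStep, h, if_true]
      rw [hd.n_eq]; linear_combination (2 * m * t * z) * hr
    · obtain ⟨z, rfl⟩ : ∃ z, y = 2 * z + 1 := ⟨y / 2, by omega⟩
      obtain ⟨r, hr⟩ := hd.dvd_e
      obtain ⟨r', hr'⟩ := hd.dvd_t
      refine ⟨t * z * r + r', ?_⟩
      simp only [layerStep, h, if_false]
      rw [hd.n_eq]
      have hK := hd.K_eq
      have hq := hd.q_eq
      linear_combination (2 * m * t * z) * hr + 2 * m * hr' + 2 * hK + 2 * hq

/-- The automorphism permuting the colours cyclically. -/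
theorem Chart.not_invariant_rotate [Finite V] (hp : Chart Γ C m n K lam p)
    (hconn : Γ.Connected) {s e q t : ℤ} (hd : Chart.Diagonal m n K lam s e q t)
    (ht : s ∣ t ^ 2 - t + 1 + q) : ¬ IsAutInvariant Γ C := by
  have hmod : ∀ {i a b : ℤ}, (n : ℤ) ∣ a - b → p (i, a) = p (i, b) := fun h =>
    (hp.eq_iff _ _).2 ⟨0, by simp, by simpa using h⟩
  have hKo := hp.K_odd
  have hdp := drift_parity hKo
  have hup : ∀ i y : ℤ, vsign (-i - y, drift K (-i - y) + -2 * drift K (-i)) = 1 := fun i y => by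
    unfold vsign; rw [if_pos]; have := hdp (-i - y); simp only; omega
  have hme : s ∣ m * e := by
    rcases hp.even_or_one with h | h
    · obtain ⟨a, rfl⟩ : ∃ a, m = 2 * a := ⟨m / 2, by omega⟩
      exact dvd_of_eq_mul hd.dvd_e a (by push_cast; ring)
    · have : m * e = 0 := by have := hd.K_eq; have := hd.q_eq; omega
      rw [this]; exact dvd_zero _
  have hDm : drift K m = m * (1 + q) := by
    rcases hp.even_or_one with h | h
    · obtain ⟨a, rfl⟩ : ∃ a, m = 2 * a := ⟨m / 2, by omega⟩
      rw [drift, hd.K_eq]; push_cast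
      rw [show (2 * (a : ℤ) + 1) / 2 = a by omega, show (2 * (a : ℤ)) / 2 = a by omega]; ring
    · have : q = 0 := by have := hd.K_eq; omega
      rw [drift, h, this]; omega
  let π : Equiv.Perm (Fin 3) := finRotate 3
  have e0 : π 0 = 1 := by decide
  have e1 : π 1 = 2 := by decide
  have e2 : π 2 = 0 := by decide
  have hfirst : ∀ i y, move K 0 (-i - y, drift K (-i - y) + -2 * drift K (-i)) =
      (-i - y + 1, drift K (-i - y) + -2 * drift K (-i)) := fun i y =>
    (move_zero_one_two K _ _ (hup i y)).1
  have hdown : ∀ i y, vsign (-i - y + 1, drift K (-i - y) + -2 * drift K (-i)) = -1 := fun i y => by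
    rw [← hfirst, vsign_move hKo, hup]
  refine hp.not_invariant_of_diagonal hconn hd π (by rw [e0]; decide)
    -- The linear map of order three on the honeycomb lattice, with i replaced by its drift to
    -- account for K. Compatibility with the deck translations is the congruence for t² - t + 1 + q.
    (fun i y => (-i - y, drift K (-i - y) + -2 * drift K (-i))) ?_ ?_ ?_ ?_
  · intro i y x
    have := hp.drift_eq hd (-i - y) (-(s * x)) (- 2 * drift K (-i))
    rw [show -i - (y + m * s * x) = -i - y + m * -(s * x) by ring, this]
    refine hmod ⟨-t * x, ?_⟩
    rw [hd.n_eq]; ring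
  · intro i y x
    have := hp.drift_eq hd (-i - y) (x - layerStep K i * t * x)
      (- 2 * (drift K (-i) + x * drift K m))
    rw [show -(i - m * x) - (y + layerStep K i * m * t * x) =
        -i - y + m * (x - layerStep K i * t * x) by ring,
      show -(i - m * x) = -i + m * x by ring, drift_add hp.even_or_one (-i), this]
    refine hmod ?_
    have h2 : s ∣ t - layerStep K i * t ^ 2 - (1 + q) := by
      unfold layerStep; split_ifs
      · exact dvd_of_eq_mul ht (-1) (by ring)
      · rw [hd.K_eq]
        refine dvd_of_eq_mul (ht.add (hme.mul_right (t ^ 2))) (-1) ?_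
        linear_combination (-t ^ 2) * hd.q_eq
    obtain ⟨r, hr⟩ := h2
    refine ⟨x * r, ?_⟩
    rw [hDm, hd.n_eq]; linear_combination 2 * m * x * hr
  · intro i y
    rw [e1, e2, hfirst, (move_zero_one_two' K _ _ (hdown i y)).2.2]
    have := drift_sub K (-i - y + 1)
    rw [show -i - y + 1 - 1 = -i - y by ring] at this
    rw [show -i - (y - 1) = -i - y + 1 by ring]
    congr 2
    omega
  · intro i y
    rw [e0, e2, hfirst, (move_zero_one_two' K _ _ (hdown i y)).2.1]
    have h3 := hp.drift_eq hd (-i - y + 1) (-(e * y)) (- 2 * drift K (-i + 1))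
    have h4 := drift_sub K (-i - y + 1)
    have h5 := drift_sub K (-i + 1)
    rw [show -i - y + 1 - 1 = -i - y by ring] at h4
    rw [show -i + 1 - 1 = -i by ring] at h5
    have hK := hd.K_eq
    have hq := hd.q_eq
    rw [show -(i - 1) - K * y = -i - y + 1 + m * (-(e * y)) by rw [hK, hq]; ring,
      show -(i - 1) = -i + 1 by ring, h3]
    refine hmod ?_
    obtain ⟨r, hr⟩ := hd.dvd_e
    obtain ⟨r', hr'⟩ := hd.dvd_t
    rw [hd.n_eq]
    by_cases h : y % 2 = 0
    · obtain ⟨z, rfl⟩ : ∃ z, y = 2 * z := ⟨y / 2, by omega⟩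
      have h6 : layerStep K (-i - 2 * z + 1) = layerStep K (-i + 1) := by
        unfold layerStep
        rw [show (-i - 2 * z + 1) % 2 = (-i + 1) % 2 by omega]
      rw [h6] at h4 ⊢
      refine ⟨- t * z * r, ?_⟩
      linear_combination (-2 * m * t * z) * hr + h4 - 2 * h5
    · obtain ⟨z, rfl⟩ : ∃ z, y = 2 * z + 1 := ⟨y / 2, by omega⟩
      by_cases hi : i % 2 = 0
      · have h6 : layerStep K (-i - (2 * z + 1) + 1) = 1 := by
          unfold layerStep; rw [if_pos (by omega)]
        have h7 : layerStep K (-i + 1) = K := by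
          unfold layerStep; rw [if_neg (by omega)]
        rw [h6] at h4 ⊢
        rw [h7] at h5
        refine ⟨- t * z * r - r', ?_⟩
        linear_combination (-2 * m * t * z) * hr + h4 - 2 * h5 - 2 * m * hr' - 2 * hK - 2 * hq
      · have h6 : layerStep K (-i - (2 * z + 1) + 1) = K := by
          unfold layerStep; rw [if_neg (by omega)]
        have h7 : layerStep K (-i + 1) = 1 := by
          unfold layerStep; rw [if_pos (by omega)]
        rw [h6] at h4 ⊢
        rw [h7] at h5
        refine ⟨- t * z * r - r' + r, ?_⟩
        linear_combination (-2 * m * t * z) * hr + h4 - 2 * h5 - 2 * m * hr' + 2 * m * hr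
          + 2 * hK + 2 * hq

end Automorphisms

end AltCycleQuotient

namespace AltCycleQuotient

/-! ### The two sporadic graphs -/

section Tables

/-- The number of the vertex with coordinates `z`. -/
def encode (m n : ℕ) (lam : ℤ) (z : ℤ × ℤ) : ℕ :=
  (z.1 % m).toNat * n + ((z.2 + lam * (z.1 / m)) % n).toNat

/-- Coordinates of the vertex with number `c`. -/
def decode (n c : ℕ) : ℤ × ℤ := ((c / n : ℕ), (c % n : ℕ))

/-- The list `T` describes an involutive automorphism that does not preserve the `2`-factor. -/
def IsBadTable (m n : ℕ) (K lam : ℤ) (T : List ℕ) : Prop :=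
  (∀ c, c < m * n → T.getD c 0 < m * n ∧ T.getD (T.getD c 0) 0 = c) ∧
  (∀ c, c < m * n → ∀ x, ∃ y, T.getD (encode m n lam (move K x (decode n c))) 0 =
    encode m n lam (move K y (decode n (T.getD c 0)))) ∧
  ∃ c, c < m * n ∧ T.getD (encode m n lam (move K 1 (decode n c))) 0 =
    encode m n lam (move K 0 (decode n (T.getD c 0)))

variable {V : Type*} {Γ C : SimpleGraph V} {m n : ℕ} {K lam : ℤ} {p : ℤ × ℤ → V}

lemma encode_lt (hm : 0 < m) (hn : 0 < n) (z : ℤ × ℤ) : encode m n lam z < m * n := by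
  have h1 := Int.emod_lt_of_pos z.1 (by omega : (0 : ℤ) < m)
  have h2 := Int.emod_lt_of_pos (z.2 + lam * (z.1 / m)) (by omega : (0 : ℤ) < n)
  have h3 := Int.emod_nonneg z.1 (by omega : (m : ℤ) ≠ 0)
  have h4 : (z.1 % m).toNat + 1 ≤ m := by omega
  have h5 : ((z.2 + lam * (z.1 / m)) % n).toNat < n := by omega
  calc encode m n lam z < (z.1 % m).toNat * n + n := by unfold encode; omega
    _ = ((z.1 % m).toNat + 1) * n := by ring
    _ ≤ m * n := Nat.mul_le_mul_right n h4

lemma Chart.decode_encode (hp : Chart Γ C m n K lam p) (z : ℤ × ℤ) :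
    p (decode n (encode m n lam z)) = p z := by
  have hm := hp.three_le
  have hn := hp.four_le
  have h3 := Int.emod_nonneg z.1 (by omega : (m : ℤ) ≠ 0)
  have h2 := Int.emod_lt_of_pos (z.2 + lam * (z.1 / m)) (by omega : (0 : ℤ) < n)
  have h4 := Int.emod_nonneg (z.2 + lam * (z.1 / m)) (by omega : (n : ℤ) ≠ 0)
  set a := (z.1 % m).toNat with ha
  set b := ((z.2 + lam * (z.1 / m)) % n).toNat with hb
  have hbn : b < n := by omega
  have e1 : (a * n + b) / n = a := by
    rw [add_comm, Nat.add_mul_div_right _ _ (by omega), Nat.div_eq_of_lt hbn, zero_add]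
  have e2 : (a * n + b) % n = b := by
    rw [add_comm, Nat.add_mul_mod_self_right, Nat.mod_eq_of_lt hbn]
  have e : decode n (encode m n lam z) = ((a : ℤ), (b : ℤ)) := by
    unfold encode decode; rw [← ha, ← hb, e1, e2]
  rw [e, hp.eq_iff]
  have h5 := Int.emod_add_mul_ediv z.1 m
  have h6 := Int.emod_add_mul_ediv (z.2 + lam * (z.1 / m)) n
  refine ⟨-(z.1 / m), ?_, ?_⟩
  · simp only [mul_neg]; omega
  · refine ⟨-((z.2 + lam * (z.1 / m)) / n), ?_⟩
    have h7 : (b : ℤ) = (z.2 + lam * (z.1 / m)) % n := by omega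
    simp only; rw [h7]; linear_combination h6

lemma Chart.encode_eq_iff (hp : Chart Γ C m n K lam p) (z w : ℤ × ℤ) :
    encode m n lam z = encode m n lam w ↔ p z = p w := by
  have hm := hp.three_le
  have hn := hp.four_le
  constructor
  · intro h
    rw [← hp.decode_encode z, h, hp.decode_encode]
  · intro h
    obtain ⟨s, h1, h2⟩ := (hp.eq_iff _ _).1 h
    have e1 : z.1 % m = w.1 % m := by rw [h1]; simp
    have e2 : z.1 / m = w.1 / m + s := by
      rw [h1, Int.add_mul_ediv_left _ _ (by omega)]
    unfold encode
    rw [e1, e2]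
    congr 2
    refine Int.ModEq.symm ((Int.modEq_iff_dvd).2 ?_)
    exact dvd_of_eq_mul h2 1 (by ring)

lemma Chart.encode_decode (hp : Chart Γ C m n K lam p) {c : ℕ} (hc : c < m * n) :
    encode m n lam (decode n c) = c := by
  have hm := hp.three_le
  have hn := hp.four_le
  have h1 : c / n < m := Nat.div_lt_of_lt_mul (by rwa [mul_comm])
  have h2 : c % n < n := Nat.mod_lt _ (by omega)
  have e1 : ((c / n : ℕ) : ℤ) % m = (c / n : ℕ) := Int.emod_eq_of_lt (Int.natCast_nonneg _)
    (by exact_mod_cast h1)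
  have e2 : ((c / n : ℕ) : ℤ) / m = 0 := Int.ediv_eq_zero_of_lt (Int.natCast_nonneg _)
    (by exact_mod_cast h1)
  have e3 : ((c % n : ℕ) : ℤ) % n = (c % n : ℕ) := Int.emod_eq_of_lt (Int.natCast_nonneg _)
    (by exact_mod_cast h2)
  unfold encode decode
  simp only
  rw [e1, e2, mul_zero, add_zero, e3, Int.toNat_natCast, Int.toNat_natCast]
  rw [mul_comm]; exact Nat.div_add_mod c n

theorem Chart.not_invariant_of_table [Finite V] (hp : Chart Γ C m n K lam p) {T : List ℕ}
    (hT : IsBadTable m n K lam T) : ¬ IsAutInvariant Γ C := by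
  obtain ⟨h1, h2, c₀, hc₀, h3⟩ := hT
  have hm := hp.three_le
  have hn := hp.four_le
  have hlt : ∀ z, encode m n lam z < m * n := encode_lt (by omega) (by omega)
  choose s hs using hp.surj
  set F : ℤ × ℤ → ℤ × ℤ := fun z => decode n (T.getD (encode m n lam z) 0) with hF
  set f : V → V := fun v => p (F (s v)) with hf
  have hfp : ∀ z, f (p z) = p (F z) := by
    intro z
    have : encode m n lam (s (p z)) = encode m n lam z := (hp.encode_eq_iff _ _).2 (hs _)
    simp only [hf, hF, this]
  have hFF : ∀ z, p (F (F z)) = p z := by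
    intro z
    simp only [hF]
    rw [hp.encode_decode (h1 _ (hlt z)).1, (h1 _ (hlt z)).2, hp.decode_encode]
  have hbij : Function.Bijective f := by
    have : Function.Involutive f := by
      intro v
      obtain ⟨z, rfl⟩ := hp.surj v
      rw [hfp z, hfp (F z), hFF]
    exact this.bijective
  have hmv : ∀ z x, encode m n lam (move K x (decode n (encode m n lam z))) =
      encode m n lam (move K x z) := fun z x =>
    (hp.encode_eq_iff _ _).2 (hp.move_eq (hp.decode_encode z) x)
  have hadj : ∀ v w, Γ.Adj v w → Γ.Adj (f v) (f w) := by
    intro v w h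
    obtain ⟨z, rfl⟩ := hp.surj v
    obtain ⟨x, rfl⟩ := (hp.adj _ _).1 h
    obtain ⟨y, hy⟩ := h2 _ (hlt z) x
    rw [hmv] at hy
    rw [hfp, hfp, hp.adj]
    refine ⟨y, ?_⟩
    simp only [hF]
    rw [hy, hp.decode_encode]
  obtain ⟨φ, hφ⟩ := exists_iso_of_bijective hbij hadj
  intro hinv
  have h4 := (hinv φ (p (decode n c₀)) (p (move K 1 (decode n c₀)))).2
    ((hp.adjC _ _).2 ⟨1, by decide, rfl⟩)
  rw [hφ, hφ, hfp, hfp, hp.adjC] at h4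
  obtain ⟨x, hx, h5⟩ := h4
  have h6 : p (F (move K 1 (decode n c₀))) = p (move K 0 (F (decode n c₀))) := by
    simp only [hF]
    rw [h3, hp.decode_encode, hp.encode_decode hc₀]
  exact hx (hp.move_inj (h6.symm.trans h5)).symm

/-- Vertex (i, j) has the number 10i + j. The witness 6 is an up vertex of layer 0 whose edge of
colour 1 is mapped to one of colour 0. -/
lemma isBadTable_ten : IsBadTable 4 10 3 0 [0, 1, 31, 34, 24, 25, 26, 36, 39, 9, 10, 22, 38, 17, 23,
    35, 27, 13, 32, 28, 20, 21, 11, 14, 4, 5, 6, 16, 19, 29, 30, 2, 18, 37, 3, 15, 7, 33, 12, 8] := by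
  refine ⟨?_, ?_, 6, ?_⟩ <;> decide +kernel

lemma isBadTable_twenty : IsBadTable 4 20 3 10 [0, 1, 71, 74, 54, 55, 56, 76, 79, 9, 10, 11, 61, 64,
    44, 45, 46, 66, 69, 19, 20, 52, 68, 37, 53, 65, 57, 33, 62, 58, 30, 42, 78, 27, 43, 75, 47, 23, 72,
    48, 50, 51, 31, 34, 14, 15, 16, 36, 39, 59, 40, 41, 21, 24, 4, 5, 6, 26, 29, 49, 70, 12, 28, 67, 13,
    25, 17, 63, 22, 18, 60, 2, 38, 77, 3, 35, 7, 73, 32, 8] := by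
  refine ⟨?_, ?_, 6, ?_⟩ <;> decide +kernel

end Tables

section Exceptions

variable {V : Type*} {Γ C : SimpleGraph V} {m n : ℕ} {K lam : ℤ} {p : ℤ × ℤ → V}

lemma Chart.diagonal_one (h : Int.gcd (lam + m) n = 2 * m) :
    ∃ s t : ℤ, Chart.Diagonal m n 1 lam s 0 0 t := by
  have h1 : ((2 * m : ℕ) : ℤ) ∣ lam + m := by rw [← h]; exact Int.gcd_dvd_left _ _
  have h2 : ((2 * m : ℕ) : ℤ) ∣ n := by rw [← h]; exact Int.gcd_dvd_right _ _
  obtain ⟨t, ht⟩ := h1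
  obtain ⟨s, hs⟩ := h2
  push_cast at ht hs
  exact ⟨s, t, hs, by ring, by ring, by linear_combination ht, by simp, by simp⟩

/-- With `lam` + m = 2mt and n = 2ms the quadratic expression equals (`lam` + m)² - 4m² = 4m²(t² -
1), while 2mn = 4m²s. So the condition says t² = 1 modulo s. -/
lemma Chart.not_invariant_of_gcd [Finite V] (hp : Chart Γ C m n 1 lam p) (hconn : Γ.Connected)
    (h : Int.gcd (lam + m) n = 2 * m)
    (hd : (2 * m * n : ℤ) ∣ lam ^ 2 + 2 * m * lam - 3 * (m : ℤ) ^ 2) : ¬ IsAutInvariant Γ C := by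
  obtain ⟨s, t, hst⟩ := Chart.diagonal_one h
  refine hp.not_invariant_swap hconn hst ?_
  have hm := hp.three_le
  have h1 : lam = 2 * m * t - m := by linear_combination hst.lam_eq
  rw [hst.n_eq, h1] at hd
  have h2 : (4 * m ^ 2 : ℤ) * s ∣ 4 * m ^ 2 * (t ^ 2 - 1) := by
    obtain ⟨x, hx⟩ := hd
    exact ⟨x, by linear_combination hx⟩
  exact (mul_dvd_mul_iff_left (by positivity)).1 h2

theorem Chart.not_invariant_of_honeycombException [Finite V] (hconn : Γ.Connected) {ℓ : ZMod n}
    (hp : Chart Γ C m n 1 ℓ.val p) (h : HoneycombException m n ℓ) : ¬ IsAutInvariant Γ C := by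
  have hm := hp.three_le
  rcases h with ⟨h1, h2⟩ | ⟨h1, h2⟩ | ⟨h1, -, h2⟩
  · exact hp.not_invariant_of_gcd hconn h1 h2
  · refine hp.mirror.not_invariant_of_gcd hconn ?_ (dvd_of_eq_mul h2 1 (by ring))
    rw [← h1, show -(ℓ.val : ℤ) + m = -((ℓ.val : ℤ) - m) by ring, Int.neg_gcd]
  · obtain ⟨s, t, hst⟩ := Chart.diagonal_one h1
    refine hp.not_invariant_rotate hconn hst ?_
    have h3 : (ℓ.val : ℤ) = 2 * m * t - m := by linear_combination hst.lam_eq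
    rw [hst.n_eq, h3] at h2
    -- In the same notation, `lam`² + 3m² = 4m²(t² - t + 1).
    have h4 : (4 * m ^ 2 : ℤ) * s ∣ 4 * m ^ 2 * (t ^ 2 - t + 1 + 0) := by
      obtain ⟨x, hx⟩ := h2
      exact ⟨x, by linear_combination hx⟩
    exact (mul_dvd_mul_iff_left (by positivity)).1 h4

lemma Chart.congr_cast (hp : Chart Γ C m n K lam p) (hm : m % 2 = 0) {k ℓ : ℤ}
    (hk : (K : ZMod n) = (k : ℤ)) (hl : (lam : ZMod n) = (ℓ : ℤ)) : Chart Γ C m n k ℓ p :=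
  hp.congr ((ZMod.intCast_eq_intCast_iff_dvd_sub _ _ _).1 hk)
    ((ZMod.intCast_eq_intCast_iff_dvd_sub _ _ _).1 hl) (Or.inl hm)

theorem Chart.not_invariant_of_xException [Finite V] (hp : Chart Γ C m n K lam p) (hm : m % 2 = 0)
    (hconn : Γ.Connected) (h : XException m n (K : ZMod n) (lam : ZMod n)) :
    ¬ IsAutInvariant Γ C := by
  rcases h with ⟨rfl, rfl, hk, hl⟩ | ⟨rfl, rfl, hk, hl⟩ | h | h
  · exact (hp.congr_cast hm (k := 3) (ℓ := 0) (by rw [hk]; norm_num)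
      (by rw [hl]; norm_num)).not_invariant_of_table isBadTable_ten
  · exact (hp.congr_cast hm (k := 3) (ℓ := 10) (by rw [hk]; norm_num)
      (by rw [hl]; norm_num)).not_invariant_of_table isBadTable_twenty
  · obtain ⟨m₀, n₀, ℓ₀, hm₀, hn₀, hℓ₀, hd, rfl, rfl, hk, hl⟩ := h
    have hp' := hp.congr_cast hm (k := 2 * m₀ * n₀ + 1) (ℓ := 2 * m₀ * ℓ₀)
      (by rw [hk]; push_cast; ring) (by rw [hl]; push_cast; ring)
    -- Otherwise the product (a - 1)(a + 3) would be odd. Oddness lets a be written as 2t - 1, and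
    -- the product becomes 4(t² - 1).
    have hodd : ((m₀ : ℤ) * n₀ + ℓ₀) % 2 = 1 := by
      by_contra hc
      set a := (m₀ : ℤ) * n₀ + ℓ₀ with ha
      obtain ⟨b, hb⟩ : ∃ b, a = 2 * b := ⟨a / 2, by omega⟩
      have h2 : (2 : ℤ) ∣ (a - 1) * (a + 3) := (Dvd.intro (4 * (n₀ : ℤ)) (by ring)).trans hd
      have h3 : (a - 1) * (a + 3) = 2 * (2 * b ^ 2 + 2 * b - 2) + 1 := by rw [hb]; ring
      omega
    obtain ⟨t, ht⟩ : ∃ t, (m₀ : ℤ) * n₀ + ℓ₀ = 2 * t - 1 := ⟨((m₀ : ℤ) * n₀ + ℓ₀ + 1) / 2, by omega⟩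
    have hsq : (2 * n₀ : ℤ) ∣ t ^ 2 - 1 := by
      rw [ht] at hd
      have : (4 : ℤ) * (2 * n₀) ∣ 4 * (t ^ 2 - 1) := by
        obtain ⟨x, hx⟩ := hd
        exact ⟨x, by linear_combination hx⟩
      exact (mul_dvd_mul_iff_left (by norm_num)).1 this
    have htodd : t % 2 = 1 := by
      by_contra hc
      obtain ⟨b, hb⟩ : ∃ b, t = 2 * b := ⟨t / 2, by omega⟩
      have h2 : (2 : ℤ) ∣ t ^ 2 - 1 := (dvd_mul_right _ _).trans hsq
      have h3 : t ^ 2 = 2 * (2 * b ^ 2) := by rw [hb]; ring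
      omega
    refine hp'.not_invariant_swap hconn (s := 2 * n₀) (e := n₀) (q := m₀ * n₀) (t := t)
      ⟨by push_cast; ring, by ring, by push_cast; ring, ?_, dvd_rfl, ?_⟩ hsq
    · push_cast; linear_combination 2 * (m₀ : ℤ) * ht
    · rw [mul_comm]; exact mul_dvd_mul_left _ (by omega)
  · obtain ⟨m₀, n₀, ℓ₀, hmo, hno, hlo, hm₀, hn₀, hℓ₀, hd4, hd, rfl, rfl, hk, hl⟩ := h
    have hp' := hp.congr_cast hm (k := 2 * m₀ * n₀ + 1) (ℓ := 2 * m₀ * ℓ₀)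
      (by rw [hk]; push_cast; ring) (by rw [hl]; push_cast; ring)
    obtain ⟨r, hr⟩ := hd4
    have ht : (m₀ : ℤ) * n₀ + ℓ₀ = 2 * (2 * r + 1) - 1 := by linear_combination hr
    have hqo : ((m₀ : ℤ) * n₀) % 2 = 1 := by
      obtain ⟨a, rfl⟩ := hmo
      obtain ⟨b, rfl⟩ := hno
      push_cast
      rw [show (2 * (a : ℤ) + 1) * (2 * b + 1) = 2 * (2 * a * b + a + b) + 1 by ring]
      omega
    refine hp'.not_invariant_rotate hconn (s := 2 * n₀) (e := n₀) (q := m₀ * n₀) (t := 2 * r + 1)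
      ⟨by push_cast; ring, by ring, by push_cast; ring, ?_, dvd_rfl, ?_⟩ ?_
    · push_cast; linear_combination 2 * (m₀ : ℤ) * ht
    · rw [mul_comm]; exact mul_dvd_mul_left _ (by omega)
    -- The congruence modulo 2n₀ splits. Modulo 2 it holds since t and m₀n₀ are odd; modulo n₀ four
    -- times the expression is ℓ₀² + 3.
    · have hcop : IsCoprime (2 : ℤ) n₀ := by
        obtain ⟨b, rfl⟩ := hno
        exact ⟨-b, 1, by push_cast; ring⟩
      refine hcop.mul_dvd ?_ ?_
      · obtain ⟨a, ha⟩ : ∃ a, (m₀ : ℤ) * n₀ = 2 * a + 1 := ⟨(m₀ : ℤ) * n₀ / 2, by omega⟩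
        rw [ha]
        exact ⟨2 * r ^ 2 + r + a + 1, by ring⟩
      · have h4 : (n₀ : ℤ) ∣ 2 ^ 2 * ((2 * r + 1) ^ 2 - (2 * r + 1) + 1 + m₀ * n₀) := by
          have hd' : (n₀ : ℤ) ∣ (ℓ₀ : ℤ) ^ 2 + 3 := by exact_mod_cast hd
          have e : (2 : ℤ) ^ 2 * ((2 * r + 1) ^ 2 - (2 * r + 1) + 1 + m₀ * n₀) =
              (ℓ₀ : ℤ) ^ 2 + 3 + n₀ * (m₀ * (m₀ * n₀ + 2 * ℓ₀) + 4 * m₀) := by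
            have h5 : (ℓ₀ : ℤ) = 2 * (2 * r + 1) - 1 - m₀ * n₀ := by linear_combination ht
            rw [h5]; ring
          rw [e]
          exact hd'.add (dvd_mul_right _ _)
        exact (hcop.symm.pow_right).dvd_of_dvd_mul_left h4

end Exceptions

end AltCycleQuotient

namespace AltCycleQuotient

/-! ### The action of an automorphism on the colours at a vertex -/

section LocalColours

variable {V : Type*} {Γ C : SimpleGraph V} {m n : ℕ} {K lam : ℤ} {p : ℤ × ℤ → V}

/-- `F` and `σ` describe the action of `φ` on vertices and on the colours at a vertex. -/
structure Chart.IsLift (_ : Chart Γ C m n K lam p) (φ : Γ ≃g Γ) (F : ℤ × ℤ → ℤ × ℤ)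
    (σ : ℤ × ℤ → Equiv.Perm (Fin 3)) : Prop where
  map : ∀ z, φ (p z) = p (F z)
  map_move : ∀ z x, φ (p (move K x z)) = p (move K (σ z x) (F z))

theorem Chart.exists_isLift (hp : Chart Γ C m n K lam p) (φ : Γ ≃g Γ) :
    ∃ F σ, hp.IsLift φ F σ := by
  choose s hs using hp.surj
  have h1 : ∀ z x, ∃ y, φ (p (move K x z)) = p (move K y (s (φ (p z)))) := by
    intro z x
    rw [← hp.adj, hs, φ.map_rel_iff, hp.adj]
    exact ⟨x, rfl⟩
  choose g hg using h1
  have hinj : ∀ z, Function.Injective (g z) := by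
    intro z x y h
    have h2 := hg z x
    rw [h, ← hg z y] at h2
    exact hp.move_inj (φ.injective h2)
  refine ⟨fun z => s (φ (p z)), fun z => Equiv.ofBijective (g z)
    (Finite.injective_iff_bijective.1 (hinj z)), fun z => (hs _).symm, fun z x => hg z x⟩

lemma Chart.IsLift.colour_eq {hp : Chart Γ C m n K lam p} {φ : Γ ≃g Γ} {F : ℤ × ℤ → ℤ × ℤ}
    {σ : ℤ × ℤ → Equiv.Perm (Fin 3)} (h : hp.IsLift φ F σ) (z : ℤ × ℤ) {x y : Fin 3}
    (e : φ (p (move K x z)) = p (move K y (F z))) : σ z x = y :=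
  hp.move_inj ((h.map_move z x).symm.trans e)

lemma Chart.IsLift.congr {hp : Chart Γ C m n K lam p} {φ : Γ ≃g Γ} {F : ℤ × ℤ → ℤ × ℤ}
    {σ : ℤ × ℤ → Equiv.Perm (Fin 3)} (h : hp.IsLift φ F σ) {z w : ℤ × ℤ} (e : p z = p w) :
    σ z = σ w := by
  ext x
  congr 1
  refine h.colour_eq z ?_
  rw [hp.move_eq e, h.map_move, hp.move_eq]
  rw [← h.map, ← h.map, e]

/-- Both ends of an edge see the same colour on its image. Two permutations of three colours agree
once they agree on two colours, so equality at neighbouring vertices requires only one further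
colour. -/
lemma Chart.IsLift.colour_move {hp : Chart Γ C m n K lam p} {φ : Γ ≃g Γ} {F : ℤ × ℤ → ℤ × ℤ}
    {σ : ℤ × ℤ → Equiv.Perm (Fin 3)} (h : hp.IsLift φ F σ) (z : ℤ × ℤ) (y : Fin 3) :
    σ (move K y z) y = σ z y := by
  refine h.colour_eq _ ?_
  have e1 : p (F (move K y z)) = p (move K (σ z y) (F z)) := by rw [← h.map, h.map_move]
  rw [move_move hp.K_odd, h.map, hp.move_eq e1, move_move hp.K_odd]

lemma perm_three_eq {σ τ : Equiv.Perm (Fin 3)} {x y : Fin 3} (hxy : x ≠ y) (hx : σ x = τ x)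
    (hy : σ y = τ y) : σ = τ := by
  revert σ τ x y; decide

/-- If the action on the colours agrees for the ends of each edge then it is constant. -/
theorem Chart.IsLift.const {hp : Chart Γ C m n K lam p} {φ : Γ ≃g Γ} {F : ℤ × ℤ → ℤ × ℤ}
    {σ : ℤ × ℤ → Equiv.Perm (Fin 3)} (h : hp.IsLift φ F σ) (hconn : Γ.Connected)
    (hσ : ∀ z y, ∃ x, x ≠ y ∧ σ (move K y z) x = σ z x) (z w : ℤ × ℤ) : σ z = σ w := by
  have key : ∀ v w, Γ.Walk v w → ∀ z, p z = v → ∀ z', p z' = w → σ z' = σ z := by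
    intro v w W
    induction W with
    | nil => intro z hz z' hz'; exact h.congr (hz'.trans hz.symm)
    | cons hadj W ih =>
      intro z hz z' hz'
      subst hz
      obtain ⟨y, rfl⟩ := (hp.adj _ _).1 hadj
      obtain ⟨x, hxy, hx⟩ := hσ z y
      rw [ih _ rfl z' hz']
      exact perm_three_eq hxy hx (h.colour_move z y)
  obtain ⟨W⟩ := hconn.preconnected (p w) (p z)
  exact key _ _ W w rfl z rfl

/-- The displacements of the closed walks of length `L` whose first steps have the colours
`x`, `y` and `w`. -/
def pathEnds (L : ℕ) (e f : ℤ) (x y w : Fin 3) : List Disp :=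
  ends e f x (L - 3) w (smove e f w (smove e f y (smove e f x (0, 0, 0))))

open Classical in
-- The path is centred at the edge of colour y at u: it starts at the neighbour of u by colour x,
-- passes u and leaves the other end by colour w. Its count thus relates the colours at both ends of
-- one edge.
theorem Chart.path_countP_eq [Fintype V] (hp : Chart Γ C m n K lam p) (φ : Γ ≃g Γ) {u u' : ℤ × ℤ}
    {x x' y y' w w' : Fin 3} (h1 : φ (p u) = p u') (h2 : φ (p (move K x u)) = p (move K x' u'))
    (h3 : φ (p (move K y u)) = p (move K y' u'))
    (h4 : φ (p (move K w (move K y u))) = p (move K w' (move K y' u'))) (L : ℕ) :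
    ∃ e ∈ [(0 : ℤ), 1], ∃ f ∈ [(0 : ℤ), 1], ∃ e' ∈ [(0 : ℤ), 1], ∃ f' ∈ [(0 : ℤ), 1],
      (pathEnds L e f x y w).countP (IsClosing m n K lam ·) =
        (pathEnds L e' f' x' y' w').countP (IsClosing m n K lam ·) := by
  have e : ∀ (u : ℤ × ℤ) (x y w : Fin 3), pos K (move K x u)
      (smove ((move K x u).1 % 2) (((move K x u).1 + (move K x u).2) % 2) w
        (smove ((move K x u).1 % 2) (((move K x u).1 + (move K x u).2) % 2) y
        (smove ((move K x u).1 % 2) (((move K x u).1 + (move K x u).2) % 2) x (0, 0, 0)))) =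
      move K w (move K y u) := by
    intro u x y w
    rw [← move_pos hp.K_odd, ← move_pos hp.K_odd, ← move_pos hp.K_odd, pos_zero,
      move_move hp.K_odd]
  refine ⟨_, emod_two_mem (move K x u).1, _, emod_two_mem ((move K x u).1 + (move K x u).2),
    _, emod_two_mem (move K x' u').1, _, emod_two_mem ((move K x' u').1 + (move K x' u').2), ?_⟩
  refine hp.countP_eq φ h2 ?_ ?_ ?_ (L - 3)
  · rw [move_move hp.K_odd, move_move hp.K_odd, h1]
  · rw [e, e, h4]
  · rw [e, e, move_move hp.K_odd, move_move hp.K_odd, h3]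

open Classical in
lemma Chart.IsLift.path_countP_eq [Fintype V] {hp : Chart Γ C m n K lam p} {φ : Γ ≃g Γ}
    {F : ℤ × ℤ → ℤ × ℤ} {σ : ℤ × ℤ → Equiv.Perm (Fin 3)} (h : hp.IsLift φ F σ) (u : ℤ × ℤ)
    (x y w : Fin 3) (L : ℕ) :
    ∃ e ∈ [(0 : ℤ), 1], ∃ f ∈ [(0 : ℤ), 1], ∃ e' ∈ [(0 : ℤ), 1], ∃ f' ∈ [(0 : ℤ), 1],
      (pathEnds L e f x y w).countP (IsClosing m n K lam ·) =
        (pathEnds L e' f' (σ u x) (σ u y) (σ (move K y u) w)).countP (IsClosing m n K lam ·) := by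
  have e1 : p (F (move K y u)) = p (move K (σ u y) (F u)) := by rw [← h.map, h.map_move]
  refine hp.path_countP_eq φ (h.map u) (h.map_move u x) (h.map_move u y) ?_ L
  rw [h.map_move, hp.move_eq e1]

open Classical in
/-- A way to recognize that the actions on the colours at the ends of an edge agree. -/
theorem Chart.IsLift.colour_eq_of_countP [Fintype V] {hp : Chart Γ C m n K lam p} {φ : Γ ≃g Γ}
    {F : ℤ × ℤ → ℤ × ℤ} {σ : ℤ × ℤ → Equiv.Perm (Fin 3)} (h : hp.IsLift φ F σ) (u : ℤ × ℤ)
    {x y : Fin 3} (L : ℕ) (hxy : x ≠ y)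
    (hc : ∀ e ∈ [(0 : ℤ), 1], ∀ f ∈ [(0 : ℤ), 1], ∀ e' ∈ [(0 : ℤ), 1], ∀ f' ∈ [(0 : ℤ), 1],
      ∀ w, w ≠ σ u x → w ≠ σ u y → (pathEnds L e f x y x).countP (IsClosing m n K lam ·) ≠
        (pathEnds L e' f' (σ u x) (σ u y) w).countP (IsClosing m n K lam ·)) :
    σ (move K y u) x = σ u x := by
  by_contra hne
  obtain ⟨e, he, f, hf, e', he', f', hf', h1⟩ := h.path_countP_eq u x y x L
  refine hc e he f hf e' he' f' hf' _ hne ?_ h1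
  rw [← h.colour_move u y]
  exact fun h2 => hxy ((σ _).injective h2)

/-- Moving along a sequence of colours. -/
def walk (K : ℤ) (w : List (Fin 3)) (z : ℤ × ℤ) : ℤ × ℤ := w.foldl (fun z x => move K x z) z

lemma walk_append (K : ℤ) (v w : List (Fin 3)) (z : ℤ × ℤ) :
    walk K (v ++ w) z = walk K w (walk K v z) := List.foldl_append

lemma walk_cons (K : ℤ) (x : Fin 3) (w : List (Fin 3)) (z : ℤ × ℤ) :
    walk K (x :: w) z = walk K w (move K x z) := rfl

/-- The symmetry that exchanges up vertices and down vertices. -/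
def turn (z : ℤ × ℤ) : ℤ × ℤ := (-z.1, 1 - z.2)

lemma move_turn (K : ℤ) (x : Fin 3) (z : ℤ × ℤ) : move K x (turn z) = turn (move K x z) := by
  have h1 : vsign (turn z) = - vsign z := vsign_flip (by simp only [turn]; omega)
  have h2 : layerStep K (turn z).1 = layerStep K z.1 := by
    simp [layerStep, turn]
  unfold move
  rw [h1, h2]
  simp only [turn]
  split_ifs <;> ext <;> simp only <;> ring

lemma walk_turn (K : ℤ) (w : List (Fin 3)) (z : ℤ × ℤ) : walk K w (turn z) = turn (walk K w z) := by
  induction w generalizing z with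
  | nil => rfl
  | cons x w ih => rw [walk_cons, walk_cons, move_turn, ih]

lemma Chart.turn_eq (hp : Chart Γ C m n K lam p) {z z' : ℤ × ℤ} (h : p z = p z') :
    p (turn z) = p (turn z') := by
  obtain ⟨s, h1, h2⟩ := (hp.eq_iff _ _).1 h
  exact (hp.eq_iff _ _).2 ⟨-s, by simp only [turn, h1]; ring,
    dvd_of_eq_mul h2 (-1) (by simp only [turn]; ring)⟩

/-- The walk along `w` is closed everywhere. -/
def IsClosedWord (p : ℤ × ℤ → V) (K : ℤ) (w : List (Fin 3)) : Prop := ∀ z, p (walk K w z) = p z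

/-- The half turn `turn` preserves colours and exchanges up and down vertices, so up vertices
suffice. -/
lemma Chart.isClosedWord (hp : Chart Γ C m n K lam p) {w : List (Fin 3)}
    (h : ∀ z : ℤ × ℤ, (z.1 + z.2) % 2 = 0 → p (walk K w z) = p z) : IsClosedWord p K w := by
  intro z
  by_cases hz : (z.1 + z.2) % 2 = 0
  · exact h z hz
  · have h1 := h (turn z) (by simp only [turn]; omega)
    rw [walk_turn] at h1
    have h2 := hp.turn_eq h1
    have e : ∀ z, turn (turn z) = z := fun z => by simp [turn]
    rwa [e, e] at h2

/-- With the same permutation at every vertex, the automorphism maps the walk along a word to the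
walk along the permuted word. This converts a colour permutation into arithmetic. -/
theorem Chart.IsLift.isClosedWord {hp : Chart Γ C m n K lam p} {φ : Γ ≃g Γ} {F : ℤ × ℤ → ℤ × ℤ}
    {σ : ℤ × ℤ → Equiv.Perm (Fin 3)} (h : hp.IsLift φ F σ) {τ : Equiv.Perm (Fin 3)}
    (hτ : ∀ z, σ z = τ) {w : List (Fin 3)} (hw : IsClosedWord p K w) :
    IsClosedWord p K (w.map τ) := by
  have key : ∀ (w : List (Fin 3)) z z', φ (p z) = p z' →
      φ (p (walk K w z)) = p (walk K (w.map τ) z') := by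
    intro w
    induction w with
    | nil => intro z z' h1; exact h1
    | cons x w ih =>
      intro z z' h1
      rw [List.map_cons, walk_cons, walk_cons]
      refine ih _ _ ?_
      rw [h.map_move, hτ]
      exact hp.move_eq ((h.map z).symm.trans h1) _
  intro z
  obtain ⟨z₀, hz₀⟩ := hp.surj (φ.symm (p z))
  have h1 : φ (p z₀) = p z := by rw [hz₀]; simp
  rw [← key w z₀ z h1, hw z₀, h1]

/-- `k` repetitions of two steps. -/
def alt (x y : Fin 3) (k : ℕ) : List (Fin 3) := (List.replicate k [x, y]).flatten

lemma alt_succ (x y : Fin 3) (k : ℕ) : alt x y (k + 1) = x :: y :: alt x y k := by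
  simp [alt, List.replicate_succ]

lemma alt_map (τ : Fin 3 → Fin 3) (x y : Fin 3) (k : ℕ) :
    (alt x y k).map τ = alt (τ x) (τ y) k := by
  induction k with
  | zero => rfl
  | succ k ih => rw [alt_succ, alt_succ, List.map_cons, List.map_cons, ih]

end LocalColours

/-! ### End points of alternating walks -/

section Walks

variable {K : ℤ}

lemma move_up (i j : ℤ) (h : (i + j) % 2 = 0) : move K 0 (i, j) = (i + 1, j) ∧
    move K 1 (i, j) = (i, j + layerStep K i) ∧ move K 2 (i, j) = (i, j - layerStep K i) := by
  simp [move, vsign, h]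

lemma move_down (i j : ℤ) (h : (i + j) % 2 = 1) : move K 0 (i, j) = (i - 1, j) ∧
    move K 1 (i, j) = (i, j - layerStep K i) ∧ move K 2 (i, j) = (i, j + layerStep K i) := by
  have h' : ¬ (i + j) % 2 = 0 := by omega
  simp [move, vsign, h, sub_eq_add_neg]

lemma walk_alt_one_two (hK : K % 2 = 1) (k : ℕ) (i j : ℤ) (h : (i + j) % 2 = 0) :
    walk K (alt 1 2 k) (i, j) = (i, j + 2 * k * layerStep K i) := by
  have hs := layerStep_odd hK i
  induction k generalizing j with
  | zero => simp [alt, walk]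
  | succ k ih =>
    rw [alt_succ, walk_cons, walk_cons, (move_up i j h).2.1, (move_down i _ (by omega)).2.2,
      ih _ (by omega)]
    ext <;> simp only; push_cast; ring

lemma walk_alt_two_one (hK : K % 2 = 1) (k : ℕ) (i j : ℤ) (h : (i + j) % 2 = 0) :
    walk K (alt 2 1 k) (i, j) = (i, j - 2 * k * layerStep K i) := by
  have hs := layerStep_odd hK i
  induction k generalizing j with
  | zero => simp [alt, walk]
  | succ k ih =>
    rw [alt_succ, walk_cons, walk_cons, (move_up i j h).2.2, (move_down i _ (by omega)).2.1,
      ih _ (by omega)]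
    ext <;> simp only; push_cast; ring

lemma walk_alt_zero_two (hK : K % 2 = 1) (k : ℕ) (i j : ℤ) (h : (i + j) % 2 = 0) :
    walk K (alt 0 2 k) (i, j) = (i + k, j + (drift K (i + k) - drift K i)) := by
  induction k generalizing i j with
  | zero => simp [alt, walk]
  | succ k ih =>
    have hs := layerStep_odd hK (i + 1)
    have hd := drift_sub K (i + 1)
    rw [add_sub_cancel_right] at hd
    rw [alt_succ, walk_cons, walk_cons, (move_up i j h).1, (move_down (i + 1) _ (by omega)).2.2,
      ih _ _ (by omega)]
    have e : i + ((k + 1 : ℕ) : ℤ) = i + 1 + k := by push_cast; ring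
    rw [e]
    ext <;> simp only; linarith

lemma walk_alt_two_zero (hK : K % 2 = 1) (k : ℕ) (i j : ℤ) (h : (i + j) % 2 = 0) :
    walk K (alt 2 0 k) (i, j) = (i - k, j + (drift K (i - k) - drift K i)) := by
  induction k generalizing i j with
  | zero => simp [alt, walk]
  | succ k ih =>
    have hs := layerStep_odd hK i
    have hd := drift_sub K i
    rw [alt_succ, walk_cons, walk_cons, (move_up i j h).2.2, (move_down i _ (by omega)).1,
      ih _ _ (by omega)]
    have e : i - ((k + 1 : ℕ) : ℤ) = i - 1 - k := by push_cast; ring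
    rw [e]
    ext <;> simp only; linarith

lemma walk_alt_one_zero (hK : K % 2 = 1) (k : ℕ) (i j : ℤ) (h : (i + j) % 2 = 0) :
    walk K (alt 1 0 k) (i, j) = (i - k, j + (drift K i - drift K (i - k))) := by
  induction k generalizing i j with
  | zero => simp [alt, walk]
  | succ k ih =>
    have hs := layerStep_odd hK i
    have hd := drift_sub K i
    rw [alt_succ, walk_cons, walk_cons, (move_up i j h).2.1, (move_down i _ (by omega)).1,
      ih _ _ (by omega)]
    have e : i - ((k + 1 : ℕ) : ℤ) = i - 1 - k := by push_cast; ring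
    rw [e]
    ext <;> simp only; linarith

end Walks

end AltCycleQuotient

/-! ### Congruences forced by a global colour permutation -/

namespace AltCycleQuotient

section

variable {V : Type*} {Γ C : SimpleGraph V} {m n : ℕ} {K lam : ℤ} {p : ℤ × ℤ → V}

lemma move_mirror (x : Fin 3) (z : ℤ × ℤ) : ((move K x z).1, -(move K x z).2) =
    move K (swapCol x) (z.1, -z.2) := by
  have hs : vsign (z.1, -z.2) = vsign z := vsign_congr (by simp only; omega)
  have e0 : swapCol 0 = 0 := by decide
  have e1 : swapCol 1 = 2 := by decide
  have e2 : swapCol 2 = 1 := by decide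
  have hx : x = 0 ∨ x = 1 ∨ x = 2 := by fin_cases x <;> simp
  unfold move
  rw [hs]
  rcases hx with rfl | rfl | rfl
  · simp [e0]
  · simp [e1]; ring
  · simp [e2]; ring

lemma Chart.IsLift.mirror {hp : Chart Γ C m n K lam p} {φ : Γ ≃g Γ} {F : ℤ × ℤ → ℤ × ℤ}
    {σ : ℤ × ℤ → Equiv.Perm (Fin 3)} (h : hp.IsLift φ F σ) :
    hp.mirror.IsLift φ (fun z => ((F (z.1, -z.2)).1, -(F (z.1, -z.2)).2))
      (fun z => swapCol * σ (z.1, -z.2) * swapCol) := by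
  have ee : ∀ x, swapCol (swapCol x) = x := by decide
  refine ⟨fun z => ?_, fun z x => ?_⟩
  · simp only [neg_neg]; exact h.map _
  · simp only [move_mirror, neg_neg, Equiv.Perm.mul_apply, ee]
    exact h.map_move _ _

/-- The possible permutations of the colours, up to mirroring. -/
lemma perm_three_cases (τ : Equiv.Perm (Fin 3)) (h : τ 0 = 1) :
    (τ 1 = 0 ∧ τ 2 = 2) ∨ (τ 1 = 2 ∧ τ 2 = 0) := by
  revert τ; decide

lemma perm_three_ne (τ : Equiv.Perm (Fin 3)) (h : τ 0 ≠ 0) :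
    τ 0 = 1 ∨ (swapCol * τ * swapCol) 0 = 1 := by
  revert τ; decide

lemma drift_mul (h : m % 2 = 0 ∨ K = 1) (s : ℤ) : drift K (m * s) = s * drift K m := by
  have := drift_add h 0 s
  rwa [zero_add, drift_zero, zero_add] at this

/-- The word (02)^m (21)^(mt) climbs m layers and turns back within the layer, and it is closed by
the choice of t. Its image under a transposition or a 3-cycle taking 0 to 1 is closed only if the
first or the second congruence holds. -/
lemma Chart.dvd_of_perm (hp : Chart Γ C m n K lam p) {φ : Γ ≃g Γ} {F : ℤ × ℤ → ℤ × ℤ}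
    {σ : ℤ × ℤ → Equiv.Perm (Fin 3)} (h : hp.IsLift φ F σ) {τ : Equiv.Perm (Fin 3)}
    (hτ : ∀ z, σ z = τ) (h0 : τ 0 = 1) {s q : ℤ} {t : ℕ} (hK : K = 1 + 2 * q)
    (hD : drift K m = m * (1 + q)) (hn : (n : ℤ) = 2 * m * s)
    (hl : (n : ℤ) ∣ lam + m * (1 + q) - 2 * m * t) (hq : (n : ℤ) ∣ 4 * m * t * q) :
    s ∣ t ^ 2 - 1 ∨ s ∣ t ^ 2 - t + 1 + q := by
  have hm := hp.three_le
  have hm2 : (2 * m : ℤ) ≠ 0 := by positivity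
  have hpar : ∀ i, (drift K i - i) % 2 = 0 := drift_parity hp.K_odd
  have hw : IsClosedWord p K (alt 0 2 m ++ alt 2 1 (m * t)) := by
    refine hp.isClosedWord fun z hz => ?_
    obtain ⟨i, j⟩ := z
    have hda := drift_add hp.even_or_one i 1
    rw [mul_one, one_mul, hD] at hda
    simp only at hz
    have h1 := hpar i
    have h2 := hpar (i + m)
    rw [walk_append, walk_alt_zero_two hp.K_odd _ _ _ hz,
      walk_alt_two_one hp.K_odd _ _ _ (by omega), hp.eq_iff, hda]
    refine ⟨1, by simp, ?_⟩
    have hl' : layerStep K (i + m) = layerStep K i := by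
      have := layerStep_congr hp.even_or_one i (-1); rwa [mul_neg, mul_one, sub_neg_eq_add] at this
    rw [hl']
    unfold layerStep
    push_cast
    split_ifs
    · exact dvd_of_eq_mul hl 1 (by ring)
    · rw [hK]; exact dvd_of_eq_mul (hl.sub hq) 1 (by ring)
  have hw' := h.isClosedWord hτ hw (0, 0)
  rw [List.map_append, alt_map, alt_map, h0, walk_append] at hw'
  rcases perm_three_cases τ h0 with ⟨h1, h2⟩ | ⟨h1, h2⟩
  · left
    rw [h1, h2, walk_alt_one_two hp.K_odd _ _ _ (by norm_num),
      walk_alt_two_zero hp.K_odd _ _ _ (by simp [layerStep]), hp.eq_iff] at hw'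
    obtain ⟨u, hu, hd⟩ := hw'
    have hmt : ((m * t : ℕ) : ℤ) = m * t := by push_cast; ring
    have hu : u = -t := by
      have : (m : ℤ) * u = m * (-t) := by rw [hmt] at hu; simp only at hu; linarith
      exact mul_left_cancel₀ (by positivity) this
    have e : (0 : ℤ) - ((m * t : ℕ) : ℤ) = m * (-t) := by push_cast; ring
    simp only [e, drift_mul hp.even_or_one, hD, drift_zero, hu] at hd
    rw [show layerStep K 0 = 1 by simp [layerStep]] at hd
    have h3 : 2 * m * s ∣ 2 * m * ((t : ℤ) ^ 2 - 1) := by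
      rw [← hn]
      exact dvd_of_eq_mul (hd.add (hl.mul_right t)) (-1) (by ring)
    exact (mul_dvd_mul_iff_left hm2).1 h3
  · right
    have e1 : (0 : ℤ) - (m : ℤ) = m * (-1) := by ring
    have e2 : ((m * t : ℕ) : ℤ) = m * t := by push_cast; ring
    rw [h1, h2, walk_alt_one_zero hp.K_odd _ _ _ (by norm_num), e1] at hw'
    have e3 := drift_mul hp.even_or_one (-1)
    have h3 := hpar (m * (-1))
    rw [walk_alt_zero_two hp.K_odd _ _ _ (by rw [drift_zero]; omega), e2, hp.eq_iff] at hw'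
    obtain ⟨u, hu, hd⟩ := hw'
    have hu : u = t - 1 := by
      have : (m : ℤ) * u = m * (t - 1) := by simp only at hu; linarith
      exact mul_left_cancel₀ (by positivity) this
    have e4 : (m : ℤ) * (-1) + m * t = m * (t - 1) := by ring
    simp only [e4, drift_mul hp.even_or_one, hD, drift_zero, hu] at hd
    have h3 : 2 * m * s ∣ 2 * m * ((t : ℤ) ^ 2 - t + 1 + q) := by
      rw [← hn]
      exact dvd_of_eq_mul (hd.sub (hl.mul_right (t - 1))) 1 (by ring)
    exact (mul_dvd_mul_iff_left hm2).1 h3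

/-- The exceptional conditions on the parameters of a honeycomb toroidal graph. -/
def IsHoneycombExc (m n : ℕ) (lam : ℤ) : Prop :=
  (Int.gcd (lam + m) n = 2 * m ∧ (2 * m * n : ℤ) ∣ lam ^ 2 + 2 * m * lam - 3 * (m : ℤ) ^ 2) ∨
    (Int.gcd (lam - m) n = 2 * m ∧ (2 * m * n : ℤ) ∣ lam ^ 2 - 2 * m * lam - 3 * (m : ℤ) ^ 2) ∨
    (Int.gcd (lam + m) n = 2 * m ∧ Int.gcd (lam - m) n = 2 * m ∧
      (2 * m * n : ℤ) ∣ lam ^ 2 + 3 * (m : ℤ) ^ 2)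

lemma IsHoneycombExc.neg (h : IsHoneycombExc m n (-lam)) : IsHoneycombExc m n lam := by
  have e1 : Int.gcd (-lam + m) n = Int.gcd (lam - m) n := by
    rw [show -lam + m = -(lam - m) by ring, Int.neg_gcd]
  have e2 : Int.gcd (-lam - m) n = Int.gcd (lam + m) n := by
    rw [show -lam - m = -(lam + m) by ring, Int.neg_gcd]
  unfold IsHoneycombExc at h ⊢
  rw [e1, e2] at h
  rcases h with ⟨h1, h2⟩ | ⟨h1, h2⟩ | ⟨h1, h2, h3⟩
  · exact Or.inr (Or.inl ⟨h1, dvd_of_eq_mul h2 1 (by ring)⟩)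
  · exact Or.inl ⟨h1, dvd_of_eq_mul h2 1 (by ring)⟩
  · exact Or.inr (Or.inr ⟨h2, h1, dvd_of_eq_mul h3 1 (by ring)⟩)

/-- Each congruence exhibits t as a unit modulo s, and the second one also t - 1; this gives the
required greatest common divisors, and the quadratic conditions follow by substitution. -/
lemma isHoneycombExc_of_dvd {s t : ℤ} (hn : (n : ℤ) = 2 * m * s) (hl : lam + m = 2 * m * t)
    (h : s ∣ t ^ 2 - 1 ∨ s ∣ t ^ 2 - t + 1) : IsHoneycombExc m n lam := by
  have hl' : lam = 2 * m * t - m := by linarith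
  have hg : ∀ u, IsCoprime u s → Int.gcd (2 * m * u) n = 2 * m := by
    intro u hu
    rw [hn, Int.gcd_mul_left, Int.isCoprime_iff_gcd_eq_one.1 hu, mul_one, Int.natAbs_mul,
      Int.natAbs_natCast]; rfl
  rcases h with ⟨c, hc⟩ | ⟨c, hc⟩
  · refine Or.inl ⟨by rw [hl]; exact hg t ⟨t, -c, by linear_combination hc⟩, ?_⟩
    exact ⟨c, by rw [hl', hn]; linear_combination 4 * (m : ℤ) ^ 2 * hc⟩
  · refine Or.inr (Or.inr ⟨by rw [hl]; exact hg t ⟨1 - t, c, by linear_combination -hc⟩, ?_, ?_⟩)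
    · rw [show lam - m = 2 * m * (t - 1) by rw [hl']; ring]
      exact hg _ ⟨-t, c, by linear_combination -hc⟩
    · exact ⟨c, by rw [hl', hn]; linear_combination 4 * (m : ℤ) ^ 2 * hc⟩

lemma drift_one (i : ℤ) : drift 1 i = i := by unfold drift; omega

/-- In a honeycomb toroidal graph, an automorphism that permutes the colours without fixing the
colour `0` exists only for exceptional parameters. -/
theorem Chart.isHoneycombExc_of_perm (hp : Chart Γ C m n 1 lam p) {φ : Γ ≃g Γ}
    {F : ℤ × ℤ → ℤ × ℤ} {σ : ℤ × ℤ → Equiv.Perm (Fin 3)} (h : hp.IsLift φ F σ)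
    {τ : Equiv.Perm (Fin 3)} (hτ : ∀ z, σ z = τ) (h0 : τ 0 ≠ 0) : IsHoneycombExc m n lam := by
  wlog h1 : τ 0 = 1 generalizing lam p F σ τ
  · refine (this hp.mirror h.mirror (τ := swapCol * τ * swapCol) (fun z => by rw [hτ]) ?_ ?_).neg
    · have := (perm_three_ne τ h0).resolve_left h1; rw [this]; decide
    · exact (perm_three_ne τ h0).resolve_left h1
  have hm := hp.three_le
  have hn := hp.n_even
  have hmz : (m : ℤ) ≠ 0 := by positivity
  obtain ⟨n', hn'⟩ : ∃ n', n = 2 * n' := ⟨n / 2, by omega⟩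
  have hn'z : (n : ℤ) = 2 * n' := by exact_mod_cast hn'
  have hl1 : ∀ i, layerStep 1 i = 1 := fun i => by simp [layerStep]
  -- This word runs once around a layer. Its image climbs or descends n/2 layers, so closedness
  -- makes n/2 a multiple of m and produces the number t for `Chart.dvd_of_perm`.
  have hw : IsClosedWord p 1 (alt 1 2 n') := by
    refine hp.isClosedWord fun z hz => ?_
    rw [walk_alt_one_two (by norm_num) _ _ _ hz, hl1, hp.eq_iff]
    exact ⟨0, by simp, dvd_of_eq_mul (dvd_refl (n : ℤ)) 1 (by rw [hn'z]; ring)⟩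
  obtain ⟨s, hs, hd⟩ : ∃ s : ℤ, (n' : ℤ) = m * s ∧ (n : ℤ) ∣ n' + lam * s := by
    have hw' := h.isClosedWord hτ hw (0, 0)
    rw [alt_map] at hw'
    rcases perm_three_cases τ h1 with ⟨h2, h3⟩ | ⟨h2, h3⟩
    · rw [h2, h3, walk_alt_zero_two (by norm_num) _ _ _ (by norm_num), hp.eq_iff] at hw'
      obtain ⟨s, hs, hd⟩ := hw'
      simp only [drift_one] at hs hd
      exact ⟨s, by linarith, dvd_of_eq_mul hd 1 (by ring)⟩
    · rw [h2, h3, walk_alt_two_zero (by norm_num) _ _ _ (by norm_num), hp.eq_iff] at hw'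
      obtain ⟨s, hs, hd⟩ := hw'
      simp only [drift_one] at hs hd
      exact ⟨-s, by linarith, dvd_of_eq_mul hd (-1) (by ring)⟩
  have hns : (n : ℤ) = 2 * m * s := by rw [hn'z, hs]; ring
  have hs0 : s ≠ 0 := by
    rintro rfl
    have := hp.four_le
    omega
  have hspos : 0 < s := by
    have h2 : (0 : ℤ) < m * s := by rw [← hs]; have := hp.four_le; omega
    exact pos_of_mul_pos_right h2 (by positivity)
  obtain ⟨t, ht⟩ : (2 * m : ℤ) ∣ lam + m := by
    rw [hns, hs] at hd
    have : s * (2 * m) ∣ s * (lam + m) := by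
      rw [mul_comm s (2 * m)]
      exact dvd_of_eq_mul hd 1 (by ring)
    exact (mul_dvd_mul_iff_left hs0).1 this
  refine isHoneycombExc_of_dvd hns ht ?_
  have h4 := Int.emod_nonneg t hs0
  have h5 := Int.emod_add_mul_ediv t s
  -- The exponent of a word must be a natural number; the congruences depend on t modulo s only.
  obtain ⟨t', ht'⟩ : ∃ t' : ℕ, (t' : ℤ) = t % s := ⟨(t % s).toNat, by omega⟩
  have h6 := hp.dvd_of_perm h hτ h1 (s := s) (q := 0) (t := t') (by norm_num)
    (by rw [drift_one]; ring) hns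
    (by rw [ht', hns]; exact ⟨t / s, by linear_combination ht - 2 * (m : ℤ) * h5⟩) (by simp)
  have h7 : t = t' + s * (t / s) := by rw [ht']; linarith
  rw [h7]
  refine h6.imp (fun h8 => ?_) (fun h8 => ?_)
  · exact dvd_of_eq_mul (h8.add (dvd_mul_right s (2 * t' * (t / s) + s * (t / s) ^ 2))) 1 (by ring)
  · exact dvd_of_eq_mul (h8.add (dvd_mul_right s (2 * t' * (t / s) + s * (t / s) ^ 2 - t / s))) 1
      (by ring)

/-- The parameters of the two families of exceptional graphs. -/
lemma family_of_dvd {m₀ n₀ : ℕ} {t : ℤ} (hm₀ : 2 ≤ m₀) (hn₀ : 1 ≤ n₀) (ht : t % 2 = 1)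
    (hl : lam = 2 * m₀ * (2 * t - 1 - m₀ * n₀))
    (h : (2 * n₀ : ℤ) ∣ t ^ 2 - 1 ∨ (2 * n₀ : ℤ) ∣ t ^ 2 - t + 1 + m₀ * n₀) :
    SwapFamily (2 * m₀) (8 * m₀ * n₀) ((2 * m₀ * n₀ + 1 : ℕ) : ZMod (8 * m₀ * n₀))
      (lam : ZMod (8 * m₀ * n₀)) ∨
    RotateFamily (2 * m₀) (8 * m₀ * n₀) ((2 * m₀ * n₀ + 1 : ℕ) : ZMod (8 * m₀ * n₀))
      (lam : ZMod (8 * m₀ * n₀)) := by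
  have hn4 : (0 : ℤ) < 4 * n₀ := by omega
  -- ℓ₀ is the residue of a modulo 4n₀; reducing a changes 2m₀a by multiples of 8m₀n₀ = n.
  set a : ℤ := 2 * t - 1 - m₀ * n₀ with ha
  have h1 := Int.emod_nonneg a hn4.ne'
  have h2 := Int.emod_lt_of_pos a hn4
  have h3 := Int.emod_add_mul_ediv a (4 * n₀)
  set c := a / (4 * n₀) with hc
  obtain ⟨ℓ₀, hℓ₀⟩ : ∃ ℓ₀ : ℕ, (ℓ₀ : ℤ) = a % (4 * n₀) := ⟨(a % (4 * n₀)).toNat, by omega⟩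
  have h4 : (ℓ₀ : ℤ) = 2 * t - 1 - m₀ * n₀ - 4 * n₀ * c := by rw [hℓ₀]; linarith
  have hlt : ℓ₀ < 4 * n₀ := by omega
  have hlam : (lam : ZMod (8 * m₀ * n₀)) = ((2 * m₀ * ℓ₀ : ℕ) : ZMod (8 * m₀ * n₀)) := by
    rw [← Int.cast_natCast (2 * m₀ * ℓ₀), ZMod.intCast_eq_intCast_iff_dvd_sub]
    refine ⟨-c, ?_⟩
    push_cast
    rw [h4, hl]; ring
  rcases h with ⟨x, hx⟩ | ⟨x, hx⟩
  · left
    refine ⟨m₀, n₀, ℓ₀, hm₀, hn₀, hlt, ?_, rfl, rfl, rfl, hlam⟩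
    rw [h4]
    exact ⟨x - 2 * c * t + 2 * n₀ * c ^ 2, by linear_combination 4 * hx⟩
  · right
    have hqo : ((m₀ : ℤ) * n₀) % 2 = 1 := by
      obtain ⟨b, rfl⟩ : ∃ b, t = 2 * b + 1 := ⟨t / 2, by omega⟩
      have e : (m₀ : ℤ) * n₀ = 2 * (n₀ * x - 2 * b ^ 2 - b) - 1 := by linear_combination hx
      rw [e]; omega
    have ho : Odd (m₀ * n₀) := by
      rw [Nat.odd_iff]; exact_mod_cast hqo
    obtain ⟨ho1, ho2⟩ := Nat.odd_mul.1 ho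
    refine ⟨m₀, n₀, ℓ₀, ho1, ho2, ?_, ?_, hn₀, hlt, ?_, ?_, rfl, rfl, rfl, hlam⟩
    · have e : 4 * (n₀ : ℤ) * c = 2 * (2 * (n₀ * c)) := by ring
      rw [e] at h4
      rw [Nat.even_iff]; omega
    · obtain ⟨b, rfl⟩ := ho1; omega
    · obtain ⟨b, rfl⟩ : ∃ b, t = 2 * b + 1 := ⟨t / 2, by omega⟩
      rw [h4]; exact ⟨b - n₀ * c, by ring⟩
    · have : (n₀ : ℤ) ∣ (ℓ₀ : ℤ) ^ 2 + 3 := by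
        refine ⟨8 * x - 4 * m₀ + m₀ ^ 2 * n₀ + 16 * n₀ * c ^ 2 - 2 * m₀ * (2 * t - 1)
          - 8 * c * (2 * t - 1) + 8 * m₀ * n₀ * c, ?_⟩
        rw [h4]; linear_combination 4 * hx
      exact_mod_cast this

/-- In `X_a(m, 8q, 1 + 2q, lam)`, an automorphism that permutes the colours without fixing the
colour `0` exists only for the parameters of the two exceptional families. -/
theorem Chart.family_of_perm {q : ℕ} (hp : Chart Γ C m (8 * q) (1 + 2 * q) lam p) (hm : m % 2 = 0)
    {φ : Γ ≃g Γ} {F : ℤ × ℤ → ℤ × ℤ} {σ : ℤ × ℤ → Equiv.Perm (Fin 3)} (h : hp.IsLift φ F σ)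
    {τ : Equiv.Perm (Fin 3)} (hτ : ∀ z, σ z = τ) (h0 : τ 0 ≠ 0) :
    ∃ ℓ : ℤ, (ℓ = lam ∨ ℓ = -lam) ∧
      (SwapFamily m (8 * q) ((1 + 2 * q : ℤ) : ZMod (8 * q)) (ℓ : ZMod (8 * q)) ∨
        RotateFamily m (8 * q) ((1 + 2 * q : ℤ) : ZMod (8 * q)) (ℓ : ZMod (8 * q))) := by
  wlog h1 : τ 0 = 1 generalizing lam p F σ τ
  · obtain ⟨ℓ, hℓ, h2⟩ := this hp.mirror h.mirror (τ := swapCol * τ * swapCol)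
      (fun z => by rw [hτ])
      (by have := (perm_three_ne τ h0).resolve_left h1; rw [this]; decide)
      ((perm_three_ne τ h0).resolve_left h1)
    exact ⟨ℓ, by rcases hℓ with rfl | rfl <;> simp, h2⟩
  refine ⟨lam, Or.inl rfl, ?_⟩
  have hm3 := hp.three_le
  have hK := hp.K_odd
  obtain ⟨m₀, rfl⟩ : ∃ m₀, m = 2 * m₀ := ⟨m / 2, by omega⟩
  have hmz : (m₀ : ℤ) ≠ 0 := by omega
  have hqpos : 0 < q := by have := hp.four_le; omega
  have hD : ∀ i : ℤ, drift (1 + 2 * (q : ℤ)) (2 * i) = i * (2 + 2 * q) := by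
    intro i
    have e1 : (2 * i + 1) / 2 = i := by omega
    have e2 : 2 * i / 2 = i := by omega
    unfold drift; rw [e1, e2]; ring
  have hstep : ∀ i : ℤ, (layerStep (1 + 2 * (q : ℤ)) i = 1 ∧
      layerStep (1 + 2 * (q : ℤ)) (i + 1) = 1 + 2 * q ∧
      layerStep (1 + 2 * (q : ℤ)) (i - 1) = 1 + 2 * q) ∨
      (layerStep (1 + 2 * (q : ℤ)) i = 1 + 2 * q ∧ layerStep (1 + 2 * (q : ℤ)) (i + 1) = 1 ∧
      layerStep (1 + 2 * (q : ℤ)) (i - 1) = 1) := by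
    intro i
    unfold layerStep
    rcases Int.emod_two_eq_zero_or_one i with hi | hi
    · left
      rw [if_pos hi, if_neg (by omega), if_neg (by omega)]; exact ⟨rfl, rfl, rfl⟩
    · right
      rw [if_neg (by omega), if_pos (by omega), if_pos (by omega)]; exact ⟨rfl, rfl, rfl⟩
  -- The word 012012, closed in the honeycomb, here shifts by twice the difference of two
  -- consecutive step lengths, that is by ±4q. Turning the layer by 4q times its step length
  -- compensates for this modulo 8q.
  have hw : IsClosedWord p (1 + 2 * (q : ℤ)) (alt 1 2 (2 * q) ++ [0, 1, 2, 0, 1, 2]) := by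
    refine hp.isClosedWord fun z hz => ?_
    obtain ⟨i, j⟩ := z
    simp only at hz
    have hs1 := layerStep_odd hK i
    have hs2 := layerStep_odd hK (i + 1)
    rw [walk_append, walk_alt_one_two hK _ _ _ hz]
    set j' := j + 2 * ((2 * q : ℕ) : ℤ) * layerStep (1 + 2 * (q : ℤ)) i with hj'
    have hj2 : (i + j') % 2 = 0 := by
      have : j' = j + 2 * (2 * q * layerStep (1 + 2 * (q : ℤ)) i) := by
        rw [hj']; push_cast; ring
      omega
    simp only [walk_cons]
    rw [(move_up i j' hj2).1, (move_down (i + 1) j' (by omega)).2.1,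
      (move_up (i + 1) _ (by omega)).2.2, (move_down (i + 1) _ (by omega)).1, add_sub_cancel_right,
      (move_up i _ (by omega)).2.1, (move_down i _ (by omega)).2.2]
    change p (i, _) = p (i, j)
    rw [hp.eq_iff]
    refine ⟨0, by simp, ?_⟩
    simp only [hj']
    push_cast
    rcases hstep i with ⟨h2, h3, -⟩ | ⟨h2, h3, -⟩
    · rw [h2, h3]; exact ⟨0, by ring⟩
    · rw [h2, h3]; exact ⟨1 + q, by ring⟩
  -- The image of the word crosses 2q layers in one direction, so m = 2m₀ divides 2q.
  obtain ⟨s, hs, hd⟩ : ∃ s : ℤ, (q : ℤ) = m₀ * s ∧ (8 * q : ℤ) ∣ 2 * q ^ 2 - 2 * q + lam * s := by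
    have hw' := h.isClosedWord hτ hw (0, 0)
    have h0 : layerStep (1 + 2 * (q : ℤ)) 0 = 1 := by simp [layerStep]
    have hs0 := hstep (2 * q)
    have hs1 := hstep (-(2 * q))
    have he1 : layerStep (1 + 2 * (q : ℤ)) (2 * q) = 1 := by simp [layerStep]
    have he2 : layerStep (1 + 2 * (q : ℤ)) (-(2 * q)) = 1 := by simp [layerStep]
    have e2q : ((2 * q : ℕ) : ℤ) = 2 * q := by push_cast; ring
    rw [List.map_append, alt_map, walk_append] at hw'
    simp only [List.map_cons, List.map_nil, h1] at hw'
    have hd1 := hD q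
    have hd2 := hD (-q)
    rw [mul_neg] at hd2
    have hpar1 : (q : ℤ) * (2 + 2 * q) = 2 * (q * (1 + q)) := by ring
    have hpar2 : -(q : ℤ) * (2 + 2 * q) = -2 * (q * (1 + q)) := by ring
    rcases perm_three_cases τ h1 with ⟨h2, h3⟩ | ⟨h2, h3⟩
    · rw [h2, h3, walk_alt_zero_two hK _ _ _ (by norm_num), e2q] at hw'
      simp only [zero_add, drift_zero, sub_zero, hd1, hpar1] at hw'
      set d := (q : ℤ) * (1 + q) with hd
      obtain ⟨-, -, h4⟩ : layerStep (1 + 2 * (q : ℤ)) (2 * q) = 1 ∧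
        layerStep (1 + 2 * (q : ℤ)) (2 * q + 1) = 1 + 2 * q ∧
        layerStep (1 + 2 * (q : ℤ)) (2 * q - 1) = 1 + 2 * q := by
        rcases hs0 with h5 | h5
        · exact h5
        · omega
      simp only [walk_cons] at hw'
      rw [(move_up (2 * q) (2 * d) (by omega)).2.1, he1,
        (move_down (2 * q) (2 * d + 1) (by omega)).1,
        (move_up (2 * q - 1) (2 * d + 1) (by omega)).2.2, h4,
        (move_down (2 * q - 1) (2 * d + 1 - (1 + 2 * q)) (by omega)).2.1, h4,
        (move_up (2 * q - 1) (2 * d + 1 - (1 + 2 * q) - (1 + 2 * q)) (by omega)).1, sub_add_cancel,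
        (move_down (2 * q) (2 * d + 1 - (1 + 2 * q) - (1 + 2 * q)) (by omega)).2.2, he1] at hw'
      change p (_, _) = p (_, _) at hw'
      rw [hp.eq_iff] at hw'
      obtain ⟨s, h5, h6⟩ := hw'
      push_cast at h5 h6
      refine ⟨s, by linarith, ?_⟩
      rw [hd] at h6
      exact dvd_of_eq_mul h6 1 (by ring)
    · rw [h2, h3, walk_alt_two_zero hK _ _ _ (by norm_num), e2q] at hw'
      simp only [zero_sub, zero_add, drift_zero, sub_zero, hd2, hpar2] at hw'
      set d := (q : ℤ) * (1 + q) with hd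
      obtain ⟨-, h4, -⟩ : layerStep (1 + 2 * (q : ℤ)) (-(2 * q)) = 1 ∧
        layerStep (1 + 2 * (q : ℤ)) (-(2 * q) + 1) = 1 + 2 * q ∧
        layerStep (1 + 2 * (q : ℤ)) (-(2 * q) - 1) = 1 + 2 * q := by
        rcases hs1 with h5 | h5
        · exact h5
        · omega
      simp only [walk_cons] at hw'
      rw [(move_up (-(2 * q)) (-2 * d) (by omega)).2.1, he2,
        (move_down (-(2 * q)) (-2 * d + 1) (by omega)).2.2, he2,
        (move_up (-(2 * q)) (-2 * d + 1 + 1) (by omega)).1,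
        (move_down (-(2 * q) + 1) (-2 * d + 1 + 1) (by omega)).2.1, h4,
        (move_up (-(2 * q) + 1) (-2 * d + 1 + 1 - (1 + 2 * q)) (by omega)).2.2, h4,
        (move_down (-(2 * q) + 1) (-2 * d + 1 + 1 - (1 + 2 * q) - (1 + 2 * q)) (by omega)).1,
        add_sub_cancel_right] at hw'
      change p (_, _) = p (_, _) at hw'
      rw [hp.eq_iff] at hw'
      obtain ⟨s, h5, h6⟩ := hw'
      push_cast at h5 h6
      refine ⟨-s, by linarith, ?_⟩
      rw [hd] at h6
      exact dvd_of_eq_mul (h6.add (dvd_mul_right (8 * q : ℤ) 1)) (-1) (by ring)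
  have hspos : 0 < s := by
    have h2 : (0 : ℤ) < m₀ * s := by rw [← hs]; omega
    exact pos_of_mul_pos_right h2 (by positivity)
  obtain ⟨n₀, rfl⟩ : ∃ n₀ : ℕ, s = n₀ := ⟨s.toNat, by omega⟩
  have hq : q = m₀ * n₀ := by exact_mod_cast hs
  have hn₀ : (n₀ : ℤ) ≠ 0 := by omega
  obtain ⟨b, hb⟩ : (8 * m₀ : ℤ) ∣ 2 * m₀ * (q - 1) + lam := by
    have : n₀ * (8 * m₀ : ℤ) ∣ n₀ * (2 * m₀ * (q - 1) + lam) := by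
      refine dvd_of_eq_mul (n := n₀ * (8 * m₀ : ℤ)) (b := 2 * q ^ 2 - 2 * q + lam * n₀) ?_ 1 ?_
      · rw [show (n₀ * (8 * m₀) : ℤ) = 8 * q by rw [hs]; ring]; exact hd
      · rw [hs]; ring
    exact (mul_dvd_mul_iff_left hn₀).1 this
  obtain ⟨t', ht'⟩ : ∃ t' : ℕ, (t' : ℤ) = (2 * b + 1) % (2 * n₀) :=
    ⟨((2 * b + 1) % (2 * n₀)).toNat, by have := Int.emod_nonneg (2 * b + 1) (by omega : (2 * n₀ : ℤ) ≠ 0); omega⟩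
  have h5 := Int.emod_add_mul_ediv (2 * b + 1) (2 * n₀)
  rw [← ht'] at h5
  set c := (2 * b + 1) / (2 * (n₀ : ℤ)) with hc
  have hn : ((8 * q : ℕ) : ℤ) = 2 * (2 * m₀ : ℕ) * (2 * n₀) := by rw [hq]; push_cast; ring
  have h6 := hp.dvd_of_perm h hτ h1 (s := 2 * n₀) (q := q) (t := t') rfl
    (by push_cast; rw [hD]; ring) hn
    (by rw [hn]; push_cast; exact ⟨c, by linear_combination hb - 4 * (m₀ : ℤ) * h5⟩)
    (by push_cast; exact ⟨m₀ * t', by ring⟩)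
  rw [hs] at h6
  subst hq
  have e : (1 + 2 * ((m₀ * n₀ : ℕ) : ℤ) : ℤ) = ((2 * m₀ * n₀ + 1 : ℕ) : ℤ) := by push_cast; ring
  rw [e, Int.cast_natCast]
  have e8 : 8 * (m₀ * n₀) = 8 * m₀ * n₀ := by ring
  rw [e8]
  refine family_of_dvd (t := 2 * b + 1) (by omega) (by omega) (by omega) ?_ ?_
  · push_cast at hb; linear_combination hb
  · rw [← h5]
    refine h6.imp (fun h8 => ?_) (fun h8 => ?_)
    · exact dvd_of_eq_mul (h8.add (dvd_mul_right (2 * n₀ : ℤ) (2 * t' * c + 2 * n₀ * c ^ 2))) 1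
        (by ring)
    · exact dvd_of_eq_mul (h8.add (dvd_mul_right (2 * n₀ : ℤ) (2 * t' * c + 2 * n₀ * c ^ 2 - c))) 1
        (by ring)

end

end AltCycleQuotient

/-! ### Invariance for honeycomb toroidal graphs -/

namespace AltCycleQuotient

/-- The displacements that occur for walks of length `6`. -/
def IsShort (t : Disp) : Prop :=
  (t.1 = 0 ∧ -6 ≤ t.2.1 + t.2.2 ∧ t.2.1 + t.2.2 ≤ 6) ∨ (t.1 = 1 ∨ t.1 = -1 ∨ t.1 = 2 ∨ t.1 = -2) ∨
    ((t.1 = 3 ∨ t.1 = -3) ∧ (t.2.1 + t.2.2 = 1 ∨ t.2.1 + t.2.2 = -1 ∨ t.2.1 + t.2.2 = 3 ∨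
      t.2.1 + t.2.2 = -3))

instance : DecidablePred IsShort := fun t => by unfold IsShort; infer_instance

lemma edgeEnds_six : ∀ e ∈ [(0 : ℤ), 1], ∀ f ∈ [(0 : ℤ), 1], ∀ x, ∀ t ∈ edgeEnds 6 e f x,
    IsShort t := by
  decide +kernel

lemma pathEnds_six : ∀ e ∈ [(0 : ℤ), 1], ∀ f ∈ [(0 : ℤ), 1], ∀ x y w, ∀ t ∈ pathEnds 6 e f x y w,
    x ≠ y → y ≠ w → IsShort t := by
  decide +kernel

lemma edgeEnds_four_bound : ∀ e ∈ [(0 : ℤ), 1], ∀ f ∈ [(0 : ℤ), 1], ∀ x, ∀ t ∈ edgeEnds 4 e f x,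
    -2 ≤ t.1 ∧ t.1 ≤ 2 := by
  decide +kernel

lemma edge_count_four : ∀ e ∈ [(0 : ℤ), 1], ∀ f ∈ [(0 : ℤ), 1], ∀ x, (edgeEnds 4 e f x).countP
    (fun t => t.1 = 0 ∧ (t.2.1 + t.2.2) % 4 = 0) = if x = 0 then 0 else 1 := by
  decide +kernel

lemma edge_count_six : ∀ e ∈ [(0 : ℤ), 1], ∀ f ∈ [(0 : ℤ), 1], ∀ x, (edgeEnds 6 e f x).countP
    (fun t => t.1 = 0 ∧ (t.2.1 + t.2.2) % 6 = 0) = if x = 0 then 2 else 3 := by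
  decide +kernel

lemma edge_count_three_six : ∀ e ∈ [(0 : ℤ), 1], ∀ f ∈ [(0 : ℤ), 1], ∀ x,
    (edgeEnds 8 e f x).countP
    (fun t => t.1 % 3 = 0 ∧ (t.2.1 + t.2.2 + t.1 / 3) % 6 = 0) =
      if x = 0 then 10 else if x = 1 then 9 else 13 := by
  decide +kernel

lemma edge_count_three_one : ∀ e ∈ [(0 : ℤ), 1], ∀ f ∈ [(0 : ℤ), 1], ∀ x,
    (edgeEnds 6 e f x).countP (fun t => (t.1 = 0 ∧ t.2.1 + t.2.2 = 0) ∨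
      (t.1 = 3 ∧ t.2.1 + t.2.2 = -1) ∨ (t.1 = -3 ∧ t.2.1 + t.2.2 = 1)) =
      if x = 0 then 5 else if x = 1 then 4 else 3 := by
  decide +kernel

lemma edge_count_three_three : ∀ e ∈ [(0 : ℤ), 1], ∀ f ∈ [(0 : ℤ), 1], ∀ x,
    (edgeEnds 6 e f x).countP (fun t => (t.1 = 0 ∧ t.2.1 + t.2.2 = 0) ∨
      (t.1 = 3 ∧ t.2.1 + t.2.2 = -3) ∨ (t.1 = -3 ∧ t.2.1 + t.2.2 = 3)) =
      if x = 2 then 2 else 3 := by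
  decide +kernel

lemma path_count_three_three : ∀ e ∈ [(0 : ℤ), 1], ∀ f ∈ [(0 : ℤ), 1], ∀ x w, x ≠ 2 → w ≠ 2 →
    (pathEnds 6 e f x 2 w).countP (fun t => (t.1 = 0 ∧ t.2.1 + t.2.2 = 0) ∨
      (t.1 = 3 ∧ t.2.1 + t.2.2 = -3) ∨ (t.1 = -3 ∧ t.2.1 + t.2.2 = 3)) =
      if x = w then 0 else 1 := by
  decide +kernel

/-- The only walks of length 6 counted here are the hexagons with colour pattern xywxyw for distinct
x, y, w: a path xyw lies on one of them, a path xyx on none. -/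
lemma path_count_six : ∀ e ∈ [(0 : ℤ), 1], ∀ f ∈ [(0 : ℤ), 1], ∀ x y w, x ≠ y → y ≠ w →
    (pathEnds 6 e f x y w).countP (fun t => t.1 = 0 ∧ t.2.1 + t.2.2 = 0) =
      if x = w then 0 else 1 := by
  decide +kernel

lemma not_dvd_of_abs_lt {n : ℕ} {c : ℤ} (h0 : c ≠ 0) (h1 : -(n : ℤ) < c) (h2 : c < n) :
    ¬ (n : ℤ) ∣ c :=
  fun h => h0 (Int.eq_zero_of_abs_lt_dvd h (abs_lt.2 ⟨h1, h2⟩))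

lemma isClosing_iff_emod {m n : ℕ} {K lam : ℤ} (hm : 0 < m) (t : Disp) : IsClosing m n K lam t ↔
    t.1 % m = 0 ∧ (t.2.1 + t.2.2 * K + lam * (t.1 / m)) % n = 0 := by
  constructor
  · rintro ⟨s, h1, h2⟩
    rw [h1, Int.mul_emod_right, Int.mul_ediv_cancel_left _ (by omega : (m : ℤ) ≠ 0)]
    exact ⟨rfl, Int.emod_eq_zero_of_dvd h2⟩
  · rintro ⟨h1, h2⟩
    exact ⟨t.1 / m, (Int.mul_ediv_cancel' (Int.dvd_of_emod_eq_zero h1)).symm,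
      Int.dvd_of_emod_eq_zero h2⟩

lemma isClosing_of_lt {m n : ℕ} {K lam : ℤ} {t : Disp} (h1 : -(m : ℤ) < t.1)
    (h2 : t.1 < m) : IsClosing m n K lam t ↔ t.1 = 0 ∧ (n : ℤ) ∣ t.2.1 + t.2.2 * K := by
  constructor
  · rintro ⟨s, h3, h4⟩
    have : t.1 = 0 := Int.eq_zero_of_abs_lt_dvd ⟨s, h3⟩ (abs_lt.2 ⟨h1, h2⟩)
    refine ⟨this, ?_⟩
    have hs : s = 0 := by
      rw [this] at h3
      rcases mul_eq_zero.1 h3.symm with h5 | h5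
      · omega
      · exact h5
    simpa [hs] using h4
  · rintro ⟨h3, h4⟩
    exact ⟨0, by simpa using h3, by simpa using h4⟩

lemma IsShort.isClosing_three {n : ℕ} {lam : ℤ} {t : Disp} (h : IsShort t) :
    IsClosing 3 n 1 lam t ↔ (t.1 = 0 ∧ (n : ℤ) ∣ t.2.1 + t.2.2) ∨
      (t.1 = 3 ∧ (n : ℤ) ∣ t.2.1 + t.2.2 + lam) ∨ (t.1 = -3 ∧ (n : ℤ) ∣ t.2.1 + t.2.2 - lam) := by
  constructor
  · rintro ⟨s, h3, h4⟩
    push_cast at h3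
    rw [mul_one] at h4
    have hs : s = 0 ∨ s = 1 ∨ s = -1 := by
      unfold IsShort at h; omega
    rcases hs with rfl | rfl | rfl
    · exact Or.inl ⟨by simpa using h3, by simpa using h4⟩
    · exact Or.inr (Or.inl ⟨by simpa using h3, by simpa using h4⟩)
    · exact Or.inr (Or.inr ⟨by simpa using h3, dvd_of_eq_mul h4 1 (by ring)⟩)
  · rintro (⟨h3, h4⟩ | ⟨h3, h4⟩ | ⟨h3, h4⟩)
    · exact ⟨0, by simpa using h3, by simpa using h4⟩
    · exact ⟨1, by simpa using h3, by simpa using h4⟩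
    · exact ⟨-1, by simpa using h3, dvd_of_eq_mul h4 1 (by ring)⟩

lemma IsShort.bounds {t : Disp} (h : IsShort t) : -3 ≤ t.1 ∧ t.1 ≤ 3 := by
  unfold IsShort at h; omega

lemma IsShort.dvd_iff {n : ℕ} (hn : 8 ≤ n) {t : Disp} (h : IsShort t) (h0 : t.1 = 0) :
    (n : ℤ) ∣ t.2.1 + t.2.2 ↔ t.2.1 + t.2.2 = 0 := by
  refine ⟨fun hd => ?_, fun h1 => h1 ▸ dvd_zero _⟩
  by_contra hne
  exact not_dvd_of_abs_lt hne (by unfold IsShort at h; omega) (by unfold IsShort at h; omega) hd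

lemma IsShort.isClosing {m n : ℕ} {lam : ℤ} (hm : 3 ≤ m) (hn : 8 ≤ n)
    (h3 : m = 3 → ∀ c : ℤ, (c = 1 ∨ c = -1 ∨ c = 3 ∨ c = -3) → ¬ (n : ℤ) ∣ lam - c) {t : Disp}
    (h : IsShort t) : IsClosing m n 1 lam t ↔ t.1 = 0 ∧ t.2.1 + t.2.2 = 0 := by
  have hb := h.bounds
  by_cases hm3 : m = 3
  · subst hm3
    rw [h.isClosing_three]
    constructor
    · rintro (⟨h1, h2⟩ | ⟨h1, h2⟩ | ⟨h1, h2⟩)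
      · exact ⟨h1, (h.dvd_iff hn h1).1 h2⟩
      · refine absurd (dvd_of_eq_mul h2 1 ?_) (h3 rfl (-(t.2.1 + t.2.2)) ?_)
        · ring
        · unfold IsShort at h; omega
      · refine absurd (dvd_of_eq_mul h2 (-1) ?_) (h3 rfl (t.2.1 + t.2.2) ?_)
        · ring
        · unfold IsShort at h; omega
    · rintro ⟨h1, h2⟩
      exact Or.inl ⟨h1, h2 ▸ dvd_zero _⟩
  · rw [isClosing_of_lt (by omega) (by omega), mul_one]
    exact and_congr_right fun h1 => h.dvd_iff hn h1

lemma IsShort.isClosing_three_of_eq {n : ℕ} {lam : ℤ} (hn : 8 ≤ n) (hl : lam = 1 ∨ lam = 3)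
    {t : Disp} (h : IsShort t) : IsClosing 3 n 1 lam t ↔ (t.1 = 0 ∧ t.2.1 + t.2.2 = 0) ∨
      (t.1 = 3 ∧ t.2.1 + t.2.2 = -lam) ∨ (t.1 = -3 ∧ t.2.1 + t.2.2 = lam) := by
  rw [h.isClosing_three]
  refine or_congr (and_congr_right fun h1 => h.dvd_iff hn h1) (or_congr (and_congr_right
    fun h1 => ⟨fun hd => ?_, fun h2 => ?_⟩) (and_congr_right fun h1 => ⟨fun hd => ?_, fun h2 => ?_⟩))
  · by_contra hne
    exact not_dvd_of_abs_lt (c := t.2.1 + t.2.2 + lam) (by omega)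
      (by unfold IsShort at h; omega) (by unfold IsShort at h; omega) hd
  · rw [h2, neg_add_cancel]; exact dvd_zero _
  · by_contra hne
    exact not_dvd_of_abs_lt (c := t.2.1 + t.2.2 - lam) (by omega)
      (by unfold IsShort at h; omega) (by unfold IsShort at h; omega) hd
  · rw [h2, sub_self]; exact dvd_zero _

/-- Replacing `lam` by `lam` + nc adds multiples of n to the quadratic expressions. The gcd
conditions, which make n and `lam` ± m multiples of 2m, turn them into multiples of 2mn. -/
lemma IsHoneycombExc.congr {m n : ℕ} {lam lam' : ℤ} (h : IsHoneycombExc m n lam)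
    (hd : (n : ℤ) ∣ lam' - lam) : IsHoneycombExc m n lam' := by
  obtain ⟨c, hc⟩ := hd
  obtain rfl : lam' = lam + n * c := by linarith
  have hg : ∀ a : ℤ, Int.gcd (lam + n * c + a) n = Int.gcd (lam + a) n := by
    intro a
    rw [show lam + n * c + a = lam + a + n * c by ring, Int.gcd_add_mul_left_left]
  have hg' : Int.gcd (lam + n * c - m) n = Int.gcd (lam - m) n := by
    rw [sub_eq_add_neg, hg, sub_eq_add_neg]
  have key : ∀ ε : ℤ, (ε = 1 ∨ ε = -1) → Int.gcd (lam + ε * m) n = 2 * m →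
      ∃ s t : ℤ, lam + ε * m = 2 * m * t ∧ (n : ℤ) = 2 * m * s := by
    intro ε _ h
    have h1 : ((2 * m : ℕ) : ℤ) ∣ lam + ε * m := by rw [← h]; exact Int.gcd_dvd_left _ _
    have h2 : ((2 * m : ℕ) : ℤ) ∣ n := by rw [← h]; exact Int.gcd_dvd_right _ _
    obtain ⟨t, ht⟩ := h1
    obtain ⟨s, hs⟩ := h2
    exact ⟨s, t, by rw [ht]; push_cast; ring, by rw [hs]; push_cast; ring⟩
  unfold IsHoneycombExc at h ⊢
  rw [hg, hg']
  rcases h with ⟨h1, h2⟩ | ⟨h1, h2⟩ | ⟨h1, h2, h3⟩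
  · obtain ⟨s, t, ht, hs⟩ := key 1 (by simp) (by rwa [one_mul])
    refine Or.inl ⟨h1, dvd_of_eq_mul (h2.add (Dvd.intro (c * (2 * t + s * c)) rfl)) 1 ?_⟩
    linear_combination 2 * (n : ℤ) * c * ht + n * c ^ 2 * hs
  · obtain ⟨s, t, ht, hs⟩ := key (-1) (by simp)
      (by rwa [neg_one_mul, ← sub_eq_add_neg])
    refine Or.inr (Or.inl ⟨h1, dvd_of_eq_mul (h2.add (Dvd.intro (c * (2 * t + s * c)) rfl)) 1 ?_⟩)
    linear_combination 2 * (n : ℤ) * c * ht + n * c ^ 2 * hs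
  · obtain ⟨s, t, ht, hs⟩ := key 1 (by simp) (by rwa [one_mul])
    refine Or.inr (Or.inr ⟨h1, h2, dvd_of_eq_mul
      (h3.add (Dvd.intro (c * (2 * t - 1 + s * c)) rfl)) 1 ?_⟩)
    linear_combination 2 * (n : ℤ) * c * ht + n * c ^ 2 * hs

section

variable {V : Type*} {Γ C : SimpleGraph V} {m n : ℕ} {K lam : ℤ} {p : ℤ × ℤ → V}

lemma Chart.exists_isLift_of_not_invariant (hp : Chart Γ C m n K lam p)
    (hinv : ¬ IsAutInvariant Γ C) : ∃ (φ : Γ ≃g Γ) (F : ℤ × ℤ → ℤ × ℤ)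
      (σ : ℤ × ℤ → Equiv.Perm (Fin 3)) (z : ℤ × ℤ), hp.IsLift φ F σ ∧ σ z 0 ≠ 0 := by
  obtain ⟨φ, z, z', y, hy, h1, h2⟩ := hp.exists_of_not_invariant hinv
  obtain ⟨F, σ, h⟩ := hp.exists_isLift φ
  refine ⟨φ, F, σ, z, h, ?_⟩
  rw [h.colour_eq z (y := y) (by rw [h2]; exact hp.move_eq (by rw [← h1, h.map]) _)]
  exact hy

open Classical in
lemma Chart.IsLift.edge_countP_eq [Fintype V] {hp : Chart Γ C m n K lam p} {φ : Γ ≃g Γ}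
    {F : ℤ × ℤ → ℤ × ℤ} {σ : ℤ × ℤ → Equiv.Perm (Fin 3)} (h : hp.IsLift φ F σ) (u : ℤ × ℤ)
    (x : Fin 3) (L : ℕ) :
    ∃ e ∈ [(0 : ℤ), 1], ∃ f ∈ [(0 : ℤ), 1], ∃ e' ∈ [(0 : ℤ), 1], ∃ f' ∈ [(0 : ℤ), 1],
      (edgeEnds L e f x).countP (IsClosing m n K lam ·) =
        (edgeEnds L e' f' (σ u x)).countP (IsClosing m n K lam ·) :=
  ⟨_, emod_two_mem _, _, emod_two_mem _, _, emod_two_mem _, _, emod_two_mem _,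
    hp.edge_countP_eq φ (h.map u) (h.map_move u x) L⟩

lemma countP_congr_closing {l : List Disp} {P Q : Disp → Prop} [DecidablePred P]
    [DecidablePred Q] (h : ∀ t ∈ l, (P t ↔ Q t)) : l.countP (P ·) = l.countP (Q ·) :=
  List.countP_congr fun t ht => by simpa using h t ht

open Classical in
/-- The `2`-factor of a honeycomb toroidal graph is invariant outside of the exceptional cases. -/
theorem Chart.honeycomb_invariant [Fintype V] (hconn : Γ.Connected) (hp : Chart Γ C m n 1 lam p)
    (hexc : ¬ IsHoneycombExc m n lam) : IsAutInvariant Γ C := by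
  have hm := hp.three_le
  have hn4 := hp.four_le
  have hn := hp.n_even
  -- The layers themselves are the 4-cycles, and likewise for n = 6, m ≥ 4 they are additional
  -- 6-cycles; so they single out the factor.
  by_cases h4 : n = 4
  · subst h4
    have hc : ∀ e ∈ [(0 : ℤ), 1], ∀ f ∈ [(0 : ℤ), 1], ∀ x,
        (edgeEnds 4 e f x).countP (IsClosing m 4 1 lam ·) = if x = 0 then 0 else 1 := by
      intro e he f hf x
      rw [← edge_count_four e he f hf x]
      refine countP_congr_closing fun t ht => ?_
      have hb := edgeEnds_four_bound e he f hf x t ht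
      rw [isClosing_of_lt (by omega) (by omega), mul_one, Int.dvd_iff_emod_eq_zero]
      rfl
    refine hp.invariant_of_countP 4 fun e he f hf e' he' f' hf' x hx => ?_
    rw [hc e he f hf, hc e' he' f' hf', if_pos rfl, if_neg hx]; norm_num
  by_cases h6 : n = 6 ∧ 4 ≤ m
  · obtain ⟨rfl, hm4⟩ := h6
    have hc : ∀ e ∈ [(0 : ℤ), 1], ∀ f ∈ [(0 : ℤ), 1], ∀ x,
        (edgeEnds 6 e f x).countP (IsClosing m 6 1 lam ·) = if x = 0 then 2 else 3 := by
      intro e he f hf x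
      rw [← edge_count_six e he f hf x]
      refine countP_congr_closing fun t ht => ?_
      have hb := (edgeEnds_six e he f hf x t ht).bounds
      rw [isClosing_of_lt (by omega) (by omega), mul_one, Int.dvd_iff_emod_eq_zero]
      rfl
    refine hp.invariant_of_countP 6 fun e he f hf e' he' f' hf' x hx => ?_
    rw [hc e he f hf, hc e' he' f' hf', if_pos rfl, if_neg hx]; norm_num
  by_contra hinv
  -- For m = 3 and `lam` = ±1 or ±3, short cycles run across all three layers and have to be counted
  -- too. After mirroring, `lam` is 1 or 3.
  by_cases hone : m = 3 ∧ ((n : ℤ) ∣ lam - 1 ∨ (n : ℤ) ∣ lam + 1)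
  · obtain ⟨rfl, hone⟩ := hone
    obtain ⟨q, hq⟩ : ∃ q, Chart Γ C 3 n 1 1 q := by
      rcases hone with h | h
      · exact ⟨_, hp.congr (by simp) (dvd_of_eq_mul h (-1) (by ring)) (Or.inr rfl)⟩
      · exact ⟨_, hp.mirror.congr (by simp) (dvd_of_eq_mul h 1 (by ring)) (Or.inr rfl)⟩
    by_cases hn6 : n = 6
    · subst hn6
      have hc : ∀ e ∈ [(0 : ℤ), 1], ∀ f ∈ [(0 : ℤ), 1], ∀ x,
          (edgeEnds 8 e f x).countP (IsClosing 3 6 1 1 ·) =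
            if x = 0 then 10 else if x = 1 then 9 else 13 := by
        intro e he f hf x
        rw [← edge_count_three_six e he f hf x]
        refine countP_congr_closing fun t ht => ?_
        rw [isClosing_iff_emod (by norm_num), mul_one, one_mul]; rfl
      refine hinv (hq.invariant_of_countP 8 fun e he f hf e' he' f' hf' x hx => ?_)
      rw [hc e he f hf, hc e' he' f' hf', if_pos rfl, if_neg hx]; split_ifs <;> norm_num
    · have hc : ∀ e ∈ [(0 : ℤ), 1], ∀ f ∈ [(0 : ℤ), 1], ∀ x,
          (edgeEnds 6 e f x).countP (IsClosing 3 n 1 1 ·) =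
            if x = 0 then 5 else if x = 1 then 4 else 3 := by
        intro e he f hf x
        rw [← edge_count_three_one e he f hf x]
        exact countP_congr_closing fun t ht =>
          (edgeEnds_six e he f hf x t ht).isClosing_three_of_eq (by omega) (Or.inl rfl)
      refine hinv (hq.invariant_of_countP 6 fun e he f hf e' he' f' hf' x hx => ?_)
      rw [hc e he f hf, hc e' he' f' hf', if_pos rfl, if_neg hx]; split_ifs <;> norm_num
  by_cases hthree : m = 3 ∧ ((n : ℤ) ∣ lam - 3 ∨ (n : ℤ) ∣ lam + 3)
  · obtain ⟨rfl, hthree⟩ := hthree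
    obtain ⟨q, hq, hexc'⟩ : ∃ q, Chart Γ C 3 n 1 3 q ∧ ¬ IsHoneycombExc 3 n 3 := by
      rcases hthree with h | h
      · exact ⟨_, hp.congr (by simp) (dvd_of_eq_mul h (-1) (by ring)) (Or.inr rfl),
          fun h' => hexc (h'.congr h)⟩
      · exact ⟨_, hp.mirror.congr (by simp) (dvd_of_eq_mul h 1 (by ring)) (Or.inr rfl),
          fun h' => hexc (h'.congr (dvd_of_eq_mul h (-1) (by ring))).neg⟩
    have hn8 : 8 ≤ n := by
      by_contra hlt
      obtain rfl : n = 6 := by omega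
      exact hexc' (by unfold IsHoneycombExc; decide)
    obtain ⟨φ, F, σ, z, h, h0⟩ := hq.exists_isLift_of_not_invariant hinv
    have hc : ∀ e ∈ [(0 : ℤ), 1], ∀ f ∈ [(0 : ℤ), 1], ∀ x,
        (edgeEnds 6 e f x).countP (IsClosing 3 n 1 3 ·) = if x = 2 then 2 else 3 := by
      intro e he f hf x
      rw [← edge_count_three_three e he f hf x]
      exact countP_congr_closing fun t ht =>
        (edgeEnds_six e he f hf x t ht).isClosing_three_of_eq hn8 (Or.inr rfl)
    have hc' : ∀ e ∈ [(0 : ℤ), 1], ∀ f ∈ [(0 : ℤ), 1], ∀ x w, x ≠ 2 → w ≠ 2 →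
        (pathEnds 6 e f x 2 w).countP (IsClosing 3 n 1 3 ·) = if x = w then 0 else 1 := by
      intro e he f hf x w hx hw
      rw [← path_count_three_three e he f hf x w hx hw]
      exact countP_congr_closing fun t ht =>
        (pathEnds_six e he f hf x 2 w t ht hx hw.symm).isClosing_three_of_eq hn8 (Or.inr rfl)
    have h2 : ∀ u, σ u 2 = 2 := by
      intro u
      obtain ⟨e, he, f, hf, e', he', f', hf', h1⟩ := h.edge_countP_eq u 2 6
      rw [hc e he f hf, hc e' he' f' hf', if_pos rfl] at h1
      by_contra hne
      rw [if_neg hne] at h1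
      omega
    -- The counts single out the colour 2, which gives the second agreement across edges of colours
    -- 0 and 1. Across an edge of colour 2 the cycles through a path decide whether its end colours
    -- are equal.
    have hτ := h.const hconn (fun u y => by
      by_cases hy : y = 2
      · subst hy
        refine ⟨0, by decide, h.colour_eq_of_countP u 6 (by decide) ?_⟩
        intro e he f hf e' he' f' hf' w hw1 hw2
        rw [h2] at hw2 ⊢
        have hx : σ u 0 ≠ 2 := by
          rw [← h2 u]; exact fun h3 => absurd ((σ u).injective h3) (by decide)
        rw [hc' e he f hf 0 0 (by decide) (by decide), hc' e' he' f' hf' _ _ hx hw2, if_pos rfl,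
          if_neg hw1.symm]
        norm_num
      · exact ⟨2, fun h3 => hy h3.symm, by rw [h2, h2]⟩)
    exact hexc' (hq.isHoneycombExc_of_perm h (fun w => hτ w z) h0)
  -- What remains of n = 6 has m = 3, where every odd `lam` is ±1 or ±3 modulo 6.
  have hn8 : 8 ≤ n := by
    by_contra hlt
    obtain rfl : n = 6 := by omega
    obtain rfl : m = 3 := by omega
    have := hp.lam_parity
    obtain ⟨a1, a2⟩ := not_or.1 fun h => hone ⟨rfl, h⟩
    obtain ⟨a3, a4⟩ := not_or.1 fun h => hthree ⟨rfl, h⟩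
    simp only [Nat.cast_ofNat] at a1 a2 a3 a4 this
    omega
  have h3 : m = 3 → ∀ c : ℤ, (c = 1 ∨ c = -1 ∨ c = 3 ∨ c = -3) → ¬ (n : ℤ) ∣ lam - c := by
    rintro hm3 c (rfl | rfl | rfl | rfl) hd
    · exact hone ⟨hm3, Or.inl hd⟩
    · exact hone ⟨hm3, Or.inr (by simpa using hd)⟩
    · exact hthree ⟨hm3, Or.inl hd⟩
    · exact hthree ⟨hm3, Or.inr (by simpa using hd)⟩
  obtain ⟨φ, F, σ, z, h, h0⟩ := hp.exists_isLift_of_not_invariant hinv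
  have hc : ∀ e ∈ [(0 : ℤ), 1], ∀ f ∈ [(0 : ℤ), 1], ∀ x y w, x ≠ y → y ≠ w →
      (pathEnds 6 e f x y w).countP (IsClosing m n 1 lam ·) = if x = w then 0 else 1 := by
    intro e he f hf x y w hxy hyw
    rw [← path_count_six e he f hf x y w hxy hyw]
    exact countP_congr_closing fun t ht =>
      (pathEnds_six e he f hf x y w t ht hxy hyw).isClosing hm hn8 h3
  -- The hexagons now are the only closed walks of length 6. They recognise whether the two ends of
  -- a path have the same colour, so the action on colours is locally constant.
  have hτ := h.const hconn (fun u y => by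
    obtain ⟨x, hxy⟩ := exists_ne y
    refine ⟨x, hxy, h.colour_eq_of_countP u 6 hxy ?_⟩
    intro e he f hf e' he' f' hf' w hw1 hw2
    rw [hc e he f hf x y x hxy hxy.symm, hc e' he' f' hf' _ _ _
      (fun h3 => hxy ((σ u).injective h3)) hw2.symm, if_pos rfl, if_neg hw1.symm]
    norm_num)
  exact hexc (hp.isHoneycombExc_of_perm h (fun w => hτ w z) h0)

end

end AltCycleQuotient

/-! ### The case n = 8q, k = 1 + 2q: parities of closed walks of length 10 -/

namespace AltCycleQuotient

/-- The information on a displacement that decides if it belongs to a closed walk of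
`X_a(m, 8q, 1 + 2q, lam)`. -/
def key (t : Disp) : ℤ × ℤ × ℤ :=
  if t.1 = 0 then (0, t.2.1 + t.2.2, t.2.2 % 4)
  else if t.1 = 4 then (4, t.2.1 + t.2.2, t.2.2 % 4)
  else if t.1 = -4 then (4, -(t.2.1 + t.2.2), (-t.2.2) % 4)
  else (7, 0, 0)

/-- The keys of closed walks. -/
def KeyCloses (m : ℕ) (q lam : ℤ) (k : ℤ × ℤ × ℤ) : Prop :=
  (k.1 = 0 ∧ 8 * q ∣ k.2.1 + 2 * q * k.2.2) ∨
    (k.1 = 4 ∧ m = 4 ∧ 8 * q ∣ k.2.1 + 2 * q * k.2.2 + lam)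

lemma dvd_key (q a b c : ℤ) : 8 * q ∣ a + b * (1 + 2 * q) + c ↔
    8 * q ∣ a + b + 2 * q * (b % 4) + c := by
  have h := Int.emod_add_mul_ediv b 4
  have e : a + b * (1 + 2 * q) + c = a + b + 2 * q * (b % 4) + c + 8 * q * (b / 4) := by
    linear_combination -(2 * q) * h
  rw [e, Int.dvd_add_left (dvd_mul_right _ _)]

lemma isClosing_iff_key {m q : ℕ} {lam : ℤ} (hm : m = 4 ∨ 6 ≤ m) {t : Disp} (h1 : -5 ≤ t.1)
    (h2 : t.1 ≤ 5) : IsClosing m (8 * q) (1 + 2 * q) lam t ↔ KeyCloses m q lam (key t) := by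
  have d0 := dvd_key q t.2.1 t.2.2 0
  have d1 := dvd_key q t.2.1 t.2.2 lam
  have d2 := dvd_key q (-t.2.1) (-t.2.2) lam
  rw [add_zero, add_zero] at d0
  have e8 : ((8 * q : ℕ) : ℤ) = 8 * q := by push_cast; ring
  have en : -(t.2.1 + t.2.2) = -t.2.1 + -t.2.2 := by ring
  rcases hm with rfl | hm
  · rw [isClosing_four h1 h2, e8, d0, d1, d2]
    unfold KeyCloses key
    split_ifs with h3 h4 h5
    · simp [h3]
    · simp [h4]
    · simp [h5, en]
    · simp [h3, h4, h5]
  · rw [isClosing_six hm h1 h2, e8, d0]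
    have hm4 : m ≠ 4 := by omega
    unfold KeyCloses key
    split_ifs with h3 h4 h5
    · simp [h3]
    · simp [h4, hm4]
    · simp [h5, hm4]
    · simp [h3]

/-- Add an element to a list, or remove it if it occurs. -/
def toggle {α : Type*} [DecidableEq α] (a : α) (l : List α) : List α :=
  if a ∈ l then l.erase a else a :: l

/-- Cancelling equal entries in pairs preserves the parity of every count and leaves few keys to be
examined. -/
lemma countP_toggle {α : Type*} [DecidableEq α] (P : α → Bool) (l : List α) :
    (l.foldr toggle []).countP P % 2 = l.countP P % 2 := by
  induction l with
  | nil => rfl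
  | cons a l ih =>
    rw [List.foldr_cons, List.countP_cons]
    set O := l.foldr toggle [] with hO
    unfold toggle
    split_ifs with h1 h2 h2
    · have := List.countP_pos_iff.2 ⟨a, h1, h2⟩
      rw [List.countP_erase, if_pos ⟨h1, h2⟩]
      omega
    · rw [List.countP_erase, if_neg (fun h3 => h2 h3.2)]
      omega
    · rw [List.countP_cons, if_pos h2]; omega
    · rw [List.countP_cons, if_neg h2]; omega

/-- A key that can not belong to closed walks for general `lam`. -/
def IsOpenKey (k : ℤ × ℤ × ℤ) : Prop :=
  (k.1 = 0 ∧ -10 ≤ k.2.1 ∧ k.2.1 ≤ 10 ∧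
      ((k.2.2 = 0 ∧ k.2.1 ≠ 0) ∨ (k.2.2 = 2 ∧ k.2.1 ≠ 8 ∧ k.2.1 ≠ -8))) ∨
    (k.1 = 4 ∧ ((k.2.2 = 0 ∧ k.2.1 ∈ [(2 : ℤ), -2, 6, -6]) ∨
      (k.2.2 = 2 ∧ k.2.1 ∈ [(0 : ℤ), 2, -2, 4, -4, 6, -6]))) ∨ k.1 = 7

instance : DecidablePred IsOpenKey := fun k => by unfold IsOpenKey; infer_instance

lemma pathEnds_ten_bound : ∀ e ∈ [(0 : ℤ), 1], ∀ f ∈ [(0 : ℤ), 1], ∀ x y w,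
    ∀ t ∈ pathEnds 10 e f x y w, x ≠ y → y ≠ w → -5 ≤ t.1 ∧ t.1 ≤ 5 := by
  decide +kernel

/-- Many walks of length 10 close because of 4k = 4, but modulo 2 they cancel apart from one trivial
key, present exactly if x ≠ w, and keys that close only for special parameters. -/
lemma pathEnds_keys : ∀ e ∈ [(0 : ℤ), 1], ∀ f ∈ [(0 : ℤ), 1], ∀ x y w, x ≠ y → y ≠ w →
    (((pathEnds 10 e f x y w).map key).foldr toggle []).count (0, 0, 0) =
      (if x = w then 0 else 1) ∧
    ∀ k ∈ ((pathEnds 10 e f x y w).map key).foldr toggle [], k = (0, 0, 0) ∨ IsOpenKey k := by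
  decide +kernel

open Classical in
/-- The parity of the number of closed walks of length `10` with given first three steps. -/
lemma path_count_parity {m q : ℕ} {lam : ℤ} (hm : m = 4 ∨ 6 ≤ m)
    (h : ∀ k, IsOpenKey k → ¬ KeyCloses m q lam k) : ∀ e ∈ [(0 : ℤ), 1], ∀ f ∈ [(0 : ℤ), 1],
    ∀ x y w, x ≠ y → y ≠ w →
    (pathEnds 10 e f x y w).countP (IsClosing m (8 * q) (1 + 2 * q) lam ·) % 2 =
      if x = w then 0 else 1 := by
  intro e he f hf x y w hxy hyw
  have e1 : (pathEnds 10 e f x y w).countP (IsClosing m (8 * q) (1 + 2 * q) lam ·) =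
      ((pathEnds 10 e f x y w).map key).countP (KeyCloses m q lam ·) := by
    rw [List.countP_map]
    refine List.countP_congr fun t ht => ?_
    obtain ⟨h1, h2⟩ := pathEnds_ten_bound e he f hf x y w t ht hxy hyw
    simp [isClosing_iff_key hm h1 h2]
  obtain ⟨h1, h2⟩ := pathEnds_keys e he f hf x y w hxy hyw
  rw [e1, ← countP_toggle]
  set O := ((pathEnds 10 e f x y w).map key).foldr toggle [] with hO
  have e2 : O.countP (KeyCloses m q lam ·) = O.count (0, 0, 0) := by
    rw [List.count]
    refine List.countP_congr fun k hk => ?_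
    simp only [decide_eq_true_eq, beq_iff_eq]
    refine ⟨fun h3 => (h2 k hk).resolve_right fun h4 => h k h4 h3, ?_⟩
    rintro rfl
    exact Or.inl ⟨rfl, by simp⟩
  rw [e2, h1]
  split_ifs <;> rfl

/-- Keys within a layer are too small to be multiples of 8q. Keys across four layers concern m = 4,
where the listed values of `lam` are the only ones that could make them close. -/
lemma IsOpenKey.not_closes {m q : ℕ} {lam : ℤ} (hq : 2 ≤ q)
    (hl : m = 4 → (8 * q : ℤ) ∣ 2 * q * lam ∨ (8 * q : ℤ) ∣ lam * (2 + 2 * q))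
    (h1 : m = 4 → ¬ (8 * q : ℤ) ∣ lam - 4 * q) (h2 : m = 4 → ¬ (8 * q : ℤ) ∣ lam - (4 * q + 4))
    (h3 : m = 4 → ¬ (8 * q : ℤ) ∣ lam + (4 * q + 4))
    (h4 : m = 4 → q = 3 → ¬ (24 : ℤ) ∣ lam - 6 ∧ ¬ (24 : ℤ) ∣ lam + 6) (k : ℤ × ℤ × ℤ)
    (hk : IsOpenKey k) : ¬ KeyCloses m q lam k := by
  have h8 : ((8 * q : ℕ) : ℤ) = 8 * q := by push_cast; ring
  obtain ⟨d, s, b⟩ := k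
  simp only [IsOpenKey, List.mem_cons, List.not_mem_nil, or_false] at hk
  rintro (⟨hd, hc⟩ | ⟨hd, rfl, hc⟩)
  · simp only at hd hc
    rcases hk with ⟨-, hs1, hs2, ⟨rfl, hs3⟩ | ⟨rfl, hs3, hs4⟩⟩ | ⟨h5, -⟩ | h5
    · rw [mul_zero, add_zero, ← h8] at hc
      exact not_dvd_of_abs_lt hs3 (by omega) (by omega) hc
    · obtain ⟨c, hc⟩ := hc
      have hc' : s = 4 * (q * (2 * c - 1)) := by linear_combination hc
      have hc0 : 2 * c - 1 ≠ 0 := by omega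
      have hq3 : q < 3 := by
        by_contra hq3
        have hd : ((4 * q : ℕ) : ℤ) ∣ s := ⟨2 * c - 1, by rw [hc']; push_cast; ring⟩
        refine not_dvd_of_abs_lt ?_ (by omega) (by omega) hd
        rintro rfl
        have : (q : ℤ) * (2 * c - 1) = 0 := by omega
        rcases mul_eq_zero.1 this with h6 | h6 <;> omega
      obtain rfl : q = 2 := by omega
      push_cast at hc'
      omega
    · omega
    · omega
  · simp only at hd hc
    have hl := hl rfl
    -- The first alternative for `lam` makes it a multiple of 4, while s is 2 modulo 4. The second
    -- makes q a divisor of s, hence of 6, and inspection leaves q = 3.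
    have key : ∀ s : ℤ, (s = 2 ∨ s = -2 ∨ s = 6 ∨ s = -6) → (4 * q : ℤ) ∣ lam + s → q = 3 ∧
        (s = 6 ∨ s = -6) := by
      intro s hs hd
      rcases hl with hl | hl
      · exfalso
        have h5 : (4 : ℤ) ∣ lam := by
          have : (2 * q : ℤ) * 4 ∣ 2 * q * lam := dvd_of_eq_mul (n := 2 * q * 4) (b := 2 * q * lam)
            (by rw [show (2 * q * 4 : ℤ) = 8 * q by ring]; exact hl) 1 (by ring)
          exact (mul_dvd_mul_iff_left (by omega)).1 this
        have h6 : (4 : ℤ) ∣ lam + s := (dvd_mul_right _ _).trans hd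
        omega
      · have h5 : (4 * q : ℤ) ∣ s * (1 + q) := by
          have h6 : (2 : ℤ) * (4 * q) ∣ 2 * (lam * (1 + q)) := by
            obtain ⟨x, hx⟩ := hl
            exact ⟨x, by linear_combination hx⟩
          have h7 := (mul_dvd_mul_iff_left (by norm_num)).1 h6
          exact dvd_of_eq_mul (n := 4 * q) ((hd.mul_right (1 + q : ℤ)).sub h7) 1 (by ring)
        have h6 : (q : ℤ) ∣ s := by
          obtain ⟨x, hx⟩ := h5
          exact ⟨4 * x - s, by linear_combination hx⟩
        have h7 : (q : ℤ) ∣ 6 := by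
          rcases hs with rfl | rfl | rfl | rfl
          · exact h6.trans (by norm_num)
          · exact h6.trans (by norm_num)
          · exact h6
          · exact h6.trans (by norm_num)
        have h8 : (q : ℤ) ≤ 6 := Int.le_of_dvd (by norm_num) h7
        have h9 : q = 2 ∨ q = 3 ∨ q = 4 ∨ q = 5 ∨ q = 6 := by omega
        rcases h9 with rfl | rfl | rfl | rfl | rfl <;> push_cast at h5 h6 <;>
          rcases hs with rfl | rfl | rfl | rfl <;> omega
    have key' : ∀ s : ℤ, (s = 2 ∨ s = -2 ∨ s = 6 ∨ s = -6) → ¬ (4 * q : ℤ) ∣ lam + s := by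
      intro s hs hd
      obtain ⟨rfl, h5⟩ := key s hs hd
      obtain ⟨h6, h7⟩ := h4 rfl rfl
      push_cast at hd
      have hpar := hl
      push_cast at hpar
      rcases h5 with rfl | rfl <;> omega
    have hc2 : ∀ s : ℤ, (8 * q : ℤ) ∣ s + 2 * q * 0 + lam → (4 * q : ℤ) ∣ lam + s := by
      rintro s ⟨x, hx⟩; exact ⟨2 * x, by linear_combination hx⟩
    have hc3 : ∀ s : ℤ, (8 * q : ℤ) ∣ s + 2 * q * 2 + lam → (4 * q : ℤ) ∣ lam + s := by
      rintro s ⟨x, hx⟩; exact ⟨2 * x - 1, by linear_combination hx⟩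
    rcases hk with ⟨h5, -⟩ | ⟨-, ⟨rfl, hs⟩ | ⟨rfl, hs⟩⟩ | h5
    · omega
    · exact key' s hs (hc2 s hc)
    · rcases hs with rfl | rfl | rfl | rfl | rfl | rfl | rfl
      · refine h1 rfl ?_
        obtain ⟨x, hx⟩ := hc
        exact ⟨x - 1, by linear_combination hx⟩
      · exact key' 2 (by simp) (hc3 2 hc)
      · exact key' (-2) (by simp) (hc3 (-2) hc)
      · refine h3 rfl ?_
        obtain ⟨x, hx⟩ := hc
        exact ⟨x, by linear_combination hx⟩
      · refine h2 rfl ?_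
        obtain ⟨x, hx⟩ := hc
        exact ⟨x - 1, by linear_combination hx⟩
      · exact key' 6 (by simp) (hc3 6 hc)
      · exact key' (-6) (by simp) (hc3 (-6) hc)
    · omega

end AltCycleQuotient

/-! ### The case n = 8q, k = 1 + 2q: special shifts and conclusion -/

namespace AltCycleQuotient

lemma edgeEnds_eight : ∀ e ∈ [(0 : ℤ), 1], ∀ f ∈ [(0 : ℤ), 1], ∀ x, ∀ t ∈ edgeEnds 8 e f x,
    (-5 ≤ t.1 ∧ t.1 ≤ 5) ∧ ((key t).1 = 0 → -8 ≤ (key t).2.1 ∧ (key t).2.1 ≤ 8 ∧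
      ((key t).2.2 = 0 ∨ (key t).2.2 = 2 ∧ -6 ≤ (key t).2.1 ∧ (key t).2.1 ≤ 6)) ∧
    ((key t).1 = 4 → -4 ≤ (key t).2.1 ∧ (key t).2.1 ≤ 4 ∧ ((key t).2.2 = 0 ∨ (key t).2.2 = 2)) := by
  decide +kernel

lemma edge_count_eight : ∀ e ∈ [(0 : ℤ), 1], ∀ f ∈ [(0 : ℤ), 1], ∀ x,
    (edgeEnds 8 e f x).countP (fun t => key t = (0, 0, 0) ∨ key t = (4, 0, 2)) =
      (if x = 0 then 2 else 1) ∧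
    (edgeEnds 8 e f x).countP (fun t => key t = (0, 0, 0) ∨ key t = (4, -4, 2)) =
      (if x = 2 then 0 else 1) := by
  decide +kernel

lemma edge_count_ten : ∀ e ∈ [(0 : ℤ), 1], ∀ f ∈ [(0 : ℤ), 1], ∀ x, (edgeEnds 10 e f x).countP
    (fun t => t.1 % 4 = 0 ∧ (t.2.1 + t.2.2 * 7 + 6 * (t.1 / 4)) % 24 = 0) =
      if x = 0 then 14 else 13 := by
  decide +kernel

/-- The displacements of the closed walks of length `L` whose first steps have the colours
`x`, `2`, `y`, `2` and `w`. -/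
def longPathEnds (L : ℕ) (e f : ℤ) (x y w : Fin 3) : List Disp :=
  ends e f x (L - 5) w (smove e f w (smove e f 2 (smove e f y (smove e f 2
    (smove e f x (0, 0, 0))))))

lemma longPathEnds_ten : ∀ e ∈ [(0 : ℤ), 1], ∀ f ∈ [(0 : ℤ), 1], ∀ x y w, x ≠ 2 → y ≠ 2 → w ≠ 2 →
    (∀ t ∈ longPathEnds 10 e f x y w, (-5 ≤ t.1 ∧ t.1 ≤ 5) ∧
      -10 ≤ (key t).2.1 ∧ (key t).2.1 ≤ 10 ∧ ((key t).2.2 = 0 ∨ (key t).2.2 = 2) ∧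
      ((key t).1 = 4 → -7 ≤ (key t).2.1 ∧ (key t).2.1 ≤ 7)) ∧
    (longPathEnds 10 e f x y w).countP (fun t => key t = (0, 0, 0) ∨ key t = (4, -4, 2)) =
      if x = w then 0 else 1 := by
  decide +kernel

/-- A key with a displacement within a layer. -/
lemma keyCloses_zero {q : ℕ} {s b : ℤ} (hs1 : -(4 * q : ℤ) < s) (hs2 : s < 4 * q)
    (hb : b = 0 ∨ b = 2) : (8 * q : ℤ) ∣ s + 2 * q * b ↔ s = 0 ∧ b = 0 := by
  refine ⟨fun h => ?_, fun ⟨h1, h2⟩ => by simp [h1, h2]⟩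
  rcases hb with rfl | rfl
  · have h1 : (8 * q : ℤ) ∣ s := by simpa using h
    exact ⟨Int.eq_zero_of_abs_lt_dvd h1 (abs_lt.2 ⟨by omega, by omega⟩), rfl⟩
  · have h1 : s + 2 * q * 2 = 0 :=
      Int.eq_zero_of_abs_lt_dvd h (abs_lt.2 ⟨by omega, by omega⟩)
    omega

section

variable {V : Type*} {Γ C : SimpleGraph V} {m n : ℕ} {K lam : ℤ} {p : ℤ × ℤ → V}

open Classical in
-- One of the special shifts for which the parity argument is unavailable; here the closed walks of
-- length 8 single out the colour 0.
lemma Chart.invariant_of_half [Fintype V] {q : ℕ} (hq : 2 ≤ q)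
    (hp : Chart Γ C 4 (8 * q) (1 + 2 * q) (4 * q) p) : IsAutInvariant Γ C := by
  have hc : ∀ e ∈ [(0 : ℤ), 1], ∀ f ∈ [(0 : ℤ), 1], ∀ x,
      (edgeEnds 8 e f x).countP (IsClosing 4 (8 * q) (1 + 2 * q) (4 * q) ·) =
        if x = 0 then 2 else 1 := by
    intro e he f hf x
    rw [← (edge_count_eight e he f hf x).1]
    refine countP_congr_closing fun t ht => ?_
    obtain ⟨⟨h1, h2⟩, h3, h4⟩ := edgeEnds_eight e he f hf x t ht
    rw [isClosing_iff_key (Or.inl rfl) h1 h2]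
    generalize key t = k at h3 h4
    obtain ⟨d, s, b⟩ := k
    simp only [KeyCloses, Prod.mk.injEq, true_and] at h3 h4 ⊢
    refine or_congr (and_congr_right fun hd => ?_) (and_congr_right fun hd => ?_)
    · obtain ⟨h5, h6, h7⟩ := h3 hd
      rcases h7 with rfl | ⟨rfl, h8, h9⟩
      · rw [mul_zero, add_zero]
        refine ⟨fun h => ⟨Int.eq_zero_of_abs_lt_dvd h (abs_lt.2 ⟨by omega, by omega⟩), rfl⟩,
          fun h => h.1 ▸ dvd_zero _⟩
      · exact keyCloses_zero (by omega) (by omega) (Or.inr rfl)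
    · obtain ⟨h5, h6, h7⟩ := h4 hd
      rcases h7 with rfl | rfl
      · refine ⟨fun h => ?_, fun h => absurd h.2 (by norm_num)⟩
        have := Int.eq_zero_of_abs_lt_dvd h (abs_lt.2 ⟨by omega, by omega⟩)
        omega
      · have e1 : s + 2 * (q : ℤ) * 2 + 4 * q = s + 8 * q * 1 := by ring
        rw [e1, Int.dvd_add_left (dvd_mul_right _ _)]
        exact ⟨fun h => ⟨Int.eq_zero_of_abs_lt_dvd h (abs_lt.2 ⟨by omega, by omega⟩), rfl⟩,
          fun h => h.1 ▸ dvd_zero _⟩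
  refine hp.invariant_of_countP 8 fun e he f hf e' he' f' hf' x hx => ?_
  rw [hc e he f hf, hc e' he' f' hf', if_pos rfl, if_neg hx]; norm_num

open Classical in
lemma Chart.invariant_twenty_four [Fintype V] (hp : Chart Γ C 4 24 7 6 p) :
    IsAutInvariant Γ C := by
  have hc : ∀ e ∈ [(0 : ℤ), 1], ∀ f ∈ [(0 : ℤ), 1], ∀ x,
      (edgeEnds 10 e f x).countP (IsClosing 4 24 7 6 ·) = if x = 0 then 14 else 13 := by
    intro e he f hf x
    rw [← edge_count_ten e he f hf x]
    refine countP_congr_closing fun t ht => ?_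
    rw [isClosing_iff_emod (by norm_num)]; rfl
  refine hp.invariant_of_countP 10 fun e he f hf e' he' f' hf' x hx => ?_
  rw [hc e he f hf, hc e' he' f' hf', if_pos rfl, if_neg hx]; norm_num

open Classical in
lemma Chart.IsLift.longPath_countP_eq [Fintype V] {hp : Chart Γ C m n K lam p} {φ : Γ ≃g Γ}
    {F : ℤ × ℤ → ℤ × ℤ} {σ : ℤ × ℤ → Equiv.Perm (Fin 3)} (h : hp.IsLift φ F σ)
    (h2 : ∀ z, σ z 2 = 2) (u : ℤ × ℤ) (x y w : Fin 3) (L : ℕ) :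
    ∃ e ∈ [(0 : ℤ), 1], ∃ f ∈ [(0 : ℤ), 1], ∃ e' ∈ [(0 : ℤ), 1], ∃ f' ∈ [(0 : ℤ), 1],
      (longPathEnds L e f x y w).countP (IsClosing m n K lam ·) =
        (longPathEnds L e' f' (σ u x) (σ (move K 2 u) y)
          (σ (move K 2 (move K y (move K 2 u))) w)).countP (IsClosing m n K lam ·) := by
  have e : ∀ (u : ℤ × ℤ) (x y w : Fin 3), pos K (move K x u)
      (smove ((move K x u).1 % 2) (((move K x u).1 + (move K x u).2) % 2) w
        (smove ((move K x u).1 % 2) (((move K x u).1 + (move K x u).2) % 2) 2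
        (smove ((move K x u).1 % 2) (((move K x u).1 + (move K x u).2) % 2) y
        (smove ((move K x u).1 % 2) (((move K x u).1 + (move K x u).2) % 2) 2
        (smove ((move K x u).1 % 2) (((move K x u).1 + (move K x u).2) % 2) x (0, 0, 0)))))) =
      move K w (move K 2 (move K y (move K 2 u))) := by
    intro u x y w
    rw [← move_pos hp.K_odd, ← move_pos hp.K_odd, ← move_pos hp.K_odd, ← move_pos hp.K_odd,
      ← move_pos hp.K_odd, pos_zero, move_move hp.K_odd]
  have h3 : ∀ z x, p (F (move K x z)) = p (move K (σ z x) (F z)) := fun z x => by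
    rw [← h.map, h.map_move]
  set x' := σ u x
  set y' := σ (move K 2 u) y with hy'
  set w' := σ (move K 2 (move K y (move K 2 u))) w with hw'
  have e1 : p (F (move K 2 u)) = p (move K 2 (F u)) := by rw [h3, h2]
  have e2 : p (F (move K y (move K 2 u))) = p (move K y' (move K 2 (F u))) := by
    rw [h3, hp.move_eq e1]
  have e3 : p (F (move K 2 (move K y (move K 2 u)))) =
      p (move K 2 (move K y' (move K 2 (F u)))) := by
    rw [h3, h2, hp.move_eq e2]
  refine ⟨_, emod_two_mem (move K x u).1, _, emod_two_mem ((move K x u).1 + (move K x u).2),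
    _, emod_two_mem (move K x' (F u)).1, _,
    emod_two_mem ((move K x' (F u)).1 + (move K x' (F u)).2), ?_⟩
  refine hp.countP_eq φ (h.map_move u x) ?_ ?_ ?_ (L - 5)
  · rw [move_move hp.K_odd, move_move hp.K_odd, h.map]
  · rw [e, e, h.map_move, hp.move_eq e3]
  · rw [e, e, move_move hp.K_odd, move_move hp.K_odd, h.map, e3]

lemma Chart.forall_of_forall_move (hp : Chart Γ C m n K lam p) (hconn : Γ.Connected)
    {Q : ℤ × ℤ → Prop} (hQ : ∀ z w, p z = p w → Q z → Q w) (hmove : ∀ z x, Q z → Q (move K x z))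
    {z : ℤ × ℤ} (hz : Q z) (w : ℤ × ℤ) : Q w := by
  have key : ∀ v v', Γ.Walk v v' → ∀ z, p z = v → Q z → ∀ z', p z' = v' → Q z' := by
    intro v v' W
    induction W with
    | nil => intro z hz hQz z' hz'; exact hQ _ _ (hz.trans hz'.symm) hQz
    | cons hadj W ih =>
      intro z hz hQz z' hz'
      subst hz
      obtain ⟨y, rfl⟩ := (hp.adj _ _).1 hadj
      exact ih _ rfl (hmove _ _ hQz) z' hz'
  obtain ⟨W⟩ := hconn.preconnected (p z) (p w)
  exact key _ _ W z rfl hz w rfl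

/-- The keys of short closed walks of `X_a(4, 8q, 1 + 2q, 4q + 4)`. -/
lemma keyCloses_iff {q : ℕ} (hq : 3 ≤ q) {k : ℤ × ℤ × ℤ} (h1 : -10 ≤ k.2.1) (h2 : k.2.1 ≤ 10)
    (h3 : k.2.2 = 0 ∨ k.2.2 = 2) (h4 : k.1 = 4 → -7 ≤ k.2.1 ∧ k.2.1 ≤ 7) :
    KeyCloses 4 q (4 * q + 4) k ↔ k = (0, 0, 0) ∨ k = (4, -4, 2) := by
  obtain ⟨d, s, b⟩ := k
  simp only [KeyCloses, Prod.mk.injEq, true_and] at h1 h2 h3 h4 ⊢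
  refine or_congr (and_congr_right fun _ => keyCloses_zero (by omega) (by omega) h3)
    (and_congr_right fun hd => ?_)
  obtain ⟨h5, h6⟩ := h4 hd
  rcases h3 with rfl | rfl
  · refine ⟨fun h => ?_, fun h => absurd h.2 (by norm_num)⟩
    have := Int.eq_zero_of_abs_lt_dvd h (abs_lt.2 ⟨by omega, by omega⟩)
    omega
  · have e1 : s + 2 * (q : ℤ) * 2 + (4 * q + 4) = s + 4 + 8 * q * 1 := by ring
    rw [e1, Int.dvd_add_left (dvd_mul_right _ _)]
    refine ⟨fun h => ?_, fun h => by rw [h.1]; simp⟩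
    have := Int.eq_zero_of_abs_lt_dvd h (abs_lt.2 ⟨by omega, by omega⟩)
    exact ⟨by omega, rfl⟩

lemma perm_three_fix {σ : Equiv.Perm (Fin 3)} (h : σ 2 = 2) :
    (σ 0 = 0 ∧ σ 1 = 1) ∨ (σ 0 = 1 ∧ σ 1 = 0) := by
  revert σ; decide

lemma vsign_walk {w : ℤ × ℤ} (hK : K % 2 = 1) :
    (walk K [0, 2, 1, 2] w).1 = w.1 + vsign w ∧ vsign (walk K [0, 2, 1, 2] w) = vsign w := by
  refine ⟨?_, ?_⟩
  · change (move K 2 (move K 1 (move K 2 (move K 0 w)))).1 = _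
    have e : ∀ z, (move K 2 z).1 = z.1 ∧ (move K 1 z).1 = z.1 ∧ (move K 0 z).1 = z.1 + vsign z :=
      fun z => ⟨by simp [move], by simp [move], by simp [move]⟩
    rw [(e _).1, (e _).2.1, (e _).1, (e _).2.2]
  · change vsign (move K 2 (move K 1 (move K 2 (move K 0 w)))) = _
    rw [vsign_move hK, vsign_move hK, vsign_move hK, vsign_move hK, neg_neg, neg_neg]

open Classical in
/-- For odd `q` an automorphism of `X_a(4, 8q, 1 + 2q, 4q + 4)` permutes the colours unless it
preserves the `2`-factor. -/
lemma Chart.exists_perm_of_odd [Fintype V] (hconn : Γ.Connected) {q : ℕ} (hq : 3 ≤ q)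
    (hqo : q % 2 = 1) (hp : Chart Γ C 4 (8 * q) (1 + 2 * q) (4 * q + 4) p)
    (hinv : ¬ IsAutInvariant Γ C) : ∃ (φ : Γ ≃g Γ) (F : ℤ × ℤ → ℤ × ℤ)
      (σ : ℤ × ℤ → Equiv.Perm (Fin 3)) (τ : Equiv.Perm (Fin 3)), hp.IsLift φ F σ ∧
      (∀ z, σ z = τ) ∧ τ 0 ≠ 0 := by
  obtain ⟨φ, F, σ, z₀, h, h0⟩ := hp.exists_isLift_of_not_invariant hinv
  set K : ℤ := 1 + 2 * q with hK
  have hKo := hp.K_odd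
  have hc : ∀ e ∈ [(0 : ℤ), 1], ∀ f ∈ [(0 : ℤ), 1], ∀ x,
      (edgeEnds 8 e f x).countP (IsClosing 4 (8 * q) K (4 * q + 4) ·) = if x = 2 then 0 else 1 := by
    intro e he f hf x
    rw [← (edge_count_eight e he f hf x).2]
    refine countP_congr_closing fun t ht => ?_
    obtain ⟨⟨h1, h2⟩, h3, h4⟩ := edgeEnds_eight e he f hf x t ht
    rw [hK, isClosing_iff_key (Or.inl rfl) h1 h2]
    by_cases h7 : (key t).1 = 0 ∨ (key t).1 = 4
    · rcases h7 with h7 | h7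
      · obtain ⟨h5, h6, h8⟩ := h3 h7
        exact keyCloses_iff hq (by omega) (by omega) (h8.imp_right fun h9 => h9.1)
          (fun h9 => by omega)
      · obtain ⟨h5, h6, h8⟩ := h4 h7
        exact keyCloses_iff hq (by omega) (by omega) h8 (fun h9 => by omega)
    · unfold KeyCloses
      constructor
      · rintro (⟨h8, -⟩ | ⟨h8, -⟩)
        · exact absurd (Or.inl h8) h7
        · exact absurd (Or.inr h8) h7
      · rintro (h8 | h8) <;> exact absurd (by simp [h8]) h7
  have hc' : ∀ e ∈ [(0 : ℤ), 1], ∀ f ∈ [(0 : ℤ), 1], ∀ x y w, x ≠ 2 → y ≠ 2 → w ≠ 2 →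
      (longPathEnds 10 e f x y w).countP (IsClosing 4 (8 * q) K (4 * q + 4) ·) =
        if x = w then 0 else 1 := by
    intro e he f hf x y w hx hy hw
    obtain ⟨h1, h2⟩ := longPathEnds_ten e he f hf x y w hx hy hw
    rw [← h2]
    refine countP_congr_closing fun t ht => ?_
    obtain ⟨⟨h3, h4⟩, h5, h6, h7, h8⟩ := h1 t ht
    rw [hK, isClosing_iff_key (Or.inl rfl) h3 h4]
    exact keyCloses_iff hq h5 h6 h7 h8
  have h2 : ∀ u, σ u 2 = 2 := by
    intro u
    obtain ⟨e, he, f, hf, e', he', f', hf', h1⟩ := h.edge_countP_eq u 2 8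
    rw [hc e he f hf, hc e' he' f' hf', if_pos rfl] at h1
    by_contra hne
    rw [if_neg hne] at h1
    omega
  have hne2 : ∀ u x, x ≠ 2 → σ u x ≠ 2 := by
    intro u x hx h3
    rw [← h2 u] at h3
    exact hx ((σ u).injective h3)
  -- Both permutations fix 2 and agree on y. Hence the action on colours can change only across
  -- edges of colour 2, and the longer paths show that it changes back across the next such edge.
  have hside : ∀ u y, y ≠ 2 → σ (move K y u) = σ u := fun u y hy =>
    perm_three_eq hy (h.colour_move u y) (by rw [h2, h2])
  have hskip : ∀ u y, y ≠ 2 → σ (move K 2 (move K y (move K 2 u))) = σ u := by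
    intro u y hy
    refine perm_three_eq (x := 0) (y := 2) (by decide) ?_ (by rw [h2, h2])
    obtain ⟨e, he, f, hf, e', he', f', hf', h1⟩ := h.longPath_countP_eq h2 u 0 y 0 10
    rw [hc' e he f hf 0 y 0 (by decide) hy (by decide), hc' e' he' f' hf' _ _ _
      (hne2 _ _ (by decide)) (hne2 _ _ hy) (hne2 _ _ (by decide)), if_pos rfl] at h1
    by_contra hne
    rw [if_neg (fun h3 => hne h3.symm)] at h1
    omega
  have hτ0 : σ z₀ 0 = 1 ∧ σ z₀ 1 = 0 := (perm_three_fix (h2 z₀)).resolve_left fun h3 => h0 h3.1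
  -- By the two preceding facts the action changes across all edges of colour 2 or across none of
  -- them.
  by_cases hflip : σ (move K 2 z₀) = σ z₀
  · refine ⟨φ, F, σ, σ z₀, h, ?_, h0⟩
    have hall := hp.forall_of_forall_move hconn (Q := fun z => σ (move K 2 z) = σ z)
      (fun z w hzw hQ => by
        rw [← h.congr hzw, ← hQ]; exact (h.congr (hp.move_eq hzw 2)).symm)
      (fun z x hQ => by
        by_cases hx : x = 2
        · subst hx
          rw [move_move hKo, hQ]
        · have h3 := hskip (move K 2 z) x hx
          rw [move_move hKo] at h3
          rw [h3, hQ, hside z x hx]) hflip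
    exact fun z => h.const hconn (fun z y => by
      obtain ⟨x, hx⟩ := exists_ne y
      refine ⟨x, hx, ?_⟩
      by_cases hy : y = 2
      · subst hy; rw [hall]
      · rw [hside z y hy]) z z₀
  · exfalso
    have hone : ∀ z, σ z = σ z₀ → σ (move K 2 z) ≠ σ z → σ (move K 2 z) 1 = 1 := by
      intro z hz hne
      rcases perm_three_fix (h2 (move K 2 z)) with h3 | h3
      · exact h3.2
      · exact absurd (perm_three_eq (x := 0) (y := 1) (by decide) (by rw [h3.1, hz, hτ0.1])
          (by rw [h3.2, hz, hτ0.2])) hne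
    -- If the action changes, the colour 1 is mapped alternately to 0 and 1 along a layer, so each
    -- block 1212 becomes 0212, which moves on by one layer.
    have hmap : ∀ (k : ℕ) z w, σ z = σ z₀ → σ (move K 2 z) ≠ σ z → φ (p z) = p w →
        ∃ w', w'.1 = w.1 + k * vsign w ∧ φ (p (walk K (alt 1 2 (2 * k)) z)) = p w' := by
      intro k
      induction k with
      | zero => intro z w _ _ h5; exact ⟨w, by simp, h5⟩
      | succ k ih =>
        intro z w h3 h4 h5
        set z1 := move K 1 z with hz1
        set z2 := move K 2 z1 with hz2
        set z3 := move K 1 z2 with hz3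
        set z4 := move K 2 z3 with hz4
        have s1 : σ z1 = σ z₀ := by rw [hz1, hside z 1 (by decide), h3]
        have s2 : σ z2 = σ (move K 2 z) := by
          have := hskip (move K 2 z) 1 (by decide)
          rwa [move_move hKo] at this
        have s3 : σ z3 = σ (move K 2 z) := by rw [hz3, hside z2 1 (by decide), s2]
        have s4 : σ z4 = σ z₀ := by
          have := hskip z1 1 (by decide)
          rw [hz4, hz3, hz2, this, s1]
        have h24 : σ (move K 2 z4) ≠ σ z4 := by
          rw [hz4, move_move hKo, s3, ← hz4, s4, ← h3]; exact h4
        have hF : ∀ z w x, φ (p z) = p w → φ (p (move K x z)) = p (move K (σ z x) w) := by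
          intro z w x h6
          rw [h.map_move]
          exact hp.move_eq (by rw [← h.map, h6]) _
        have m1 := hF z w 1 h5
        have m2 := hF _ _ 2 m1
        have m3 := hF _ _ 1 m2
        have m4 := hF _ _ 2 m3
        rw [← hz1, ← hz2, ← hz3, ← hz4, h2, h2, h3, hτ0.2, s2, hone z h3 h4] at m4
        obtain ⟨h6, h7⟩ := vsign_walk (w := w) hKo
        obtain ⟨w', h8, h9⟩ := ih z4 (walk K [0, 2, 1, 2] w) s4 h24 m4
        refine ⟨w', ?_, ?_⟩
        · rw [h8, h6, h7]; push_cast; ring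
        · rw [show 2 * (k + 1) = 2 * k + 1 + 1 by ring, alt_succ, alt_succ]
          exact h9
    -- This closed word has an image crossing 2q layers, which is no multiple of m = 4 for odd q.
    have hw : IsClosedWord p K (alt 1 2 (2 * (2 * q))) := by
      refine hp.isClosedWord fun z hz => ?_
      rw [walk_alt_one_two hKo _ _ _ hz, hp.eq_iff]
      exact ⟨0, by simp, ⟨layerStep K z.1, by push_cast; ring⟩⟩
    obtain ⟨w', h3, h4⟩ := hmap (2 * q) z₀ (F z₀) rfl hflip (h.map z₀)
    rw [hw z₀, h.map z₀, hp.eq_iff] at h4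
    obtain ⟨s, h5, -⟩ := h4
    rcases AltCycleQuotient.vsign_eq (F z₀) with h6 | h6
    · rw [h6] at h3; push_cast at h3 h5; omega
    · rw [h6] at h3; push_cast at h3 h5; omega

open Classical in
/-- The `2`-factor of `X_a(m, 8q, 1 + 2q, lam)` is invariant outside of the exceptional families. -/
theorem Chart.exists_family_of_not_invariant [Fintype V] (hconn : Γ.Connected) {q : ℕ} (hq : 2 ≤ q)
    (hp : Chart Γ C m (8 * q) (1 + 2 * q) lam p) (hm : m % 2 = 0)
    (hl : m = 4 → (8 * q : ℤ) ∣ 2 * q * lam ∨ (8 * q : ℤ) ∣ lam * (2 + 2 * q))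
    (hinv : ¬ IsAutInvariant Γ C) : ∃ ℓ : ℤ, (ℓ = lam ∨ ℓ = -lam) ∧
      (SwapFamily m (8 * q) ((1 + 2 * q : ℤ) : ZMod (8 * q)) (ℓ : ZMod (8 * q)) ∨
        RotateFamily m (8 * q) ((1 + 2 * q : ℤ) : ZMod (8 * q)) (ℓ : ZMod (8 * q))) := by
  have hm3 := hp.three_le
  have e8 : ((8 * q : ℕ) : ℤ) = 8 * q := by push_cast; ring
  have h1 : m = 4 → ¬ (8 * q : ℤ) ∣ lam - 4 * q := by
    rintro rfl hd
    exact hinv ((hp.congr (by simp) (lam' := 4 * q) (by rw [e8]; exact dvd_of_eq_mul hd (-1) (by ring))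
      (Or.inl rfl)).invariant_of_half hq)
  have h4 : m = 4 → q = 3 → ¬ (24 : ℤ) ∣ lam - 6 ∧ ¬ (24 : ℤ) ∣ lam + 6 := by
    rintro rfl rfl
    refine ⟨fun hd => hinv ?_, fun hd => hinv ?_⟩
    · exact ((hp.congr (K' := 7) (by simp) (lam' := 6) (dvd_of_eq_mul hd (-1) (by ring))
        (Or.inl rfl)).invariant_twenty_four)
    · exact ((hp.mirror.congr (K' := 7) (by simp) (lam' := 6) (dvd_of_eq_mul hd 1 (by ring))
        (Or.inl rfl)).invariant_twenty_four)
  -- The last shifts that escape the parity argument. For even q they belong to an exceptional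
  -- family with m₀ = 2; for odd q the colour action is shown to be constant in a different way.
  by_cases h23 : m = 4 ∧ ((8 * q : ℤ) ∣ lam - (4 * q + 4) ∨ (8 * q : ℤ) ∣ lam + (4 * q + 4))
  · obtain ⟨rfl, h23⟩ := h23
    obtain ⟨ℓ, hℓ, c, hc⟩ : ∃ ℓ : ℤ, (ℓ = lam ∨ ℓ = -lam) ∧ (8 * q : ℤ) ∣ ℓ - (4 * q + 4) := by
      rcases h23 with h | h
      · exact ⟨lam, Or.inl rfl, h⟩
      · exact ⟨-lam, Or.inr rfl, dvd_of_eq_mul h (-1) (by ring)⟩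
    by_cases hqe : q % 2 = 0
    · obtain ⟨n₀, rfl⟩ : ∃ n₀, q = 2 * n₀ := ⟨q / 2, by omega⟩
      refine ⟨ℓ, hℓ, ?_⟩
      have e : (1 + 2 * ((2 * n₀ : ℕ) : ℤ) : ℤ) = ((2 * 2 * n₀ + 1 : ℕ) : ℤ) := by push_cast; ring
      rw [e, Int.cast_natCast, show 8 * (2 * n₀) = 8 * 2 * n₀ by ring]
      push_cast at hc
      refine family_of_dvd (m₀ := 2) (n₀ := n₀) (t := 1 + 2 * n₀ + 2 * n₀ * c) le_rfl (by omega)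
        (by rw [show (1 + 2 * n₀ + 2 * n₀ * c : ℤ) = 1 + 2 * (n₀ + n₀ * c) by ring]; omega) ?_
        (Or.inl ?_)
      · push_cast; linear_combination hc
      · exact ⟨(1 + c) * (2 + 2 * n₀ * (1 + c)), by ring⟩
    · obtain ⟨p', hp'⟩ : ∃ p', Chart Γ C 4 (8 * q) (1 + 2 * q) (4 * q + 4) p' := by
        rcases hℓ with rfl | rfl
        · exact ⟨_, hp.congr (by simp) ⟨-c, by rw [e8]; linear_combination -hc⟩ (Or.inl rfl)⟩
        · exact ⟨_, hp.mirror.congr (by simp) ⟨-c, by rw [e8]; linear_combination -hc⟩ (Or.inl rfl)⟩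
      obtain ⟨φ, F, σ, τ, h, hτ, h0⟩ := hp'.exists_perm_of_odd hconn (by omega) (by omega) hinv
      obtain ⟨ℓ', hℓ', hfam⟩ := hp'.family_of_perm hm h hτ h0
      have hcast : (((4 * q + 4 : ℤ)) : ZMod (8 * q)) = (ℓ : ZMod (8 * q)) :=
        (ZMod.intCast_eq_intCast_iff_dvd_sub _ _ _).2 (by rw [e8]; exact ⟨c, hc⟩)
      rcases hℓ' with rfl | rfl
      · rw [hcast] at hfam
        exact ⟨ℓ, hℓ, hfam⟩
      · rw [Int.cast_neg, hcast, ← Int.cast_neg] at hfam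
        exact ⟨-ℓ, by rcases hℓ with rfl | rfl <;> simp, hfam⟩
  -- In all remaining cases the parity of the count tells whether the end colours of a path agree.
  have hparity := path_count_parity (m := m) (q := q) (lam := lam) (by omega)
    (fun k hk => hk.not_closes hq hl h1 (fun h5 h6 => h23 ⟨h5, Or.inl h6⟩)
      (fun h5 h6 => h23 ⟨h5, Or.inr h6⟩) h4)
  obtain ⟨φ, F, σ, z, h, h0⟩ := hp.exists_isLift_of_not_invariant hinv
  have hτ := h.const hconn (fun u y => by
    obtain ⟨x, hxy⟩ := exists_ne y
    refine ⟨x, hxy, h.colour_eq_of_countP u 10 hxy ?_⟩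
    intro e he f hf e' he' f' hf' w hw1 hw2 heq
    have h5 := hparity e he f hf x y x hxy hxy.symm
    have h6 := hparity e' he' f' hf' _ _ _ (fun h3 => hxy ((σ u).injective h3)) hw2.symm
    rw [if_pos rfl] at h5
    rw [if_neg hw1.symm] at h6
    omega)
  exact hp.family_of_perm hm h (fun w => hτ w z) h0

end

end AltCycleQuotient

/-! ### Normalisation of the parameters and the main theorem -/

namespace AltCycleQuotient

section

variable {V : Type*} {Γ C : SimpleGraph V} {m n : ℕ} {K lam : ℤ} {p : ℤ × ℤ → V}

lemma intCast_dvd_iff (a : ℤ) : (a : ZMod n) = 0 ↔ (n : ℤ) ∣ a := ZMod.intCast_zmod_eq_zero_iff_dvd a n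

lemma XParameters.isXStep (h : XParameters m n (K : ZMod n) (lam : ZMod n)) : IsXStep n K := by
  obtain ⟨-, -, -, ⟨h1, h2⟩, h3, -⟩ := h
  refine ⟨fun hd => h1 ?_, fun hd => h2 ?_, h3.imp (fun hd => ?_) (fun hd => ?_)⟩
  · have := (intCast_dvd_iff _).2 hd; push_cast at this; linear_combination this
  · have := (intCast_dvd_iff _).2 hd; push_cast at this; linear_combination this
  · rw [← intCast_dvd_iff]; push_cast; linear_combination hd
  · rw [← intCast_dvd_iff]; push_cast; linear_combination hd

lemma XParameters.dvd (h : XParameters m n (K : ZMod n) (lam : ZMod n)) (hm : m = 4) :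
    (n : ℤ) ∣ lam * K - lam ∨ (n : ℤ) ∣ lam * K + lam := by
  obtain ⟨-, -, -, -, -, ⟨h1, -⟩ | ⟨-, h1, -⟩⟩ := h
  · refine h1.imp (fun hd => ?_) (fun hd => ?_)
    · rw [← intCast_dvd_iff]; push_cast; linear_combination hd
    · rw [← intCast_dvd_iff]; push_cast; linear_combination hd
  · omega

/-- The graphs with `4 k = ± 4` can be normalized. -/
lemma exists_reachable_of_four (hn4 : 4 ≤ n) (hn : n % 2 = 0) (hK : K % 2 = 1)
    (h : IsXStep n K) (h4 : (n : ℤ) ∣ 4 * K - 4 ∨ (n : ℤ) ∣ 4 * K + 4) :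
    ∃ q : ℕ, n = 8 * q ∧ 2 ≤ q ∧ (∃ ε : ℤ, (ε = 1 ∨ ε = -1) ∧
      (n : ℤ) ∣ 2 * (1 + 2 * q) - 2 * ε * K) ∧ ∃ lam₁ : ℤ, (m = 4 → lam₁ = lam) ∧
      Reachable m n (K : ZMod n) (lam : ZMod n) ((1 + 2 * q : ℤ) : ZMod n) (lam₁ : ZMod n) := by
  obtain ⟨ε, hε, hR, hsub, hadd, c, hc⟩ : ∃ ε : ℤ, (ε = 1 ∨ ε = -1) ∧
      Reachable m n (K : ZMod n) (lam : ZMod n) ((ε * K : ℤ) : ZMod n) (lam : ZMod n) ∧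
      (¬ (n : ℤ) ∣ 2 * (ε * K) - 2) ∧ (¬ (n : ℤ) ∣ 2 * (ε * K) + 2) ∧
      (n : ℤ) ∣ 4 * (ε * K) - 4 := by
    rcases h4 with h4 | h4
    · refine ⟨1, Or.inl rfl, ?_, ?_, ?_, ?_⟩
      · rw [one_mul]; exact Reachable.refl
      · rw [one_mul]; exact h.sub
      · rw [one_mul]; exact h.add
      · rwa [one_mul]
    · refine ⟨-1, Or.inr rfl, ?_, ?_, ?_, ?_⟩
      · rw [neg_one_mul, Int.cast_neg]; exact Reachable.refl.neg_left
      · exact fun hd => h.add (dvd_of_eq_mul hd (-1) (by ring))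
      · exact fun hd => h.sub (dvd_of_eq_mul hd (-1) (by ring))
      · exact dvd_of_eq_mul h4 (-1) (by ring)
  have hKo : (ε * K) % 2 = 1 := by rcases hε with rfl | rfl <;> omega
  set K₁ := ε * K with hK₁
  -- An even c would give 2K₁ = 2 modulo n. Since 4(K₁ - 1) is a multiple of 8 and c is odd, 8
  -- divides n; and q = 1 would give 2K₁ = -2.
  have hco : c % 2 = 1 := by
    by_contra hce
    obtain ⟨d, rfl⟩ : ∃ d, c = 2 * d := ⟨c / 2, by omega⟩
    exact hsub ⟨d, by linarith⟩
  obtain ⟨a, ha⟩ : ∃ a, K₁ = 2 * a + 1 := ⟨K₁ / 2, by omega⟩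
  have h8 : (8 : ℤ) ∣ n := by
    have hcop : IsCoprime ((2 : ℤ) ^ 3) c := by
      refine IsCoprime.pow_left ⟨-(c / 2), 1, by omega⟩
    have : (2 : ℤ) ^ 3 ∣ n * c := ⟨a, by rw [← hc, ha]; ring⟩
    exact hcop.dvd_of_dvd_mul_right this
  obtain ⟨q, rfl⟩ : ∃ q, n = 8 * q := ⟨n / 8, by omega⟩
  have e8 : ((8 * q : ℕ) : ℤ) = 8 * q := by push_cast; ring
  obtain ⟨d, rfl⟩ : ∃ d, c = 2 * d + 1 := ⟨c / 2, by omega⟩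
  have hKd : K₁ = 1 + 2 * q + 4 * q * d := by rw [e8] at hc; linarith
  have hq2 : 2 ≤ q := by
    by_contra hq
    obtain rfl : q = 1 := by omega
    refine hadd ⟨1 + d, ?_⟩
    rw [hKd]; push_cast; ring
  refine ⟨q, rfl, hq2, ⟨ε, hε, -d, ?_⟩, ?_⟩
  · rw [e8, mul_assoc 2 ε K, ← hK₁, hKd]; ring
  -- K₁ is 1 + 2q or differs from it by the half turn 4q modulo 8q; in the second case the shift of
  -- the parameters by n/2 applies, which affects `lam` only if 4 does not divide m.
  by_cases hd : d % 2 = 0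
  · obtain ⟨b, rfl⟩ : ∃ b, d = 2 * b := ⟨d / 2, by omega⟩
    refine ⟨lam, fun _ => rfl, ?_⟩
    have e : ((1 + 2 * q : ℤ) : ZMod (8 * q)) = (K₁ : ZMod (8 * q)) :=
      (ZMod.intCast_eq_intCast_iff_dvd_sub _ _ _).2 ⟨b, by rw [e8, hKd]; ring⟩
    rw [e]; exact hR
  · obtain ⟨b, rfl⟩ : ∃ b, d = 2 * b + 1 := ⟨d / 2, by omega⟩
    have hn2 : 8 * q / 2 = 4 * q := by omega
    have e : ((1 + 2 * q : ℤ) : ZMod (8 * q)) =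
        (K₁ : ZMod (8 * q)) + ((8 * q / 2 : ℕ) : ZMod (8 * q)) := by
      rw [hn2, ← Int.cast_natCast (4 * q), ← Int.cast_add]
      refine (ZMod.intCast_eq_intCast_iff_dvd_sub _ _ _).2 ⟨b + 1, ?_⟩
      rw [e8, hKd]; push_cast; ring
    rw [e]
    by_cases hm4 : 4 ∣ m
    · exact ⟨lam, fun _ => rfl, hR.shift (by omega) hm4⟩
    · refine ⟨lam + 4 * q, fun h5 => absurd (by rw [h5]) hm4, ?_⟩
      have e2 : ((lam + 4 * q : ℤ) : ZMod (8 * q)) =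
          (lam : ZMod (8 * q)) + ((8 * q / 2 : ℕ) : ZMod (8 * q)) := by
        rw [hn2]; push_cast; ring
      rw [e2]
      exact hR.shift_both (by omega) hm4

lemma ten_cases : ∀ K lam : ZMod 10, K.val % 2 = 1 → lam.val % 2 = 0 → 2 * K ≠ 2 → 2 * K ≠ -2 →
    (2 * K ^ 2 = 2 ∨ 2 * K ^ 2 = -2) → (lam * K = lam ∨ lam * K = -lam) →
    (K = 3 ∨ K = -3) ∧ lam = 0 := by
  decide +kernel

lemma twenty_cases : ∀ K : ZMod 20, K.val % 2 = 1 → 2 * K ≠ 2 → 2 * K ≠ -2 →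
    (2 * K ^ 2 = 2 ∨ 2 * K ^ 2 = -2) → K = 3 ∨ K = -3 ∨ K + 10 = 3 ∨ -K + 10 = 3 := by
  decide +kernel

open Classical in
/-- The `2`-factor of `X_a(m, n, k, ℓ)` is invariant outside of the exceptional cases. -/
theorem Chart.exists_xException_of_not_invariant [Fintype V] (hconn : Γ.Connected)
    (hp : Chart Γ C m n K lam p) (h : XParameters m n (K : ZMod n) (lam : ZMod n))
    (hinv : ¬ IsAutInvariant Γ C) : ∃ k' ℓ' : ZMod n,
      Reachable m n (K : ZMod n) (lam : ZMod n) k' ℓ' ∧ XException m n k' ℓ' := by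
  have hm : m % 2 = 0 := Nat.even_iff.1 h.1
  have hstep := h.isXStep
  have hlam : lam % 2 = 0 := by have := hp.lam_parity; omega
  by_cases h4 : (n : ℤ) ∣ 4 * K - 4 ∨ (n : ℤ) ∣ 4 * K + 4
  · obtain ⟨q, rfl, hq, ⟨ε, hε, hd⟩, lam₁, hl₁, hR⟩ :=
      exists_reachable_of_four (m := m) (lam := lam) hp.four_le hp.n_even hp.K_odd hstep h4
    have e8 : ((8 * q : ℕ) : ℤ) = 8 * q := by push_cast; ring
    obtain ⟨K', lam', p', hK', hl', hp'⟩ := hR.chart hm hp rfl rfl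
    have hp'' := hp'.congr_cast hm hK' hl'
    obtain ⟨ℓ, hℓ, hfam⟩ := hp''.exists_family_of_not_invariant hconn hq hm (fun hm4 => by
      rw [hl₁ hm4, ← e8]
      obtain ⟨μ, rfl⟩ : ∃ μ, lam = 2 * μ := ⟨lam / 2, by omega⟩
      have h5 := hd.mul_left μ
      have h6 := h.dvd hm4
      rcases hε with rfl | rfl
      · exact h6.imp (fun h7 => dvd_of_eq_mul (h5.add h7) 1 (by ring))
          (fun h7 => dvd_of_eq_mul (h5.add h7) 1 (by ring))
      · exact h6.symm.imp (fun h7 => dvd_of_eq_mul (h5.sub h7) 1 (by ring))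
          (fun h7 => dvd_of_eq_mul (h5.sub h7) 1 (by ring))) hinv
    refine ⟨_, (ℓ : ZMod (8 * q)), ?_, Or.inr (Or.inr hfam)⟩
    rcases hℓ with rfl | rfl
    · exact hR
    · rw [Int.cast_neg]; exact hR.neg_right
  · rw [not_or] at h4
    by_cases h10 : m = 4 ∧ n = 10
    · obtain ⟨rfl, rfl⟩ := h10
      obtain ⟨-, h1, h2, ⟨h3, h5⟩, h6, ⟨h7, -⟩ | ⟨-, h7, -⟩⟩ := h
      · obtain ⟨h8, h9⟩ := ten_cases _ _ h1 h2 h3 h5 h6 h7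
        rcases h8 with h8 | h8
        · exact ⟨_, _, Reachable.refl, Or.inl ⟨rfl, rfl, h8, h9⟩⟩
        · exact ⟨_, _, Reachable.refl.neg_left, Or.inl ⟨rfl, rfl, by rw [h8, neg_neg], h9⟩⟩
      · omega
    by_cases h20 : m = 4 ∧ n = 20 ∧ (n : ℤ) ∣ lam - 10
    · obtain ⟨rfl, rfl, hd⟩ := h20
      obtain ⟨-, h1, h2, ⟨h3, h5⟩, h6, -⟩ := h
      have hl : (lam : ZMod 20) = 10 := by
        have := (intCast_dvd_iff (n := 20) _).2 hd
        push_cast at this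
        linear_combination this
      have hex : ∀ k : ZMod 20, k = 3 → XException 4 20 k lam :=
        fun k hk => Or.inr (Or.inl ⟨rfl, rfl, hk, hl⟩)
      rcases twenty_cases _ h1 h3 h5 h6 with h8 | h8 | h8 | h8
      · exact ⟨_, _, Reachable.refl, hex _ h8⟩
      · exact ⟨_, _, Reachable.refl.neg_left, hex _ (by rw [h8, neg_neg])⟩
      · exact ⟨_, _, Reachable.refl.shift (by norm_num) (by norm_num), hex _ h8⟩
      · exact ⟨_, _, Reachable.refl.neg_left.shift (by norm_num) (by norm_num), hex _ h8⟩
    exact absurd (hp.invariant_of_not_four hm hstep h4.1 h4.2 h.dvd h10 h20) hinv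

lemma Chart.card_eq (hp : Chart Γ C m n K lam p) : Nat.card V = m * n := by
  have hm := hp.three_le
  have : NeZero m := ⟨by omega⟩
  obtain ⟨φ, -⟩ := hp.factorIso (chart_model hp.three_le hp.four_le hp.n_even hp.K_odd
    hp.lam_parity hp.even_or_one hp.not_dvd)
  rw [Nat.card_congr φ.toEquiv, Nat.card_prod, Nat.card_fin, Nat.card_zmod]

/-- A member together with its two neighbours in the quotient graph makes three. -/
lemma IsAlternating.three_le [Finite V] (halt : IsAlternating Γ C)
    (hm : Nat.card C.ConnectedComponent = m) : 3 ≤ m := by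
  obtain ⟨c⟩ := halt.1.1.nonempty
  have h1 := halt.1.2 c
  have h2 : c ∉ (quotientGraph Γ C).neighborSet c := fun h => h.1 rfl
  have h3 := Set.ncard_insert_of_notMem h2 (Set.toFinite _)
  rw [h1] at h3
  rw [← hm, ← Set.ncard_univ]
  exact h3.ge.trans (Set.ncard_le_ncard (Set.subset_univ _) (Set.toFinite _))

end

end AltCycleQuotient

theorem mainTheorem2 {V : Type*} [Finite V] (Γ C I : SimpleGraph V)
    [Γ.LocallyFinite] [C.LocallyFinite] [I.LocallyFinite]
    (hconn : Γ.Connected) (hcubic : Γ.IsRegularOfDegree 3) (hvt : IsVertexTransitive Γ)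
    (hpart : IsFactorPartition Γ C I) (halt : IsAlternating Γ C)
    (m n : ℕ) (hm : Nat.card C.ConnectedComponent = m) (hn : Nat.card V = m * n) :
    IsAutInvariant Γ C ↔
      (Even n ∧ 4 ≤ n ∧ ∃ ℓ : ZMod n, ℓ.val % 2 = m % 2 ∧
          FactorIso Γ C (honeycomb m n ℓ) (standardFactor (honeycomb m n ℓ)) ∧
          ¬ HoneycombException m n ℓ) ∨
        (Even n ∧ 4 ≤ n ∧ ∃ k ℓ : ZMod n, XParameters m n k ℓ ∧
          FactorIso Γ C (xGraph m n k ℓ) (standardFactor (xGraph m n k ℓ)) ∧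
          ∀ k' ℓ' : ZMod n, Reachable m n k ℓ k' ℓ' → ¬ XException m n k' ℓ') := by
  have hm3 := halt.three_le hm
  have : NeZero m := ⟨by omega⟩
  constructor
  · intro hinv
    obtain ⟨n', ι, c, S⟩ := exists_altSystem I hconn hvt hpart halt hinv hm
    obtain ⟨K, lam, p, hp, hK, hKK⟩ := S.exists_chart
    obtain rfl : n' = n := Nat.eq_of_mul_eq_mul_left (by omega) (hp.card_eq.symm.trans hn)
    have hne := hp.n_even
    have hn4 := hp.four_le
    have : NeZero n' := ⟨by omega⟩
    have hmodel := hp.factorIso (chart_model hp.three_le hp.four_le hp.n_even hp.K_odd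
      hp.lam_parity hp.even_or_one hp.not_dvd)
    by_cases hK1 : K = 1
    · subst hK1
      refine Or.inl ⟨Nat.even_iff.2 hne, hn4, (lam : ZMod n'), ?_, ?_, fun hexc => ?_⟩
      · have h1 := val_parity hne lam
        have h2 := hp.lam_parity
        omega
      · rw [honeycomb_eq]; exact hmodel
      · refine (hp.congr (K' := 1) (lam' := (lam : ZMod n').val) (by simp) ?_
          (Or.inr rfl)).not_invariant_of_honeycombException hconn hexc hinv
        rw [ZMod.val_intCast]
        exact ⟨-(lam / n'), by linear_combination Int.emod_add_mul_ediv lam n'⟩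
    · have hme : m % 2 = 0 := hp.even_or_one.resolve_right hK1
      refine Or.inr ⟨Nat.even_iff.2 hne, hn4, K, lam,
        hp.xParameters hme (hK.resolve_left hK1) hKK hinv hvt, ?_, fun k' ℓ' hR hexc => ?_⟩
      · rw [xGraph_eq]; exact hmodel
      · obtain ⟨K', lam', q, rfl, rfl, hq⟩ := hR.chart hme hp rfl rfl
        exact hq.not_invariant_of_xException hme hconn hexc hinv
  · have := Fintype.ofFinite V
    rintro (⟨hne, hn4, ℓ, hℓ, hiso, hexc⟩ | ⟨hne, hn4, k, ℓ, hX, hiso, hexc⟩)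
    · have hn2 := Nat.even_iff.1 hne
      have : NeZero n := ⟨by omega⟩
      have e : (((ℓ.val : ℤ)) : ZMod n) = ℓ := by simp
      rw [← e, honeycomb_eq] at hiso
      obtain ⟨p, hp⟩ := (chart_model hm3 hn4 hn2 (by norm_num) (by omega) (Or.inr rfl)
        (not_dvd_of_abs_lt (by norm_num) (by omega) (by omega))).of_factorIso hiso
      exact hp.honeycomb_invariant hconn hexc
    · have hn2 := Nat.even_iff.1 hne
      have : NeZero n := ⟨by omega⟩
      obtain ⟨K, hK⟩ : ∃ K : ℤ, (K : ZMod n) = k := ⟨k.val, by simp⟩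
      obtain ⟨lam, hl⟩ : ∃ lam : ℤ, (lam : ZMod n) = ℓ := ⟨ℓ.val, by simp⟩
      subst hK hl
      have hme := Nat.even_iff.1 hX.1
      have hstep := hX.isXStep
      have h1 := val_parity hn2 K
      have h2 := val_parity hn2 lam
      have h3 := hX.2.1
      have h4 := hX.2.2.1
      rw [xGraph_eq] at hiso
      obtain ⟨p, hp⟩ := (chart_model hm3 hn4 hn2 (by omega) (by omega) (Or.inl hme)
        (fun hd => by
          -- If n divided 2K it would divide 2K², which is ±2 modulo n.
          have h4n : (n : ℤ) ∣ 2 := by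
            rcases hstep.sq with h5 | h5
            · exact dvd_of_eq_mul ((hd.mul_right K).sub h5) 1 (by ring)
            · exact dvd_of_eq_mul (h5.sub (hd.mul_right K)) 1 (by ring)
          exact not_dvd_of_abs_lt (by norm_num) (by omega) (by omega) h4n)).of_factorIso hiso
      by_contra hinv
      obtain ⟨k', ℓ', hR, h5⟩ := hp.exists_xException_of_not_invariant hconn hX hinv
      exact hexc k' ℓ' hR h5
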